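/- **Conventions.** Let $k$ be a field of characteristic $0$. All gradings are by $\mathbb Z$ and are the shifted ones (an $A_\infty$-algebra is described on $\overline A[1]$); $|x|$ denotes this degree, also the total degree of a word, and all signs follow the Koszul rule. Let $G\subset\mathbb R_{\ge 0}\times 2\mathbb Z$ be a submonoid, with elements $\beta=(\lambda(\beta),\mu(\beta))$, such that only finitely many values $\lambda(\beta)$ lie below any bound, $\lambda(\beta)=0$ only for $\beta=0$, and each value of $\lambda$ is taken finitely often. A $G$-gapped filtered $A_\infty$-algebra $A$ over the Novikov ring consists of a graded vector space $\overline A$ and maps $m_{n,\beta}:\overline A[1]^{\otimes n}\to\overline A[1]$ ($n\ge 0$, $\beta\in G$) of degree $1-\mu(\beta)$, with $m_{0,0}=0$, such that $m_n=\sum_\beta T^{\lambda(\beta)}e^{\mu(\beta)/2}m_{n,\beta}$ satisfy the $A_\infty$-relations. A gapped filtered $A_\infty$-bimodule $C$ over $A$ is likewise given by maps $b_{p,q,\beta}:\overline A[1]^{\otimes p}\otimes\overline C\otimes\overline A[1]^{\otimes q}\to\overline C$ of degree $1-\mu(\beta)$ with $\widehat b\circ\widehat b=0$ (where $\widehat b$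 includes the insertions of $m_0$); $A$ is a bimodule over itself with $b_{p,q}=m_{p+1+q}$. $G$-gapped homomorphisms have components of degree $-\mu(\beta)$; an $A_\infty$-homomorphism $f$ of algebras may have $f_{0,\beta}\ne0$ for $\beta\neq 0$. $H^*(C)$ is the cohomology of $(\overline C,b_{0,0,0})$, $H^*(A)$ that of $(\overline A,m_{1,0})$; a quasi-isomorphism is a homomorphism whose energy-zero linear part $g_{0,0,0}$ (resp. $f_{1,0}$) induces an isomorphism on $H^*$. Fix $N\in\mathbb Z$. The dual $C^*$ is shifted so that a functional of degree $r$ is supported in degree $-r-N$, and its structure maps are $$b^*_{p,q}(\vec x,f,\vec y)(w)=(-1)^{1+|f|+|\vec x|(|f|+|\vec y|+|w|)}f\big(b_{q,p}(\vec y,w,\vec x)\big).$$ The dual of a bimodule homomorphism $g:C\to D$ is $g^*(\vec x,f,\vec y)(w)=(-1)^{|\vec x|(|f|+|\vec y|+|w|)}f(g(\vec y,w,\vec x))$. A cyclic symmetric inner product of degree $N$ on a bimodule $D$ is a bilinear form $\langle\,,\rangle$ on $\overline D$, with $\langle v,w\rangle\ne0$ only if $|v|+|w|+N=0$, which is skew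 ($\langle v,w\rangle=-(-1)^{|v||w|}\langle w,v\rangle$), non-degenerate (it induces isomorphisms $\overline D^{\,i}\cong(\overline D^{\,-i-N})^*$), and such that $\psi_{0,0,0}=\langle\,,\rangle$, all other $\psi_{p,q,\beta}=0$, is a bimodule homomorphism $\psi:D\to D^*$. A cyclic symmetric inner product on an algebra $B$ is such a form on $\overline B[1]$ with $\langle m_{n,\beta}(x_1,\dots,x_n),x_{n+1}\rangle=(-1)^{|x_1|(|x_2|+\dots+|x_{n+1}|)}\langle m_{n,\beta}(x_2,\dots,x_{n+1}),x_1\rangle$ for all $n,\beta$. A bimodule homomorphism $\phi:C\to C^*$ is a *homotopy inner product* if $\phi=g^*\circ\psi\circ g$ for a gapped filtered bimodule $D$ over $A$ with a cyclic symmetric inner product $\psi$ and a bimodule quasi-isomorphism $g:C\to D$. A bimodule homomorphism $\phi:A\to A^*$ is a *strong homotopy inner product* if $\phi=\widetilde f^*\circ\psi\circ\widetilde f$ for a gapped filtered $A_\infty$-algebra $B$ with a cyclic symmetric inner product $\psi$ and an $A_\infty$-quasi-isomorphism $f:A\to B$, where $\widetilde f_{p,q}=f_{p+1+q}$. **Corollary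 8.1.** Let $A$ be a $G$-gapped filtered $A_\infty$-algebra and $N\in\mathbb Z$. (a) Let $C$ be a $G$-gapped filtered $A_\infty$-bimodule over $A$ with $H^*(C)$ finite dimensional in every degree. There is a homotopy inner product $C\to C^*$ if and only if there is a bimodule homomorphism $\phi:C\to C^*$ with 1. (skew symmetry) $\phi_{p,q,\beta}(\vec a,v,\vec b)(w)=-(-1)^{(|\vec a|+|v|)(|\vec b|+|w|)}\phi_{q,p,\beta}(\vec b,w,\vec a)(v)$ for all $p,q,\beta$ and all homogeneous arguments; 2. (homological non-degeneracy) for every non-zero $[a]\in H^*(C)$ there is $[b]\in H^*(C)$ with $\phi_{0,0,0}(a)(b)\neq0$. (b) Suppose that $H^*(A)$ is finite dimensional in every degree. There is a strong homotopy inner product $A\to A^*$ if and only if there is a bimodule homomorphism $\phi:A\to A^*$ which is skew symmetric and homologically non-degenerate as in (a) (with $C=A$) and closed: for all $\beta\in G$, all homogeneous $a_1,\dots,a_n$ and all $1\le i<j<l\le n$, $$[a_i,a_j]_\beta+[a_j,a_l]_\beta+[a_l,a_i]_\beta=0,$$ where $[a_s,a_t]_\beta=(-1)^{(|a_1|+\dots+|a_t|)(|a_{t+1}|+\dots+|a_n|)}\,\phi_\beta(a_{t+1},\dots,a_n,a_1,\dots,\underline{a_s},\dots,a_{t-1})(a_t)$,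 the family being written in cyclic order ending with $a_t$, and $\underline{a_s}$ being the bimodule entry. -/

import Mathlib

universe u v w

/-! ### Energy monoids -/

/-- A submonoid `G` of `ℝ_{≥ 0} × 2ℤ`, with elements `β = (λ(β), μ(β))`, over which structures are
gapped. "Discrete" means that only finitely many energies lie below any bound, so that the energies
form a finite sequence or one that tends to infinity. -/
structure GappingMonoid where
  toAddSubmonoid : AddSubmonoid (ℝ × ℤ)
  energy_nonneg : ∀ β ∈ toAddSubmonoid, 0 ≤ β.1
  even_maslov : ∀ β ∈ toAddSubmonoid, Even β.2
  discrete : ∀ E : ℝ, (Prod.fst '' (toAddSubmonoid : Set (ℝ × ℤ)) ∩ Set.Iic E).Finite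
  eq_zero_of_energy : ∀ β ∈ toAddSubmonoid, β.1 = 0 → β = 0
  finite_fiber : ∀ l : ℝ, {β : ℝ × ℤ | β ∈ toAddSubmonoid ∧ β.1 = l}.Finite

namespace GappingMonoid

/-- The type of elements of `G`. -/
abbrev Elt (G : GappingMonoid) : Type := ↥G.toAddSubmonoid

/-- The degree `μ(β)` of `e ^ (μ(β) / 2)`. -/
def maslov {G : GappingMonoid} (β : G.Elt) : ℤ := β.1.2

theorem finite_energy_le (G : GappingMonoid) (E : ℝ) : {β : G.Elt | β.1.1 ≤ E}.Finite := by
  have h : {β : ℝ × ℤ | β ∈ G.toAddSubmonoid ∧ β.1 ≤ E}.Finite := by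
    refine ((G.discrete E).biUnion (fun l _ => G.finite_fiber l)).subset ?_
    rintro β ⟨hβ, hE⟩
    simp only [Set.mem_iUnion]
    exact ⟨β.1, ⟨⟨β, hβ, rfl⟩, hE⟩, hβ, rfl⟩
  refine Set.Finite.of_finite_image (f := Subtype.val) (h.subset ?_) Subtype.val_injective.injOn
  rintro _ ⟨β, hβ, rfl⟩
  exact ⟨β.2, hβ⟩

theorem finite_decompositions (G : GappingMonoid) (β : G.Elt) :
    {p : G.Elt × G.Elt | p.1 + p.2 = β}.Finite := by
  refine ((G.finite_energy_le β.1.1).prod (G.finite_energy_le β.1.1)).subset ?_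
  rintro ⟨p, q⟩ (h : p + q = β)
  have h1 := G.energy_nonneg p.1 p.2
  have h2 := G.energy_nonneg q.1 q.2
  have h3 : p.1.1 + q.1.1 = β.1.1 := by rw [← h]; rfl
  constructor
  · change p.1.1 ≤ β.1.1
    linarith
  · change q.1.1 ≤ β.1.1
    linarith

/-- The finitely many decompositions `β = β₁ + β₂` in `G`. -/
noncomputable def decomps {G : GappingMonoid} (β : G.Elt) : Finset (G.Elt × G.Elt) :=
  (G.finite_decompositions β).toFinset

@[simp] theorem mem_decomps {G : GappingMonoid} {β : G.Elt} {p : G.Elt × G.Elt} :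
    p ∈ decomps β ↔ p.1 + p.2 = β := by
  simp [decomps]

end GappingMonoid

/-! ### Graded vector spaces and words -/

/-- A `ℤ`-graded vector space over `k`. -/
structure GradedSpace (k : Type v) [Field k] where
  carrier : Type u
  [addCommGroup : AddCommGroup carrier]
  [module : Module k carrier]
  piece : ℤ → Submodule k carrier
  isInternal : DirectSum.IsInternal piece

attribute [instance] GradedSpace.addCommGroup GradedSpace.module

namespace GradedSpace

variable {k : Type v} [Field k] (V : GradedSpace.{u} k)

/-- Homogeneous elements, together with their degree. -/
abbrev Homog : Type u := Σ i : ℤ, V.piece i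

/-- The underlying space of the bar construction `⨁ₙ V ^ ⊗ n`. -/
abbrev Bar : Type (max u v) := TensorAlgebra k V.carrier

variable {V}

/-- The tensor `x₁ ⊗ ⋯ ⊗ xₙ` of a word of homogeneous elements. -/
noncomputable def word (x : List V.Homog) : V.Bar :=
  (x.map fun a => TensorAlgebra.ι k (a.2 : V.carrier)).prod

/-- The total degree `|x₁| + ⋯ + |xₙ|` of a word. -/
def deg (x : List V.Homog) : ℤ := (x.map Sigma.fst).sum

@[simp] theorem word_append (x y : List V.Homog) : word (x ++ y) = word x * word y := by
  simp [word]

@[simp] theorem word_cons (a : V.Homog) (x : List V.Homog) :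
    word (a :: x) = TensorAlgebra.ι k (a.2 : V.carrier) * word x := by
  simp [word]

@[simp] theorem deg_append (x y : List V.Homog) : deg (x ++ y) = deg x + deg y := by
  simp [deg]

@[simp] theorem deg_cons (a : V.Homog) (x : List V.Homog) : deg (a :: x) = a.1 + deg x := by
  simp [deg]

/-- The cohomology of an endomorphism `d` of `V` (with `d ∘ d = 0`) is finite dimensional in every
degree. -/
def FiniteCohomology (d : V.carrier →ₗ[k] V.carrier) : Prop :=
  ∀ i : ℤ, FiniteDimensional k
    (↥(LinearMap.ker d ⊓ V.piece i) ⧸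
      (LinearMap.range d).submoduleOf (LinearMap.ker d ⊓ V.piece i))

/-- The chain map `g : (V, d) → (W, d')` induces an isomorphism on cohomology: the induced map is
injective and surjective. -/
def InducesIso {W : GradedSpace.{w} k} (d : V.carrier →ₗ[k] V.carrier)
    (d' : W.carrier →ₗ[k] W.carrier) (g : V.carrier →ₗ[k] W.carrier) : Prop :=
  (∀ a, d a = 0 → g a ∈ LinearMap.range d' → a ∈ LinearMap.range d) ∧
  (∀ b, d' b = 0 → ∃ a, d a = 0 ∧ b - g a ∈ LinearMap.range d')

end GradedSpace

/-- The sum of `F x' x''` over all ways to cut `x` into two consecutive, possibly empty, words. -/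
def sumSplit {α : Type*} {M : Type*} [AddCommMonoid M] (x : List α)
    (F : List α → List α → M) : M :=
  ∑ i ∈ Finset.range (x.length + 1), F (x.take i) (x.drop i)

theorem sumSplit_append_cons {α : Type*} {M : Type*} [AddCommMonoid M] (x : List α) (a : α)
    (y : List α) (F : List α → List α → M) :
    sumSplit (x ++ a :: y) F =
      sumSplit x (fun x₁ x₂ => F x₁ (x₂ ++ a :: y)) +
        sumSplit y (fun y₁ y₂ => F (x ++ a :: y₁) y₂) := by
  unfold sumSplit
  have h : (x ++ a :: y).length + 1 = (x.length + 1) + (y.length + 1) := by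
    simp only [List.length_append, List.length_cons]; omega
  rw [h, Finset.sum_range_add]
  congr 1
  · refine Finset.sum_congr rfl fun i hi => ?_
    have hi' : i ≤ x.length := Nat.lt_succ_iff.mp (Finset.mem_range.mp hi)
    rw [List.take_append_of_le_length hi', List.drop_append_of_le_length hi']
  · refine Finset.sum_congr rfl fun i _ => ?_
    have e : x.length + 1 + i = x.length + (i + 1) := by omega
    rw [e, List.take_length_add_append, List.drop_length_add_append]
    simp

theorem sumSplit_add {α : Type*} {M : Type*} [AddCommMonoid M] (x : List α)
    (F F' : List α → List α → M) :
    sumSplit x (fun x₁ x₂ => F x₁ x₂ + F' x₁ x₂) = sumSplit x F + sumSplit x F' :=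
  Finset.sum_add_distrib

/-! ### Gapped filtered `A∞`-algebras

All gradings are the shifted ones. A gapped filtered structure on `V ⊗ Λ₀` is given by components
indexed by `β ∈ G`, the total operation being the sum of
`T ^ λ(β) e ^ (μ(β) / 2)` times the `β`-component, where `T` has degree `0` and `e` has degree `2`.
So the `β`-component of an operation of degree `r` has degree `r - μ(β)`; as `μ(β)` is even, it
never contributes to a sign. -/

/-- A `G`-gapped filtered `A∞`-algebra; `carrier` is the reduced space, with the shifted grading,
and `m β` restricted to the words of length `n` is `m_{n,β}`. -/
structure GappedAlgebra (k : Type v) [Field k] (G : GappingMonoid) extends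
    GradedSpace.{u} k where
  m : G.Elt → toGradedSpace.Bar →ₗ[k] carrier
  m_degree : ∀ (β : G.Elt) (x : List toGradedSpace.Homog),
    m β (GradedSpace.word x) ∈ piece (GradedSpace.deg x + 1 - GappingMonoid.maslov β)
  /-- `m₀` has positive energy. -/
  m_zero : m 0 1 = 0
  /-- The `A∞`-relations. -/
  relation : ∀ (β : G.Elt) (x : List toGradedSpace.Homog),
    ∑ p ∈ GappingMonoid.decomps β,
      sumSplit x (fun x₁ r => sumSplit r (fun x₂ x₃ =>
        (GradedSpace.deg x₁).negOnePow •
          m p.1 (GradedSpace.word x₁ * TensorAlgebra.ι k (m p.2 (GradedSpace.word x₂)) *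
            GradedSpace.word x₃))) = 0

/-! ### Gapped filtered bimodules -/

section Bimodule

variable {k : Type v} [Field k] {G : GappingMonoid}

/-- Families of maps `V ^ ⊗ p ⊗ M ⊗ V ^ ⊗ q → M'`, for all `p` and `q`. -/
abbrev BiOp (V : GradedSpace.{u} k) (M M' : Type*) [AddCommGroup M] [Module k M]
    [AddCommGroup M'] [Module k M'] : Type _ :=
  V.Bar →ₗ[k] M →ₗ[k] V.Bar →ₗ[k] M'

/-- The component with no inputs from `V`. -/
def BiOp.core {V : GradedSpace.{u} k} {M M' : Type*} [AddCommGroup M] [Module k M]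
    [AddCommGroup M'] [Module k M'] (b : BiOp V M M') : M →ₗ[k] M' :=
  (b 1).flip 1

/-- The family `f_{p+1+q}` of a family `f_n : V ^ ⊗ n → M`. -/
noncomputable def BiOp.ofOp {V : GradedSpace.{u} k} {M : Type*} [AddCommGroup M] [Module k M]
    (f : V.Bar →ₗ[k] M) : BiOp V V.carrier M :=
  LinearMap.mk₂ k (fun x a => f ∘ₗ LinearMap.mulLeft k (x * TensorAlgebra.ι k a))
    (by intro x x' a; ext y; simp [add_mul, mul_assoc])
    (by intro c x a; ext y; simp [mul_assoc])
    (by intro x a a'; ext y; simp [add_mul, mul_add, mul_assoc])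
    (by intro c x a; ext y; simp [mul_assoc])

@[simp] theorem BiOp.ofOp_apply {V : GradedSpace.{u} k} {M : Type*} [AddCommGroup M] [Module k M]
    (f : V.Bar →ₗ[k] M) (x : V.Bar) (a : V.carrier) (y : V.Bar) :
    BiOp.ofOp f x a y = f (x * TensorAlgebra.ι k a * y) := rfl

open GradedSpace

/-- The `β`-component of `φ ∘ b̂` at `x ⊗ v ⊗ y`, where `b̂` is the coderivation induced by `b` and
by the operations of `A`. -/
noncomputable def compHat (A : GappedAlgebra.{u} k G) (C : GradedSpace.{w} k)
    {M : Type*} [AddCommGroup M] [Module k M]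
    (φ : G.Elt → BiOp A.toGradedSpace C.carrier M)
    (b : G.Elt → BiOp A.toGradedSpace C.carrier C.carrier)
    (β : G.Elt) (x : List A.Homog) (v : C.Homog) (y : List A.Homog) : M :=
  ∑ p ∈ GappingMonoid.decomps β,
    (sumSplit x (fun x₁ r => sumSplit r (fun x₂ x₃ =>
        (deg x₁).negOnePow •
          φ p.1 (word x₁ * TensorAlgebra.ι k (A.m p.2 (word x₂)) * word x₃) v.2 (word y)))
      + sumSplit x (fun x₁ x₂ => sumSplit y (fun y₁ y₂ =>
        (deg x₁).negOnePow • φ p.1 (word x₁) (b p.2 (word x₂) v.2 (word y₁)) (word y₂)))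
      + sumSplit y (fun y₁ r => sumSplit r (fun y₂ y₃ =>
        (deg x + v.1 + deg y₁).negOnePow •
          φ p.1 (word x) v.2
            (word y₁ * TensorAlgebra.ι k (A.m p.2 (word y₂)) * word y₃))))

/-- A `G`-gapped filtered `A∞`-bimodule over `A`. -/
structure GappedBimodule (A : GappedAlgebra.{u} k G) extends GradedSpace.{w} k where
  b : G.Elt → BiOp A.toGradedSpace carrier carrier
  b_degree : ∀ (β : G.Elt) (x : List A.Homog) (c : toGradedSpace.Homog) (y : List A.Homog),
    b β (word x) c.2 (word y) ∈ piece (deg x + c.1 + deg y + 1 - GappingMonoid.maslov β)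
  /-- The bimodule relations `b̂ ∘ b̂ = 0`. -/
  relation : ∀ (β : G.Elt) (x : List A.Homog) (c : toGradedSpace.Homog) (y : List A.Homog),
    compHat A toGradedSpace b b β x c y = 0

/-- The algebra `A` as a bimodule over itself, with `b_{p,q} = m_{p+1+q}`. -/
noncomputable abbrev GappedAlgebra.diagonal (A : GappedAlgebra.{u} k G) : GappedBimodule.{u, v, u} A where
  toGradedSpace := A.toGradedSpace
  b β := BiOp.ofOp (A.m β)
  b_degree β x c y := by
    have h := A.m_degree β (x ++ c :: y)
    simp only [word_append, word_cons, deg_append, deg_cons] at h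
    rw [BiOp.ofOp_apply, mul_assoc]
    convert h using 2
    ring
  relation β x c y := by
    rw [← A.relation β (x ++ c :: y)]
    unfold compHat
    refine Finset.sum_congr rfl fun p _ => ?_
    simp only [sumSplit_append_cons, sumSplit_add, word_append, word_cons, deg_append, deg_cons,
      BiOp.ofOp_apply, mul_assoc, add_assoc]

variable {A : GappedAlgebra.{u} k G}

/-- The differential of the reduced bimodule: the component `b_{0,0}` of energy zero. -/
def GappedBimodule.d (C : GappedBimodule.{u, v, w} A) : C.carrier →ₗ[k] C.carrier := (C.b 0).core

/-- A gapped filtered `A∞`-bimodule homomorphism `C → D` (of degree `0`). -/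
structure BimoduleHom (C D : GappedBimodule.{u, v, w} A) where
  g : G.Elt → BiOp A.toGradedSpace C.carrier D.carrier
  g_degree : ∀ (β : G.Elt) (x : List A.Homog) (c : C.Homog) (y : List A.Homog),
    g β (word x) c.2 (word y) ∈ D.piece (deg x + c.1 + deg y - GappingMonoid.maslov β)
  /-- `g ∘ b̂ = b ∘ ĝ`. -/
  relation : ∀ (β : G.Elt) (x : List A.Homog) (c : C.Homog) (y : List A.Homog),
    compHat A C.toGradedSpace g C.b β x c y =
      ∑ p ∈ GappingMonoid.decomps β,
        sumSplit x (fun x₁ x₂ => sumSplit y (fun y₁ y₂ =>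
          D.b p.1 (word x₁) (g p.2 (word x₂) c.2 (word y₁)) (word y₂)))

/-- The energy zero part of `g_{0,0}` induces an isomorphism on cohomology. -/
def BimoduleHom.IsQuasiIso {C D : GappedBimodule.{u, v, w} A} (g : BimoduleHom C D) : Prop :=
  InducesIso (V := C.toGradedSpace) (W := D.toGradedSpace) C.d D.d (g.g 0).core

/-! ### Duals -/

/-- The structure map of the dual bimodule: `b^*(x, f, y)(c)`, for a functional `f` of degree
`r`, is `v ↦ f (b (y, c, x))` up to the sign
`(-1) ^ (1 + r + |x| (r + |y| + |c|))`. -/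
noncomputable def dualOp {V : GradedSpace.{u} k} {C : GradedSpace.{w} k}
    (b : BiOp V C.carrier C.carrier)
    (x : List V.Homog) (r : ℤ) (f : Module.Dual k C.carrier) (y : List V.Homog) (c : C.Homog) : k :=
  (1 + r + deg x * (r + deg y + c.1)).negOnePow • f (b (word y) c.2 (word x))

/-- The dual `g^* : D^* → C^*` of a family `g : C → D` of degree `0`: `g^*(x, f, y)(c)`, for a
functional `f` of degree `r`. -/
noncomputable def dualMap {V : GradedSpace.{u} k} {C D : GradedSpace.{w} k}
    (g : BiOp V C.carrier D.carrier)
    (x : List V.Homog) (r : ℤ) (f : Module.Dual k D.carrier) (y : List V.Homog) (c : C.Homog) : k :=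
  (deg x * (r + deg y + c.1)).negOnePow • f (g (word y) c.2 (word x))

/-- A gapped filtered `A∞`-bimodule homomorphism `φ : C → C^*` for pairings of degree `N`: the dual
is shifted so that a functional has degree `r` if it vanishes on all homogeneous elements of degree
other than `- r - N`, and with this grading `φ` has degree `0`. -/
structure DualHom (C : GappedBimodule.{u, v, w} A) (N : ℤ) where
  φ : G.Elt → BiOp A.toGradedSpace C.carrier (Module.Dual k C.carrier)
  φ_degree : ∀ (β : G.Elt) (x : List A.Homog) (c : C.Homog) (y : List A.Homog) (c' : C.Homog),
    φ β (word x) c.2 (word y) c'.2 ≠ 0 →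
      c'.1 = - (deg x + c.1 + deg y - GappingMonoid.maslov β) - N
  /-- `φ ∘ b̂ = b^* ∘ φ̂`, evaluated at `c'`. -/
  relation : ∀ (β : G.Elt) (x : List A.Homog) (c : C.Homog) (y : List A.Homog) (c' : C.Homog),
    compHat A C.toGradedSpace φ C.b β x c y (c'.2 : C.carrier) =
      ∑ p ∈ GappingMonoid.decomps β,
        sumSplit x (fun x₁ x₂ => sumSplit y (fun y₁ y₂ =>
          dualOp (C.b p.1) x₁ (deg x₂ + c.1 + deg y₁) (φ p.2 (word x₂) c.2 (word y₁)) y₂ c'))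

/-! ### Inner products -/

/-- A non-degenerate skew symmetric bilinear form of degree `N` on a graded space. Non-degeneracy
means that the form identifies each graded piece with the dual of the complementary one. -/
structure SkewForm (V : GradedSpace.{w} k) (N : ℤ) where
  form : V.carrier →ₗ[k] Module.Dual k V.carrier
  degree : ∀ a b : V.Homog, form a.2 b.2 ≠ 0 → a.1 + b.1 + N = 0
  skew : ∀ a b : V.Homog, form a.2 b.2 = -((a.1 * b.1).negOnePow • form b.2 a.2)
  nondegenerate : ∀ i : ℤ, Function.Bijective
    (fun a : V.piece i => (form a).domRestrict (V.piece (-i - N)))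

/-- The form is a cyclic symmetric inner product on the bimodule `D`, that is, the family with the
single non-zero component `form` is a bimodule homomorphism `D → D^*`. -/
def SkewForm.IsCyclicBimodule {N : ℤ} {D : GappedBimodule.{u, v, w} A}
    (B : SkewForm D.toGradedSpace N) : Prop :=
  ∀ (β : G.Elt) (x : List A.Homog) (v : D.Homog) (y : List A.Homog) (c : D.Homog),
    B.form (D.b β (word x) v.2 (word y)) c.2 = dualOp (D.b β) x v.1 (B.form v.2) y c

/-- The form is a cyclic symmetric inner product on the algebra `A` (the condition is
void for `m₀`). -/
def SkewForm.IsCyclicAlgebra {N : ℤ} {A : GappedAlgebra.{u} k G}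
    (B : SkewForm A.toGradedSpace N) : Prop :=
  ∀ (β : G.Elt) (a : A.Homog) (x : List A.Homog) (c : A.Homog),
    B.form (A.m β (word (a :: x))) c.2 =
      (a.1 * (deg x + c.1)).negOnePow • B.form (A.m β (word (x ++ [c]))) a.2

/-- The composition `g^* ∘ ψ ∘ g`, where `ψ` has the single non-zero component `form`: its
`β`-component at `x ⊗ v ⊗ y`, evaluated at `c`. -/
noncomputable def pullback {V : GradedSpace.{u} k} {C D : GradedSpace.{w} k}
    (g : G.Elt → BiOp V C.carrier D.carrier) (form : D.carrier →ₗ[k] Module.Dual k D.carrier)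
    (β : G.Elt) (x : List V.Homog) (v : C.Homog) (y : List V.Homog) (c : C.Homog) : k :=
  ∑ p ∈ GappingMonoid.decomps β,
    sumSplit x (fun x₁ x₂ => sumSplit y (fun y₁ y₂ =>
      dualMap (g p.1) x₁ (deg x₂ + v.1 + deg y₁)
        (form (g p.2 (word x₂) v.2 (word y₁))) y₂ c))

/-- `φ : C → C^*` is a homotopy inner product. -/
def DualHom.IsHomotopyInnerProduct {C : GappedBimodule.{u, v, w} A} {N : ℤ} (φ : DualHom C N) : Prop :=
  ∃ (D : GappedBimodule.{u, v, w} A) (B : SkewForm D.toGradedSpace N) (g : BimoduleHom C D),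
    B.IsCyclicBimodule ∧ g.IsQuasiIso ∧
      ∀ (β : G.Elt) (x : List A.Homog) (v : C.Homog) (y : List A.Homog) (c : C.Homog),
        φ.φ β (word x) v.2 (word y) c.2 = pullback g.g B.form β x v y c

/-- Skew symmetry of `φ : C → C^*`. -/
def DualHom.IsSkew {C : GappedBimodule.{u, v, w} A} {N : ℤ} (φ : DualHom C N) : Prop :=
  ∀ (β : G.Elt) (x : List A.Homog) (v : C.Homog) (y : List A.Homog) (c : C.Homog),
    φ.φ β (word x) v.2 (word y) c.2 =
      -(((deg x + v.1) * (deg y + c.1)).negOnePow • φ.φ β (word y) c.2 (word x) v.2)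

/-- Homological non-degeneracy of `φ : C → C^*`, on the cohomology of the reduced bimodule. -/
def DualHom.IsHomologicallyNondegenerate {C : GappedBimodule.{u, v, w} A} {N : ℤ}
    (φ : DualHom C N) : Prop :=
  ∀ a : C.carrier, C.d a = 0 → a ∉ LinearMap.range C.d →
    ∃ b : C.carrier, C.d b = 0 ∧ (φ.φ 0).core a b ≠ 0

/-- Closedness of `φ : A → A^*`. The word `p a q b r c s` has three marked letters `a`, `b`, `c`;
each term rotates it so that the letter at which `φ` is evaluated comes last, with the Koszul
sign of that rotation. -/
def DualHom.IsClosed {N : ℤ} (φ : DualHom A.diagonal N) : Prop :=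
  ∀ (β : G.Elt) (p q r s : List A.Homog) (a b c : A.Homog),
    ((deg p + a.1 + deg q + b.1) * (deg r + c.1 + deg s)).negOnePow •
        φ.φ β (word (r ++ c :: s ++ p)) (a.2 : A.carrier) (word q) (b.2 : A.carrier)
      + ((deg p + a.1 + deg q + b.1 + deg r + c.1) * deg s).negOnePow •
        φ.φ β (word (s ++ p ++ a :: q)) (b.2 : A.carrier) (word r) (c.2 : A.carrier)
      + ((deg p + a.1) * (deg q + b.1 + deg r + c.1 + deg s)).negOnePow •
        φ.φ β (word (q ++ b :: r)) (c.2 : A.carrier) (word (s ++ p)) (a.2 : A.carrier) = 0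

/-! ### Homomorphisms of algebras -/

/-- The sum over all ways to cut `x` into `n` consecutive, possibly empty, words `x₁, …, xₙ` and to
write `β = β₁ + ⋯ + βₙ`, of `F (f_{β₁}(x₁) ⊗ ⋯ ⊗ f_{βₙ}(xₙ))`. -/
noncomputable def sumHat {V : GradedSpace.{u} k} {W : GradedSpace.{w} k} {M : Type*}
    [AddCommGroup M] [Module k M] (f : G.Elt → V.Bar →ₗ[k] W.carrier) :
    ℕ → G.Elt → List V.Homog → (W.Bar →ₗ[k] M) → M
  | 0, β, x, F => open Classical in if β = 0 ∧ x = [] then F 1 else 0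
  | n + 1, β, x, F => ∑ p ∈ GappingMonoid.decomps β, sumSplit x (fun x₁ x₂ =>
      sumHat f n p.2 x₂ (F ∘ₗ LinearMap.mulLeft k (TensorAlgebra.ι k (f p.1 (word x₁)))))

/-- A gapped filtered `A∞`-homomorphism `A → B`. Components without inputs are allowed
if they have positive energy; for this reason only finitely many of the terms of the sum over `n`
in the defining relation are non-zero. -/
structure AlgebraHom (A B : GappedAlgebra.{u} k G) where
  f : G.Elt → A.Bar →ₗ[k] B.carrier
  f_degree : ∀ (β : G.Elt) (x : List A.Homog),
    f β (word x) ∈ B.piece (deg x - GappingMonoid.maslov β)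
  f_zero : f 0 1 = 0
  /-- `f ∘ m̂ = m ∘ f̂`. -/
  relation : ∀ (β : G.Elt) (x : List A.Homog),
    ∑ p ∈ GappingMonoid.decomps β,
      sumSplit x (fun x₁ r => sumSplit r (fun x₂ x₃ =>
        (deg x₁).negOnePow •
          f p.1 (word x₁ * TensorAlgebra.ι k (A.m p.2 (word x₂)) * word x₃))) =
    ∑ᶠ n : ℕ, ∑ p ∈ GappingMonoid.decomps β, sumHat f n p.2 x (B.m p.1)

/-- The differential of the reduced algebra: the component `m₁` of energy zero. -/
noncomputable def GappedAlgebra.d (A : GappedAlgebra.{u} k G) : A.carrier →ₗ[k] A.carrier :=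
  A.m 0 ∘ₗ TensorAlgebra.ι k

/-- The energy zero part of `f₁` induces an isomorphism on cohomology. -/
def AlgebraHom.IsQuasiIso {A B : GappedAlgebra.{u} k G} (f : AlgebraHom A B) : Prop :=
  InducesIso (V := A.toGradedSpace) (W := B.toGradedSpace) A.d B.d (f.f 0 ∘ₗ TensorAlgebra.ι k)

/-- `φ : A → A^*` is a strong homotopy inner product: it is `g^* ∘ ψ ∘ g` for a cyclic algebra with
inner product `ψ` and the bimodule map `g_{p,q} = f_{p+1+q}` of an `A∞`-quasi-isomorphism `f`. -/
def DualHom.IsStrongHomotopyInnerProduct {A : GappedAlgebra.{u} k G} {N : ℤ}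
    (φ : DualHom A.diagonal N) : Prop :=
  ∃ (B : GappedAlgebra.{u} k G) (ψ : SkewForm B.toGradedSpace N) (f : AlgebraHom A B),
    ψ.IsCyclicAlgebra ∧ f.IsQuasiIso ∧
      ∀ (β : G.Elt) (x : List A.Homog) (v : A.Homog) (y : List A.Homog) (c : A.Homog),
        φ.φ β (word x) (v.2 : A.carrier) (word y) (c.2 : A.carrier) =
          pullback (C := A.toGradedSpace) (D := B.toGradedSpace)
            (fun β => BiOp.ofOp (f.f β)) ψ.form β x v y c

end Bimodule

-- The forward implications are soft. Let ψ be a constant skew form and g a homomorphism. The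
-- pullback g^*ψg is skew because the Koszul rotation `BiOp.rotT` commutes with pullback
-- (`BiFam.frot_pull`). It is non-degenerate on cohomology because, for a non-degenerate form
-- compatible with the differential, only boundaries are orthogonal to all cycles
-- (`SkewForm.mem_range`, `SkewForm.exists_ne_zero_of_inducesIso`). For algebras the families
-- φ_{p,q} are read as noncommutative two-forms. A pullback of a constant form along an algebra
-- homomorphism is, up to the factor 2, the antisymmetrisation of a one-form, so it is exact and
-- therefore closed (`BiFam.closed_pull_fconst`).
--
-- The converses pass to cohomology and then use a Darboux theorem. A contraction h of the complex
-- onto harmonic elements H transfers the structure to H, together with homomorphisms i out of H and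
-- p onto H: `BiFam.exists_transfer` for bimodules, `exists_minimal_model` for algebras. The
-- pullback i^*φi is again a skew (and closed) homomorphism. Its constant part is a form B on H,
-- which is injective by homological non-degeneracy; finite dimension in each degree makes it
-- non-degenerate (`GradedSpace.Contraction.exists_skewForm`). The Darboux theorem supplies an
-- invertible g, with leading part the identity, such that g^*Bg = i^*φi. Transporting the structure
-- of H along g gives one for which B is cyclic, and g∘p is a quasi-isomorphism onto it. The
-- homotopy inner product obtained is p^*i^*φ, not φ itself.
--
-- For bimodules the Darboux equation for g = 1 + η reads B + Bη + (its rotated partner) + η^*Bη =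
-- i^*φi. Skew symmetry allows Bη to be half of the remainder, and the resulting fixed point
-- equation is solved in `BiFam.exists_pull_eq`. For algebras η must come from maps η_n on whole
-- words, so halving is not available. The Poincaré lemma replaces it: averaging over the position
-- of the bimodule entry is contraction with the Euler vector field, whose Lie derivative multiplies
-- by the number of letters, and this number is invertible in characteristic zero
-- (`BiOp.eq_euler_sub_rotT`). Hence a closed skew family is the antisymmetrisation of a one-form,
-- and the same iteration works (`BiFam.exists_pull_fofOp_eq`).
--
-- Every inverse, homotopy and coordinate change is the fixed point of a contraction for the weight
-- `wt`, which is twice an integral energy plus the length of the word. The factor 2 makes a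
-- curvature term m_{0,β} lower the weight even though it creates a letter. The same weight proves
-- that the maps constructed are homomorphisms: the defect of the relation satisfies a linear
-- equation that raises its own order, so it vanishes.
--
-- Koszul signs such as (-1)^{ab} are realised on the tensor algebra by parity operators, since the
-- sign is a polynomial in (-1)^a and (-1)^b with coefficients ±1/2 (`sgn_mul_formula`). An algebra
-- homomorphism f acts on families in two steps: change of algebra along the coalgebra map `Conv.hat
-- f`, followed by the bimodule homomorphism f_{p+1+q} (`frel_pull_fofOp`).

universe u₁ u₂ u₃ u₄

set_option maxSynthPendingDepth 3

/-! ### Decompositions in the gapping monoid -/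

namespace GappingMonoid

variable {G : GappingMonoid}

theorem decomps_zero : decomps (0 : G.Elt) = {(0, 0)} := by
  ext ⟨p, q⟩
  simp only [mem_decomps, Finset.mem_singleton, Prod.mk.injEq]
  constructor
  · intro h
    have h1 := G.energy_nonneg p.1 p.2
    have h2 := G.energy_nonneg q.1 q.2
    have h3 : p.1.1 + q.1.1 = 0 := by
      have : (p + q).1.1 = p.1.1 + q.1.1 := rfl
      rw [← this, h]; rfl
    exact ⟨Subtype.ext (G.eq_zero_of_energy _ p.2 (by linarith)),
      Subtype.ext (G.eq_zero_of_energy _ q.2 (by linarith))⟩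
  · rintro ⟨rfl, rfl⟩; simp

theorem sum_decomps_swap {M : Type*} [AddCommMonoid M] (β : G.Elt) (F : G.Elt → G.Elt → M) :
    ∑ p ∈ decomps β, F p.1 p.2 = ∑ p ∈ decomps β, F p.2 p.1 :=
  Finset.sum_bij' (fun p _ => p.swap) (fun p _ => p.swap)
    (by intro p hp; simpa [add_comm] using hp) (by intro p hp; simpa [add_comm] using hp)
    (by simp) (by simp) (by simp)

/-- Both sides run over the decompositions of `β` into three summands. -/
theorem sum_decomps_assoc {M : Type*} [AddCommMonoid M] (β : G.Elt)
    (F : G.Elt → G.Elt → G.Elt → M) :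
    ∑ p ∈ decomps β, ∑ q ∈ decomps p.1, F q.1 q.2 p.2 =
      ∑ p ∈ decomps β, ∑ q ∈ decomps p.2, F p.1 q.1 q.2 := by
  rw [Finset.sum_sigma', Finset.sum_sigma']
  refine Finset.sum_bij' (fun x _ => ⟨(x.2.1, x.2.2 + x.1.2), (x.2.2, x.1.2)⟩)
    (fun x _ => ⟨(x.1.1 + x.2.1, x.2.2), (x.1.1, x.2.1)⟩) ?_ ?_ ?_ ?_ ?_
  · rintro ⟨⟨a, b⟩, ⟨c, d⟩⟩ h
    simp only [Finset.mem_sigma, mem_decomps] at h ⊢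
    exact ⟨by rw [← h.1, ← h.2, add_assoc], trivial⟩
  · rintro ⟨⟨a, b⟩, ⟨c, d⟩⟩ h
    simp only [Finset.mem_sigma, mem_decomps] at h ⊢
    exact ⟨by rw [← h.1, ← h.2, add_assoc], trivial⟩
  · rintro ⟨⟨a, b⟩, ⟨c, d⟩⟩ h
    simp only [Finset.mem_sigma, mem_decomps] at h
    simp [h.2]
  · rintro ⟨⟨a, b⟩, ⟨c, d⟩⟩ h
    simp only [Finset.mem_sigma, mem_decomps] at h
    simp [h.2]
  · rintro ⟨⟨a, b⟩, ⟨c, d⟩⟩ _; rfl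

theorem sum_decomps_left_zero {M : Type*} [AddCommMonoid M] (β : G.Elt) (F : G.Elt → G.Elt → M)
    (h : ∀ b c, b ≠ 0 → F b c = 0) : ∑ p ∈ decomps β, F p.1 p.2 = F 0 β := by
  rw [Finset.sum_eq_single (0, β)]
  · rintro ⟨b, c⟩ hp hne
    refine h _ _ fun hb => hne ?_
    simp only [mem_decomps] at hp
    subst hb
    rw [← hp]; simp
  · simp

theorem sum_decomps_right_zero {M : Type*} [AddCommMonoid M] (β : G.Elt) (F : G.Elt → G.Elt → M)
    (h : ∀ b c, c ≠ 0 → F b c = 0) : ∑ p ∈ decomps β, F p.1 p.2 = F β 0 := by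
  rw [sum_decomps_swap, sum_decomps_left_zero β (fun b c => F c b) fun b c hb => h _ _ hb]

/-- Non-zero elements have energy at least some c > 0, because only finitely many elements have
energy at most 1. The floor of energy / c is then superadditive and positive away from 0. It
replaces the real energy filtration by one on which induction is possible. -/
theorem exists_ord (G : GappingMonoid) : ∃ o : G.Elt → ℕ,
    (∀ a b, o a + o b ≤ o (a + b)) ∧ ∀ a, a ≠ 0 → 1 ≤ o a := by
  obtain ⟨c, hc, hmin⟩ : ∃ c : ℝ, 0 < c ∧ ∀ a : G.Elt, a ≠ 0 → c ≤ a.1.1 := by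
    have hpos : ∀ a : G.Elt, a ≠ 0 → 0 < a.1.1 := fun a ha =>
      lt_of_le_of_ne (G.energy_nonneg _ a.2)
        fun h => ha (Subtype.ext (G.eq_zero_of_energy _ a.2 h.symm))
    let S := ((G.finite_energy_le 1).toFinset.filter (· ≠ 0))
    by_cases hS : S.Nonempty
    · obtain ⟨a, ha, hle⟩ := S.exists_min_image (fun a => a.1.1) hS
      have ha' : a ≠ 0 := (Finset.mem_filter.mp ha).2
      -- Elements of energy above 1 are bounded below by 1, the finitely many remaining ones by
      -- their minimum.
      refine ⟨min 1 a.1.1, lt_min one_pos (hpos a ha'), fun b hb => ?_⟩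
      by_cases h1 : b.1.1 ≤ 1
      · exact (min_le_right _ _).trans (hle b (Finset.mem_filter.mpr ⟨by simpa using h1, hb⟩))
      · exact (min_le_left _ _).trans (not_le.mp h1).le
    · refine ⟨1, one_pos, fun b hb => ?_⟩
      by_contra h1
      exact hS ⟨b, Finset.mem_filter.mpr ⟨by simpa using (not_le.mp h1).le, hb⟩⟩
  refine ⟨fun a => ⌊a.1.1 / c⌋₊, fun a b => ?_, fun a ha => ?_⟩
  · have e : (a + b).1.1 / c = a.1.1 / c + b.1.1 / c := by
      rw [← add_div]; rfl
    have ha := Nat.floor_le (div_nonneg (G.energy_nonneg _ a.2) hc.le)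
    have hb := Nat.floor_le (div_nonneg (G.energy_nonneg _ b.2) hc.le)
    refine Nat.le_floor ?_
    rw [e]; push_cast; linarith
  · refine Nat.le_floor ?_
    rw [Nat.cast_one, le_div_iff₀ hc, one_mul]
    exact hmin a ha

/-- A superadditive function with values in `ℕ` which is positive away from `0`. -/
noncomputable def ord (a : G.Elt) : ℕ := G.exists_ord.choose a

theorem ord_add_le (a b : G.Elt) : ord a + ord b ≤ ord (a + b) := G.exists_ord.choose_spec.1 a b

theorem ord_pos {a : G.Elt} (h : a ≠ 0) : 1 ≤ ord a := G.exists_ord.choose_spec.2 a h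

theorem ord_zero : ord (0 : G.Elt) = 0 := by
  have := ord_add_le (0 : G.Elt) 0
  rw [add_zero] at this; omega

theorem ord_add_le_of_mem {β : G.Elt} {p : G.Elt × G.Elt} (h : p ∈ decomps β) :
    ord p.1 + ord p.2 ≤ ord β := by
  rw [mem_decomps] at h
  rw [← h]; exact ord_add_le _ _

theorem maslov_zero : maslov (0 : G.Elt) = 0 := rfl

theorem maslov_even (a : G.Elt) : Even (maslov a) := G.even_maslov _ a.2

theorem maslov_of_mem {β : G.Elt} {p : G.Elt × G.Elt} (h : p ∈ decomps β) :
    maslov β = maslov p.1 + maslov p.2 := by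
  rw [mem_decomps] at h
  rw [← h]; rfl

end GappingMonoid

/-! ### Extension of bilinear operations to families indexed by the gapping monoid -/

section Lift

open GappingMonoid

variable {k : Type v} [Field k] {G : GappingMonoid}
variable {M₁ M₂ M₃ M₁₂ M₂₃ M : Type*} [AddCommGroup M₁] [Module k M₁] [AddCommGroup M₂] [Module k M₂]
  [AddCommGroup M₃] [Module k M₃] [AddCommGroup M₁₂] [Module k M₁₂] [AddCommGroup M₂₃]
  [Module k M₂₃] [AddCommGroup M] [Module k M]

/-- The Cauchy product of two families with respect to a bilinear operation. -/
noncomputable def lift₂ (μ : M₁ →ₗ[k] M₂ →ₗ[k] M) (f : G.Elt → M₁) (g : G.Elt → M₂) : G.Elt → M :=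
  fun β => ∑ p ∈ decomps β, μ (f p.1) (g p.2)

theorem lift₂_flip (μ : M₁ →ₗ[k] M₂ →ₗ[k] M) (f : G.Elt → M₁) (g : G.Elt → M₂) :
    lift₂ μ.flip g f = lift₂ μ f g := by
  funext β
  exact sum_decomps_swap β fun a b => μ (f b) (g a)

theorem lift₂_add_left (μ : M₁ →ₗ[k] M₂ →ₗ[k] M) (f f' : G.Elt → M₁) (g : G.Elt → M₂) :
    lift₂ μ (f + f') g = lift₂ μ f g + lift₂ μ f' g := by
  funext β; simp [lift₂, Finset.sum_add_distrib]

theorem lift₂_add_right (μ : M₁ →ₗ[k] M₂ →ₗ[k] M) (f : G.Elt → M₁) (g g' : G.Elt → M₂) :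
    lift₂ μ f (g + g') = lift₂ μ f g + lift₂ μ f g' := by
  funext β; simp [lift₂, Finset.sum_add_distrib]

theorem lift₂_neg_left (μ : M₁ →ₗ[k] M₂ →ₗ[k] M) (f : G.Elt → M₁) (g : G.Elt → M₂) :
    lift₂ μ (-f) g = -lift₂ μ f g := by
  funext β; simp [lift₂]

theorem lift₂_neg_right (μ : M₁ →ₗ[k] M₂ →ₗ[k] M) (f : G.Elt → M₁) (g : G.Elt → M₂) :
    lift₂ μ f (-g) = -lift₂ μ f g := by
  funext β; simp [lift₂]

theorem lift₂_zero_left (μ : M₁ →ₗ[k] M₂ →ₗ[k] M) (g : G.Elt → M₂) :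
    lift₂ μ (0 : G.Elt → M₁) g = 0 := by
  funext β; simp [lift₂]

theorem lift₂_zero_right (μ : M₁ →ₗ[k] M₂ →ₗ[k] M) (f : G.Elt → M₁) :
    lift₂ μ f (0 : G.Elt → M₂) = 0 := by
  funext β; simp [lift₂]

/-- A common normal form for nested Cauchy products, shared with the mirror statement below:
identities between families then reduce to identities between components at three fixed energies. -/
theorem lift₂_lift₂_left (μ : M₁₂ →ₗ[k] M₃ →ₗ[k] M) (ν : M₁ →ₗ[k] M₂ →ₗ[k] M₁₂)
    (f : G.Elt → M₁) (g : G.Elt → M₂) (h : G.Elt → M₃) (β : G.Elt) :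
    lift₂ μ (lift₂ ν f g) h β =
      ∑ p ∈ decomps β, ∑ q ∈ decomps p.2, μ (ν (f p.1) (g q.1)) (h q.2) := by
  rw [← sum_decomps_assoc β fun a b c => μ (ν (f a) (g b)) (h c)]
  simp [lift₂]

theorem lift₂_lift₂_right (μ : M₁ →ₗ[k] M₂₃ →ₗ[k] M) (ν : M₂ →ₗ[k] M₃ →ₗ[k] M₂₃)
    (f : G.Elt → M₁) (g : G.Elt → M₂) (h : G.Elt → M₃) (β : G.Elt) :
    lift₂ μ f (lift₂ ν g h) β =
      ∑ p ∈ decomps β, ∑ q ∈ decomps p.2, μ (f p.1) (ν (g q.1) (h q.2)) := by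
  simp [lift₂]

/-- The family concentrated at energy zero. -/
noncomputable def single (x : M) : G.Elt → M := open Classical in fun β => if β = 0 then x else 0

@[simp] theorem single_zero (x : M) : single (G := G) x 0 = x := by simp [single]

theorem single_of_ne (x : M) {β : G.Elt} (h : β ≠ 0) : single x β = 0 := by simp [single, h]

theorem lift₂_single_left (μ : M₁ →ₗ[k] M₂ →ₗ[k] M) (x : M₁) (g : G.Elt → M₂) (β : G.Elt) :
    lift₂ μ (single x) g β = μ x (g β) := by
  unfold lift₂
  rw [sum_decomps_left_zero β (fun a b => μ (single x a) (g b))]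
  · simp
  · intro b c hb; simp [single_of_ne x hb]

theorem lift₂_single_right (μ : M₁ →ₗ[k] M₂ →ₗ[k] M) (f : G.Elt → M₁) (y : M₂) (β : G.Elt) :
    lift₂ μ f (single y) β = μ (f β) y := by
  unfold lift₂
  rw [sum_decomps_right_zero β (fun a b => μ (f a) (single y b))]
  · simp
  · intro b c hb; simp [single_of_ne y hb]

end Lift

/-! ### Signs -/

section Sgn

variable (k : Type v) [Field k]

/-- The sign `(-1) ^ n`. -/
def sgn (n : ℤ) : k := ((n.negOnePow : ℤ) : k)

variable {k}

theorem negOnePow_smul {M : Type*} [AddCommGroup M] [Module k M] (n : ℤ) (x : M) :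
    n.negOnePow • x = sgn k n • x := by
  rw [Units.smul_def, sgn, Int.cast_smul_eq_zsmul]

theorem sgn_add (a b : ℤ) : sgn k (a + b) = sgn k a * sgn k b := by
  simp [sgn, Int.negOnePow_add]

theorem sgn_even {n : ℤ} (h : Even n) : sgn k n = 1 := by simp [sgn, Int.negOnePow_even n h]

theorem sgn_odd {n : ℤ} (h : Odd n) : sgn k n = -1 := by simp [sgn, Int.negOnePow_odd n h]

@[simp] theorem sgn_zero : sgn k 0 = 1 := sgn_even (by decide)

@[simp] theorem sgn_one : sgn k 1 = -1 := sgn_odd (by decide)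

/-- Moves the comparison of exponents to `ZMod 2`, where every sign verification becomes a
polynomial identity. -/
theorem sgn_congr {a b : ℤ} (h : (a : ZMod 2) = b) : sgn k a = sgn k b := by
  rw [← sub_eq_zero, ← Int.cast_sub] at h
  have h2 : Even (a - b) := by
    rw [even_iff_two_dvd]; exact (ZMod.intCast_zmod_eq_zero_iff_dvd _ 2).mp (by exact_mod_cast h)
  rw [← sub_add_cancel a b, sgn_add, sgn_even h2, one_mul]

theorem sgn_mul_self (a : ℤ) : sgn k a * sgn k a = 1 := by
  rw [← sgn_add]; exact sgn_even ⟨a, rfl⟩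

/-- A linear operator on words can produce (-1)^a, but not a sign whose exponent is a product of two
degrees. This formula writes the latter through the former, at the price of dividing by 2. -/
theorem sgn_mul_formula [CharZero k] (a b : ℤ) :
    sgn k (a * b) = 2⁻¹ * (1 + sgn k a + sgn k b - sgn k a * sgn k b) := by
  rcases Int.even_or_odd a with ha | ha <;> rcases Int.even_or_odd b with hb | hb
  · rw [sgn_even ha, sgn_even hb, sgn_even (ha.mul_right b)]; norm_num
  · rw [sgn_even ha, sgn_odd hb, sgn_even (ha.mul_right b)]; norm_num
  · rw [sgn_odd ha, sgn_even hb, sgn_even (hb.mul_left a)]; norm_num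
  · rw [sgn_odd ha, sgn_odd hb, sgn_odd (ha.mul hb)]; norm_num

end Sgn

/-! ### Sums over the cuts of a word -/

section Split

variable {α : Type*} {M : Type*} [AddCommMonoid M]

theorem sumSplit_nil (F : List α → List α → M) : sumSplit [] F = F [] [] := by
  simp [sumSplit]

theorem sumSplit_cons (a : α) (x : List α) (F : List α → List α → M) :
    sumSplit (a :: x) F = F [] (a :: x) + sumSplit x fun x₁ x₂ => F (a :: x₁) x₂ := by
  have := sumSplit_append_cons [] a x F
  simpa [sumSplit_nil] using this

theorem sumSplit_congr {x : List α} {F F' : List α → List α → M}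
    (h : ∀ a b, x = a ++ b → F a b = F' a b) : sumSplit x F = sumSplit x F' :=
  Finset.sum_congr rfl fun _ _ => h _ _ (List.take_append_drop _ _).symm

theorem sumSplit_eq_zero {x : List α} {F : List α → List α → M}
    (h : ∀ a b, x = a ++ b → F a b = 0) : sumSplit x F = 0 :=
  Finset.sum_eq_zero fun _ _ => h _ _ (List.take_append_drop _ _).symm

/-- Coassociativity of deconcatenation: both sides run over the cuts of `x` into three words. -/
theorem sumSplit_assoc (x : List α) (F : List α → List α → List α → M) :
    sumSplit x (fun l c => sumSplit l fun a b => F a b c) =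
      sumSplit x (fun a r => sumSplit r fun b c => F a b c) := by
  induction x generalizing F with
  | nil => simp [sumSplit_nil]
  | cons y x ih =>
    simp only [sumSplit_cons, sumSplit_nil, sumSplit_add]
    rw [ih fun a b c => F (y :: a) b c, add_assoc]

theorem sumSplit_comm {α' : Type*} (x : List α) (y : List α')
    (F : List α → List α → List α' → List α' → M) :
    sumSplit x (fun a b => sumSplit y fun c d => F a b c d) =
      sumSplit y (fun c d => sumSplit x fun a b => F a b c d) := by
  unfold sumSplit; exact Finset.sum_comm

theorem sumSplit_sum {ι : Type*} (s : Finset ι) (x : List α) (F : ι → List α → List α → M) :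
    sumSplit x (fun a b => ∑ i ∈ s, F i a b) = ∑ i ∈ s, sumSplit x (F i) := by
  unfold sumSplit; exact Finset.sum_comm

theorem map_sumSplit {M' : Type*} [AddCommMonoid M'] {T : Type*} [FunLike T M M']
    [AddMonoidHomClass T M M'] (f : T) (x : List α) (F : List α → List α → M) :
    f (sumSplit x F) = sumSplit x fun a b => f (F a b) := by
  unfold sumSplit; exact map_sum f _ _

theorem smul_sumSplit {R : Type*} [DistribSMul R M] (c : R) (x : List α)
    (F : List α → List α → M) : c • sumSplit x F = sumSplit x fun a b => c • F a b := by
  unfold sumSplit; exact Finset.smul_sum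

theorem sumSplit_neg {M : Type*} [AddCommGroup M] (x : List α) (F : List α → List α → M) :
    sumSplit x (fun a b => -F a b) = -sumSplit x F := by
  unfold sumSplit; exact Finset.sum_neg_distrib _

theorem sumSplit_sub {M : Type*} [AddCommGroup M] (x : List α) (F F' : List α → List α → M) :
    sumSplit x (fun a b => F a b - F' a b) = sumSplit x F - sumSplit x F' := by
  unfold sumSplit; exact Finset.sum_sub_distrib _ _

theorem sumSplit_eq_left (x : List α) (F : List α → List α → M)
    (h : ∀ a b, b ≠ [] → F a b = 0) : sumSplit x F = F x [] := by
  induction x generalizing F with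
  | nil => simp [sumSplit_nil]
  | cons a x ih =>
    rw [sumSplit_cons, h _ _ (by simp), zero_add, ih _ fun b c hc => h _ _ hc]

theorem sumSplit_eq_right (x : List α) (F : List α → List α → M)
    (h : ∀ a b, a ≠ [] → F a b = 0) : sumSplit x F = F [] x := by
  cases x with
  | nil => simp [sumSplit_nil]
  | cons a x =>
    rw [sumSplit_cons, sumSplit_eq_zero fun b c _ => h _ _ (by simp), add_zero]

/-- The sum over all ways to replace a subword `x₂` of `x = x₁ x₂ x₃` by a letter `ℓ x₂` and then to
cut the result. -/
theorem sumSplit_insert (ℓ : List α → α) (x : List α)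
    (F : List α → List α → List α → List α → List α → M) :
    sumSplit x (fun x₁ r => sumSplit r fun x₂ x₃ =>
        sumSplit (x₁ ++ ℓ x₂ :: x₃) fun a b => F x₁ x₂ x₃ a b) =
      sumSplit x (fun a b => sumSplit b fun b₁ r => sumSplit r fun b₂ b₃ =>
        F (a ++ b₁) b₂ b₃ a (b₁ ++ ℓ b₂ :: b₃)) +
      sumSplit x (fun a b => sumSplit a fun a₁ r => sumSplit r fun a₂ a₃ =>
        F a₁ a₂ (a₃ ++ b) (a₁ ++ ℓ a₂ :: a₃) b) := by
  -- A cut of the new word falls either to the left or to the right of the inserted letter; these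
  -- are the two sums on the right.
  simp only [sumSplit_append_cons, sumSplit_add]
  congr 1
  · have e : ∀ x₁ r : List α, sumSplit r (fun x₂ x₃ => sumSplit x₁ fun x y =>
        F x₁ x₂ x₃ x (y ++ ℓ x₂ :: x₃)) = sumSplit x₁ fun x y => sumSplit r fun x₂ x₃ =>
        F (x ++ y) x₂ x₃ x (y ++ ℓ x₂ :: x₃) := by
      intro x₁ r
      rw [sumSplit_comm]
      refine sumSplit_congr fun a b h => ?_
      rw [h]
    simp only [e]
    rw [sumSplit_assoc x fun a b r => sumSplit r fun x₂ x₃ => F (a ++ b) x₂ x₃ a (b ++ ℓ x₂ :: x₃)]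
  · rw [sumSplit_assoc x fun a₁ r b => sumSplit r fun a₂ a₃ =>
      F a₁ a₂ (a₃ ++ b) (a₁ ++ ℓ a₂ :: a₃) b]
    refine sumSplit_congr fun x₁ r _ => ?_
    rw [sumSplit_assoc r fun a₂ a₃ b => F x₁ a₂ (a₃ ++ b) (x₁ ++ ℓ a₂ :: a₃) b]
    refine sumSplit_congr fun x₂ x₃ _ => sumSplit_congr fun a b h => ?_
    rw [h]

end Split

/-! ### The tensor algebra of a graded space: words, parity, cuts -/

namespace GradedSpace

variable {k : Type v} [Field k] {V : GradedSpace.{u} k}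

open TensorAlgebra

@[simp] theorem word_nil : word ([] : List V.Homog) = 1 := by simp [word]

theorem word_singleton (a : V.Homog) : word [a] = ι k (a.2 : V.carrier) := by simp [word]

@[simp] theorem deg_nil : deg ([] : List V.Homog) = 0 := by simp [deg]

theorem span_homog : Submodule.span k {x : V.carrier | ∃ a : V.Homog, x = a.2} = ⊤ := by
  have h := V.isInternal.submodule_iSup_eq_top
  rw [eq_top_iff, ← h, iSup_le_iff]
  intro i x hx
  exact Submodule.subset_span ⟨⟨i, ⟨x, hx⟩⟩, rfl⟩

theorem hom_ext_homog {M : Type*} [AddCommGroup M] [Module k M] {f g : V.carrier →ₗ[k] M}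
    (h : ∀ a : V.Homog, f a.2 = g a.2) : f = g := by
  refine LinearMap.ext_on_range (v := fun a : V.Homog => (a.2 : V.carrier)) ?_ h
  rw [← span_homog]
  congr 1; ext x; simp [eq_comm]

/-- Words of homogeneous letters span the tensor algebra. -/
theorem bar_ext {M : Type*} [AddCommGroup M] [Module k M] {f g : V.Bar →ₗ[k] M}
    (h : ∀ x : List V.Homog, f (word x) = g (word x)) : f = g := by
  -- The claim is strengthened to products with a word, and quantified over the maps, so that a
  -- product is handled by absorbing its left factor into the maps.
  have key : ∀ z : V.Bar, ∀ f g : V.Bar →ₗ[k] M, (∀ x : List V.Homog, f (word x) = g (word x)) →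
      ∀ x : List V.Homog, f (z * word x) = g (z * word x) := by
    intro z
    induction z using TensorAlgebra.induction with
    | algebraMap r =>
      intro f g h x
      rw [← Algebra.smul_def, map_smul, map_smul, h]
    | ι v =>
      intro f g h x
      have : (f ∘ₗ LinearMap.mulRight k (word x)) ∘ₗ ι k =
          (g ∘ₗ LinearMap.mulRight k (word x)) ∘ₗ ι k :=
        hom_ext_homog fun a => by simpa using h (a :: x)
      exact LinearMap.congr_fun this v
    | mul a b iha ihb =>
      intro f g h x
      have := iha (f) (g) h
      have h2 := ihb (f ∘ₗ LinearMap.mulLeft k a) (g ∘ₗ LinearMap.mulLeft k a)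
        (fun x => this x) x
      simpa [mul_assoc] using h2
    | add a b iha ihb =>
      intro f g h x
      rw [add_mul, map_add, map_add, iha f g h, ihb f g h]
  ext z
  simpa using key z f g h []

/-! #### Parity -/

variable (V) in
/-- The operator `(-1) ^ deg`. -/
noncomputable def par : V.carrier →ₗ[k] V.carrier :=
  (DirectSum.toModule k ℤ V.carrier fun i => sgn k i • (V.piece i).subtype) ∘ₗ
    (LinearEquiv.ofBijective (DirectSum.coeLinearMap V.piece) V.isInternal).symm.toLinearMap

theorem par_of_mem {i : ℤ} {x : V.carrier} (h : x ∈ V.piece i) : V.par x = sgn k i • x := by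
  have e : (LinearEquiv.ofBijective (DirectSum.coeLinearMap V.piece) V.isInternal).symm x =
      DirectSum.lof k ℤ (fun i => V.piece i) i ⟨x, h⟩ := by
    rw [LinearEquiv.symm_apply_eq]
    exact (DirectSum.coeLinearMap_lof V.piece i ⟨x, h⟩).symm
  rw [par, LinearMap.comp_apply, LinearEquiv.coe_coe, e, DirectSum.toModule_lof]
  rfl

theorem par_homog (a : V.Homog) : V.par a.2 = sgn k a.1 • (a.2 : V.carrier) := par_of_mem a.2.2

theorem par_comp_par : V.par ∘ₗ V.par = LinearMap.id :=
  hom_ext_homog fun a => by simp [par_homog, smul_smul, sgn_mul_self]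

variable (V) in
/-- The operator `(-1) ^ deg` on words. -/
noncomputable def parT : V.Bar →ₐ[k] V.Bar := lift k (ι k ∘ₗ V.par)

@[simp] theorem parT_ι (x : V.carrier) : V.parT (ι k x) = ι k (V.par x) := by simp [parT]

theorem parT_word (x : List V.Homog) : V.parT (word x) = sgn k (deg x) • word x := by
  induction x with
  | nil => simp
  | cons a x ih => simp [ih, par_homog, sgn_add, smul_smul, mul_comm]

theorem parT_parT (x : V.Bar) : V.parT (V.parT x) = x := by
  have : V.parT.toLinearMap ∘ₗ V.parT.toLinearMap = LinearMap.id :=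
    bar_ext fun x => by simp [parT_word, smul_smul, sgn_mul_self]
  exact LinearMap.congr_fun this x

/-! #### Deconcatenation -/

section Cut

variable {M : Type*} [AddCommGroup M] [Module k M]

open TensorProduct in
variable (V) in
/-- The operator describing how the pair of a coproduct and a word changes when a letter is
prepended. -/
noncomputable def consOp : V.carrier →ₗ[k] Module.End k ((V.Bar ⊗[k] V.Bar) × V.Bar) :=
  LinearMap.mk₂ k (fun v z => ((1 : V.Bar) ⊗ₜ[k] (ι k v * z.2) +
      TensorProduct.map (LinearMap.mulLeft k (ι k v)) LinearMap.id z.1, ι k v * z.2))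
    (by
      intro v v' z
      have : LinearMap.mulLeft k (ι k v + ι k v') =
        LinearMap.mulLeft k (ι k v) + LinearMap.mulLeft k (ι k v') := by ext; simp [add_mul]
      ext <;> simp [add_mul, tmul_add, this, TensorProduct.map_add_left, add_add_add_comm])
    (by
      intro c v z
      have : LinearMap.mulLeft k (c • ι k v) = c • LinearMap.mulLeft k (ι k v) := by ext; simp
      ext <;> simp [this, TensorProduct.map_smul_left, smul_add])
    (by intro v z z'; ext <;> simp [mul_add, tmul_add, add_add_add_comm])
    (by intro c v z; ext <;> simp [smul_add])

open TensorProduct in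
variable (V) in
/-- Deconcatenation. -/
noncomputable def cop : V.Bar →ₗ[k] V.Bar ⊗[k] V.Bar :=
  LinearMap.fst k _ _ ∘ₗ (LinearMap.applyₗ ((1 : V.Bar) ⊗ₜ[k] (1 : V.Bar), (1 : V.Bar))) ∘ₗ
    (lift k V.consOp).toLinearMap

open TensorProduct in
theorem consOp_apply (v : V.carrier) (z : (V.Bar ⊗[k] V.Bar) × V.Bar) :
    V.consOp v z = ((1 : V.Bar) ⊗ₜ[k] (ι k v * z.2) +
      TensorProduct.map (LinearMap.mulLeft k (ι k v)) LinearMap.id z.1, ι k v * z.2) := rfl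

-- The second coordinate of the operator `consOp` rebuilds the word itself. This is what allows the
-- first coordinate to add, at each new letter, the cut whose left part is empty.
open TensorProduct in
theorem lift_consOp_snd (x : List V.Homog) :
    (lift k V.consOp (word x) ((1 : V.Bar) ⊗ₜ[k] (1 : V.Bar), (1 : V.Bar))).2 = word x := by
  induction x with
  | nil => simp
  | cons a x ih =>
    rw [word_cons, map_mul, lift_ι_apply, Module.End.mul_apply, consOp_apply, ih]

open TensorProduct in
theorem cop_word (x : List V.Homog) :
    V.cop (word x) = sumSplit x fun a b => word a ⊗ₜ[k] word b := by
  induction x with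
  | nil => simp [cop, sumSplit_nil]
  | cons a x ih =>
    have h2 := lift_consOp_snd x
    simp only [cop, LinearMap.comp_apply, LinearMap.applyₗ_apply_apply, LinearMap.fst_apply,
      AlgHom.toLinearMap_apply] at ih ⊢
    rw [sumSplit_cons, word_cons, map_mul, lift_ι_apply, Module.End.mul_apply]
    rw [consOp_apply, h2, ih, map_sumSplit]
    simp

/-- The linear map whose value at a word is the sum of the values of a bilinear map at the cuts of
the word. -/
noncomputable def cut : (V.Bar →ₗ[k] V.Bar →ₗ[k] M) →ₗ[k] (V.Bar →ₗ[k] M) :=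
  LinearMap.lcomp k M V.cop ∘ₗ (TensorProduct.lift.equiv (.id k) V.Bar V.Bar M).toLinearMap

theorem cut_word (Q : V.Bar →ₗ[k] V.Bar →ₗ[k] M) (x : List V.Homog) :
    cut Q (word x) = sumSplit x fun a b => Q (word a) (word b) := by
  simp [cut, cop_word, map_sumSplit]

/-- The projection of words to words of length one. -/
noncomputable abbrev letter : V.Bar →ₗ[k] V.carrier := TensorAlgebra.ιInv

@[simp] theorem letter_ι (v : V.carrier) : letter (V := V) (ι k v) = v := ι_leftInverse v

@[simp] theorem letter_one : letter (V := V) 1 = 0 := by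
  have : letter (V := V) (algebraMap k V.Bar 1) = 0 := by
    simp only [letter, TensorAlgebra.ιInv, LinearMap.comp_apply, AlgHom.toLinearMap_apply,
      AlgHom.commutes]
    rfl
  simpa using this

theorem letter_mul_ι (v w : V.carrier) (x : V.Bar) : letter (V := V) (ι k v * (ι k w * x)) = 0 := by
  simp [letter, TensorAlgebra.ιInv, TensorAlgebra.toTrivSqZeroExt_ι]

theorem letter_word_of_length_ne {x : List V.Homog} (h : x.length ≠ 1) :
    letter (word x) = 0 := by
  match x with
  | [] => simp
  | [a] => simp at h
  | a :: b :: x => simpa using letter_mul_ι _ _ _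

end Cut

/-! #### Linear maps defined on words of each length -/

variable (V) in
theorem exists_homog_basis : ∃ (κ : Type u) (b : Module.Basis κ k V.carrier) (e : κ → V.Homog),
    ∀ i, b i = (e i).2 := by
  refine ⟨_, V.isInternal.collectedBasis fun i => Module.Basis.ofVectorSpace k (V.piece i),
    fun a => ⟨a.1, Module.Basis.ofVectorSpace k (V.piece a.1) a.2⟩, fun i => ?_⟩
  simp

/-- Multilinearity: the letters are expanded in the basis one at a time, which keeps the length
fixed. -/
theorem eq_on_length {M : Type*} [AddCommGroup M] [Module k M] {κ : Type*}
    (b : Module.Basis κ k V.carrier) (e : κ → V.Homog) (hb : ∀ i, b i = (e i).2) (n : ℕ)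
    {f g : V.Bar →ₗ[k] M}
    (h : ∀ l : List κ, l.length = n → f (word (l.map e)) = g (word (l.map e)))
    (x : List V.Homog) (hx : x.length = n) : f (word x) = g (word x) := by
  induction x generalizing f g n with
  | nil => simpa using h [] hx
  | cons a x ih =>
    have : (f ∘ₗ LinearMap.mulRight k (word x)) ∘ₗ ι k =
        (g ∘ₗ LinearMap.mulRight k (word x)) ∘ₗ ι k := by
      refine b.ext fun i => ?_
      have := ih x.length (f := f ∘ₗ LinearMap.mulLeft k (ι k (b i)))
        (g := g ∘ₗ LinearMap.mulLeft k (ι k (b i)))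
        (fun l hl => by
          have := h (i :: l) (by simpa [hl] using hx)
          simpa [hb] using this) rfl
      simpa using this
    simpa using LinearMap.congr_fun this a.2

theorem basisFreeMonoid_apply (κ : Type*) (w : FreeMonoid κ) :
    FreeAlgebra.basisFreeMonoid k κ w =
      FreeAlgebra.equivMonoidAlgebraFreeMonoid.symm (MonoidAlgebra.of k (FreeMonoid κ) w) := rfl

/-- Words in a homogeneous basis form a basis of the tensor algebra, so a linear map may be
prescribed independently on each length. This is used for limits of weightwise stabilising sequences
and for the length-dependent factor of the Euler homotopy. -/
theorem exists_of_length {M : Type*} [AddCommGroup M] [Module k M] (F : ℕ → V.Bar →ₗ[k] M) :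
    ∃ f : V.Bar →ₗ[k] M, ∀ x : List V.Homog, f (word x) = F x.length (word x) := by
  obtain ⟨κ, b, e, hb⟩ := V.exists_homog_basis
  let B := b.tensorAlgebra
  have hB : ∀ l : List κ, B (FreeMonoid.ofList l) = word (l.map e) := by
    intro l
    induction l with
    | nil =>
      have h1 : FreeMonoid.ofList ([] : List κ) = 1 := rfl
      simp only [B, Module.Basis.tensorAlgebra, Module.Basis.map_apply, basisFreeMonoid_apply, h1,
        map_one]
      simp
    | cons i l ih =>
      rw [List.map_cons, word_cons, ← ih, ← hb]
      have h1 : FreeMonoid.ofList (i :: l) = FreeMonoid.of i * FreeMonoid.ofList l := rfl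
      simp only [B, Module.Basis.tensorAlgebra, Module.Basis.map_apply, basisFreeMonoid_apply, h1,
        map_mul]
      simp [FreeAlgebra.equivMonoidAlgebraFreeMonoid]
  refine ⟨B.constr k fun l => F l.toList.length (B l), fun x => ?_⟩
  refine eq_on_length b e hb x.length (fun l hl => ?_) x rfl
  rw [← hB, B.constr_basis]
  simp [hl]

/-- The one-variable construction is applied to the right argument and then to the left one. -/
theorem exists_of_length₂ {C : Type*} [AddCommGroup C] [Module k C] {M : Type*} [AddCommGroup M]
    [Module k M] (F : ℕ → ℕ → BiOp V C M) :
    ∃ f : BiOp V C M, ∀ (x : List V.Homog) (c : C) (y : List V.Homog),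
      f (word x) c (word y) = F x.length y.length (word x) c (word y) := by
  have h : ∀ n : ℕ, ∃ f : BiOp V C M, ∀ (x : V.Bar) (c : C) (y : List V.Homog),
      f x c (word y) = F n y.length x c (word y) := by
    intro n
    let s : (C →ₗ[k] V.Bar →ₗ[k] M) →ₗ[k] (V.Bar →ₗ[k] C →ₗ[k] M) := LinearMap.lflip.toLinearMap
    let s' : (V.Bar →ₗ[k] C →ₗ[k] M) →ₗ[k] (C →ₗ[k] V.Bar →ₗ[k] M) := LinearMap.lflip.toLinearMap
    obtain ⟨f, hf⟩ := exists_of_length fun m => (s ∘ₗ F n m).flip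
    refine ⟨s' ∘ₗ f.flip, fun x c y => ?_⟩
    have := LinearMap.congr_fun (LinearMap.congr_fun (hf y) x) c
    simpa [s, s'] using this
  choose F' hF' using h
  obtain ⟨f, hf⟩ := exists_of_length F'
  exact ⟨f, fun x c y => by rw [hf, hF']⟩

end GradedSpace

/-! ### Fixed points of contractions -/

section FixedPoint

/-- Banach's fixed point theorem for a complete filtration: the iterates of `Φ` stabilise at every
level and their limit is fixed. The closed condition `P` carries degree and order restrictions
along, so that `Φ` need only contract on families satisfying them. -/
theorem exists_fixed_point {X : Type*} (agree : ℕ → X → X → Prop)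
    (symm : ∀ n f g, agree n f g → agree n g f)
    (trans : ∀ n f g h, agree n f g → agree n g h → agree n f h)
    (zero : ∀ f g, agree 0 f g) (mono : ∀ n f g, agree (n + 1) f g → agree n f g)
    (sep : ∀ f g, (∀ n, agree n f g) → f = g)
    (complete : ∀ F : ℕ → X, (∀ n, agree n (F n) (F (n + 1))) → ∃ f, ∀ n, agree n f (F n))
    (P : X → Prop) (closed : ∀ f, (∀ n, ∃ g, P g ∧ agree n f g) → P f)
    (x₀ : X) (h₀ : P x₀) (Φ : X → X) (hP : ∀ f, P f → P (Φ f))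
    (hΦ : ∀ n f g, P f → P g → agree n f g → agree (n + 1) (Φ f) (Φ g)) :
    ∃ f, P f ∧ Φ f = f := by
  let F : ℕ → X := fun n => Φ^[n] x₀
  have hFP : ∀ n, P (F n) := by
    intro n
    induction n with
    | zero => exact h₀
    | succ n ih =>
      have := hP _ ih
      simpa only [F, ← Function.iterate_succ_apply'] using this
  have hF : ∀ n, agree n (F n) (F (n + 1)) := by
    intro n
    induction n with
    | zero => exact zero _ _
    | succ n ih =>
      have := hΦ n _ _ (hFP _) (hFP _) ih
      simpa only [F, ← Function.iterate_succ_apply'] using this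
  obtain ⟨f, hf⟩ := complete F hF
  have hfP : P f := closed f fun n => ⟨F n, hFP n, hf n⟩
  refine ⟨f, hfP, sep _ _ fun n => mono _ _ _ ?_⟩
  have h1 : agree (n + 1) (Φ f) (F (n + 1)) := by
    have := hΦ n _ _ hfP (hFP n) (hf n)
    simpa only [F, ← Function.iterate_succ_apply'] using this
  exact trans _ _ _ _ h1 (symm _ _ _ (hf (n + 1)))

open GappingMonoid GradedSpace

variable {k : Type v} [Field k] (G : GappingMonoid) (V : GradedSpace.{u} k)

/-- Families of linear maps on words, indexed by the gapping monoid. -/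
abbrev Coch (M : Type*) [AddCommGroup M] [Module k M] : Type _ := G.Elt → (V.Bar →ₗ[k] M)

/-- Families of bimodule operations, indexed by the gapping monoid. -/
abbrev BiFam (C M : Type*) [AddCommGroup C] [Module k C] [AddCommGroup M] [Module k M] : Type _ :=
  G.Elt → BiOp V C M

variable {G V}

/-- The weight of a word with an energy; every operation that is not linear of energy zero
decreases it. -/
noncomputable def wt (β : G.Elt) (n : ℕ) : ℕ := 2 * ord β + n

theorem BiOp.ext_word {C : GradedSpace.{w} k} {M : Type*} [AddCommGroup M] [Module k M]
    {f g : BiOp V C.carrier M} (h : ∀ (x : List V.Homog) (v : C.Homog) (y : List V.Homog),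
      f (word x) v.2 (word y) = g (word x) v.2 (word y)) : f = g :=
  bar_ext fun x => hom_ext_homog fun v => bar_ext fun y => h x v y

variable {M : Type*} [AddCommGroup M] [Module k M]

theorem Coch.exists_fixed_point (P : Coch G V M → Prop)
    (closed : ∀ f, (∀ n, ∃ g, P g ∧ ∀ (β : G.Elt) (x : List V.Homog), wt β x.length < n →
      f β (word x) = g β (word x)) → P f) (h₀ : P 0)
    (Φ : Coch G V M → Coch G V M) (hP : ∀ f, P f → P (Φ f))
    (hΦ : ∀ (n : ℕ) (f g : Coch G V M), P f → P g →
      (∀ (β : G.Elt) (x : List V.Homog), wt β x.length < n → f β (word x) = g β (word x)) →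
      ∀ (β : G.Elt) (x : List V.Homog), wt β x.length < n + 1 → Φ f β (word x) = Φ g β (word x)) :
    ∃ f, P f ∧ Φ f = f := by
  refine _root_.exists_fixed_point (X := Coch G V M)
    (fun n f g => ∀ (β : G.Elt) (x : List V.Homog), wt β x.length < n →
      f β (word x) = g β (word x))
    (fun n f g h β x hx => (h β x hx).symm)
    (fun n f g h h1 h2 β x hx => (h1 β x hx).trans (h2 β x hx))
    (fun f g β x hx => absurd hx (by omega)) (fun n f g h β x hx => h β x (by omega))
    (fun f g h => funext fun β => bar_ext fun x => h _ β x (Nat.lt_succ_self _)) ?_ P closed 0 h₀ Φ hP hΦ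
  intro F hF
  have hF' : ∀ m n : ℕ, ∀ (β : G.Elt) (x : List V.Homog), wt β x.length < n →
      F n β (word x) = F (n + m) β (word x) := by
    intro m n β x hx
    induction m with
    | zero => rfl
    | succ m ih => rw [ih]; exact hF (n + m) β x (by omega)
  -- The limit takes on words of length n at energy β the member of the sequence with index one more
  -- than their weight; from there on the sequence is constant on them.
  choose f hf using fun β : G.Elt => exists_of_length (V := V) fun n => F (wt β n + 1) β
  refine ⟨f, fun n β x hx => ?_⟩
  rw [hf]
  obtain ⟨m, rfl⟩ := Nat.exists_eq_add_of_le (Nat.succ_le_iff.mpr hx)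
  exact hF' m _ β x (Nat.lt_succ_self _)

theorem BiFam.exists_fixed_point {C : GradedSpace.{w} k}
    (P : BiFam G V C.carrier M → Prop)
    (closed : ∀ f, (∀ n, ∃ g, P g ∧ ∀ (β : G.Elt) (x : List V.Homog) (c : C.Homog)
      (y : List V.Homog), wt β (x.length + y.length) < n →
        f β (word x) c.2 (word y) = g β (word x) c.2 (word y)) → P f) (h₀ : P 0)
    (Φ : BiFam G V C.carrier M → BiFam G V C.carrier M) (hP : ∀ f, P f → P (Φ f))
    (hΦ : ∀ (n : ℕ) (f g : BiFam G V C.carrier M), P f → P g →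
      (∀ (β : G.Elt) (x : List V.Homog) (c : C.Homog) (y : List V.Homog),
        wt β (x.length + y.length) < n → f β (word x) c.2 (word y) = g β (word x) c.2 (word y)) →
      ∀ (β : G.Elt) (x : List V.Homog) (c : C.Homog) (y : List V.Homog),
        wt β (x.length + y.length) < n + 1 →
          Φ f β (word x) c.2 (word y) = Φ g β (word x) c.2 (word y)) :
    ∃ f, P f ∧ Φ f = f := by
  refine _root_.exists_fixed_point (X := BiFam G V C.carrier M)
    (fun n f g => ∀ (β : G.Elt) (x : List V.Homog) (c : C.Homog) (y : List V.Homog),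
      wt β (x.length + y.length) < n → f β (word x) c.2 (word y) = g β (word x) c.2 (word y))
    (fun n f g h β x c y hx => (h β x c y hx).symm)
    (fun n f g h h1 h2 β x c y hx => (h1 β x c y hx).trans (h2 β x c y hx))
    (fun f g β x c y hx => absurd hx (by omega)) (fun n f g h β x c y hx => h β x c y (by omega))
    (fun f g h => funext fun β => BiOp.ext_word fun x c y => h _ β x c y (Nat.lt_succ_self _))
    ?_ P closed 0 h₀ Φ hP hΦ
  intro F hF
  have hF' : ∀ m n : ℕ, ∀ (β : G.Elt) (x : List V.Homog) (c : C.Homog) (y : List V.Homog),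
      wt β (x.length + y.length) < n →
      F n β (word x) c.2 (word y) = F (n + m) β (word x) c.2 (word y) := by
    intro m n β x c y hx
    induction m with
    | zero => rfl
    | succ m ih => rw [ih]; exact hF (n + m) β x c y (by omega)
  choose f hf using fun β : G.Elt => exists_of_length₂ (V := V) (C := C.carrier)
    fun n m => F (wt β (n + m) + 1) β
  refine ⟨f, fun n β x c y hx => ?_⟩
  rw [hf]
  obtain ⟨m, rfl⟩ := Nat.exists_eq_add_of_le (Nat.succ_le_iff.mpr hx)
  exact hF' m _ β x c y (Nat.lt_succ_self _)

end FixedPoint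

/-! ### Operations on families of bimodule operations -/

section BiOps

open GradedSpace

variable {k : Type v} [Field k] {V : GradedSpace.{u} k}
variable {C : GradedSpace.{u₁} k} {C' : GradedSpace.{u₂} k}
variable {D E M W W' : Type*} [AddCommGroup D] [Module k D] [AddCommGroup E] [Module k E]
  [AddCommGroup M] [Module k M] [AddCommGroup W] [Module k W] [AddCommGroup W'] [Module k W']

namespace BiOp

/-- Precomposition of the three inputs with linear maps. -/
noncomputable def comp₃ {D' : Type*} [AddCommGroup D'] [Module k D'] {V' : GradedSpace.{u₃} k}
    (K : BiOp V D M) (a : V'.Bar →ₗ[k] V.Bar) (b : D' →ₗ[k] D)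
    (c : V'.Bar →ₗ[k] V.Bar) : BiOp V' D' M :=
  LinearMap.mk₂ k (fun x v => K (a x) (b v) ∘ₗ c) (by intros; ext; simp) (by intros; ext; simp)
    (by intros; ext; simp) (by intros; ext; simp)

@[simp] theorem comp₃_apply {D' : Type*} [AddCommGroup D'] [Module k D'] {V' : GradedSpace.{u₃} k}
    (K : BiOp V D M) (a : V'.Bar →ₗ[k] V.Bar) (b : D' →ₗ[k] D)
    (c : V'.Bar →ₗ[k] V.Bar) (x : V'.Bar) (v : D') (y : V'.Bar) :
    comp₃ K a b c x v y = K (a x) (b v) (c y) := rfl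

/-- Replacing the first argument by its image under a linear map. -/
noncomputable def insL : BiOp V D M →ₗ[k] (V.Bar →ₗ[k] V.Bar) →ₗ[k] BiOp V D M :=
  LinearMap.mk₂ k (fun K t => comp₃ K t LinearMap.id LinearMap.id) (by intros; ext; simp)
    (by intros; ext; simp) (by intros; ext; simp) (by intros; ext; simp)

@[simp] theorem insL_apply (K : BiOp V D M) (t : V.Bar →ₗ[k] V.Bar) (x : V.Bar) (v : D)
    (y : V.Bar) : insL K t x v y = K (t x) v y := rfl

/-- Replacing the last argument by its image under a linear map of odd degree. -/
noncomputable def insR : BiOp V C.carrier M →ₗ[k] (V.Bar →ₗ[k] V.Bar) →ₗ[k] BiOp V C.carrier M :=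
  LinearMap.mk₂ k (fun K t => comp₃ K V.parT.toLinearMap C.par t) (by intros; ext; simp)
    (by intros; ext; simp) (by intros; ext; simp) (by intros; ext; simp)

@[simp] theorem insR_apply (K : BiOp V C.carrier M) (t : V.Bar →ₗ[k] V.Bar) (x : V.Bar)
    (v : C.carrier) (y : V.Bar) : insR K t x v y = K (V.parT x) (C.par v) (t y) := rfl

/-- The sign of the first argument. -/
noncomputable def sL : BiOp V D M →ₗ[k] BiOp V D M where
  toFun K := comp₃ K V.parT.toLinearMap LinearMap.id LinearMap.id
  map_add' _ _ := rfl
  map_smul' _ _ := rfl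

@[simp] theorem sL_apply (K : BiOp V D M) (x : V.Bar) (v : D)
    (y : V.Bar) : sL K x v y = K (V.parT x) v y := rfl

/-- The sign of all arguments. -/
noncomputable def sA : BiOp V C.carrier M →ₗ[k] BiOp V C.carrier M where
  toFun K := comp₃ K V.parT.toLinearMap C.par V.parT.toLinearMap
  map_add' _ _ := rfl
  map_smul' _ _ := rfl

@[simp] theorem sA_apply (K : BiOp V C.carrier M) (x : V.Bar) (v : C.carrier)
    (y : V.Bar) : sA K x v y = K (V.parT x) (C.par v) (V.parT y) := rfl

-- The part of the composition in which only the right argument is cut. The cut of the left argument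
-- is added in `mul`.
variable (V D E M) in
noncomputable def mulInner : (E →ₗ[k] V.Bar →ₗ[k] M) →ₗ[k] (D →ₗ[k] V.Bar →ₗ[k] E) →ₗ[k]
    (D →ₗ[k] V.Bar →ₗ[k] M) :=
  LinearMap.mk₂ k (fun f g => cut ∘ₗ LinearMap.compRight k f ∘ₗ g)
    (by intro f f' g; ext v; simp [LinearMap.add_comp])
    (by intro c f g; ext v; simp [LinearMap.smul_comp])
    (by intro f g g'; ext v; simp [LinearMap.comp_add]) (by intro c f g; ext v; simp [LinearMap.comp_smul])

/-- The composition `(x, v, y) ↦ ∑ f (x₁, g (x₂, v, y₁), y₂)`. -/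
noncomputable def mul : BiOp V E M →ₗ[k] BiOp V D E →ₗ[k] BiOp V D M :=
  LinearMap.mk₂ k (fun f g => cut ((mulInner V D E M).compl₁₂ f g))
    (by intro f f' g; rw [← map_add]; congr 1; ext; simp)
    (by intro c f g; rw [← map_smul]; congr 1; ext; simp)
    (by intro f g g'; rw [← map_add]; congr 1; ext; simp)
    (by intro c f g; rw [← map_smul]; congr 1; ext; simp)

theorem mul_word (f : BiOp V E M) (g : BiOp V D E) (x : List V.Homog) (v : D) (y : List V.Homog) :
    mul f g (word x) v (word y) = sumSplit x fun x₁ x₂ => sumSplit y fun y₁ y₂ =>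
      f (word x₁) (g (word x₂) v (word y₁)) (word y₂) := by
  simp only [mul, LinearMap.mk₂_apply, cut_word]
  let ev : (D →ₗ[k] V.Bar →ₗ[k] M) →ₗ[k] M :=
    (LinearMap.applyₗ (word y)) ∘ₗ LinearMap.applyₗ v
  change ev _ = _
  rw [map_sumSplit]
  refine sumSplit_congr fun a b _ => ?_
  simp [ev, mulInner, cut_word]

/-- The operation of a single linear map without further inputs. -/
noncomputable def const : (D →ₗ[k] M) →ₗ[k] BiOp V D M where
  toFun f := LinearMap.mk₂ k
    (fun x v => (TensorAlgebra.algebraMapInv x) • (LinearMap.toSpanSingleton k M (f v)) ∘ₗ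
      TensorAlgebra.algebraMapInv.toLinearMap)
    (by intros; ext; simp [add_smul]) (by intros; ext; simp [mul_smul])
    (by intros; ext; simp) (by intros; ext; simp [smul_smul]; ring_nf)
  map_add' f g := by ext; simp
  map_smul' c f := by ext; simp [smul_smul]; ring_nf

theorem const_apply (f : D →ₗ[k] M) (x : V.Bar) (v : D) (y : V.Bar) :
    const f x v y = TensorAlgebra.algebraMapInv x • TensorAlgebra.algebraMapInv y • f v := by
  simp [const]

@[simp] theorem algebraMapInv_word_cons (a : V.Homog) (x : List V.Homog) :
    TensorAlgebra.algebraMapInv (word (a :: x)) = (0 : k) := by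
  simp [TensorAlgebra.algebraMapInv]

theorem algebraMapInv_word_of_ne {x : List V.Homog} (h : x ≠ []) :
    TensorAlgebra.algebraMapInv (word x) = (0 : k) := by
  cases x with
  | nil => exact absurd rfl h
  | cons a x => exact algebraMapInv_word_cons a x

@[simp] theorem const_one (f : D →ₗ[k] M) (v : D) : const f (1 : V.Bar) v 1 = f v := by
  simp [const_apply]

theorem const_left_ne (f : D →ₗ[k] M) {x : List V.Homog} (h : x ≠ []) (v : D) (y : V.Bar) :
    const f (word x) v y = 0 := by
  rw [const_apply, algebraMapInv_word_of_ne h, zero_smul]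

theorem const_right_ne (f : D →ₗ[k] M) (x : V.Bar) (v : D) {y : List V.Homog} (h : y ≠ []) :
    const f x v (word y) = 0 := by
  rw [const_apply, algebraMapInv_word_of_ne h, zero_smul, smul_zero]

-- The part of the pairing in which only the right argument is cut, with the pieces of the left
-- argument already fed to the two families.
variable (V C') in
noncomputable def pairInner (B : W →ₗ[k] W' →ₗ[k] k) :
    (V.Bar →ₗ[k] W) →ₗ[k] (V.Bar →ₗ[k] C'.carrier →ₗ[k] W') →ₗ[k]
      (V.Bar →ₗ[k] Module.Dual k C'.carrier) :=
  LinearMap.mk₂ k (fun κ F => cut (LinearMap.mk₂ k (fun y₁ y₂ => B (κ y₁) ∘ₗ F y₂)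
      (by intros; ext; simp) (by intros; ext; simp) (by intros; ext; simp) (by intros; ext; simp)))
    (by intros; rw [← map_add]; congr 1; ext; simp)
    (by intros; rw [← map_smul]; congr 1; ext; simp)
    (by intros; rw [← map_add]; congr 1; ext; simp)
    (by intros; rw [← map_smul]; congr 1; ext; simp)

/-- Exchanging the order of the arguments `y`, `c` and `x`. -/
noncomputable def rot : BiOp V C'.carrier W' →ₗ[k]
    (V.Bar →ₗ[k] V.Bar →ₗ[k] C'.carrier →ₗ[k] W') where
  toFun F := LinearMap.flip
    ((LinearMap.lflip : (C'.carrier →ₗ[k] V.Bar →ₗ[k] W') ≃ₗ[k] _).toLinearMap ∘ₗ F)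
  map_add' _ _ := rfl
  map_smul' _ _ := rfl

@[simp] theorem rot_apply (F : BiOp V C'.carrier W') (x y : V.Bar) (c : C'.carrier) :
    rot F x y c = F y c x := rfl

variable (V C C') in
noncomputable def pairOuter (B : W →ₗ[k] W' →ₗ[k] k) :
    (V.Bar →ₗ[k] C'.carrier →ₗ[k] W') →ₗ[k] (C.carrier →ₗ[k] V.Bar →ₗ[k] W) →ₗ[k]
      (C.carrier →ₗ[k] V.Bar →ₗ[k] Module.Dual k C'.carrier) :=
  LinearMap.mk₂ k (fun F K => (pairInner V C' B).flip F ∘ₗ K)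
    (by intro f f' g; rw [map_add, LinearMap.add_comp])
    (by intro c f g; rw [map_smul, LinearMap.smul_comp])
    (by intro f f' g; rw [LinearMap.comp_add])
    (by intro c f g; rw [LinearMap.comp_smul])

/-- The unsigned form of the pairing of two families. -/
noncomputable def pair₀ (B : W →ₗ[k] W' →ₗ[k] k) : BiOp V C.carrier W →ₗ[k]
    BiOp V C'.carrier W' →ₗ[k] BiOp V C.carrier (Module.Dual k C'.carrier) :=
  LinearMap.mk₂ k (fun K F => cut ((pairOuter V C C' B).compl₁₂ (rot F) K))
    (by intro f f' g; rw [← map_add]; congr 1; ext; simp)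
    (by intro c f g; rw [← map_smul]; congr 1; ext; simp)
    (by intro f g g'; rw [← map_add]; congr 1; ext; simp)
    (by intro c f g; rw [← map_smul]; congr 1; ext; simp)

theorem pair₀_word (B : W →ₗ[k] W' →ₗ[k] k) (K : BiOp V C.carrier W) (F : BiOp V C'.carrier W')
    (x : List V.Homog) (v : C.carrier) (y : List V.Homog) (c : C'.carrier) :
    pair₀ B K F (word x) v (word y) c = sumSplit x fun x₁ x₂ => sumSplit y fun y₁ y₂ =>
      B (K (word x₂) v (word y₁)) (F (word y₂) c (word x₁)) := by
  simp only [pair₀, LinearMap.mk₂_apply, cut_word]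
  let ev : (C.carrier →ₗ[k] V.Bar →ₗ[k] Module.Dual k C'.carrier) →ₗ[k] k :=
    (LinearMap.applyₗ c) ∘ₗ (LinearMap.applyₗ (word y)) ∘ₗ LinearMap.applyₗ v
  change ev _ = _
  rw [map_sumSplit]
  refine sumSplit_congr fun a b _ => ?_
  simp only [ev, pairInner, pairOuter, LinearMap.compl₁₂_apply, LinearMap.comp_apply, LinearMap.flip_apply, LinearMap.mk₂_apply,
    LinearMap.applyₗ_apply_apply, cut_word]
  let ev' : Module.Dual k C'.carrier →ₗ[k] k := LinearMap.applyₗ c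
  change ev' _ = _
  rw [map_sumSplit]
  rfl

/-- The pairing of two families with values in spaces with a bilinear form. -/
noncomputable def pair (B : W →ₗ[k] W' →ₗ[k] k) : BiOp V C.carrier W →ₗ[k]
    BiOp V C'.carrier W' →ₗ[k] BiOp V C.carrier (Module.Dual k C'.carrier) :=
  LinearMap.mk₂ k (fun K F => (2⁻¹ : k) • (pair₀ B K F +
      pair₀ B K (comp₃ F LinearMap.id LinearMap.id V.parT.toLinearMap) +
      pair₀ B (sA K) (comp₃ F V.parT.toLinearMap C'.par LinearMap.id) -
      pair₀ B (sA K) (sA F)))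
    (fun K K' F => by
      refine LinearMap.ext fun x => LinearMap.ext fun v => LinearMap.ext fun y =>
        LinearMap.ext fun c => ?_
      simp only [map_add, LinearMap.add_apply, LinearMap.sub_apply, LinearMap.smul_apply,
        smul_eq_mul]
      ring)
    (fun r K F => by
      refine LinearMap.ext fun x => LinearMap.ext fun v => LinearMap.ext fun y =>
        LinearMap.ext fun c => ?_
      simp only [map_smul, LinearMap.add_apply, LinearMap.sub_apply, LinearMap.smul_apply,
        smul_eq_mul]
      ring)
    (fun K F F' => by
      have e : ∀ a b c, comp₃ (V' := V) (D' := C'.carrier) (F + F') a b c =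
        comp₃ F a b c + comp₃ F' a b c := fun _ _ _ => rfl
      refine LinearMap.ext fun x => LinearMap.ext fun v => LinearMap.ext fun y =>
        LinearMap.ext fun c => ?_
      simp only [map_add, e, LinearMap.add_apply, LinearMap.sub_apply, LinearMap.smul_apply,
        smul_eq_mul]
      ring)
    (fun r K F => by
      have e : ∀ a b c, comp₃ (V' := V) (D' := C'.carrier) (r • F) a b c =
        r • comp₃ F a b c := fun _ _ _ => rfl
      refine LinearMap.ext fun x => LinearMap.ext fun v => LinearMap.ext fun y =>
        LinearMap.ext fun c => ?_
      simp only [map_smul, e, LinearMap.add_apply, LinearMap.sub_apply, LinearMap.smul_apply,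
        smul_eq_mul]
      ring)

/-- The four terms in the definition of `pair` are the four terms of `sgn_mul_formula`; together
they give the Koszul sign for moving the prefix `x₁` behind everything else. -/
theorem pair_word [CharZero k] (B : W →ₗ[k] W' →ₗ[k] k) (K : BiOp V C.carrier W)
    (F : BiOp V C'.carrier W')
    (x : List V.Homog) (v : C.Homog) (y : List V.Homog) (c : C'.Homog) :
    pair B K F (word x) v.2 (word y) c.2 = sumSplit x fun x₁ x₂ => sumSplit y fun y₁ y₂ =>
      sgn k (deg x₁ * (deg x₂ + v.1 + deg y₁ + deg y₂ + c.1)) *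
        B (K (word x₂) v.2 (word y₁)) (F (word y₂) c.2 (word x₁)) := by
  simp only [pair, LinearMap.mk₂_apply, LinearMap.smul_apply, LinearMap.add_apply,
    LinearMap.sub_apply, pair₀_word, ← sumSplit_add, ← sumSplit_sub, smul_sumSplit]
  refine sumSplit_congr fun x₁ x₂ _ => sumSplit_congr fun y₁ y₂ _ => ?_
  simp only [comp₃_apply, sA_apply, parT_word, AlgHom.toLinearMap_apply, par_homog, map_smul,
    LinearMap.smul_apply, LinearMap.id_apply, smul_eq_mul]
  rw [sgn_mul_formula, sgn_add, sgn_add, sgn_add, sgn_add]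
  ring

end BiOp

end BiOps

/-! ### Auxiliary identities for iterated cuts and for parities -/

section Aux

variable {α : Type*} {k : Type v} [Field k]

theorem sumSplit_lapply {M M' : Type*} [AddCommGroup M] [Module k M] [AddCommGroup M'] [Module k M']
    (x : List α) (F : List α → List α → (M →ₗ[k] M')) (v : M) :
    sumSplit x F v = sumSplit x fun a b => F a b v :=
  map_sumSplit (LinearMap.applyₗ v) x F

theorem mul_sumSplit {R : Type*} [NonUnitalNonAssocSemiring R] (c : R) (x : List α)
    (F : List α → List α → R) : c * sumSplit x F = sumSplit x fun a b => c * F a b := by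
  unfold sumSplit; exact Finset.mul_sum _ _ _

theorem sumSplit_mul {R : Type*} [NonUnitalNonAssocSemiring R] (c : R) (x : List α)
    (F : List α → List α → R) : sumSplit x F * c = sumSplit x fun a b => F a b * c := by
  unfold sumSplit; exact Finset.sum_mul _ _ _

theorem sgn_mul_congr {a b c d : ℤ} (t : k)
    (h : (a : ZMod 2) + b = c + d) : sgn k a * (sgn k b * t) = sgn k c * (sgn k d * t) := by
  rw [← mul_assoc, ← mul_assoc, ← sgn_add, ← sgn_add,
    sgn_congr (show ((a + b : ℤ) : ZMod 2) = ((c + d : ℤ) : ZMod 2) by push_cast; exact h)]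

/-- Both sides cut each of `x` and `y` into three words. Associativity of the composition of
operations rests on this rearrangement. -/
theorem sumSplit_bi_assoc {M : Type*} [AddCommMonoid M] (x y : List α)
    (H : List α → List α → List α → List α → List α → List α → M) :
    sumSplit x (fun x₁ x₂ => sumSplit y fun y₁ y₂ => sumSplit x₁ fun a b =>
      sumSplit y₂ fun c d => H a b x₂ y₁ c d) =
    sumSplit x (fun a r => sumSplit y fun s d => sumSplit r fun b x₂ =>
      sumSplit s fun y₁ c => H a b x₂ y₁ c d) := by
  have e1 : ∀ x₁ x₂ : List α, sumSplit y (fun y₁ y₂ => sumSplit x₁ fun a b =>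
      sumSplit y₂ fun c d => H a b x₂ y₁ c d) =
      sumSplit x₁ fun a b => sumSplit y fun y₁ y₂ => sumSplit y₂ fun c d => H a b x₂ y₁ c d :=
    fun x₁ x₂ => sumSplit_comm _ _ _
  have e2 : ∀ a r : List α, sumSplit y (fun s d => sumSplit r fun b x₂ =>
      sumSplit s fun y₁ c => H a b x₂ y₁ c d) =
      sumSplit r fun b x₂ => sumSplit y fun s d => sumSplit s fun y₁ c => H a b x₂ y₁ c d :=
    fun a r => sumSplit_comm _ _ _
  simp only [e1, e2]
  rw [sumSplit_assoc x fun a b x₂ => sumSplit y fun y₁ y₂ => sumSplit y₂ fun c d =>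
    H a b x₂ y₁ c d]
  refine sumSplit_congr fun a r _ => sumSplit_congr fun b x₂ _ => ?_
  rw [sumSplit_assoc y fun y₁ c d => H a b x₂ y₁ c d]

theorem odd_cast {e : ℤ} (h : Odd e) : (e : ZMod 2) = 1 := by
  obtain ⟨r, rfl⟩ := h
  push_cast
  have : (2 : ZMod 2) = 0 := by decide
  rw [this]; simp

theorem even_cast {e : ℤ} (h : Even e) : (e : ZMod 2) = 0 := by
  obtain ⟨r, rfl⟩ := h
  push_cast
  exact CharTwo.add_self_eq_zero _

end Aux

section BiOps

open GradedSpace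

variable {k : Type v} [Field k] {V : GradedSpace.{u} k}

/-! ### Convolution and coderivations -/

section Conv

variable {R : Type*} [Ring R] [Algebra k R]

/-- The convolution product of maps from words to an algebra. -/
noncomputable def conv : (V.Bar →ₗ[k] R) →ₗ[k] (V.Bar →ₗ[k] R) →ₗ[k] (V.Bar →ₗ[k] R) :=
  LinearMap.mk₂ k (fun f g => cut ((LinearMap.mul k R).compl₁₂ f g))
    (by intro f f' g; rw [← map_add]; congr 1; ext; simp)
    (by intro c f g; rw [← map_smul]; congr 1; ext; simp)
    (by intro f g g'; rw [← map_add]; congr 1; ext; simp [mul_add])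
    (by intro c f g; rw [← map_smul]; congr 1; ext; simp)

theorem conv_word (f g : V.Bar →ₗ[k] R) (x : List V.Homog) :
    conv f g (word x) = sumSplit x fun a b => f (word a) * g (word b) := by
  simp [conv, cut_word]

/-- The coderivation of the tensor coalgebra induced by a map of odd degree. -/
noncomputable def coder : (V.Bar →ₗ[k] V.carrier) →ₗ[k] (V.Bar →ₗ[k] V.Bar) where
  toFun m := conv V.parT.toLinearMap (conv (TensorAlgebra.ι k ∘ₗ m) LinearMap.id)
  map_add' f g := by rw [LinearMap.comp_add, map_add, LinearMap.add_apply, map_add]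
  map_smul' c f := by
    rw [LinearMap.comp_smul, map_smul, LinearMap.smul_apply, map_smul, RingHom.id_apply]

theorem coder_word (m : V.Bar →ₗ[k] V.carrier) (x : List V.Homog) :
    coder m (word x) = sumSplit x fun x₁ r => sumSplit r fun x₂ x₃ =>
      sgn k (deg x₁) • (word x₁ * TensorAlgebra.ι k (m (word x₂)) * word x₃) := by
  simp only [coder, LinearMap.coe_mk, AddHom.coe_mk, conv_word, AlgHom.toLinearMap_apply,
    parT_word, LinearMap.comp_apply, LinearMap.id_apply, mul_sumSplit, smul_mul_assoc, mul_assoc]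

end Conv

/-- The map `m` on words has degree `e`. -/
def IsHomog {C : GradedSpace.{u₁} k} (e : ℤ) (m : V.Bar →ₗ[k] C.carrier) : Prop :=
  ∀ x : List V.Homog, m (word x) ∈ C.piece (deg x + e)

/-- The value of a homogeneous operation, as a homogeneous element. -/
noncomputable def IsHomog.val {C : GradedSpace.{u₁} k} {e : ℤ} {m : V.Bar →ₗ[k] C.carrier}
    (h : IsHomog e m) (x : List V.Homog) : C.Homog := ⟨deg x + e, ⟨m (word x), h x⟩⟩

theorem coder_word' {m : V.Bar →ₗ[k] V.carrier} {e : ℤ} (h : IsHomog e m) (x : List V.Homog) :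
    coder m (word x) = sumSplit x fun x₁ r => sumSplit r fun x₂ x₃ =>
      sgn k (deg x₁) • word (x₁ ++ h.val x₂ :: x₃) := by
  simp [coder_word, IsHomog.val, mul_assoc]

theorem parT_coder {m : V.Bar →ₗ[k] V.carrier} {e : ℤ} (h : IsHomog e m) (he : Odd e) (x : V.Bar) :
    V.parT (coder m x) = -coder m (V.parT x) := by
  have : V.parT.toLinearMap ∘ₗ coder m = -(coder m ∘ₗ V.parT.toLinearMap) := by
    refine bar_ext fun x => ?_
    simp only [LinearMap.comp_apply, AlgHom.toLinearMap_apply, LinearMap.neg_apply, parT_word,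
      map_smul, coder_word' h, smul_sumSplit, map_sumSplit, ← sumSplit_neg]
    refine sumSplit_congr fun x₁ r hx => sumSplit_congr fun x₂ x₃ hr => ?_
    have he' := odd_cast he
    rw [← neg_smul, smul_smul, smul_smul, ← neg_one_mul, ← sgn_one, mul_comm (sgn k (deg x₁)),
      ← sgn_add, ← sgn_add, ← sgn_add]
    refine congr_arg (· • _) (sgn_congr ?_)
    rw [hx, hr]
    simp only [deg_append, deg_cons, IsHomog.val, Int.cast_add, Int.cast_one]
    grind
  exact LinearMap.congr_fun this x

/-- A word with an inserted letter is never empty, so the augmentation kills it. Hence constant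
operations are annihilated by insertions. -/
theorem coder_eq_insert_ne {m : V.Bar →ₗ[k] V.carrier} (x : List V.Homog) {e : ℤ}
    (h : IsHomog e m) : TensorAlgebra.algebraMapInv (coder m (word x)) = (0 : k) := by
  rw [coder_word' h, map_sumSplit]
  refine sumSplit_eq_zero fun a b _ => ?_
  rw [map_sumSplit]
  refine sumSplit_eq_zero fun c d _ => ?_
  rw [map_smul, BiOp.algebraMapInv_word_of_ne (by simp), smul_zero]

namespace BiOp

variable {C : GradedSpace.{u₁} k} {C' : GradedSpace.{u₂} k} {D : GradedSpace.{u₃} k}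
  {D' : GradedSpace.{u₄} k}
variable {E F M W W' : Type*} [AddCommGroup E] [Module k E]
  [AddCommGroup F] [Module k F]
  [AddCommGroup M] [Module k M] [AddCommGroup W] [Module k W] [AddCommGroup W'] [Module k W']

/-- The family of operations has degree `e`. -/
def IsHom (e : ℤ) (f : BiOp V C.carrier D.carrier) : Prop :=
  ∀ (x : List V.Homog) (v : C.Homog) (y : List V.Homog),
    f (word x) v.2 (word y) ∈ D.piece (deg x + v.1 + deg y + e)

/-- The value of a homogeneous operation, as a homogeneous element. -/
noncomputable def IsHom.val {e : ℤ} {f : BiOp V C.carrier D.carrier} (h : IsHom e f)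
    (x : List V.Homog) (v : C.Homog) (y : List V.Homog) : D.Homog :=
  ⟨deg x + v.1 + deg y + e, ⟨f (word x) v.2 (word y), h x v y⟩⟩

theorem ext_dual {f g : BiOp V C.carrier (Module.Dual k C'.carrier)}
    (h : ∀ (x : List V.Homog) (v : C.Homog) (y : List V.Homog) (c : C'.Homog),
      f (word x) v.2 (word y) c.2 = g (word x) v.2 (word y) c.2) : f = g :=
  ext_word fun x v y => hom_ext_homog fun c => h x v y c

theorem mul_assoc' (f : BiOp V F M) (g : BiOp V E F) (h : BiOp V C.carrier E) :
    mul (mul f g) h = mul f (mul g h) := by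
  refine ext_word fun x v y => ?_
  simp only [mul_word, map_sumSplit, sumSplit_lapply]
  exact sumSplit_bi_assoc x y fun a b x₂ y₁ c d =>
    f (word a) (g (word b) (h (word x₂) v.2 (word y₁)) (word c)) (word d)

theorem mul_const_left (a : E →ₗ[k] M) (f : BiOp V C.carrier E) (x : V.Bar) (v : C.carrier)
    (y : V.Bar) : mul (const a) f x v y = a (f x v y) := by
  have : mul (const a) f = (LinearMap.compRight k (LinearMap.compRight k a)) ∘ₗ f := by
    refine ext_word fun x v y => ?_
    rw [mul_word, sumSplit_eq_right, sumSplit_eq_left]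
    · simp
    · intro p q hq; exact const_right_ne _ _ _ hq
    · intro p q hp
      exact sumSplit_eq_zero fun _ _ _ => const_left_ne _ hp _ _
  rw [this]; rfl

theorem mul_const_right (f : BiOp V E M) (a : C.carrier →ₗ[k] E) (x : V.Bar) (v : C.carrier)
    (y : V.Bar) : mul f (const a) x v y = f x (a v) y := by
  have : mul f (const a) = comp₃ f LinearMap.id a LinearMap.id := by
    refine ext_word fun x v y => ?_
    rw [mul_word, sumSplit_eq_left, sumSplit_eq_right]
    · simp
    · intro p q hp; rw [const_right_ne _ _ _ hp]; simp
    · intro p q hq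
      exact sumSplit_eq_zero fun _ _ _ => by rw [const_left_ne _ hq]; simp
  rw [this]; rfl

theorem const_id_mul (f : BiOp V C.carrier E) : mul (const LinearMap.id) f = f := by
  refine ext_word fun x v y => ?_
  rw [mul_const_left]; rfl

theorem mul_const_id (f : BiOp V C.carrier E) : mul f (const LinearMap.id) = f := by
  refine ext_word fun x v y => ?_
  rw [mul_const_right]; rfl

theorem sL_mul (f : BiOp V E M) (g : BiOp V C.carrier E) : sL (mul f g) = mul (sL f) (sL g) := by
  refine ext_word fun x v y => ?_
  simp only [sL_apply, parT_word, map_smul, LinearMap.smul_apply, mul_word, smul_sumSplit]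
  refine sumSplit_congr fun x₁ x₂ hx => sumSplit_congr fun y₁ y₂ hy => ?_
  rw [hx, deg_append, sgn_add, smul_smul, mul_comm]

theorem sL_sL (f : BiOp V E M) : sL (sL f) = f := by
  ext x v y; simp [parT_parT]

theorem algebraMapInv_parT (x : V.Bar) :
    TensorAlgebra.algebraMapInv (V.parT x) = (TensorAlgebra.algebraMapInv x : k) := by
  have : (TensorAlgebra.algebraMapInv : V.Bar →ₐ[k] k).toLinearMap ∘ₗ V.parT.toLinearMap =
      (TensorAlgebra.algebraMapInv : V.Bar →ₐ[k] k).toLinearMap := by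
    refine bar_ext fun x => ?_
    cases x with
    | nil => simp
    | cons a x =>
      simp only [LinearMap.comp_apply, AlgHom.toLinearMap_apply, parT_word, map_smul,
        algebraMapInv_word_cons, smul_zero]
  exact LinearMap.congr_fun this x

theorem sL_const (f : E →ₗ[k] M) : sL (V := V) (const f) = const f := by
  refine LinearMap.ext fun x => LinearMap.ext fun v => LinearMap.ext fun y => ?_
  simp [const_apply, algebraMapInv_parT]

theorem insL_const (f : C.carrier →ₗ[k] M) {m : V.Bar →ₗ[k] V.carrier} {e : ℤ} (h : IsHomog e m) :
    insL (V := V) (const f) (coder m) = 0 := by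
  refine ext_word fun x v y => ?_
  simp [const_apply, coder_eq_insert_ne x h]

theorem insR_const (f : C.carrier →ₗ[k] M) {m : V.Bar →ₗ[k] V.carrier} {e : ℤ} (h : IsHomog e m) :
    insR (V := V) (const f) (coder m) = 0 := by
  refine ext_word fun x v y => ?_
  simp [const_apply, coder_eq_insert_ne y h]

theorem sL_insL (K : BiOp V E M) {m : V.Bar →ₗ[k] V.carrier} {e : ℤ} (h : IsHomog e m)
    (he : Odd e) : sL (insL K (coder m)) = -insL (sL K) (coder m) := by
  refine LinearMap.ext fun x => LinearMap.ext fun v => LinearMap.ext fun y => ?_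
  simp [parT_coder h he]

theorem sL_insR (K : BiOp V C.carrier M) (t : V.Bar →ₗ[k] V.Bar) :
    sL (insR K t) = insR (sL K) t := rfl

/-- The insertion lands in the part of `x` given to `f` or in the part given to `g`; in the second
case it has to pass the first part, which is the sign in `sL f`. -/
theorem insL_mul (f : BiOp V E M) (g : BiOp V C.carrier E) {m : V.Bar →ₗ[k] V.carrier} {e : ℤ}
    (h : IsHomog e m) :
    insL (mul f g) (coder m) = mul (insL f (coder m)) g + mul (sL f) (insL g (coder m)) := by
  refine ext_word fun x v y => ?_
  simp only [insL_apply, LinearMap.add_apply, mul_word, coder_word' h, map_sumSplit,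
    sumSplit_lapply, map_smul, LinearMap.smul_apply, smul_sumSplit, sL_apply, parT_word]
  rw [sumSplit_insert h.val, add_comm]
  congr 1
  · refine sumSplit_congr fun a b hx => ?_
    rw [sumSplit_comm]
    refine sumSplit_congr fun a₁ r ha => ?_
    rw [sumSplit_comm]
  · refine sumSplit_congr fun a b hx => ?_
    rw [sumSplit_comm]
    refine sumSplit_congr fun a₁ r ha => ?_
    rw [sumSplit_comm]
    refine sumSplit_congr fun y₁ y₂ hy => ?_
    refine sumSplit_congr fun b₂ b₃ hb => ?_
    simp [sgn_add, smul_smul, mul_comm]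

theorem insL_word (f : BiOp V C.carrier M) {m : V.Bar →ₗ[k] V.carrier} {e : ℤ}
    (h : IsHomog e m) (x : List V.Homog) (v : C.carrier) (y : V.Bar) :
    insL f (coder m) (word x) v y = sumSplit x fun x₁ r => sumSplit r fun x₂ x₃ =>
      sgn k (deg x₁) • f (word (x₁ ++ h.val x₂ :: x₃)) v y := by
  simp only [insL_apply, coder_word' h, map_sumSplit, sumSplit_lapply, map_smul,
    LinearMap.smul_apply]

theorem insR_word (f : BiOp V C.carrier M) {m : V.Bar →ₗ[k] V.carrier} {e : ℤ}
    (h : IsHomog e m) (x : List V.Homog) (v : C.Homog) (y : List V.Homog) :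
    insR f (coder m) (word x) v.2 (word y) = sumSplit y fun y₁ r => sumSplit r fun y₂ y₃ =>
      sgn k (deg x + v.1 + deg y₁) • f (word x) v.2 (word (y₁ ++ h.val y₂ :: y₃)) := by
  simp only [insR_apply, coder_word' h, map_sumSplit, map_smul, parT_word, par_homog,
    LinearMap.smul_apply, smul_smul, sgn_add]
  refine sumSplit_congr fun _ _ _ => sumSplit_congr fun _ _ _ => ?_
  congr 1
  ring

theorem sA_word (f : BiOp V C.carrier M) (x : List V.Homog) (v : C.Homog) (y : List V.Homog) :
    sA f (word x) v.2 (word y) = sgn k (deg x + v.1 + deg y) • f (word x) v.2 (word y) := by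
  simp only [sA_apply, parT_word, par_homog, map_smul, LinearMap.smul_apply, smul_smul, sgn_add]
  congr 1
  ring

theorem sL_word (f : BiOp V E M) (x : List V.Homog) (v : E) (y : V.Bar) :
    sL f (word x) v y = sgn k (deg x) • f (word x) v y := by
  simp only [sL_apply, parT_word, map_smul, LinearMap.smul_apply]

/-- An insertion behind the entries of `g` passes those entries on the left side, but passes the
value of `g` on the right side. The degrees differ by `e'`, hence the extra sign. -/
theorem insR_mul (f : BiOp V D.carrier M) {g : BiOp V C.carrier D.carrier} {e' : ℤ}
    (hg : IsHom e' g) {m : V.Bar →ₗ[k] V.carrier} {e : ℤ} (h : IsHomog e m) :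
    insR (mul f g) (coder m) =
      sgn k e' • mul (insR f (coder m)) g + mul (sL f) (insR g (coder m)) := by
  refine ext_word fun x v y => ?_
  have hf : ∀ (a b c d : List V.Homog), insR f (coder m) (word a) (g (word b) v.2 (word c))
      (word d) = sumSplit d fun y₁ r => sumSplit r fun y₂ y₃ =>
        sgn k (deg a + (deg b + v.1 + deg c + e') + deg y₁) •
          f (word a) (g (word b) v.2 (word c)) (word (y₁ ++ h.val y₂ :: y₃)) :=
    fun a b c d => insR_word f h a (hg.val b v c) d
  simp only [insR_word _ h, LinearMap.add_apply, LinearMap.smul_apply, mul_word, hf, sL_word,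
    map_sumSplit, map_smul, smul_sumSplit, sumSplit_lapply]
  simp only [sumSplit_comm _ x]
  rw [← sumSplit_add]
  refine sumSplit_congr fun x₁ x₂ hx => ?_
  rw [sumSplit_insert h.val]
  congr 1
  · refine sumSplit_congr fun a b hy => sumSplit_congr fun _ _ hb => sumSplit_congr fun _ _ _ => ?_
    rw [smul_smul, ← sgn_add]
    refine congr_arg (· • _) (sgn_congr ?_)
    simp only [hx, deg_append, Int.cast_add]
    grind
  · refine sumSplit_congr fun a b hy => sumSplit_congr fun _ _ hb => sumSplit_congr fun _ _ _ => ?_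
    rw [smul_smul, ← sgn_add]
    refine congr_arg (· • _) (sgn_congr ?_)
    simp only [hx, deg_append, Int.cast_add]
    grind

end BiOp

end BiOps

/-! ### Leibniz rules and associativity for the pairing -/

section BiOps

open GradedSpace

variable {k : Type v} [Field k] {V : GradedSpace.{u} k}

theorem sumSplit_bi_assoc' {α : Type*} {M : Type*} [AddCommMonoid M] (x y : List α)
    (H : List α → List α → List α → List α → List α → List α → M) :
    sumSplit x (fun a r => sumSplit y fun s d => sumSplit r fun b x₂ =>
      sumSplit s fun y₁ c => H a b x₂ y₁ c d) =
    sumSplit x (fun x₁ x₂ => sumSplit y fun y₁ y₂ => sumSplit y₂ fun c d =>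
      sumSplit x₁ fun a b => H a b x₂ y₁ c d) := by
  rw [← sumSplit_bi_assoc]
  refine sumSplit_congr fun _ _ _ => sumSplit_congr fun _ _ _ => ?_
  rw [sumSplit_comm]

namespace BiOp

variable {C : GradedSpace.{u₁} k} {C' : GradedSpace.{u₂} k} {D : GradedSpace.{u₃} k}
  {D' : GradedSpace.{u₄} k}
variable {E F M W W' : Type*} [AddCommGroup E] [Module k E]
  [AddCommGroup F] [Module k F]
  [AddCommGroup M] [Module k M] [AddCommGroup W] [Module k W] [AddCommGroup W'] [Module k W']

/-- The prefix of `x` is rotated to the far end and becomes the right argument of `F`. So an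
insertion on the left is either a left insertion for `K` or a right insertion for `F`, and in the
latter case it passes all inputs of `K`. The next lemma is the mirror image. -/
theorem insL_pair [CharZero k] (B : W →ₗ[k] W' →ₗ[k] k) (K : BiOp V C.carrier W)
    (F : BiOp V C'.carrier W') {m : V.Bar →ₗ[k] V.carrier} {e : ℤ} (h : IsHomog e m) (he : Odd e) :
    insL (pair B K F) (coder m) = pair B (insL K (coder m)) F +
      pair B (sA K) (insR F (coder m)) := by
  refine ext_dual fun x v y c => ?_
  have he' := odd_cast he
  simp only [LinearMap.add_apply, pair_word, insL_word _ h, insR_word _ h, sA_word,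
    LinearMap.smul_apply, sumSplit_lapply, map_sumSplit, map_smul, smul_eq_mul, mul_sumSplit]
  simp only [sumSplit_comm _ y]
  rw [← sumSplit_add]
  refine sumSplit_congr fun y₁ y₂ hy => ?_
  rw [sumSplit_insert h.val]
  refine congr_arg₂ (· + ·) ?_ ?_
  · refine sumSplit_congr fun a b hx => sumSplit_congr fun b₁ r hb => sumSplit_congr fun b₂ b₃ hr => ?_
    refine sgn_mul_congr _ ?_
    simp only [hb, hr, IsHomog.val, deg_append, deg_cons, Int.cast_add, Int.cast_mul]
    grind
  · refine sumSplit_congr fun a b hx => sumSplit_congr fun b₁ r hb => sumSplit_congr fun b₂ b₃ hr => ?_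
    simp only [← mul_assoc, ← sgn_add]
    refine congr_arg (· * _) (sgn_congr ?_)
    simp only [hb, hr, IsHomog.val, deg_append, deg_cons, Int.cast_add, Int.cast_mul]
    grind

theorem insR_pair [CharZero k] (B : W →ₗ[k] W' →ₗ[k] k) (K : BiOp V C.carrier W)
    (F : BiOp V C'.carrier W') {m : V.Bar →ₗ[k] V.carrier} {e : ℤ} (h : IsHomog e m) (he : Odd e) :
    insR (pair B K F) (coder m) = pair B (insR K (coder m)) F +
      pair B (sA K) (insL F (coder m)) := by
  refine ext_dual fun x v y c => ?_
  have he' := odd_cast he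
  simp only [LinearMap.add_apply, pair_word, insL_word _ h, insR_word _ h, sA_word,
    LinearMap.smul_apply, sumSplit_lapply, map_sumSplit, map_smul, smul_eq_mul, mul_sumSplit]
  simp only [sumSplit_comm _ x]
  rw [← sumSplit_add]
  refine sumSplit_congr fun x₁ x₂ hx => ?_
  rw [sumSplit_insert h.val, add_comm]
  refine congr_arg₂ (· + ·) ?_ ?_
  · refine sumSplit_congr fun a b hy => sumSplit_congr fun b₁ r hb =>
      sumSplit_congr fun b₂ b₃ hr => ?_
    refine sgn_mul_congr _ ?_
    simp only [hx, hb, hr, IsHomog.val, deg_append, deg_cons, Int.cast_add, Int.cast_mul]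
    grind
  · refine sumSplit_congr fun a b hy => sumSplit_congr fun b₁ r hb =>
      sumSplit_congr fun b₂ b₃ hr => ?_
    simp only [← mul_assoc, ← sgn_add]
    refine congr_arg (· * _) (sgn_congr ?_)
    simp only [hx, hb, hr, IsHomog.val, deg_append, deg_cons, Int.cast_add, Int.cast_mul]
    grind

theorem pair_word_val [CharZero k] (B : W →ₗ[k] W' →ₗ[k] k) (K : BiOp V D.carrier W)
    (F : BiOp V C'.carrier W') {g : BiOp V C.carrier D.carrier} {e : ℤ} (hg : IsHom e g)
    (a b : List V.Homog) (v : C.Homog) (c : List V.Homog) (y : List V.Homog) (c' : C'.Homog) :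
    pair B K F (word a) (g (word b) v.2 (word c)) (word y) c'.2 =
      sumSplit a fun x₁ x₂ => sumSplit y fun y₁ y₂ =>
      sgn k (deg x₁ * (deg x₂ + (deg b + v.1 + deg c + e) + deg y₁ + deg y₂ + c'.1)) *
        B (K (word x₂) (g (word b) v.2 (word c)) (word y₁)) (F (word y₂) c'.2 (word x₁)) :=
  pair_word B K F a (hg.val b v c) y c'

theorem pair_word_val' [CharZero k] (B : W →ₗ[k] W' →ₗ[k] k) (K : BiOp V C.carrier W)
    (F : BiOp V D.carrier W') {g : BiOp V C'.carrier D.carrier} {e : ℤ} (hg : IsHom e g)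
    (x : List V.Homog) (v : C.Homog) (y : List V.Homog) (a : List V.Homog) (c' : C'.Homog)
    (b : List V.Homog) :
    pair B K F (word x) v.2 (word y) (g (word a) c'.2 (word b)) =
      sumSplit x fun x₁ x₂ => sumSplit y fun y₁ y₂ =>
      sgn k (deg x₁ * (deg x₂ + v.1 + deg y₁ + deg y₂ + (deg a + c'.1 + deg b + e))) *
        B (K (word x₂) v.2 (word y₁)) (F (word y₂) (g (word a) c'.2 (word b)) (word x₁)) :=
  pair_word B K F x v y (hg.val a c' b)

theorem mul_pair [CharZero k] (B : W →ₗ[k] W' →ₗ[k] k) (K : BiOp V D.carrier W)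
    (F : BiOp V C'.carrier W') {g : BiOp V C.carrier D.carrier} {e : ℤ} (hg : IsHom e g)
    (he : Even e) : mul (pair B K F) g = pair B (mul K g) F := by
  refine ext_dual fun x v y c => ?_
  have he' := even_cast he
  simp only [mul_word, sumSplit_lapply, pair_word_val _ _ _ hg, pair_word, map_sumSplit,
    mul_sumSplit]
  rw [sumSplit_bi_assoc x y fun a b x₂ y₁ c' d => sgn k (deg a * (deg b + (deg x₂ + v.1 + deg y₁ + e)
    + deg c' + deg d + c.1)) * B (K (word b) (g (word x₂) v.2 (word y₁)) (word c'))
      (F (word d) c.2 (word a))]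
  refine sumSplit_congr fun a r hx => sumSplit_congr fun s d hy => sumSplit_congr fun b x₂ hr =>
    sumSplit_congr fun y₁ c' hs => ?_
  refine congr_arg (· * _) (sgn_congr ?_)
  simp only [hr, hs, deg_append, Int.cast_add, Int.cast_mul]
  grind

theorem mul_sL_pair [CharZero k] (B : W →ₗ[k] W' →ₗ[k] k) (K : BiOp V D.carrier W)
    (F : BiOp V C'.carrier W') {g : BiOp V C.carrier D.carrier} {e : ℤ} (hg : IsHom e g)
    (he : Odd e) : mul (sL (pair B K F)) g = pair B (mul (sL K) g) F := by
  refine ext_dual fun x v y c => ?_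
  have he' := odd_cast he
  simp only [mul_word, sumSplit_lapply, pair_word_val _ _ _ hg, pair_word, map_sumSplit, sL_word,
    mul_sumSplit, LinearMap.smul_apply, map_smul, smul_eq_mul]
  -- The degree of `x₁` in the sign is first rewritten through its own cut, so that the summand
  -- depends only on the six pieces and the rearrangement of iterated cuts applies.
  rw [sumSplit_congr fun x₁ x₂ hx => sumSplit_congr fun y₁ y₂ hy => sumSplit_congr fun a b ha =>
    sumSplit_congr fun c' d hc => congr_arg (sgn k · * _) (congr_arg deg ha)]
  rw [sumSplit_bi_assoc x y fun a b x₂ y₁ c' d => sgn k (deg (a ++ b)) *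
    (sgn k (deg a * (deg b + (deg x₂ + v.1 + deg y₁ + e)
    + deg c' + deg d + c.1)) * B (K (word b) (g (word x₂) v.2 (word y₁)) (word c'))
      (F (word d) c.2 (word a)))]
  refine sumSplit_congr fun a r hx => sumSplit_congr fun s d hy => sumSplit_congr fun b x₂ hr =>
    sumSplit_congr fun y₁ c' hs => ?_
  refine sgn_mul_congr _ ?_
  simp only [hr, hs, deg_append, Int.cast_add, Int.cast_mul]
  grind

/-- Pairing with `LinearMap.id` is composition with the dual of `g`, so this is associativity on the
dual side. The parity of the degree of `g` decides which of this lemma and the next applies. -/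
theorem pair_pair [CharZero k] (B : W →ₗ[k] W' →ₗ[k] k) (K : BiOp V C.carrier W)
    (F : BiOp V D.carrier W') {g : BiOp V C'.carrier D.carrier} {e : ℤ} (hg : IsHom e g)
    (he : Even e) : pair LinearMap.id (pair B K F) g = pair B K (mul F g) := by
  refine ext_dual fun x v y c => ?_
  have he' := even_cast he
  simp only [mul_word, pair_word_val' _ _ _ hg, pair_word, map_sumSplit,
    mul_sumSplit, LinearMap.id_apply]
  rw [sumSplit_congr fun x₁ x₂ hx => sumSplit_congr fun y₁ y₂ hy => sumSplit_congr fun a b ha =>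
    sumSplit_congr fun c' d hc => congr_arg (· * _) (congr_arg (sgn k)
      (congr_arg₂ (fun s t => deg x₁ * (deg s + v.1 + deg t + deg y₂ + c.1)) ha hc))]
  rw [sumSplit_bi_assoc' x y fun x₁ p q r s y₂ => sgn k (deg x₁ * (deg (p ++ q) + v.1 +
    deg (r ++ s) + deg y₂ + c.1)) * (sgn k (deg p * (deg q + v.1 + deg r + deg s + (deg y₂ + c.1 +
      deg x₁ + e))) * B (K (word q) v.2 (word r)) (F (word s) (g (word y₂) c.2 (word x₁))
        (word p)))]
  refine sumSplit_congr fun a r hx => sumSplit_congr fun s d hy => sumSplit_congr fun b x₂ hr =>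
    sumSplit_congr fun y₁ c' hs => ?_
  simp only [← mul_assoc, ← sgn_add]
  refine congr_arg (· * _) (sgn_congr ?_)
  simp only [hr, hs, deg_append, Int.cast_add, Int.cast_mul]
  grind

theorem pair_sA_pair [CharZero k] (B : W →ₗ[k] W' →ₗ[k] k) (K : BiOp V C.carrier W)
    (F : BiOp V D.carrier W') {g : BiOp V C'.carrier D.carrier} {e : ℤ} (hg : IsHom e g)
    (he : Odd e) : pair LinearMap.id (sA (pair B K F)) g = pair B (sA K) (mul (sL F) g) := by
  refine ext_dual fun x v y c => ?_
  have he' := odd_cast he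
  simp only [mul_word, sA_word, sL_word, map_smul, LinearMap.smul_apply,
    smul_eq_mul, pair_word_val' _ _ _ hg, pair_word, map_sumSplit,
    mul_sumSplit, LinearMap.id_apply]
  rw [sumSplit_congr fun x₁ x₂ hx => sumSplit_congr fun y₁ y₂ hy => sumSplit_congr fun a b ha =>
    sumSplit_congr fun c' d hc => congr_arg₂ (fun s t =>
      sgn k (deg x₁ * (deg s + v.1 + deg t + deg y₂ + c.1)) * (sgn k (deg s + v.1 + deg t) * _))
        ha hc]
  rw [sumSplit_bi_assoc' x y fun x₁ p q r s y₂ => sgn k (deg x₁ * (deg (p ++ q) + v.1 +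
    deg (r ++ s) + deg y₂ + c.1)) * (sgn k (deg (p ++ q) + v.1 + deg (r ++ s)) *
      (sgn k (deg p * (deg q + v.1 + deg r + deg s + (deg y₂ + c.1 +
      deg x₁ + e))) * B (K (word q) v.2 (word r)) (F (word s) (g (word y₂) c.2 (word x₁))
        (word p))))]
  refine sumSplit_congr fun a r hx => sumSplit_congr fun s d hy => sumSplit_congr fun b x₂ hr =>
    sumSplit_congr fun y₁ c' hs => ?_
  simp only [← mul_assoc, ← sgn_add]
  refine congr_arg (· * _) (sgn_congr ?_)
  simp only [hr, hs, deg_append, Int.cast_add, Int.cast_mul]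
  grind

theorem sA_mul (f : BiOp V D.carrier M) {g : BiOp V C.carrier D.carrier} {e : ℤ}
    (hg : IsHom e g) (he : Even e) : sA (mul f g) = mul (sA f) g := by
  refine ext_word fun x v y => ?_
  have he' := even_cast he
  have hf : ∀ (a b c d : List V.Homog), sA f (word a) (g (word b) v.2 (word c)) (word d) =
      sgn k (deg a + (deg b + v.1 + deg c + e) + deg d) •
          f (word a) (g (word b) v.2 (word c)) (word d) :=
    fun a b c d => sA_word f a (hg.val b v c) d
  simp only [sA_word, mul_word, hf, smul_sumSplit]
  refine sumSplit_congr fun x₁ x₂ hx => sumSplit_congr fun y₁ y₂ hy => ?_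
  refine congr_arg (· • _) (sgn_congr ?_)
  simp only [hx, hy, deg_append, Int.cast_add]
  grind

end BiOp

end BiOps

section BiOps

open GradedSpace

variable {k : Type v} [Field k] {V : GradedSpace.{u} k}

namespace BiOp

variable {C : GradedSpace.{u₁} k} {C' : GradedSpace.{u₂} k} {D : GradedSpace.{u₃} k}
  {D' : GradedSpace.{u₄} k}

/-! ### Rotation of families with values in a dual space -/

/-- The unsigned rotation. -/
noncomputable def flipDual : BiOp V C.carrier (Module.Dual k C'.carrier) →ₗ[k]
    BiOp V C'.carrier (Module.Dual k C.carrier) where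
  toFun ω := LinearMap.mk₂ k (fun x v => LinearMap.mk₂ k (fun y c => ω y c x v)
      (by intros; simp) (by intros; simp) (by intros; simp) (by intros; simp))
    (by intros; ext; simp) (by intros; ext; simp) (by intros; ext; simp) (by intros; ext; simp)
  map_add' _ _ := rfl
  map_smul' _ _ := rfl

@[simp] theorem flipDual_apply (ω : BiOp V C.carrier (Module.Dual k C'.carrier)) (x : V.Bar)
    (v : C'.carrier) (y : V.Bar) (c : C.carrier) : flipDual ω x v y c = ω y c x v := rfl

/-- The rotation, with the Koszul sign. -/
noncomputable def rotT : BiOp V C.carrier (Module.Dual k C'.carrier) →ₗ[k]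
    BiOp V C'.carrier (Module.Dual k C.carrier) where
  toFun ω := (2⁻¹ : k) • (flipDual ω + comp₃ (flipDual ω) V.parT.toLinearMap C'.par LinearMap.id +
    flipDual (comp₃ ω V.parT.toLinearMap C.par LinearMap.id) -
    comp₃ (flipDual (comp₃ ω V.parT.toLinearMap C.par LinearMap.id))
      V.parT.toLinearMap C'.par LinearMap.id)
  map_add' f g := by
    refine LinearMap.ext fun x => LinearMap.ext fun v => LinearMap.ext fun y =>
        LinearMap.ext fun c => ?_
    simp only [comp₃_apply, flipDual_apply, map_add, LinearMap.add_apply, LinearMap.sub_apply,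
      LinearMap.smul_apply, smul_eq_mul]
    ring
  map_smul' r f := by
    refine LinearMap.ext fun x => LinearMap.ext fun v => LinearMap.ext fun y =>
        LinearMap.ext fun c => ?_
    simp only [comp₃_apply, flipDual_apply, map_smul, LinearMap.add_apply, LinearMap.sub_apply,
      LinearMap.smul_apply, smul_eq_mul, RingHom.id_apply]
    ring

theorem rotT_word [CharZero k] (ω : BiOp V C.carrier (Module.Dual k C'.carrier))
    (x : List V.Homog) (v : C'.Homog) (y : List V.Homog) (c : C.Homog) :
    rotT ω (word x) v.2 (word y) c.2 =
      sgn k ((deg x + v.1) * (deg y + c.1)) * ω (word y) c.2 (word x) v.2 := by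
  simp only [rotT, LinearMap.coe_mk, AddHom.coe_mk, LinearMap.smul_apply, LinearMap.add_apply,
    LinearMap.sub_apply, flipDual_apply, comp₃_apply, parT_word, AlgHom.toLinearMap_apply,
    par_homog, map_smul, LinearMap.id_apply, smul_eq_mul]
  rw [sgn_mul_formula, sgn_add, sgn_add]
  ring

theorem rotT_rotT [CharZero k] (ω : BiOp V C.carrier (Module.Dual k C'.carrier)) :
    rotT (rotT ω) = ω := by
  refine ext_dual fun x v y c => ?_
  rw [rotT_word, rotT_word, ← mul_assoc, ← sgn_add, sgn_congr (b := 0), sgn_zero, one_mul]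
  push_cast
  grind

/-- Rotation exchanges the roles of the bimodule entry and the evaluated entry, hence of `g` and
`g'`. Since both have even degree, applying them does not disturb the Koszul sign. -/
theorem rotT_pair_mul [CharZero k] (ω : BiOp V D.carrier (Module.Dual k D'.carrier))
    {g : BiOp V C.carrier D.carrier} {g' : BiOp V C'.carrier D'.carrier} {e e' : ℤ}
    (hg : IsHom e g) (hg' : IsHom e' g') (he : Even e) (he' : Even e') :
    rotT (pair LinearMap.id (mul ω g) g') = pair LinearMap.id (mul (rotT ω) g') g := by
  refine ext_dual fun x v y c => ?_
  have h1 := even_cast he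
  have h2 := even_cast he'
  have hr : ∀ a b c' d p q, rotT ω (word a) (g' (word b) v.2 (word c')) (word d)
      (g (word p) c.2 (word q)) =
      sgn k ((deg a + (deg b + v.1 + deg c' + e')) * (deg d + (deg p + c.1 + deg q + e))) *
      ω (word d) (g (word p) c.2 (word q)) (word a) (g' (word b) v.2 (word c')) :=
    fun a b c' d p q => rotT_word ω a (hg'.val b v c') d (hg.val p c q)
  simp only [rotT_word, pair_word, LinearMap.id_apply, mul_word, sumSplit_lapply, mul_sumSplit, hr]
  rw [sumSplit_comm, sumSplit_congr fun x₁ x₂ hx => sumSplit_congr fun y₁ y₂ hy =>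
    sumSplit_congr fun a b ha =>
    sumSplit_congr fun c' d hc => congr_arg (_ * ·) (congr_arg (· * _) (congr_arg (sgn k)
      (congr_arg₂ (fun s t => deg y₁ * (deg s + c.1 + deg t + deg x₂ + v.1)) ha hc)))]
  rw [← sumSplit_bi_assoc' x y fun p q x₂ y₁ a b => sgn k ((deg x + v.1) * (deg y + c.1)) *
    (sgn k (deg y₁ * (deg (a ++ b) + c.1 + deg (p ++ q) + deg x₂ + v.1)) *
      ω (word a) (g (word b) c.2 (word p)) (word q) (g' (word x₂) v.2 (word y₁)))]
  refine sumSplit_congr fun a r hx => sumSplit_congr fun s d hy => sumSplit_congr fun b x₂ hr =>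
    sumSplit_congr fun y₁ c' hs => ?_
  simp only [← mul_assoc, ← sgn_add]
  refine congr_arg (· * _) (sgn_congr ?_)
  simp only [hx, hy, hr, hs, deg_append, Int.cast_add, Int.cast_mul]
  grind

theorem pair_const_right [CharZero k] {W W' : Type*} [AddCommGroup W] [Module k W] [AddCommGroup W']
    [Module k W'] (B : W →ₗ[k] W' →ₗ[k] k) (K : BiOp V C.carrier W) (f : C'.carrier →ₗ[k] W')
    (x : V.Bar) (v : C.carrier) (y : V.Bar) (c : C'.carrier) :
    pair B K (const f) x v y c = B (K x v y) (f c) := by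
  have : pair B K (const f) =
      (LinearMap.compRight k (LinearMap.compRight k (B.compl₂ f))) ∘ₗ K := by
    refine ext_dual fun x v y c => ?_
    rw [pair_word, sumSplit_eq_right, sumSplit_eq_left]
    · simp
    · intro p q hq; simp [const_left_ne _ hq]
    · intro p q hp
      exact sumSplit_eq_zero fun _ _ _ => by simp [const_right_ne _ _ _ hp]
  rw [this]; rfl

theorem pair_const_left [CharZero k] {W W' : Type*} [AddCommGroup W] [Module k W] [AddCommGroup W']
    [Module k W'] (B : W →ₗ[k] W' →ₗ[k] k) (f : C.carrier →ₗ[k] W) (F : BiOp V C'.carrier W')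
    (x : List V.Homog) (v : C.Homog) (y : List V.Homog) (c : C'.Homog) :
    pair B (const f) F (word x) v.2 (word y) c.2 =
      sgn k (deg x * (v.1 + deg y + c.1)) * B (f v.2) (F (word y) c.2 (word x)) := by
  rw [pair_word, sumSplit_eq_left, sumSplit_eq_right]
  · simp
  · intro p q hp; simp [const_right_ne _ _ _ hp]
  · intro p q hq
    exact sumSplit_eq_zero fun _ _ _ => by simp [const_left_ne _ hq]

end BiOp

end BiOps

section BiOps

open GradedSpace

variable {k : Type v} [Field k] {V : GradedSpace.{u} k}

namespace BiOp

/-! ### Closed families -/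

/-- Closedness of a family on an algebra with values in the dual. -/
def Closed (ω : BiOp V V.carrier (Module.Dual k V.carrier)) : Prop :=
  ∀ (p q r s : List V.Homog) (a b c : V.Homog),
    sgn k ((deg p + a.1 + deg q + b.1) * (deg r + c.1 + deg s)) *
        ω (word (r ++ c :: s ++ p)) a.2 (word q) b.2
      + sgn k ((deg p + a.1 + deg q + b.1 + deg r + c.1) * deg s) *
        ω (word (s ++ p ++ a :: q)) b.2 (word r) c.2
      + sgn k ((deg p + a.1) * (deg q + b.1 + deg r + c.1 + deg s)) *
        ω (word (q ++ b :: r)) c.2 (word (s ++ p)) a.2 = 0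

variable {W W' : Type*} [AddCommGroup W] [Module k W] [AddCommGroup W'] [Module k W']

/-- With three marked letters there are three cyclic arrangements. If each bracket is the difference
X − Y at one arrangement minus the same difference at the next one, each arrangement occurs twice in
the closedness sum, with opposite signs. -/
theorem closed_of_cyclic_sums (ω : BiOp V V.carrier (Module.Dual k V.carrier))
    (X Y : List V.Homog → V.Homog → List V.Homog → V.Homog → List V.Homog → V.Homog → k)
    (h : ∀ l m u a y b, ω (word (l ++ m :: u)) a.2 (word y) b.2 =
      (X l m u a y b - Y l m u a y b) +
        sgn k ((deg y + b.1) * (deg l + m.1 + deg u + a.1)) * (Y y b l m u a - X y b l m u a)) :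
    Closed ω := by
  intro p q r s a b c
  have e1 := h r c (s ++ p) a q b
  have e2 := h (s ++ p) a q b r c
  have e3 := h q b r c (s ++ p) a
  rw [show r ++ c :: s ++ p = r ++ c :: (s ++ p) by simp, e1, e2, e3]
  have g : ∀ a b c : ℤ, (a : ZMod 2) + b = c → sgn k a * sgn k b = sgn k c := fun a b c h => by
    rw [← sgn_add]; exact sgn_congr (by push_cast; exact h)
  have g1 := g ((deg p + a.1 + deg q + b.1) * (deg r + c.1 + deg s))
      ((deg q + b.1) * (deg r + c.1 + deg (s ++ p) + a.1))
      ((deg p + a.1) * (deg q + b.1 + deg r + c.1 + deg s)) (by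
    simp only [deg_append, Int.cast_add, Int.cast_mul]; grind)
  have g2 := g ((deg p + a.1 + deg q + b.1 + deg r + c.1) * deg s)
      ((deg r + c.1) * (deg (s ++ p) + a.1 + deg q + b.1))
      ((deg p + a.1 + deg q + b.1) * (deg r + c.1 + deg s)) (by
    simp only [deg_append, Int.cast_add, Int.cast_mul]; grind)
  have g3 := g ((deg p + a.1) * (deg q + b.1 + deg r + c.1 + deg s))
      ((deg (s ++ p) + a.1) * (deg q + b.1 + deg r + c.1))
      ((deg p + a.1 + deg q + b.1 + deg r + c.1) * deg s) (by
    simp only [deg_append, Int.cast_add, Int.cast_mul]; grind)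
  linear_combination (Y q b r c (s ++ p) a - X q b r c (s ++ p) a) * g1 +
    (Y r c (s ++ p) a q b - X r c (s ++ p) a q b) * g2 +
    (Y (s ++ p) a q b r c - X (s ++ p) a q b r c) * g3

/-- Exact two-forms are closed. The terms are sorted by the way in which the cuts distribute three
marked letters between `K` and `F`: X collects those where `K` receives two of them, Y those where
`K` receives one. -/
theorem closed_pair_sub_rotT [CharZero k] (B : W →ₗ[k] W' →ₗ[k] k) (K : V.Bar →ₗ[k] W)
    (F : V.Bar →ₗ[k] W') :
    Closed (pair B (ofOp K) (ofOp F) - rotT (pair (C := V) (C' := V) B (ofOp K) (ofOp F))) := by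
  refine closed_of_cyclic_sums _
    (fun l m u a y b => sumSplit l fun l₁ l₂ => sumSplit y fun y₁ y₂ =>
      sgn k (deg l₁ * (deg l₂ + m.1 + deg u + a.1 + deg y + b.1)) *
        B (K (word (l₂ ++ m :: (u ++ a :: y₁)))) (F (word (y₂ ++ b :: l₁))))
    (fun l m u a y b => sumSplit l fun l₁ l₂ => sumSplit y fun y₁ y₂ =>
      sgn k ((deg l + m.1 + deg u + a.1) * (deg y + b.1) +
          deg y₁ * (deg y₂ + b.1 + deg l + m.1 + deg u + a.1)) *
        B (K (word (y₂ ++ b :: l₁))) (F (word (l₂ ++ m :: (u ++ a :: y₁))))) fun l m u a y b => ?_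
  have hω : ∀ (x : List V.Homog) (v : V.Homog) (y : List V.Homog) (c : V.Homog),
      pair B (ofOp K) (ofOp F) (word x) v.2 (word y) c.2 =
      sumSplit x fun x₁ x₂ => sumSplit y fun y₁ y₂ =>
      sgn k (deg x₁ * (deg x₂ + v.1 + deg y₁ + deg y₂ + c.1)) *
        B (K (word (x₂ ++ v :: y₁))) (F (word (y₂ ++ c :: x₁))) := by
    intro x v y c
    rw [pair_word]
    simp only [ofOp_apply, word_append, word_cons, mul_assoc]
  simp only [LinearMap.sub_apply, rotT_word, hω, mul_sub, mul_sumSplit]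
  -- A cut of `l m u` falls to the left or to the right of the third marked letter `m`. The
  -- resulting four sums are identified in `f1` to `f4` with X, Y and their values at the rotated
  -- arrangement.
  rw [sumSplit_comm y (l ++ m :: u), sumSplit_append_cons, sumSplit_append_cons]
  have f1 : (sumSplit l fun l₁ l₂ => sumSplit y fun y₁ y₂ =>
      sgn k (deg l₁ * (deg (l₂ ++ m :: u) + a.1 + deg y₁ + deg y₂ + b.1)) *
        B (K (word (l₂ ++ m :: u ++ a :: y₁))) (F (word (y₂ ++ b :: l₁)))) =
      sumSplit l fun l₁ l₂ => sumSplit y fun y₁ y₂ =>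
      sgn k (deg l₁ * (deg l₂ + m.1 + deg u + a.1 + deg y + b.1)) *
        B (K (word (l₂ ++ m :: (u ++ a :: y₁)))) (F (word (y₂ ++ b :: l₁))) := by
    refine sumSplit_congr fun l₁ l₂ hl => sumSplit_congr fun y₁ y₂ hy => ?_
    rw [List.append_assoc, List.cons_append]
    refine congr_arg (· * _) (sgn_congr ?_)
    simp only [hy, deg_append, deg_cons, Int.cast_add, Int.cast_mul]
    grind
  have f2 : (sumSplit l fun l₁ l₂ => sumSplit y fun y₁ y₂ =>
      sgn k ((deg (l ++ m :: u) + a.1) * (deg y + b.1)) *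
      (sgn k (deg y₁ * (deg y₂ + b.1 + deg l₁ + deg (l₂ ++ m :: u) + a.1)) *
        B (K (word (y₂ ++ b :: l₁))) (F (word (l₂ ++ m :: u ++ a :: y₁))))) =
      sumSplit l fun l₁ l₂ => sumSplit y fun y₁ y₂ =>
      sgn k ((deg l + m.1 + deg u + a.1) * (deg y + b.1) +
          deg y₁ * (deg y₂ + b.1 + deg l + m.1 + deg u + a.1)) *
        B (K (word (y₂ ++ b :: l₁))) (F (word (l₂ ++ m :: (u ++ a :: y₁)))) := by
    refine sumSplit_congr fun l₁ l₂ hl => sumSplit_congr fun y₁ y₂ hy => ?_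
    rw [List.append_assoc, List.cons_append, ← mul_assoc, ← sgn_add]
    refine congr_arg (· * _) (sgn_congr ?_)
    simp only [hl, deg_append, deg_cons, Int.cast_add, Int.cast_mul]
    grind
  have f3 : (sumSplit u fun u₁ u₂ => sumSplit y fun y₁ y₂ =>
      sgn k (deg (l ++ m :: u₁) * (deg u₂ + a.1 + deg y₁ + deg y₂ + b.1)) *
        B (K (word (u₂ ++ a :: y₁))) (F (word (y₂ ++ b :: (l ++ m :: u₁))))) =
      sumSplit y fun y₁ y₂ => sumSplit u fun u₁ u₂ =>
      sgn k ((deg y + b.1) * (deg l + m.1 + deg u + a.1)) *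
      (sgn k ((deg y + b.1 + deg l + m.1) * (deg u + a.1) +
          deg u₁ * (deg u₂ + a.1 + deg y + b.1 + deg l + m.1)) *
        B (K (word (u₂ ++ a :: y₁))) (F (word (y₂ ++ b :: (l ++ m :: u₁))))) := by
    rw [sumSplit_comm]
    refine sumSplit_congr fun y₁ y₂ hy => sumSplit_congr fun u₁ u₂ hu => ?_
    rw [← mul_assoc, ← sgn_add]
    refine congr_arg (· * _) (sgn_congr ?_)
    simp only [hy, hu, deg_append, deg_cons, Int.cast_add, Int.cast_mul]
    grind
  have f4 : (sumSplit u fun u₁ u₂ => sumSplit y fun y₁ y₂ =>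
      sgn k ((deg (l ++ m :: u) + a.1) * (deg y + b.1)) *
      (sgn k (deg y₁ * (deg y₂ + b.1 + deg (l ++ m :: u₁) + deg u₂ + a.1)) *
        B (K (word (y₂ ++ b :: (l ++ m :: u₁)))) (F (word (u₂ ++ a :: y₁))))) =
      sumSplit y fun y₁ y₂ => sumSplit u fun u₁ u₂ =>
      sgn k ((deg y + b.1) * (deg l + m.1 + deg u + a.1)) *
      (sgn k (deg y₁ * (deg y₂ + b.1 + deg l + m.1 + deg u + a.1)) *
        B (K (word (y₂ ++ b :: (l ++ m :: u₁)))) (F (word (u₂ ++ a :: y₁)))) := by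
    rw [sumSplit_comm]
    refine sumSplit_congr fun y₁ y₂ hy => sumSplit_congr fun u₁ u₂ hu => ?_
    rw [← mul_assoc, ← sgn_add, ← mul_assoc, ← sgn_add]
    refine congr_arg (· * _) (sgn_congr ?_)
    simp only [hu, deg_append, deg_cons, Int.cast_add, Int.cast_mul]
    grind
  rw [f1, f2, f3, f4]
  ring

end BiOp

end BiOps

/-! ### Sums over the marked letters of a word -/

section Mark

variable {α : Type*} {M : Type*} [AddCommMonoid M]

/-- The sum of `F x' a x''` over all decompositions `x = x' ++ a :: x''`. -/
def sumMark : List α → (List α → α → List α → M) → M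
  | [], _ => 0
  | a :: x, F => F [] a x + sumMark x fun x' b x'' => F (a :: x') b x''

theorem sumMark_append (x y : List α) (F : List α → α → List α → M) :
    sumMark (x ++ y) F = sumMark x (fun x' a x'' => F x' a (x'' ++ y)) +
      sumMark y fun y' a y'' => F (x ++ y') a y'' := by
  induction x generalizing F with
  | nil => simp [sumMark]
  | cons a x ih => simp [sumMark, ih, add_assoc]

theorem sumMark_congr {x : List α} {F F' : List α → α → List α → M}
    (h : ∀ x' a x'', x = x' ++ a :: x'' → F x' a x'' = F' x' a x'') :
    sumMark x F = sumMark x F' := by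
  induction x generalizing F F' with
  | nil => rfl
  | cons a x ih =>
    simp only [sumMark]
    rw [h [] a x rfl, ih fun x' b x'' hx => h _ _ _ (by rw [hx]; rfl)]

theorem sumMark_add (x : List α) (F F' : List α → α → List α → M) :
    sumMark x (fun x' a x'' => F x' a x'' + F' x' a x'') = sumMark x F + sumMark x F' := by
  induction x generalizing F F' with
  | nil => simp [sumMark]
  | cons a x ih => simp only [sumMark, ih]; abel

theorem sumMark_const (x : List α) (c : M) : sumMark x (fun _ _ _ => c) = x.length • c := by
  induction x with
  | nil => simp [sumMark]
  | cons a x ih => simp only [sumMark, ih, List.length_cons, succ_nsmul']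

theorem map_sumMark {M' : Type*} [AddCommMonoid M'] {T : Type*} [FunLike T M M']
    [AddMonoidHomClass T M M'] (f : T) (x : List α) (F : List α → α → List α → M) :
    f (sumMark x F) = sumMark x fun a b c => f (F a b c) := by
  induction x generalizing F with
  | nil => exact map_zero f
  | cons a x ih => simp only [sumMark, map_add, ih]

theorem mul_sumMark {R : Type*} [Semiring R] (c : R) (x : List α)
    (F : List α → α → List α → R) : c * sumMark x F = sumMark x fun a b d => c * F a b d :=
  map_sumMark (AddMonoidHom.mulLeft c) x F

end Mark

/-! ### The Euler homotopy: closed skew families are exact -/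

section BiOps

open GradedSpace

variable {k : Type v} [Field k] {V : GradedSpace.{u} k}

namespace BiOp

variable {M : Type*} [AddCommGroup M] [Module k M]

/-- The sum over all ways to choose the bimodule entry among the letters of a word. -/
noncomputable def mark (ω : BiOp V V.carrier M) : V.Bar →ₗ[k] M :=
  cut (cut.comp <| (LinearMap.lcomp k (V.Bar →ₗ[k] M) (letter (V := V))) ∘ₗ ω)

theorem mark_word (ω : BiOp V V.carrier M) (x : List V.Homog) :
    mark ω (word x) = sumMark x fun x' a x'' => ω (word x') a.2 (word x'') := by
  have h1 : mark ω (word x) = sumSplit x fun x' r => sumSplit r fun r₁ r₂ =>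
      ω (word x') (letter (word r₁)) (word r₂) := by
    rw [mark, cut_word]
    refine sumSplit_congr fun x' r _ => ?_
    rw [LinearMap.comp_apply, cut_word]
    rfl
  rw [h1]
  clear h1
  -- The dependence on the prefix is generalised, because the induction on the word transfers
  -- letters into it.
  suffices h : ∀ W : List V.Homog → V.carrier →ₗ[k] V.Bar →ₗ[k] M,
      (sumSplit x fun x' r => sumSplit r fun r₁ r₂ => W x' (letter (word r₁)) (word r₂)) =
        sumMark x fun x' a x'' => W x' a.2 (word x'') from h fun x' => ω (word x')
  intro W
  have h2 : ∀ (U : V.carrier →ₗ[k] V.Bar →ₗ[k] M) (a : V.Homog) (r : List V.Homog),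
      (sumSplit (a :: r) fun r₁ r₂ => U (letter (word r₁)) (word r₂)) = U a.2 (word r) := by
    intro U a r
    rw [sumSplit_cons, sumSplit_eq_right, letter_word_of_length_ne (by simp), word_singleton,
      letter_ι]
    · simp
    · intro p q hp
      rw [letter_word_of_length_ne]
      · simp
      · simpa using hp
  induction x generalizing W with
  | nil =>
    rw [sumSplit_nil, sumSplit_nil, letter_word_of_length_ne (by simp)]
    simp [sumMark]
  | cons a x ih =>
    rw [sumSplit_cons, h2, ih fun x' => W (a :: x')]
    rfl

/-- Contraction with the Euler vector field. The denominator is the total number of letters,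
including the one at which the functional will be evaluated. -/
theorem exists_euler (ω : BiOp V V.carrier M) : ∃ f : V.Bar →ₗ[k] M, ∀ x : List V.Homog,
    f (word x) = ((x.length : k) + 1)⁻¹ • sumMark x fun x' a x'' => ω (word x') a.2 (word x'') := by
  obtain ⟨f, hf⟩ := exists_of_length (V := V) fun n => ((n : k) + 1)⁻¹ • mark ω
  exact ⟨f, fun x => by rw [hf, LinearMap.smul_apply, mark_word]⟩

/-- The average over all ways to choose the bimodule entry. -/
noncomputable def euler (ω : BiOp V V.carrier M) : V.Bar →ₗ[k] M := (exists_euler ω).choose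

theorem euler_word (ω : BiOp V V.carrier M) (x : List V.Homog) :
    euler ω (word x) =
      ((x.length : k) + 1)⁻¹ • sumMark x fun x' a x'' => ω (word x') a.2 (word x'') :=
  (exists_euler ω).choose_spec x

/-- The Poincaré lemma. Closedness for each letter of `x` and of `y`, together with `v` and `c`,
contributes one copy of ω; the term marked at `v` and its rotation contribute two by skew symmetry.
The total number of copies is the number of letters of `x v y c`, which is the denominator of the
average. -/
theorem eq_euler_sub_rotT [CharZero k] {ω : BiOp V V.carrier (Module.Dual k V.carrier)}
    (hc : Closed ω) (hs : rotT ω = -ω) :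
    ω = pair LinearMap.id (ofOp (euler ω)) (const LinearMap.id) -
      rotT (pair (C := V) (C' := V) LinearMap.id (ofOp (euler ω)) (const LinearMap.id)) := by
  have hs' : ∀ (x : List V.Homog) (v : V.Homog) (y : List V.Homog) (c : V.Homog),
      ω (word x) v.2 (word y) c.2 =
        -(sgn k ((deg x + v.1) * (deg y + c.1)) * ω (word y) c.2 (word x) v.2) := by
    intro x v y c
    rw [← rotT_word, hs]; simp
  refine ext_dual fun x v y c => ?_
  have hn : ((x.length : k) + y.length + 1 + 1) ≠ 0 := by
    have : ((x.length + y.length + 1 + 1 : ℕ) : k) ≠ 0 := Nat.cast_ne_zero.mpr (by omega)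
    exact_mod_cast this
  simp only [LinearMap.sub_apply, rotT_word, pair_const_right, LinearMap.id_apply, ofOp_apply]
  have e1 : ∀ (x : List V.Homog) (v : V.Homog) (y : List V.Homog) (c : V.Homog),
      euler ω (word x * TensorAlgebra.ι k (v.2 : V.carrier) * word y) c.2 =
      ((x.length : k) + y.length + 1 + 1)⁻¹ *
        ((sumMark x fun x' a x'' => ω (word x') a.2 (word (x'' ++ v :: y)) c.2) +
        (ω (word x) v.2 (word y) c.2 +
          sumMark y fun y' a y'' => ω (word (x ++ v :: y')) a.2 (word y'') c.2)) := by
    intro x v y c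
    rw [mul_assoc, ← word_cons, ← word_append, euler_word, LinearMap.smul_apply, smul_eq_mul]
    congr 1
    · rw [List.length_append, List.length_cons]; push_cast; ring
    · rw [sumMark_append]
      simp only [sumMark, LinearMap.add_apply, List.append_nil]
      congr 1
      · exact map_sumMark (LinearMap.applyₗ (c.2 : V.carrier)) _ _
      · congr 1
        exact map_sumMark (LinearMap.applyₗ (c.2 : V.carrier)) _ _
  rw [e1, e1, add_comm (y.length : k)]
  -- Closedness for the marked letters `a`, `v`, `c` with `a` in `x`: up to the rotated sum, each
  -- letter of `x` gives one copy of ω. The same is done for the letters of `y` afterwards.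
  have hX : (sumMark x fun x' a x'' => ω (word x') a.2 (word (x'' ++ v :: y)) c.2) =
      (sumMark x fun x' a x'' => sgn k ((deg x + v.1) * (deg y + c.1)) *
        ω (word (y ++ c :: x')) a.2 (word x'') v.2) + (x.length : k) * ω (word x) v.2 (word y) c.2 := by
    rw [← nsmul_eq_mul, ← sumMark_const x (ω (word x) v.2 (word y) c.2), ← sumMark_add]
    refine sumMark_congr fun x' a x'' hx => ?_
    have h1 := hc x' x'' y [] a v c
    have h2 := hs' (x'' ++ v :: y) c x' a
    simp only [deg_nil, add_zero, mul_zero, sgn_zero, one_mul,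
      List.nil_append, List.append_assoc, List.cons_append] at h1
    rw [← hx] at h1
    have h5 : sgn k ((deg x' + a.1) * (deg x'' + v.1 + deg y + c.1)) *
        sgn k ((deg (x'' ++ v :: y) + c.1) * (deg x' + a.1)) = 1 := by
      rw [← sgn_add, ← sgn_zero, sgn_congr]
      simp only [deg_append, deg_cons, Int.cast_add, Int.cast_mul, Int.cast_zero]
      grind
    rw [show deg x + v.1 = deg x' + a.1 + deg x'' + v.1 by rw [hx]; simp; ring]
    linear_combination -h1 + sgn k ((deg x' + a.1) * (deg x'' + v.1 + deg y + c.1)) * h2 -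
      ω (word x') a.2 (word (x'' ++ v :: y)) c.2 * h5
  have hY : (sumMark y fun y' a y'' => ω (word (x ++ v :: y')) a.2 (word y'') c.2) =
      (sumMark y fun y' a y'' => sgn k ((deg x + v.1) * (deg y + c.1)) *
        ω (word y') a.2 (word (y'' ++ c :: x)) v.2) + (y.length : k) * ω (word x) v.2 (word y) c.2 := by
    rw [← nsmul_eq_mul, ← sumMark_const y (ω (word x) v.2 (word y) c.2), ← sumMark_add]
    refine sumMark_congr fun y' a y'' hy => ?_
    have h1 := hc x y' y'' [] v a c
    have h2 := hs' (y'' ++ c :: x) v y' a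
    have h3 := hs' x v y c
    simp only [deg_nil, add_zero, mul_zero, sgn_zero, one_mul,
      List.nil_append, List.append_assoc, List.cons_append] at h1
    rw [← hy] at h1
    have h5 : sgn k ((deg x + v.1 + deg y' + a.1) * (deg y'' + c.1)) *
        sgn k ((deg (y'' ++ c :: x) + v.1) * (deg y' + a.1)) =
          sgn k ((deg x + v.1) * (deg y + c.1)) := by
      rw [← sgn_add, sgn_congr]
      simp only [hy, deg_append, deg_cons, Int.cast_add, Int.cast_mul]
      grind
    rw [show deg y' + a.1 + deg y'' + c.1 = deg y + c.1 by rw [hy]; simp; ring] at h1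
    linear_combination h1 - h3 - sgn k ((deg x + v.1 + deg y' + a.1) * (deg y'' + c.1)) * h2 +
      ω (word y') a.2 (word (y'' ++ c :: x)) v.2 * h5
  have h4 := hs' x v y c
  rw [hX, hY]
  simp only [← mul_sumMark]
  field_simp
  linear_combination h4

end BiOp

end BiOps

/-! ### Families over the gapping monoid: composition and convolution -/

section Families

open GradedSpace GappingMonoid

variable {k : Type v} [Field k] {G : GappingMonoid}

section Interchange

variable {M₁ M₂ M₃ M₄ N N' L L' M : Type*} [AddCommGroup M₁] [Module k M₁] [AddCommGroup M₂]
  [Module k M₂] [AddCommGroup M₃] [Module k M₃] [AddCommGroup M₄] [Module k M₄]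
  [AddCommGroup N] [Module k N] [AddCommGroup N'] [Module k N'] [AddCommGroup L] [Module k L]
  [AddCommGroup L'] [Module k L'] [AddCommGroup M] [Module k M]

/-- Identities of components at arbitrary energies lift to Cauchy products. The hypothesis is needed
only at the members of the given families, so it may use their degrees. -/
theorem lift₂_assoc {μ : N →ₗ[k] M₃ →ₗ[k] M} {ν : M₁ →ₗ[k] M₂ →ₗ[k] N}
    {μ' : M₁ →ₗ[k] N' →ₗ[k] M} {ν' : M₂ →ₗ[k] M₃ →ₗ[k] N'} {f : G.Elt → M₁} {g : G.Elt → M₂}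
    {h : G.Elt → M₃}
    (H : ∀ a b c, μ (ν (f a) (g b)) (h c) = μ' (f a) (ν' (g b) (h c))) :
    lift₂ μ (lift₂ ν f g) h = lift₂ μ' f (lift₂ ν' g h) := by
  funext β
  rw [lift₂_lift₂_left, lift₂_lift₂_right]
  exact Finset.sum_congr rfl fun p _ => Finset.sum_congr rfl fun q _ => H _ _ _

theorem lift₂_right_comm {μ : N →ₗ[k] M₃ →ₗ[k] M} {ν : M₁ →ₗ[k] M₂ →ₗ[k] N}
    {μ' : N' →ₗ[k] M₂ →ₗ[k] M} {ν' : M₁ →ₗ[k] M₃ →ₗ[k] N'} {f : G.Elt → M₁} {g : G.Elt → M₂}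
    {h : G.Elt → M₃}
    (H : ∀ a b c, μ (ν (f a) (g b)) (h c) = μ' (ν' (f a) (h c)) (g b)) :
    lift₂ μ (lift₂ ν f g) h = lift₂ μ' (lift₂ ν' f h) g := by
  funext β
  rw [lift₂_lift₂_left, lift₂_lift₂_left]
  refine Finset.sum_congr rfl fun p _ => ?_
  rw [sum_decomps_swap p.2 fun a b => μ (ν (f p.1) (g a)) (h b)]
  exact Finset.sum_congr rfl fun q _ => H _ _ _

theorem lift₂_interchange {μ : N →ₗ[k] L →ₗ[k] M} {ν : M₁ →ₗ[k] M₂ →ₗ[k] N}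
    {l : M₃ →ₗ[k] M₄ →ₗ[k] L} {μ' : N' →ₗ[k] L' →ₗ[k] M} {ν' : M₁ →ₗ[k] M₃ →ₗ[k] N'}
    {l' : M₂ →ₗ[k] M₄ →ₗ[k] L'} {f : G.Elt → M₁} {g : G.Elt → M₂}
    {h : G.Elt → M₃} {j : G.Elt → M₄}
    (H : ∀ a b c d, μ (ν (f a) (g b)) (l (h c) (j d)) = μ' (ν' (f a) (h c)) (l' (g b) (j d))) :
    lift₂ μ (lift₂ ν f g) (lift₂ l h j) = lift₂ μ' (lift₂ ν' f h) (lift₂ l' g j) := by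
  funext β
  rw [lift₂_lift₂_left, lift₂_lift₂_left]
  refine Finset.sum_congr rfl fun p _ => ?_
  simp only [lift₂, map_sum]
  rw [← sum_decomps_assoc p.2 fun a b c => μ (ν (f p.1) (g a)) (l (h b) (j c)),
    ← sum_decomps_assoc p.2 fun a b c => μ' (ν' (f p.1) (h a)) (l' (g b) (j c))]
  refine Finset.sum_congr rfl fun q _ => ?_
  rw [sum_decomps_swap q.1 fun a b => μ (ν (f p.1) (g a)) (l (h b) (j q.2))]
  exact Finset.sum_congr rfl fun r _ => H _ _ _ _

theorem lift₂_sub_left (μ : M₁ →ₗ[k] M₂ →ₗ[k] M) (f f' : G.Elt → M₁) (g : G.Elt → M₂) :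
    lift₂ μ (f - f') g = lift₂ μ f g - lift₂ μ f' g := by
  rw [sub_eq_add_neg, lift₂_add_left, lift₂_neg_left, ← sub_eq_add_neg]

theorem lift₂_sub_right (μ : M₁ →ₗ[k] M₂ →ₗ[k] M) (f : G.Elt → M₁) (g g' : G.Elt → M₂) :
    lift₂ μ f (g - g') = lift₂ μ f g - lift₂ μ f g' := by
  rw [sub_eq_add_neg, lift₂_add_right, lift₂_neg_right, ← sub_eq_add_neg]

end Interchange

section Comp

variable {M₁ M₂ M₃ M₄ : Type*} [AddCommGroup M₁] [Module k M₁] [AddCommGroup M₂]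
  [Module k M₂] [AddCommGroup M₃] [Module k M₃] [AddCommGroup M₄] [Module k M₄]

/-- The composition of families of linear maps. -/
noncomputable def fcomp (X : G.Elt → (M₂ →ₗ[k] M₃)) (Y : G.Elt → (M₁ →ₗ[k] M₂)) :
    G.Elt → (M₁ →ₗ[k] M₃) := lift₂ (LinearMap.llcomp k M₁ M₂ M₃) X Y

theorem fcomp_apply (X : G.Elt → (M₂ →ₗ[k] M₃)) (Y : G.Elt → (M₁ →ₗ[k] M₂)) (β : G.Elt) (z : M₁) :
    fcomp X Y β z = ∑ p ∈ decomps β, X p.1 (Y p.2 z) := by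
  simp [fcomp, lift₂]

theorem fcomp_assoc (X : G.Elt → (M₃ →ₗ[k] M₄)) (Y : G.Elt → (M₂ →ₗ[k] M₃))
    (Z : G.Elt → (M₁ →ₗ[k] M₂)) : fcomp (fcomp X Y) Z = fcomp X (fcomp Y Z) :=
  lift₂_assoc fun _ _ _ => rfl

theorem fcomp_single (X : G.Elt → (M₂ →ₗ[k] M₃)) (t : M₁ →ₗ[k] M₂) (β : G.Elt) :
    fcomp X (single t) β = X β ∘ₗ t := lift₂_single_right _ _ _ _

theorem single_fcomp (t : M₂ →ₗ[k] M₃) (X : G.Elt → (M₁ →ₗ[k] M₂)) (β : G.Elt) :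
    fcomp (single t) X β = t ∘ₗ X β := lift₂_single_left _ _ _ _

theorem fcomp_id (X : G.Elt → (M₂ →ₗ[k] M₃)) : fcomp X (single LinearMap.id) = X :=
  funext fun _ => fcomp_single _ _ _

theorem id_fcomp (X : G.Elt → (M₂ →ₗ[k] M₃)) : fcomp (single LinearMap.id) X = X :=
  funext fun _ => single_fcomp _ _ _

theorem add_fcomp (X X' : G.Elt → (M₂ →ₗ[k] M₃)) (Y : G.Elt → (M₁ →ₗ[k] M₂)) :
    fcomp (X + X') Y = fcomp X Y + fcomp X' Y := lift₂_add_left _ _ _ _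

theorem fcomp_add (X : G.Elt → (M₂ →ₗ[k] M₃)) (Y Y' : G.Elt → (M₁ →ₗ[k] M₂)) :
    fcomp X (Y + Y') = fcomp X Y + fcomp X Y' := lift₂_add_right _ _ _ _

theorem sub_fcomp (X X' : G.Elt → (M₂ →ₗ[k] M₃)) (Y : G.Elt → (M₁ →ₗ[k] M₂)) :
    fcomp (X - X') Y = fcomp X Y - fcomp X' Y := lift₂_sub_left _ _ _ _

theorem fcomp_sub (X : G.Elt → (M₂ →ₗ[k] M₃)) (Y Y' : G.Elt → (M₁ →ₗ[k] M₂)) :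
    fcomp X (Y - Y') = fcomp X Y - fcomp X Y' := lift₂_sub_right _ _ _ _

theorem neg_fcomp (X : G.Elt → (M₂ →ₗ[k] M₃)) (Y : G.Elt → (M₁ →ₗ[k] M₂)) :
    fcomp (-X) Y = -fcomp X Y := lift₂_neg_left _ _ _

theorem fcomp_neg (X : G.Elt → (M₂ →ₗ[k] M₃)) (Y : G.Elt → (M₁ →ₗ[k] M₂)) :
    fcomp X (-Y) = -fcomp X Y := lift₂_neg_right _ _ _

theorem zero_fcomp (Y : G.Elt → (M₁ →ₗ[k] M₂)) :
    fcomp (0 : G.Elt → (M₂ →ₗ[k] M₃)) Y = 0 := lift₂_zero_left _ _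

theorem fcomp_zero (X : G.Elt → (M₂ →ₗ[k] M₃)) :
    fcomp X (0 : G.Elt → (M₁ →ₗ[k] M₂)) = 0 := lift₂_zero_right _ _

end Comp

/-! ### The convolution algebra -/

variable {V : GradedSpace.{u} k} {W : GradedSpace.{u₁} k}

theorem Coch.ext_word {M : Type*} [AddCommGroup M] [Module k M] {X Y : G.Elt → (V.Bar →ₗ[k] M)}
    (h : ∀ β x, X β (word x) = Y β (word x)) : X = Y :=
  funext fun β => bar_ext fun x => h β x

/-- The family vanishes below a given weight. -/
def IsSmall {M : Type*} [AddCommGroup M] [Module k M] (n : ℕ) (X : G.Elt → (V.Bar →ₗ[k] M)) : Prop :=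
  ∀ (β : G.Elt) (x : List V.Homog), wt β x.length < n → X β (word x) = 0

theorem eq_zero_of_small {M : Type*} [AddCommGroup M] [Module k M] {X : G.Elt → (V.Bar →ₗ[k] M)}
    (h : ∀ n, IsSmall n X) : X = 0 :=
  Coch.ext_word fun β x => h _ β x (Nat.lt_succ_self _)

theorem small_one {M : Type*} [AddCommGroup M] [Module k M] {X : G.Elt → (V.Bar →ₗ[k] M)}
    (h : X 0 1 = 0) : IsSmall 1 X := by
  intro β x hx
  unfold wt at hx
  have h1 : x = [] := List.length_eq_zero_iff.mp (by omega)
  have h2 : β = 0 := by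
    by_contra hβ
    have := ord_pos hβ
    omega
  rw [h1, h2, word_nil, h]

theorem wt_split {β : G.Elt} {p : G.Elt × G.Elt} (hp : p ∈ decomps β) (m n : ℕ) :
    wt p.1 m + wt p.2 n ≤ wt β (m + n) := by
  have := ord_add_le_of_mem hp
  unfold wt; omega

variable (G V) in
/-- Families of maps from words to an algebra, with the convolution product. -/
@[ext] structure Conv (R : Type*) [Ring R] [Algebra k R] where
  fam : G.Elt → (V.Bar →ₗ[k] R)

namespace Conv

variable {R R' : Type*} [Ring R] [Algebra k R] [Ring R'] [Algebra k R']

theorem ext_word {X Y : Conv G V R} (h : ∀ β x, X.fam β (word x) = Y.fam β (word x)) : X = Y :=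
  Conv.ext (Coch.ext_word h)

noncomputable instance : Zero (Conv G V R) := ⟨⟨0⟩⟩
noncomputable instance : Add (Conv G V R) := ⟨fun X Y => ⟨X.fam + Y.fam⟩⟩
noncomputable instance : Neg (Conv G V R) := ⟨fun X => ⟨-X.fam⟩⟩
noncomputable instance : Mul (Conv G V R) := ⟨fun X Y => ⟨lift₂ conv X.fam Y.fam⟩⟩
noncomputable instance : One (Conv G V R) :=
  ⟨⟨single (Algebra.linearMap k R ∘ₗ (TensorAlgebra.algebraMapInv : V.Bar →ₐ[k] k).toLinearMap)⟩⟩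

@[simp] theorem zero_fam : (0 : Conv G V R).fam = 0 := rfl
@[simp] theorem add_fam (X Y : Conv G V R) : (X + Y).fam = X.fam + Y.fam := rfl
@[simp] theorem neg_fam (X : Conv G V R) : (-X).fam = -X.fam := rfl

theorem mul_fam (X Y : Conv G V R) : (X * Y).fam = lift₂ conv X.fam Y.fam := rfl

theorem one_fam : (1 : Conv G V R).fam = single (Algebra.linearMap k R ∘ₗ
    (TensorAlgebra.algebraMapInv : V.Bar →ₐ[k] k).toLinearMap) := rfl

theorem mul_word (X Y : Conv G V R) (β : G.Elt) (x : List V.Homog) :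
    (X * Y).fam β (word x) =
      ∑ p ∈ decomps β, sumSplit x fun x₁ x₂ => X.fam p.1 (word x₁) * Y.fam p.2 (word x₂) := by
  simp only [mul_fam, lift₂, LinearMap.sum_apply, conv_word]

theorem conv_assoc (f g h : V.Bar →ₗ[k] R) : conv (conv f g) h = conv f (conv g h) := by
  refine bar_ext fun x => ?_
  simp only [conv_word, sumSplit_mul, mul_sumSplit]
  rw [sumSplit_assoc x fun a b c => f (word a) * g (word b) * h (word c)]
  simp only [mul_assoc]

noncomputable instance : Ring (Conv G V R) where
  add_assoc X Y Z := Conv.ext (add_assoc _ _ _)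
  zero_add X := Conv.ext (zero_add _)
  add_zero X := Conv.ext (add_zero _)
  add_comm X Y := Conv.ext (add_comm _ _)
  neg_add_cancel X := Conv.ext (neg_add_cancel _)
  nsmul := nsmulRec
  zsmul := zsmulRec
  left_distrib X Y Z := Conv.ext (lift₂_add_right _ _ _ _)
  right_distrib X Y Z := Conv.ext (lift₂_add_left _ _ _ _)
  zero_mul X := Conv.ext (lift₂_zero_left _ _)
  mul_zero X := Conv.ext (lift₂_zero_right _ _)
  mul_assoc X Y Z := Conv.ext (lift₂_assoc fun _ _ _ => conv_assoc _ _ _)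
  one_mul X := by
    refine ext_word fun β x => ?_
    rw [mul_fam, one_fam, lift₂_single_left, conv_word, sumSplit_eq_right]
    · simp
    · intro a b ha
      simp [BiOp.algebraMapInv_word_of_ne ha]
  mul_one X := by
    refine ext_word fun β x => ?_
    rw [mul_fam, one_fam, lift₂_single_right, conv_word, sumSplit_eq_left]
    · simp
    · intro a b ha
      simp [BiOp.algebraMapInv_word_of_ne ha]

@[simp] theorem sub_fam (X Y : Conv G V R) : (X - Y).fam = X.fam - Y.fam := by
  rw [sub_eq_add_neg, add_fam, neg_fam, ← sub_eq_add_neg]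

theorem small_mul {a b : ℕ} {X Y : Conv G V R} (hX : IsSmall a X.fam) (hY : IsSmall b Y.fam) :
    IsSmall (a + b) (X * Y).fam := by
  intro β x hx
  rw [mul_word]
  refine Finset.sum_eq_zero fun p hp => sumSplit_eq_zero fun x₁ x₂ h => ?_
  have hw := wt_split hp x₁.length x₂.length
  rw [h, List.length_append] at hx
  rcases lt_or_ge (wt p.1 x₁.length) a with h1 | h1
  · rw [hX _ _ h1, zero_mul]
  · rw [hY _ _ (by omega), mul_zero]

/-- Multiplication by `a` raises the order by one, so the order of `X` is unbounded. -/
theorem eq_zero_of_eq_mul {a X : Conv G V R} (ha : IsSmall 1 a.fam) (h : X = a * X) : X = 0 := by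
  refine Conv.ext (eq_zero_of_small fun n => ?_)
  induction n with
  | zero => intro β x hx; omega
  | succ n ih => rw [h, add_comm]; exact small_mul ha ih

theorem eq_of_eq_add_mul {a b X Y : Conv G V R} (ha : IsSmall 1 a.fam) (hX : X = b + a * X)
    (hY : Y = b + a * Y) : X = Y := by
  rw [← sub_eq_zero]
  refine eq_zero_of_eq_mul ha ?_
  nth_rw 1 [hX, hY]
  rw [mul_sub]; abel

/-- The solution is the geometric series with terms a^n b, which converges for the weight. -/
theorem exists_eq_add_mul {a : Conv G V R} (ha : IsSmall 1 a.fam) (b : Conv G V R) :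
    ∃ X : Conv G V R, X = b + a * X := by
  obtain ⟨X, -, hX⟩ := Coch.exists_fixed_point (G := G) (V := V) (M := R) (fun _ => True)
    (fun _ _ => trivial) trivial (fun X => (b + a * ⟨X⟩ : Conv G V R).fam) (fun _ _ => trivial) (by
      intro n X Y _ _ h β x hx
      have h1 : IsSmall n (⟨X⟩ - ⟨Y⟩ : Conv G V R).fam := fun β x hx => by
        rw [sub_fam, Pi.sub_apply, LinearMap.sub_apply, h β x hx, sub_self]
      have h2 := small_mul ha h1 β x (by omega)
      have h3 : a * (⟨X⟩ - ⟨Y⟩ : Conv G V R) = (b + a * ⟨X⟩) - (b + a * ⟨Y⟩) := by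
        rw [mul_sub]; abel
      rw [h3, sub_fam] at h2
      exact sub_eq_zero.mp h2)
  exact ⟨⟨X⟩, Conv.ext hX.symm⟩

/-- Composition with an algebra homomorphism. -/
noncomputable def map (t : R →ₐ[k] R') : Conv G V R →+* Conv G V R' where
  toFun X := ⟨fun β => t.toLinearMap ∘ₗ X.fam β⟩
  map_one' := by
    refine ext_word fun β x => ?_
    by_cases h : β = 0
    · subst h; simp [one_fam, Algebra.algebraMap_eq_smul_one]
    · simp [one_fam, single_of_ne _ h]
  map_mul' X Y := by
    refine ext_word fun β x => ?_
    simp only [LinearMap.comp_apply, mul_word, map_sum, AlgHom.toLinearMap_apply, map_sumSplit,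
      map_mul]
  map_zero' := Conv.ext (funext fun _ => LinearMap.comp_zero _)
  map_add' X Y := Conv.ext (funext fun _ => LinearMap.comp_add _ _ _)

theorem map_fam (t : R →ₐ[k] R') (X : Conv G V R) (β : G.Elt) (z : V.Bar) :
    (map t X).fam β z = t (X.fam β z) := rfl

/-- Composition with the parity operator. -/
noncomputable def s : Conv G V R →+* Conv G V R where
  toFun X := ⟨fun β => X.fam β ∘ₗ V.parT.toLinearMap⟩
  map_one' := by
    refine Conv.ext (funext fun β => LinearMap.ext fun x => ?_)
    by_cases h : β = 0
    · subst h; simp [one_fam, BiOp.algebraMapInv_parT]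
    · simp [one_fam, single_of_ne _ h]
  map_mul' X Y := by
    refine ext_word fun β x => ?_
    simp only [LinearMap.comp_apply, mul_word, AlgHom.toLinearMap_apply, parT_word, map_smul,
      Finset.smul_sum, smul_sumSplit]
    refine Finset.sum_congr rfl fun p _ => sumSplit_congr fun x₁ x₂ hx => ?_
    rw [hx, deg_append, sgn_add, smul_mul_smul_comm]
  map_zero' := Conv.ext (funext fun _ => LinearMap.zero_comp _)
  map_add' X Y := Conv.ext (funext fun _ => LinearMap.add_comp _ _ _)

theorem s_fam (X : Conv G V R) (β : G.Elt) (z : V.Bar) : (s X).fam β z = X.fam β (V.parT z) := rfl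

theorem s_s (X : Conv G V R) : s (s X) = X := by
  refine Conv.ext (funext fun β => LinearMap.ext fun z => ?_)
  rw [s_fam, s_fam, parT_parT]

theorem small_s {n : ℕ} {X : Conv G V R} (h : IsSmall n X.fam) : IsSmall n (s X).fam := by
  intro β x hx
  rw [s_fam, parT_word, map_smul, h β x hx, smul_zero]

/-- Composition of a family with a family of linear maps between spaces of words. -/
noncomputable def comp (X : Conv G W R) (L : Conv G V W.Bar) : Conv G V R := ⟨fcomp X.fam L.fam⟩

theorem comp_fam (X : Conv G W R) (L : Conv G V W.Bar) : (X.comp L).fam = fcomp X.fam L.fam := rfl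

variable (G V) in
/-- The identity, as an element of the convolution algebra. -/
noncomputable def idc : Conv G V V.Bar := ⟨single LinearMap.id⟩

/-- The family of maps to words of length one. -/
noncomputable def letters (f : Coch G V W.carrier) : Conv G V W.Bar :=
  ⟨fun β => TensorAlgebra.ι k ∘ₗ f β⟩

theorem letters_fam (f : Coch G V W.carrier) (β : G.Elt) (z : V.Bar) :
    (letters f).fam β z = TensorAlgebra.ι k (f β z) := rfl

theorem letters_fcomp {U : GradedSpace.{u₂} k} (f : Coch G V W.carrier) (L : Conv G U V.Bar) :
    letters (fcomp f L.fam) = (letters f).comp L := by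
  refine Conv.ext (funext fun β => LinearMap.ext fun z => ?_)
  rw [letters_fam, comp_fam, fcomp_apply, fcomp_apply, map_sum]; rfl

theorem small_letters {n : ℕ} {f : Coch G V W.carrier} (h : IsSmall n f) :
    IsSmall n (letters f).fam := by
  intro β x hx
  rw [letters_fam, h β x hx, map_zero]

theorem comp_assoc {U : GradedSpace.{u₂} k} (X : Conv G W R) (L : Conv G V W.Bar)
    (L' : Conv G U V.Bar) : (X.comp L).comp L' = X.comp (L.comp L') :=
  Conv.ext (fcomp_assoc _ _ _)

theorem add_comp (X Y : Conv G W R) (L : Conv G V W.Bar) : (X + Y).comp L = X.comp L + Y.comp L :=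
  Conv.ext (add_fcomp _ _ _)

theorem comp_add (X : Conv G W R) (L L' : Conv G V W.Bar) :
    X.comp (L + L') = X.comp L + X.comp L' := Conv.ext (fcomp_add _ _ _)

theorem comp_idc (X : Conv G V R) : X.comp (idc G V) = X := Conv.ext (fcomp_id _)

theorem idc_comp (X : Conv G V W.Bar) : (idc G W).comp X = X := Conv.ext (id_fcomp _)

theorem map_comp (t : R →ₐ[k] R') (X : Conv G W R) (L : Conv G V W.Bar) :
    (map t X).comp L = map t (X.comp L) := by
  refine Conv.ext (funext fun β => LinearMap.ext fun z => ?_)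
  rw [map_fam, comp_fam, comp_fam, fcomp_apply, fcomp_apply, map_sum]; rfl

theorem map_idc_comp (t : W.Bar →ₐ[k] R) (L : Conv G V W.Bar) :
    (map t (idc G W)).comp L = map t L := by rw [map_comp, idc_comp]

end Conv

end Families

/-! ### The tensor coalgebra with coefficients in the gapping monoid -/

section Coalgebra

open GradedSpace GappingMonoid

variable {k : Type v} [Field k] {G : GappingMonoid}
variable {V : GradedSpace.{u} k} {W : GradedSpace.{u₁} k} {U : GradedSpace.{u₂} k}

theorem lift₂_deriv {M₁ M₂ M₃ N N₁ N₂ M : Type*} [AddCommGroup M₁] [Module k M₁] [AddCommGroup M₂]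
    [Module k M₂] [AddCommGroup M₃] [Module k M₃] [AddCommGroup N] [Module k N]
    [AddCommGroup N₁] [Module k N₁] [AddCommGroup N₂] [Module k N₂] [AddCommGroup M] [Module k M]
    {μ : N →ₗ[k] M₃ →ₗ[k] M} {ν : M₁ →ₗ[k] M₂ →ₗ[k] N} {μ₁ : N₁ →ₗ[k] M₂ →ₗ[k] M}
    {ν₁ : M₁ →ₗ[k] M₃ →ₗ[k] N₁} {μ₂ : M₁ →ₗ[k] N₂ →ₗ[k] M} {ν₂ : M₂ →ₗ[k] M₃ →ₗ[k] N₂}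
    {f f' : G.Elt → M₁} {g : G.Elt → M₂} {h : G.Elt → M₃}
    (H : ∀ a b c, μ (ν (f a) (g b)) (h c) =
      μ₁ (ν₁ (f a) (h c)) (g b) + μ₂ (f' a) (ν₂ (g b) (h c))) :
    lift₂ μ (lift₂ ν f g) h = lift₂ μ₁ (lift₂ ν₁ f h) g + lift₂ μ₂ f' (lift₂ ν₂ g h) := by
  funext β
  rw [Pi.add_apply, lift₂_lift₂_left, lift₂_lift₂_left, lift₂_lift₂_right, ← Finset.sum_add_distrib]
  refine Finset.sum_congr rfl fun p _ => ?_
  rw [sum_decomps_swap p.2 fun a b => μ₁ (ν₁ (f p.1) (h a)) (g b), ← Finset.sum_add_distrib]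
  exact Finset.sum_congr rfl fun q _ => H _ _ _

/-- The family `f` has degree `e`, up to the degrees of the elements of the gapping monoid. -/
def CoDeg (e : ℤ) (f : Coch G V W.carrier) : Prop := ∀ β, IsHomog (e - maslov β) (f β)

theorem CoDeg.odd {m : Coch G V W.carrier} (_ : CoDeg 1 m) (β : G.Elt) :
    Odd (1 - maslov β) := odd_one.sub_even (maslov_even β)

namespace Conv

variable {R R' : Type*} [Ring R] [Algebra k R] [Ring R'] [Algebra k R']

/-! ### Coderivations -/

/-- The coderivation induced by a family of odd degree. -/
noncomputable def chat (m : Coch G V V.carrier) : Conv G V V.Bar :=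
  s (idc G V) * letters m * idc G V

theorem chat_fam (m : Coch G V V.carrier) (β : G.Elt) : (chat m).fam β = coder (m β) := by
  have h1 : ((letters m) * idc G V).fam =
      fun β => conv (TensorAlgebra.ι k ∘ₗ m β) (LinearMap.id : V.Bar →ₗ[k] V.Bar) := by
    funext β
    rw [mul_fam, idc, lift₂_single_right]; rfl
  have h2 : (s (idc G V)).fam = single V.parT.toLinearMap := by
    funext β
    refine LinearMap.ext fun z => ?_
    by_cases hβ : β = 0
    · subst hβ; simp [s_fam, idc]
    · simp [s_fam, idc, single_of_ne _ hβ]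
  rw [chat, mul_assoc, mul_fam, h1, h2, lift₂_single_left]
  rfl

theorem conv_comp_coder (f g : V.Bar →ₗ[k] R) {m : V.Bar →ₗ[k] V.carrier} {e : ℤ}
    (h : IsHomog e m) : conv f g ∘ₗ coder m =
      conv (f ∘ₗ coder m) g + conv (f ∘ₗ V.parT.toLinearMap) (g ∘ₗ coder m) := by
  refine bar_ext fun x => ?_
  simp only [LinearMap.comp_apply, LinearMap.add_apply, conv_word, coder_word' h, map_sumSplit,
    map_smul, smul_sumSplit, sumSplit_mul, mul_sumSplit, AlgHom.toLinearMap_apply, parT_word]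
  rw [sumSplit_insert h.val, add_comm]
  congr 1
  · refine sumSplit_congr fun a b hx => sumSplit_congr fun a₁ r ha => sumSplit_congr fun _ _ _ => ?_
    rw [smul_mul_assoc]
  · refine sumSplit_congr fun a b hx => sumSplit_congr fun a₁ r ha => sumSplit_congr fun _ _ _ => ?_
    rw [smul_mul_smul_comm, deg_append, sgn_add]

/-- The coderivation property in dual form: precomposition with `chat m` is a derivation of the
convolution algebra twisted by the parity `s`. -/
theorem mul_comp_chat (X Y : Conv G V R) {m : Coch G V V.carrier} {e : ℤ} (h : CoDeg e m) :
    (X * Y).comp (chat m) = X.comp (chat m) * Y + s X * Y.comp (chat m) := by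
  refine Conv.ext ?_
  rw [add_fam, mul_fam, mul_fam]
  refine lift₂_deriv fun a b c => ?_
  rw [chat_fam]
  exact conv_comp_coder _ _ (h c)

theorem one_comp_chat {m : Coch G V V.carrier} {e : ℤ} (h : CoDeg e m) :
    (1 : Conv G V R).comp (chat m) = 0 := by
  have := mul_comp_chat (1 : Conv G V R) 1 h
  rw [one_mul, mul_one, map_one, one_mul] at this
  simpa using this

theorem s_comp_chat (X : Conv G V R) {m : Coch G V V.carrier} (h : CoDeg 1 m) :
    (s X).comp (chat m) = -s (X.comp (chat m)) := by
  refine Conv.ext (funext fun β => LinearMap.ext fun z => ?_)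
  rw [comp_fam, fcomp_apply, neg_fam, Pi.neg_apply, LinearMap.neg_apply, s_fam, comp_fam,
    fcomp_apply, ← Finset.sum_neg_distrib]
  refine Finset.sum_congr rfl fun p _ => ?_
  rw [s_fam, chat_fam, parT_coder (h _) (h.odd _), map_neg]

/-! ### Coalgebra homomorphisms -/

/-- The geometric series of the convolution powers of `f`. The hypothesis is put inside the
statement so that `hat` is defined for every family. -/
theorem exists_hat (f : Coch G V W.carrier) : ∃ F : Conv G V W.Bar,
    IsSmall 1 f → F = 1 + letters f * F := by
  by_cases h : IsSmall 1 f
  · obtain ⟨F, hF⟩ := exists_eq_add_mul (small_letters h) 1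
    exact ⟨F, fun _ => hF⟩
  · exact ⟨0, fun h' => absurd h' h⟩

/-- The coalgebra homomorphism induced by a family. -/
noncomputable def hat (f : Coch G V W.carrier) : Conv G V W.Bar := (exists_hat f).choose

theorem hat_eq {f : Coch G V W.carrier} (h : IsSmall 1 f) : hat f = 1 + letters f * hat f :=
  (exists_hat f).choose_spec h

theorem eq_hat {f : Coch G V W.carrier} (h : IsSmall 1 f) {F : Conv G V W.Bar}
    (hF : F = 1 + letters f * F) : F = hat f :=
  eq_of_eq_add_mul (small_letters h) hF (hat_eq h)

variable (G V) in
/-- The projection to words of length one. -/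
noncomputable def pr : Coch G V V.carrier := single letter

theorem small_pr : IsSmall 1 (pr G V) := small_one (by simp [pr])

theorem idc_eq : idc G V = 1 + letters (pr G V) * idc G V := by
  have h : letters (pr G V) = ⟨single (TensorAlgebra.ι k ∘ₗ letter)⟩ := by
    refine Conv.ext (funext fun β => LinearMap.ext fun z => ?_)
    by_cases hβ : β = 0
    · subst hβ; simp [letters_fam, pr]
    · simp [letters_fam, pr, single_of_ne _ hβ]
  refine ext_word fun β x => ?_
  rw [add_fam, Pi.add_apply, LinearMap.add_apply, mul_fam, h, lift₂_single_left, one_fam, idc]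
  by_cases hβ : β = 0
  · subst hβ
    simp only [single_zero, LinearMap.id_apply, conv_word, LinearMap.comp_apply,
      AlgHom.toLinearMap_apply, Algebra.linearMap_apply]
    cases x with
    | nil => rw [sumSplit_nil, letter_word_of_length_ne (by simp)]; simp
    | cons a x =>
      rw [BiOp.algebraMapInv_word_cons, map_zero, zero_add, sumSplit_cons,
        letter_word_of_length_ne (by simp), map_zero, zero_mul, zero_add, sumSplit_eq_right,
        word_singleton, letter_ι, word_cons]
      intro p q hp
      rw [letter_word_of_length_ne (by simpa using hp), map_zero, zero_mul]
  · simp [single_of_ne _ hβ]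

theorem idc_eq_hat : idc G V = hat (pr G V) := eq_hat small_pr idc_eq

/-- `hat f` is grouplike: it commutes with deconcatenation. Both sides solve the same equation X = b
+ aX with `a` of order one, which has only one solution. -/
theorem cop_comp_hat {f : Coch G V W.carrier} (h : IsSmall 1 f) :
    (⟨single W.cop⟩ : Conv G W _).comp (hat f) =
      map Algebra.TensorProduct.includeLeft (hat f) *
        map Algebra.TensorProduct.includeRight (hat f) := by
  set i₁ : W.Bar →ₐ[k] TensorProduct k W.Bar W.Bar := Algebra.TensorProduct.includeLeft
  set i₂ : W.Bar →ₐ[k] TensorProduct k W.Bar W.Bar := Algebra.TensorProduct.includeRight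
  have ha : IsSmall 1 (map i₁ (letters f)).fam := fun β x hx => by
    rw [map_fam, small_letters h β x hx, map_zero]
  refine eq_of_eq_add_mul (b := map i₂ (hat f)) ha ?_ ?_
  · have key : ∀ F : Conv G V W.Bar, (⟨single W.cop⟩ : Conv G W _).comp (letters f * F) =
        map i₂ (letters f * F) + map i₁ (letters f) * (⟨single W.cop⟩ : Conv G W _).comp F := by
      intro F
      -- Prepending a letter creates exactly one new cut, the one before that letter.
      have hc : ∀ a (z : W.Bar), W.cop (TensorAlgebra.ι k a * z) =
          i₂ (TensorAlgebra.ι k a * z) + i₁ (TensorAlgebra.ι k a) * W.cop z := by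
        intro a z
        have : (W.cop ∘ₗ LinearMap.mulLeft k (TensorAlgebra.ι k a)) =
            (i₂.toLinearMap ∘ₗ LinearMap.mulLeft k (TensorAlgebra.ι k a)) +
              (LinearMap.mulLeft k (i₁ (TensorAlgebra.ι k a)) ∘ₗ W.cop) := by
          revert a
          suffices h : (LinearMap.llcomp k W.Bar W.Bar (TensorProduct k W.Bar W.Bar) W.cop) ∘ₗ
              (LinearMap.mul k W.Bar ∘ₗ TensorAlgebra.ι k) =
              (LinearMap.llcomp k W.Bar W.Bar (TensorProduct k W.Bar W.Bar) i₂.toLinearMap) ∘ₗ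
              (LinearMap.mul k W.Bar ∘ₗ TensorAlgebra.ι k) +
              ((LinearMap.llcomp k W.Bar _ (TensorProduct k W.Bar W.Bar)).flip W.cop) ∘ₗ
                (LinearMap.mul k (TensorProduct k W.Bar W.Bar) ∘ₗ i₁.toLinearMap ∘ₗ
                  TensorAlgebra.ι k) from
            fun a => LinearMap.congr_fun h a
          refine hom_ext_homog fun a => bar_ext fun x => ?_
          have e := cop_word (a :: x)
          rw [sumSplit_cons, word_cons] at e
          simp only [LinearMap.comp_apply, LinearMap.llcomp_apply, LinearMap.mul_apply',
            LinearMap.add_apply, LinearMap.flip_apply, AlgHom.toLinearMap_apply]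
          rw [e, cop_word, mul_sumSplit]
          simp [i₁, i₂]
        exact LinearMap.congr_fun this z
      refine ext_word fun β x => ?_
      simp only [comp_fam, single_fcomp, LinearMap.comp_apply, mul_word, map_sum, map_sumSplit,
        add_fam, Pi.add_apply, LinearMap.add_apply, map_fam, letters_fam, hc, sumSplit_add,
        Finset.sum_add_distrib]
    have h1 : (⟨single W.cop⟩ : Conv G W _).comp (1 : Conv G V W.Bar) = 1 := by
      refine ext_word fun β x => ?_
      rw [comp_fam, single_fcomp]
      by_cases hβ : β = 0
      · subst hβ
        simp only [one_fam, single_zero, LinearMap.comp_apply, AlgHom.toLinearMap_apply,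
          Algebra.linearMap_apply, Algebra.algebraMap_eq_smul_one, map_smul]
        have := cop_word ([] : List W.Homog)
        rw [sumSplit_nil, word_nil] at this
        rw [this]; rfl
      · simp [one_fam, single_of_ne _ hβ]
    nth_rw 1 [hat_eq h]
    rw [comp_add, key, h1]
    nth_rw 3 [hat_eq h]
    rw [map_add, map_one]; abel
  · nth_rw 1 [hat_eq h]
    rw [map_add, map_one, map_mul]; noncomm_ring

/-- Convolution factors through deconcatenation, and `hat f` is grouplike; so precomposition with it
is multiplicative. -/
theorem mul_comp_hat (X Y : Conv G W R) {f : Coch G V W.carrier} (h : IsSmall 1 f) :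
    (X * Y).comp (hat f) = X.comp (hat f) * Y.comp (hat f) := by
  have h1 := congr_arg Conv.fam (cop_comp_hat h)
  let μ : (W.Bar →ₗ[k] R) →ₗ[k] (W.Bar →ₗ[k] R) →ₗ[k] (TensorProduct k W.Bar W.Bar →ₗ[k] R) :=
    LinearMap.mk₂ k (fun f g => TensorProduct.lift ((LinearMap.mul k R).compl₁₂ f g))
      (by intros; ext; simp) (by intros; ext; simp) (by intros; ext; simp [mul_add])
      (by intros; ext; simp)
  have h2 : (X * Y).fam = fcomp (lift₂ μ X.fam Y.fam) (single W.cop) := by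
    funext β
    rw [fcomp_single, mul_fam]
    refine bar_ext fun x => ?_
    simp only [lift₂, LinearMap.sum_apply, LinearMap.comp_apply, conv_word, cop_word, map_sumSplit]
    rw [← sumSplit_sum]
    simp [μ]
  let l : (V.Bar →ₗ[k] W.Bar) →ₗ[k] (V.Bar →ₗ[k] W.Bar) →ₗ[k]
      (V.Bar →ₗ[k] TensorProduct k W.Bar W.Bar) := conv.compl₁₂
    (LinearMap.llcomp k V.Bar W.Bar (TensorProduct k W.Bar W.Bar)
      (Algebra.TensorProduct.includeLeft : W.Bar →ₐ[k] TensorProduct k W.Bar W.Bar).toLinearMap)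
    (LinearMap.llcomp k V.Bar W.Bar (TensorProduct k W.Bar W.Bar)
      (Algebra.TensorProduct.includeRight : W.Bar →ₐ[k] TensorProduct k W.Bar W.Bar).toLinearMap)
  have h3 : (map (Algebra.TensorProduct.includeLeft : W.Bar →ₐ[k] TensorProduct k W.Bar W.Bar)
      (hat f) * map Algebra.TensorProduct.includeRight (hat f)).fam =
      lift₂ l (hat f).fam (hat f).fam := rfl
  refine Conv.ext ?_
  rw [comp_fam, h2, fcomp_assoc]
  rw [comp_fam] at h1
  rw [h1, h3, mul_fam]
  refine lift₂_interchange (ν := μ) (l := l) (μ' := conv (V := V) (R := R)) fun a b c d => bar_ext fun x => ?_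
  simp only [LinearMap.llcomp_apply, conv_word, map_sumSplit, l, LinearMap.compl₁₂_apply]
  refine sumSplit_congr fun p q _ => ?_
  simp [μ]

theorem one_comp_hat {f : Coch G V W.carrier} (h : IsSmall 1 f) :
    (1 : Conv G W R).comp (hat f) = 1 := by
  have e : ∀ z : Conv G W R, z.comp (hat f) = z.comp (hat f) * (1 : Conv G W R).comp (hat f) := by
    intro z; rw [← mul_comp_hat _ _ h, mul_one]
  have h0 : ∀ F : Conv G V W.Bar, (1 : Conv G W R).comp (letters f * F) = 0 := by
    intro F
    refine ext_word fun β x => ?_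
    simp only [comp_fam, one_fam, single_fcomp, LinearMap.comp_apply, mul_word, map_sum,
      map_sumSplit, letters_fam, AlgHom.toLinearMap_apply, map_mul]
    refine Finset.sum_eq_zero fun p _ => sumSplit_eq_zero fun a b _ => ?_
    rw [show TensorAlgebra.algebraMapInv (TensorAlgebra.ι k (f p.1 (word a))) = (0 : k) by
      simp [TensorAlgebra.algebraMapInv], zero_mul, map_zero]
  rw [hat_eq h, comp_add, h0, add_zero]
  refine ext_word fun β x => ?_
  rw [comp_fam]
  simp only [one_fam, single_fcomp]
  by_cases hβ : β = 0
  · subst hβ; simp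
  · simp [single_of_ne _ hβ]

end Conv

end Coalgebra

section Coalgebra

open GradedSpace GappingMonoid

variable {k : Type v} [Field k] {G : GappingMonoid}
variable {V : GradedSpace.{u} k} {W : GradedSpace.{u₁} k} {U : GradedSpace.{u₂} k}

namespace Conv

variable {R R' : Type*} [Ring R] [Algebra k R] [Ring R'] [Algebra k R']

theorem pr_comp_letters_mul (f : Coch G V W.carrier) (F : Conv G V W.Bar)
    (hF : (1 : Conv G W k).comp F = 1) : fcomp (pr G W) (letters f * F).fam = f := by
  have h1 : ∀ (a : W.carrier) (z : W.Bar), letter (TensorAlgebra.ι k a * z) =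
      TensorAlgebra.algebraMapInv z • a := by
    intro a z
    have : letter ∘ₗ LinearMap.mulLeft k (TensorAlgebra.ι k a) =
        (LinearMap.toSpanSingleton k W.carrier a) ∘ₗ
          (TensorAlgebra.algebraMapInv : W.Bar →ₐ[k] k).toLinearMap := by
      refine bar_ext fun x => ?_
      cases x with
      | nil => simp [letter_ι]
      | cons b x =>
        simp only [LinearMap.comp_apply, LinearMap.mulLeft_apply, AlgHom.toLinearMap_apply,
          BiOp.algebraMapInv_word_cons, map_zero]
        rw [word_cons, letter_mul_ι]
    exact LinearMap.congr_fun this z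
  refine Coch.ext_word fun β x => ?_
  have h2 : ∀ β z, TensorAlgebra.algebraMapInv (F.fam β z) = (1 : Conv G V k).fam β z := by
    intro β z
    rw [← hF, comp_fam, one_fam, single_fcomp]; rfl
  rw [pr, single_fcomp, LinearMap.comp_apply, mul_word, map_sum]
  simp only [map_sumSplit, letters_fam, h1, h2]
  have h3 : ∀ (a : k) (y : W.carrier), a • y = (LinearMap.toSpanSingleton k W.carrier y) a :=
    fun _ _ => rfl
  rw [sum_decomps_right_zero β fun b c => sumSplit x fun a b' =>
    (1 : Conv G V k).fam c (word b') • f b (word a)]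
  · rw [one_fam, single_zero, sumSplit_eq_left]
    · simp
    · intro a b hb
      simp [BiOp.algebraMapInv_word_of_ne hb]
  · intro b c hc
    refine sumSplit_eq_zero fun a b' _ => ?_
    rw [one_fam, single_of_ne _ hc]; simp

theorem pr_fcomp_hat {f : Coch G V W.carrier} (h : IsSmall 1 f) :
    fcomp (pr G W) (hat f).fam = f := by
  have h0 : fcomp (pr G W) (1 : Conv G V W.Bar).fam = 0 := by
    refine Coch.ext_word fun β x => ?_
    rw [pr, single_fcomp, one_fam]
    by_cases hβ : β = 0
    · subst hβ; simp [Algebra.algebraMap_eq_smul_one, letter_one]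
    · simp [single_of_ne _ hβ]
  rw [hat_eq h, add_fam, fcomp_add, h0, zero_add, pr_comp_letters_mul _ _ (one_comp_hat h)]

theorem small_fcomp_hat {f : Coch G V W.carrier} (h : IsSmall 1 f) {g : Coch G W U.carrier}
    (hg : IsSmall 1 g) : IsSmall 1 (fcomp g (hat f).fam) := by
  refine small_one ?_
  have h1 : (hat f).fam 0 1 = 1 := by
    rw [hat_eq h, add_fam, Pi.add_apply, LinearMap.add_apply, ← word_nil, mul_word, decomps_zero]
    simp [sumSplit_nil, letters_fam, one_fam,
      show f 0 1 = 0 from by simpa using h 0 [] (by simp [wt, ord_zero])]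
  rw [fcomp_apply, decomps_zero, Finset.sum_singleton, h1]
  simpa using hg 0 [] (by simp [wt, ord_zero])

/-- By multiplicativity the composite satisfies the equation that characterises the coalgebra
homomorphism on the right. -/
theorem hat_comp_hat {f : Coch G V W.carrier} (h : IsSmall 1 f) {g : Coch G W U.carrier}
    (hg : IsSmall 1 g) : (hat g).comp (hat f) = hat (fcomp g (hat f).fam) := by
  refine eq_hat (small_fcomp_hat h hg) ?_
  nth_rw 1 [hat_eq hg]
  rw [add_comp, one_comp_hat h, mul_comp_hat _ _ h, letters_fcomp]

theorem letters_add (f g : Coch G V W.carrier) : letters (f + g) = letters f + letters g :=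
  Conv.ext (funext fun _ => LinearMap.comp_add _ _ _)

theorem letters_neg (f : Coch G V W.carrier) : letters (-f) = -letters f :=
  Conv.ext (funext fun _ => LinearMap.comp_neg _ _)

theorem letters_sub (f g : Coch G V W.carrier) : letters (f - g) = letters f - letters g := by
  rw [sub_eq_add_neg, letters_add, letters_neg, ← sub_eq_add_neg]

theorem letters_zero : letters (0 : Coch G V W.carrier) = 0 :=
  Conv.ext (funext fun _ => LinearMap.comp_zero _)

theorem chat_add (m n : Coch G V V.carrier) : chat (m + n) = chat m + chat n := by
  simp only [chat, letters_add]; noncomm_ring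

theorem map_parT_letters {e : ℤ} (he : Even e) {f : Coch G V W.carrier} (h : CoDeg e f) :
    map W.parT (letters f) = s (letters f) := by
  refine ext_word fun β x => ?_
  rw [map_fam, letters_fam, parT_ι, s_fam, parT_word, map_smul, letters_fam, par_of_mem (h β x),
    map_smul, sgn_congr]
  have := even_cast (he.sub (maslov_even β))
  rw [Int.cast_add, this, add_zero]

theorem map_parT_hat {f : Coch G V W.carrier} (hf : IsSmall 1 f) (h : CoDeg 0 f) :
    map W.parT (hat f) = s (hat f) := by
  refine eq_of_eq_add_mul (b := 1) (small_s (small_letters hf)) ?_ ?_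
  · nth_rw 1 [hat_eq hf]
    rw [map_add, map_one, map_mul, map_parT_letters Even.zero h]
  · nth_rw 1 [hat_eq hf]
    rw [map_add, map_one, map_mul]

theorem s_idc_comp (F : Conv G V W.Bar) : (s (idc G W)).comp F = map W.parT F := by
  have : s (idc G W) = map W.parT (idc G W) := by
    refine Conv.ext (funext fun β => LinearMap.ext fun z => ?_)
    rw [s_fam, map_fam, idc]
    by_cases hβ : β = 0
    · subst hβ; simp
    · simp [single_of_ne _ hβ]
  rw [this, map_idc_comp]

theorem chat_comp_hat (m : Coch G W W.carrier) {f : Coch G V W.carrier} (hf : IsSmall 1 f)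
    (h : CoDeg 0 f) :
    (chat m).comp (hat f) = s (hat f) * letters (fcomp m (hat f).fam) * hat f := by
  rw [chat, mul_comp_hat _ _ hf, mul_comp_hat _ _ hf, s_idc_comp, map_parT_hat hf h, idc_comp,
    letters_fcomp]

/-- A coderivation along `hat f` is determined by its projection to words of length one. Together
with `chat_comp_hat` this reduces the relation between the full bar maps to its component in words
of length one. -/
theorem hat_comp_chat {m : Coch G V V.carrier} {e : ℤ} (hm : CoDeg e m) {f : Coch G V W.carrier}
    (hf : IsSmall 1 f) :
    (hat f).comp (chat m) = s (hat f) * letters (fcomp f (chat m).fam) * hat f := by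
  refine eq_of_eq_add_mul (b := letters (fcomp f (chat m).fam) * hat f)
    (small_s (small_letters hf)) ?_ ?_
  · nth_rw 1 [hat_eq hf]
    rw [add_comp, one_comp_chat hm, zero_add, mul_comp_chat _ _ hm, letters_fcomp]
  · nth_rw 1 [hat_eq hf]
    rw [map_add, map_one, map_mul]; noncomm_ring

theorem hat_comp_chat_of_comm {m : Coch G V V.carrier} {m' : Coch G W W.carrier} {e : ℤ}
    (hm : CoDeg e m) {f : Coch G V W.carrier} (hf : IsSmall 1 f) (h : CoDeg 0 f)
    (hc : fcomp f (chat m).fam = fcomp m' (hat f).fam) :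
    (hat f).comp (chat m) = (chat m').comp (hat f) := by
  rw [hat_comp_chat hm hf, chat_comp_hat _ hf h, hc]

/-- The square of an odd coderivation is a coderivation, so it vanishes with its projection to
letters. Concretely, the two remaining terms are the double insertions at separate places, which
cancel. -/
theorem chat_comp_chat {m : Coch G V V.carrier} (hm : CoDeg 1 m)
    (h : fcomp m (chat m).fam = 0) : (chat m).comp (chat m) = 0 := by
  have h1 : (letters m).comp (chat m) = 0 := by rw [← letters_fcomp, h, letters_zero]
  have h2 : s (chat m) = idc G V * s (letters m) * s (idc G V) := by
    rw [chat, map_mul, map_mul, s_s]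
  have h3 : chat m = s (idc G V) * letters m * idc G V := rfl
  have h4 : (s (idc G V) * letters m * idc G V).comp (chat m) =
      -(idc G V * s (letters m) * s (idc G V)) * letters m * idc G V +
        idc G V * s (letters m) * chat m := by
    rw [mul_comp_chat _ _ hm, mul_comp_chat _ _ hm, h1, s_comp_chat _ hm, idc_comp, h2, mul_zero,
      add_zero, map_mul, s_s]
  rw [← h3] at h4
  rw [h4, h3]
  noncomm_ring

/-! ### Operators that lower the length of words -/

variable (W) in
/-- The span of the words `y` with `|y| + j ≤ n`. -/
def lengthFil (j n : ℕ) : Submodule k W.Bar :=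
  Submodule.span k {z | ∃ y : List W.Homog, y.length + j ≤ n ∧ z = word y}

theorem lengthFil_mono {j n n' : ℕ} (h : n ≤ n') : lengthFil W j n ≤ lengthFil W j n' :=
  Submodule.span_mono (by rintro _ ⟨y, hy, rfl⟩; exact ⟨y, hy.trans h, rfl⟩)

theorem lengthFil_mul {i j m n : ℕ} {a b : W.Bar} (ha : a ∈ lengthFil W i m)
    (hb : b ∈ lengthFil W j n) : a * b ∈ lengthFil W (i + j) (m + n) := by
  have : lengthFil W i m * lengthFil W j n ≤ lengthFil W (i + j) (m + n) := by
    rw [lengthFil, lengthFil, Submodule.span_mul_span]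
    refine Submodule.span_mono ?_
    rintro _ ⟨_, ⟨y, hy, rfl⟩, _, ⟨z, hz, rfl⟩, rfl⟩
    exact ⟨y ++ z, by rw [List.length_append]; omega, (word_append _ _).symm⟩
  exact this (Submodule.mul_mem_mul ha hb)

theorem ι_mem_lengthFil (v : W.carrier) {j n : ℕ} (h : 1 + j ≤ n) :
    TensorAlgebra.ι k v ∈ lengthFil W j n := by
  have h1 : v ∈ Submodule.span k {x : W.carrier | ∃ a : W.Homog, x = a.2} := by
    rw [span_homog]; trivial
  induction h1 using Submodule.span_induction with
  | mem x hx =>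
    obtain ⟨a, rfl⟩ := hx
    exact Submodule.subset_span ⟨[a], by simpa using h, (word_singleton a).symm⟩
  | zero => rw [map_zero]; exact Submodule.zero_mem _
  | add x y _ _ hx hy => rw [map_add]; exact Submodule.add_mem _ hx hy
  | smul c x _ hx => rw [map_smul]; exact Submodule.smul_mem _ _ hx

/-- The family consumes at least `j` units of weight. -/
def Lowers (j : ℕ) (L : Conv G V W.Bar) : Prop :=
  ∀ (β : G.Elt) (x : List V.Homog), L.fam β (word x) ∈ lengthFil W j (wt β x.length)

theorem wt_mono_left (β : G.Elt) {m n : ℕ} (h : m ≤ n) : wt β m ≤ wt β n := by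
  unfold wt; omega

theorem small_fcomp {M : Type*} [AddCommGroup M] [Module k M] {n j : ℕ} {X : Coch G W M}
    (hX : IsSmall n X) {L : Conv G V W.Bar} (hL : Lowers j L) : IsSmall (n + j) (fcomp X L.fam) := by
  intro β x hx
  rw [fcomp_apply]
  refine Finset.sum_eq_zero fun p hp => ?_
  have h1 := hL p.2 x
  have h2 := ord_add_le_of_mem hp
  have : lengthFil W j (wt p.2 x.length) ≤ LinearMap.ker (X p.1) := by
    refine Submodule.span_le.mpr ?_
    rintro _ ⟨y, hy, rfl⟩
    refine hX _ _ ?_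
    unfold wt at *
    omega
  exact this h1

theorem Lowers.mul {i j : ℕ} {L L' : Conv G V W.Bar} (h : Lowers i L) (h' : Lowers j L') :
    Lowers (i + j) (L * L') := by
  intro β x
  rw [mul_word]
  refine Submodule.sum_mem _ fun p hp => ?_
  unfold sumSplit
  refine Submodule.sum_mem _ fun i _ => ?_
  refine lengthFil_mono ?_ (lengthFil_mul (h p.1 _) (h' p.2 _))
  refine (wt_split hp _ _).trans (wt_mono_left _ ?_)
  rw [← List.length_append, List.take_append_drop]

theorem Lowers.s {j : ℕ} {L : Conv G V W.Bar} (h : Lowers j L) : Lowers j (s L) := by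
  intro β x
  rw [s_fam, parT_word, map_smul]
  exact Submodule.smul_mem _ _ (h β x)

theorem lowers_one : Lowers 0 (1 : Conv G V W.Bar) := by
  intro β x
  rw [one_fam]
  by_cases hβ : β = 0
  · subst hβ
    simp only [single_zero, LinearMap.comp_apply, AlgHom.toLinearMap_apply,
      Algebra.linearMap_apply, Algebra.algebraMap_eq_smul_one]
    exact Submodule.smul_mem _ _ (Submodule.subset_span ⟨[], by simp, by simp⟩)
  · rw [single_of_ne _ hβ]; exact Submodule.zero_mem _

theorem lowers_idc : Lowers 0 (idc G V) := by
  intro β x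
  rw [idc]
  by_cases hβ : β = 0
  · subst hβ
    simp only [single_zero]
    exact Submodule.subset_span ⟨x, by unfold wt; omega, rfl⟩
  · simp only [single_of_ne _ hβ]; exact Submodule.zero_mem _

/-- The value is a single letter, which restores one unit of weight: order j + 1 gives a net loss of
j. -/
theorem lowers_letters {j : ℕ} {f : Coch G V W.carrier} (h : IsSmall (j + 1) f) :
    Lowers j (letters f) := by
  intro β x
  rw [letters_fam]
  rcases lt_or_ge (wt β x.length) (j + 1) with h1 | h1
  · rw [h β x h1, map_zero]; exact Submodule.zero_mem _
  · exact ι_mem_lengthFil _ (by omega)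

theorem lowers_chat {j : ℕ} {m : Coch G V V.carrier} (h : IsSmall (j + 1) m) :
    Lowers j (chat m) := by
  have := (lowers_idc (G := G) (V := V)).s.mul ((lowers_letters h).mul (lowers_idc (G := G) (V := V)))
  rw [← mul_assoc, zero_add, add_zero] at this
  exact this

/-- Induction on the weight: the factor `a` vanishes unless it consumes at least one unit, so `X` on
the right only sees arguments of smaller weight. -/
theorem lowers_of_eq {j : ℕ} {a b X : Conv G V W.Bar} (ha : IsSmall 1 a.fam) (ha' : Lowers 0 a)
    (hb : Lowers j b) (h : X = b + a * X) : Lowers j X := by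
  suffices ∀ n, ∀ β (x : List V.Homog), wt β x.length < n →
      X.fam β (word x) ∈ lengthFil W j (wt β x.length) from
    fun β x => this _ β x (Nat.lt_succ_self _)
  intro n
  induction n with
  | zero => intro β x hx; omega
  | succ n ih =>
    intro β x hx
    rw [h, add_fam, Pi.add_apply, LinearMap.add_apply]
    refine Submodule.add_mem _ (hb β x) ?_
    rw [mul_word]
    refine Submodule.sum_mem _ fun p hp => ?_
    unfold sumSplit
    refine Submodule.sum_mem _ fun i _ => ?_
    have hw := wt_split hp (x.take i).length (x.drop i).length
    rw [← List.length_append, List.take_append_drop] at hw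
    rcases lt_or_ge (wt p.1 (x.take i).length) 1 with h1 | h1
    · beta_reduce
      rw [ha _ _ h1, zero_mul]; exact Submodule.zero_mem _
    · have := lengthFil_mul (ha' p.1 (x.take i)) (ih p.2 (x.drop i) (by omega))
      rw [zero_add] at this
      exact lengthFil_mono hw this

theorem lowers_hat {f : Coch G V W.carrier} (h : IsSmall 1 f) : Lowers 0 (hat f) :=
  lowers_of_eq (small_letters h) (lowers_letters h) lowers_one (hat_eq h)

/-- The difference D of the two geometric series satisfies D = (f − g) · f̂ + g · D. -/
theorem lowers_hat_sub_hat {j : ℕ} {f g : Coch G V W.carrier} (hf : IsSmall 1 f)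
    (hg : IsSmall 1 g) (h : IsSmall (j + 1) (f - g)) : Lowers j (hat f - hat g) := by
  have h1 := (lowers_letters h).mul (lowers_hat hf)
  rw [add_zero] at h1
  refine lowers_of_eq (small_letters hg) (lowers_letters hg) h1 ?_
  calc hat f - hat g = (1 + letters f * hat f) - (1 + letters g * hat g) := by
        rw [← hat_eq hf, ← hat_eq hg]
    _ = letters (f - g) * hat f + letters g * (hat f - hat g) := by
        rw [letters_sub]; noncomm_ring

theorem IsSmall_add {M : Type*} [AddCommGroup M] [Module k M] {n : ℕ}
    {X Y : G.Elt → (V.Bar →ₗ[k] M)} (hX : IsSmall n X) (hY : IsSmall n Y) : IsSmall n (X + Y) := by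
  intro β x hx
  rw [Pi.add_apply, LinearMap.add_apply, hX β x hx, hY β x hx, add_zero]

theorem IsSmall_neg {M : Type*} [AddCommGroup M] [Module k M] {n : ℕ}
    {X : G.Elt → (V.Bar →ₗ[k] M)} (hX : IsSmall n X) : IsSmall n (-X) := by
  intro β x hx
  rw [Pi.neg_apply, LinearMap.neg_apply, hX β x hx, neg_zero]

theorem IsSmall_sub {M : Type*} [AddCommGroup M] [Module k M] {n : ℕ}
    {X Y : G.Elt → (V.Bar →ₗ[k] M)} (hX : IsSmall n X) (hY : IsSmall n Y) : IsSmall n (X - Y) := by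
  rw [sub_eq_add_neg]; exact IsSmall_add hX (IsSmall_neg hY)

theorem IsSmall_mono {M : Type*} [AddCommGroup M] [Module k M] {n n' : ℕ} (hn : n' ≤ n)
    {X : G.Elt → (V.Bar →ₗ[k] M)} (hX : IsSmall n X) : IsSmall n' X :=
  fun β x hx => hX β x (by omega)

/-! ### Degrees -/

variable (W) in
/-- The words of degree `n`. -/
def degPart (n : ℤ) : Submodule k W.Bar :=
  Submodule.span k {z | ∃ y : List W.Homog, deg y = n ∧ z = word y}

theorem degPart_mul {m n : ℤ} {a b : W.Bar} (ha : a ∈ degPart W m)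
    (hb : b ∈ degPart W n) : a * b ∈ degPart W (m + n) := by
  have : degPart W m * degPart W n ≤ degPart W (m + n) := by
    rw [degPart, degPart, Submodule.span_mul_span]
    refine Submodule.span_mono ?_
    rintro _ ⟨_, ⟨y, hy, rfl⟩, _, ⟨z, hz, rfl⟩, rfl⟩
    exact ⟨y ++ z, by rw [deg_append, hy, hz], (word_append _ _).symm⟩
  exact this (Submodule.mul_mem_mul ha hb)

/-- The family has degree `e`, up to the degrees of the elements of the gapping monoid. -/
def ConvDeg (e : ℤ) (L : Conv G V W.Bar) : Prop :=
  ∀ (β : G.Elt) (x : List V.Homog), L.fam β (word x) ∈ degPart W (deg x + (e - maslov β))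

theorem _root_.CoDeg.fcomp {e e' : ℤ} {X : Coch G W U.carrier} (hX : CoDeg e X) {L : Conv G V W.Bar}
    (hL : ConvDeg e' L) : CoDeg (e + e') (fcomp X L.fam) := by
  intro β x
  rw [fcomp_apply]
  refine Submodule.sum_mem _ fun p hp => ?_
  have h : degPart W (deg x + (e' - maslov p.2)) ≤
      (U.piece (deg x + (e + e' - maslov β))).comap (X p.1) := by
    refine Submodule.span_le.mpr ?_
    rintro _ ⟨y, hy, rfl⟩
    have := hX p.1 y
    rwa [hy, show deg x + (e' - maslov p.2) + (e - maslov p.1) = deg x + (e + e' - maslov β) by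
      rw [maslov_of_mem hp]; ring] at this
  exact h (hL p.2 x)

theorem ConvDeg.mul {e e' : ℤ} {L L' : Conv G V W.Bar} (h : ConvDeg e L) (h' : ConvDeg e' L') :
    ConvDeg (e + e') (L * L') := by
  intro β x
  rw [mul_word]
  refine Submodule.sum_mem _ fun p hp => ?_
  unfold sumSplit
  refine Submodule.sum_mem _ fun i _ => ?_
  have := degPart_mul (h p.1 (x.take i)) (h' p.2 (x.drop i))
  rwa [show deg (x.take i) + (e - maslov p.1) + (deg (x.drop i) + (e' - maslov p.2)) =
    deg (x.take i ++ x.drop i) + (e + e' - maslov β) by rw [maslov_of_mem hp, deg_append]; ring,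
    List.take_append_drop] at this

theorem ConvDeg.add {e : ℤ} {L L' : Conv G V W.Bar} (h : ConvDeg e L) (h' : ConvDeg e L') :
    ConvDeg e (L + L') := fun β x => Submodule.add_mem _ (h β x) (h' β x)

theorem ConvDeg.neg {e : ℤ} {L : Conv G V W.Bar} (h : ConvDeg e L) :
    ConvDeg e (-L) := fun β x => Submodule.neg_mem _ (h β x)

theorem ConvDeg.sub {e : ℤ} {L L' : Conv G V W.Bar} (h : ConvDeg e L) (h' : ConvDeg e L') :
    ConvDeg e (L - L') := by rw [sub_eq_add_neg]; exact h.add h'.neg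

theorem ConvDeg.s {e : ℤ} {L : Conv G V W.Bar} (h : ConvDeg e L) : ConvDeg e (s L) := by
  intro β x
  rw [s_fam, parT_word, map_smul]
  exact Submodule.smul_mem _ _ (h β x)

theorem ConvDeg.one : ConvDeg 0 (1 : Conv G V W.Bar) := by
  intro β x
  rw [one_fam]
  by_cases hβ : β = 0
  · subst hβ
    simp only [single_zero, LinearMap.comp_apply, AlgHom.toLinearMap_apply,
      Algebra.linearMap_apply, Algebra.algebraMap_eq_smul_one, maslov_zero]
    cases x with
    | nil =>
      exact Submodule.smul_mem _ _ (Submodule.subset_span ⟨[], by simp, by simp⟩)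
    | cons a x => rw [BiOp.algebraMapInv_word_cons, zero_smul]; exact Submodule.zero_mem _
  · rw [single_of_ne _ hβ]; exact Submodule.zero_mem _

theorem ConvDeg.idc : ConvDeg 0 (idc G V) := by
  intro β x
  rw [Conv.idc]
  by_cases hβ : β = 0
  · subst hβ
    simp only [single_zero, maslov_zero]
    exact Submodule.subset_span ⟨x, by simp, rfl⟩
  · simp only [single_of_ne _ hβ]; exact Submodule.zero_mem _

theorem ConvDeg.letters {e : ℤ} {f : Coch G V W.carrier} (h : CoDeg e f) :
    ConvDeg e (letters f) := by
  intro β x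
  rw [letters_fam]
  exact Submodule.subset_span ⟨[⟨deg x + (e - maslov β), f β (word x), h β x⟩], by simp,
    (word_singleton (V := W) ⟨deg x + (e - maslov β), f β (word x), h β x⟩).symm⟩

theorem ConvDeg.chat {m : Coch G V V.carrier} {e : ℤ} (h : CoDeg e m) : ConvDeg e (chat m) := by
  have := (ConvDeg.idc (G := G) (V := V)).s.mul
    ((ConvDeg.letters h).mul (ConvDeg.idc (G := G) (V := V)))
  rw [← mul_assoc, zero_add, add_zero] at this
  exact this

theorem ConvDeg.of_eq {e : ℤ} {a b X : Conv G V W.Bar} (ha : IsSmall 1 a.fam) (ha' : ConvDeg 0 a)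
    (hb : ConvDeg e b) (h : X = b + a * X) : ConvDeg e X := by
  suffices ∀ n, ∀ β (x : List V.Homog), wt β x.length < n →
      X.fam β (word x) ∈ degPart W (deg x + (e - maslov β)) from
    fun β x => this _ β x (Nat.lt_succ_self _)
  intro n
  induction n with
  | zero => intro β x hx; omega
  | succ n ih =>
    intro β x hx
    rw [h, add_fam, Pi.add_apply, LinearMap.add_apply]
    refine Submodule.add_mem _ (hb β x) ?_
    rw [mul_word]
    refine Submodule.sum_mem _ fun p hp => ?_
    unfold sumSplit
    refine Submodule.sum_mem _ fun i _ => ?_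
    have hw := wt_split hp (x.take i).length (x.drop i).length
    rw [← List.length_append, List.take_append_drop] at hw
    rcases lt_or_ge (wt p.1 (x.take i).length) 1 with h1 | h1
    · beta_reduce
      rw [ha _ _ h1, zero_mul]; exact Submodule.zero_mem _
    · have := degPart_mul (ha' p.1 (x.take i)) (ih p.2 (x.drop i) (by omega))
      rwa [show deg (x.take i) + (0 - maslov p.1) + (deg (x.drop i) + (e - maslov p.2)) =
        deg (x.take i ++ x.drop i) + (e - maslov β) by rw [maslov_of_mem hp, deg_append]; ring,
        List.take_append_drop] at this

theorem ConvDeg.hat {f : Coch G V W.carrier} (h : IsSmall 1 f) (hf : CoDeg 0 f) :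
    ConvDeg 0 (hat f) :=
  ConvDeg.of_eq (small_letters h) (ConvDeg.letters hf) ConvDeg.one (hat_eq h)

theorem _root_.CoDeg.pr : CoDeg 0 (pr G V) := by
  intro β x
  rw [Conv.pr]
  by_cases hβ : β = 0
  · subst hβ
    rw [single_zero, maslov_zero]
    by_cases hx : x.length = 1
    · obtain ⟨a, rfl⟩ := List.length_eq_one_iff.mp hx
      rw [word_singleton, letter_ι]
      simp
    · rw [letter_word_of_length_ne hx]; exact Submodule.zero_mem _
  · rw [single_of_ne _ hβ]; exact Submodule.zero_mem _

theorem _root_.CoDeg.add {e : ℤ} {f g : Coch G V W.carrier} (hf : CoDeg e f) (hg : CoDeg e g) :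
    CoDeg e (f + g) := fun β x => Submodule.add_mem _ (hf β x) (hg β x)

theorem _root_.CoDeg.sub {e : ℤ} {f g : Coch G V W.carrier} (hf : CoDeg e f) (hg : CoDeg e g) :
    CoDeg e (f - g) := fun β x => Submodule.sub_mem _ (hf β x) (hg β x)

theorem _root_.CoDeg.zero {e : ℤ} : CoDeg e (0 : Coch G V W.carrier) := fun _ _ => Submodule.zero_mem _

theorem _root_.CoDeg.of_approx {e : ℤ} (f : Coch G V W.carrier)
    (h : ∀ n, ∃ g, CoDeg e g ∧ IsSmall n (f - g)) : CoDeg e f := by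
  intro β x
  obtain ⟨g, hg, hfg⟩ := h (wt β x.length + 1)
  rw [sub_eq_zero.mp (hfg β x (Nat.lt_succ_self _))]
  exact hg β x

theorem _root_.IsSmall.of_approx {M : Type*} [AddCommGroup M] [Module k M] {n : ℕ} (f : Coch G V M)
    (h : ∀ j, ∃ g, IsSmall n g ∧ IsSmall j (f - g)) : IsSmall n f := by
  intro β x hx
  obtain ⟨g, hg, hfg⟩ := h (wt β x.length + 1)
  rw [sub_eq_zero.mp (hfg β x (Nat.lt_succ_self _))]
  exact hg β x hx

/-- A contraction with respect to the weight has a fixed point. -/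
theorem exists_fixed_of_small {M : Type*} [AddCommGroup M] [Module k M] (P : Coch G V M → Prop)
    (closed : ∀ f, (∀ n, ∃ g, P g ∧ IsSmall n (f - g)) → P f) (h₀ : P 0)
    (Φ : Coch G V M → Coch G V M) (hP : ∀ f, P f → P (Φ f))
    (h : ∀ n X Y, P X → P Y → IsSmall n (X - Y) → IsSmall (n + 1) (Φ X - Φ Y)) :
    ∃ X, P X ∧ Φ X = X := by
  refine Coch.exists_fixed_point P (fun f hf => closed f fun n => ?_) h₀ Φ hP
    fun n X Y hX hY hXY β x hx => ?_
  · obtain ⟨g, hg, hfg⟩ := hf n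
    exact ⟨g, hg, fun β x hx => sub_eq_zero.mpr (hfg β x hx)⟩
  · refine sub_eq_zero.mp (h n X Y hX hY (fun β x hx => ?_) β x hx)
    exact sub_eq_zero.mpr (hXY β x hx)

/-- A family with linear part the identity has an inverse for composition. -/
theorem exists_left_inverse {f : Coch G V V.carrier} (hd : CoDeg 0 f)
    (hf : IsSmall 2 (f - pr G V)) : ∃ g : Coch G V V.carrier, CoDeg 0 g ∧
      IsSmall 2 (g - pr G V) ∧ fcomp g (hat f).fam = pr G V := by
  have hf1 : IsSmall 1 f := by
    have := IsSmall_add (IsSmall_mono one_le_two hf) (small_pr (G := G) (V := V))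
    rwa [sub_add_cancel] at this
  have hl : Lowers 1 (hat f - idc G V) := by
    rw [idc_eq_hat]
    exact lowers_hat_sub_hat hf1 small_pr hf
  -- The equation for a left inverse is written g = pr − g ∘ (f̂ − 1). This is a contraction because
  -- f̂ − 1 lowers the weight.
  obtain ⟨g, hgd, hg⟩ := exists_fixed_of_small (G := G) (V := V) (M := V.carrier) (CoDeg 0)
    CoDeg.of_approx CoDeg.zero (fun g => pr G V - fcomp g (hat f - idc G V).fam)
    (fun g hg => CoDeg.pr.sub (hg.fcomp ((ConvDeg.hat hf1 hd).sub ConvDeg.idc))) (by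
      intro n X Y _ _ h
      have e : pr G V - fcomp X (hat f - idc G V).fam - (pr G V - fcomp Y (hat f - idc G V).fam) =
          -fcomp (X - Y) (hat f - idc G V).fam := by rw [sub_fcomp]; abel
      rw [e]
      exact IsSmall_neg (small_fcomp h hl))
  have hg0 : IsSmall 1 g := by
    rw [← hg]
    exact IsSmall_sub small_pr (by
      have := small_fcomp (n := 0) (X := g) (fun β x hx => absurd hx (by omega)) hl
      simpa using this)
  refine ⟨g, hgd, ?_, ?_⟩
  · nth_rw 1 [← hg]
    rw [show pr G V - fcomp g (hat f - idc G V).fam - pr G V = -fcomp g (hat f - idc G V).fam by abel]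
    exact IsSmall_neg (small_fcomp hg0 hl)
  · have e : fcomp g (hat f).fam = fcomp g (hat f - idc G V).fam + fcomp g (idc G V).fam := by
      rw [← fcomp_add, ← add_fam, sub_add_cancel]
    rw [e, show fcomp g (idc G V).fam = g from fcomp_id g]
    nth_rw 2 [← hg]
    abel

theorem small_one_of_sub_pr {f : Coch G V V.carrier} (hf : IsSmall 2 (f - pr G V)) :
    IsSmall 1 f := by
  have := IsSmall_add (IsSmall_mono one_le_two hf) (small_pr (G := G) (V := V))
  rwa [sub_add_cancel] at this

/-- A left inverse again has linear part the identity, so it has a left inverse too, which must then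
be `f`. -/
theorem exists_inverse {f : Coch G V V.carrier} (hd : CoDeg 0 f)
    (hf : IsSmall 2 (f - pr G V)) : ∃ g : Coch G V V.carrier, CoDeg 0 g ∧ IsSmall 2 (g - pr G V) ∧ fcomp g (hat f).fam = pr G V ∧
      fcomp f (hat g).fam = pr G V ∧ (hat g).comp (hat f) = idc G V ∧
      (hat f).comp (hat g) = idc G V := by
  have key : ∀ f g : Coch G V V.carrier, IsSmall 2 (f - pr G V) → IsSmall 2 (g - pr G V) →
      fcomp g (hat f).fam = pr G V → (hat g).comp (hat f) = idc G V := by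
    intro f g hf hg h
    rw [hat_comp_hat (small_one_of_sub_pr hf) (small_one_of_sub_pr hg), h, idc_eq_hat]
  obtain ⟨g, hgd, hg, hgf⟩ := exists_left_inverse hd hf
  obtain ⟨e, _, he, heg⟩ := exists_left_inverse hgd hg
  have h1 := key f g hf hg hgf
  have h2 := key g e hg he heg
  have h3 : hat e = hat f := by
    rw [← comp_idc (hat e), ← h1, ← comp_assoc, h2, idc_comp]
  have h4 : e = f := by
    rw [← pr_fcomp_hat (small_one_of_sub_pr he), h3, pr_fcomp_hat (small_one_of_sub_pr hf)]
  rw [h4] at heg h2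
  exact ⟨g, hgd, hg, hgf, heg, h1, h2⟩

end Conv

end Coalgebra

/-! ### Cauchy products with a sign operator in between -/

section Twisted

open GappingMonoid

variable {k : Type v} [Field k] {G : GappingMonoid}
variable {M₁ M₂ M₃ N N₂ N' M : Type*} [AddCommGroup M₁] [Module k M₁] [AddCommGroup M₂]
  [Module k M₂] [AddCommGroup M₃] [Module k M₃] [AddCommGroup N] [Module k N]
  [AddCommGroup N₂] [Module k N₂] [AddCommGroup N'] [Module k N'] [AddCommGroup M] [Module k M]

theorem lift₂_right_comm_map {μ : N₂ →ₗ[k] M₃ →ₗ[k] M} {ν : M₁ →ₗ[k] M₂ →ₗ[k] N} (t : N →ₗ[k] N₂)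
    {μ' : N' →ₗ[k] M₂ →ₗ[k] M} {ν' : M₁ →ₗ[k] M₃ →ₗ[k] N'} {f f' : G.Elt → M₁} {g : G.Elt → M₂}
    {h : G.Elt → M₃}
    (H : ∀ a b c, μ (t (ν (f a) (g b))) (h c) = μ' (ν' (f' a) (h c)) (g b)) :
    lift₂ μ (fun β => t (lift₂ ν f g β)) h = lift₂ μ' (lift₂ ν' f' h) g := by
  funext β
  rw [lift₂_lift₂_left]
  simp only [lift₂, map_sum, LinearMap.sum_apply]
  rw [sum_decomps_assoc β fun a b c => μ (t (ν (f a) (g b))) (h c)]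
  refine Finset.sum_congr rfl fun p _ => ?_
  rw [sum_decomps_swap p.2 fun a b => μ (t (ν (f p.1) (g a))) (h b)]
  exact Finset.sum_congr rfl fun q _ => H _ _ _

theorem lift₂_assoc_map {μ : N₂ →ₗ[k] M₃ →ₗ[k] M} {ν : M₁ →ₗ[k] M₂ →ₗ[k] N} (t : N →ₗ[k] N₂)
    {μ' : M₁ →ₗ[k] N' →ₗ[k] M} {ν' : M₂ →ₗ[k] M₃ →ₗ[k] N'} {f f' : G.Elt → M₁}
    {g g' : G.Elt → M₂} {h : G.Elt → M₃}
    (H : ∀ a b c, μ (t (ν (f a) (g b))) (h c) = μ' (f' a) (ν' (g' b) (h c))) :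
    lift₂ μ (fun β => t (lift₂ ν f g β)) h = lift₂ μ' f' (lift₂ ν' g' h) := by
  funext β
  rw [lift₂_lift₂_right]
  simp only [lift₂, map_sum, LinearMap.sum_apply]
  rw [sum_decomps_assoc β fun a b c => μ (t (ν (f a) (g b))) (h c)]
  exact Finset.sum_congr rfl fun p _ => Finset.sum_congr rfl fun q _ => H _ _ _

theorem map_lift₂_eq {ν : M₁ →ₗ[k] M₂ →ₗ[k] N} (t : N →ₗ[k] N₂) {ν' : M₁ →ₗ[k] M₂ →ₗ[k] N₂}
    {f f' : G.Elt → M₁} {g g' : G.Elt → M₂} (H : ∀ a b, t (ν (f a) (g b)) = ν' (f' a) (g' b)) :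
    (fun β => t (lift₂ ν f g β)) = lift₂ ν' f' g' := by
  funext β
  rw [lift₂, map_sum]
  exact Finset.sum_congr rfl fun p _ => H _ _

end Twisted

/-! ### Calculus of families of bimodule operations -/

section BimoduleCalculus

open GradedSpace GappingMonoid BiOp

variable {k : Type v} [Field k] {G : GappingMonoid} {V : GradedSpace.{u} k}
variable {C : GradedSpace.{u₁} k} {C' : GradedSpace.{u₂} k} {D : GradedSpace.{u₃} k}
  {D' : GradedSpace.{u₄} k}
variable {E F M W W' : Type*} [AddCommGroup E] [Module k E]
  [AddCommGroup F] [Module k F]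
  [AddCommGroup M] [Module k M] [AddCommGroup W] [Module k W] [AddCommGroup W'] [Module k W']

namespace BiFam

/-- The family of operations has degree `e`, up to the degrees of elements of the gapping
monoid. -/
def BiDeg (e : ℤ) (f : BiFam G V C.carrier D.carrier) : Prop := ∀ β, IsHom (e - maslov β) (f β)

theorem even_sub (β : G.Elt) : Even (0 - maslov β) := Even.zero.sub (maslov_even β)

theorem odd_sub (β : G.Elt) : Odd (1 - maslov β) := odd_one.sub_even (maslov_even β)

theorem ext_word {f g : BiFam G V C.carrier M} (h : ∀ β (x : List V.Homog) (v : C.Homog)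
    (y : List V.Homog), f β (word x) v.2 (word y) = g β (word x) v.2 (word y)) : f = g :=
  funext fun β => BiOp.ext_word fun x v y => h β x v y

/-- Here and below the prefix f marks the extension of an operation on `BiOp` to families: bilinear
operations become Cauchy products, linear ones act at each energy. -/
noncomputable def fmul (f : BiFam G V E M) (g : BiFam G V F E) : BiFam G V F M := lift₂ mul f g

noncomputable def fpair (B : W →ₗ[k] W' →ₗ[k] k) (K : BiFam G V C.carrier W)
    (F : BiFam G V C'.carrier W') : BiFam G V C.carrier (Module.Dual k C'.carrier) :=
  lift₂ (pair B) K F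

noncomputable def fsL (f : BiFam G V E M) : BiFam G V E M := fun β => sL (f β)

noncomputable def fsA (f : BiFam G V C.carrier M) : BiFam G V C.carrier M := fun β => sA (f β)

noncomputable def frot (f : BiFam G V C.carrier (Module.Dual k C'.carrier)) :
    BiFam G V C'.carrier (Module.Dual k C.carrier) := fun β => rotT (f β)

noncomputable def finsL (m : Coch G V V.carrier) (f : BiFam G V E M) : BiFam G V E M :=
  lift₂ (insL.compl₂ coder) f m

noncomputable def finsR (m : Coch G V V.carrier) (f : BiFam G V C.carrier M) :
    BiFam G V C.carrier M :=
  lift₂ (insR.compl₂ coder) f m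

/-- The constant family at energy zero without further inputs. -/
noncomputable def fconst (f : E →ₗ[k] M) : BiFam G V E M := single (const f)

/-- The composition of a family with the coderivation induced by a bimodule structure. -/
noncomputable def fhat (m : Coch G V V.carrier) (f : BiFam G V C.carrier M)
    (b : BiFam G V C.carrier C.carrier) : BiFam G V C.carrier M :=
  finsL m f + fmul (fsL f) b + finsR m f

theorem fmul_word (f : BiFam G V E M) (g : BiFam G V F E) (β : G.Elt) (x : List V.Homog) (v : F)
    (y : List V.Homog) : fmul f g β (word x) v (word y) = ∑ p ∈ decomps β,
      sumSplit x fun x₁ x₂ => sumSplit y fun y₁ y₂ =>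
        f p.1 (word x₁) (g p.2 (word x₂) v (word y₁)) (word y₂) := by
  simp only [fmul, lift₂, LinearMap.sum_apply, mul_word]

theorem fpair_word [CharZero k] (B : W →ₗ[k] W' →ₗ[k] k) (K : BiFam G V C.carrier W)
    (F : BiFam G V C'.carrier W') (β : G.Elt) (x : List V.Homog) (v : C.Homog) (y : List V.Homog)
    (c : C'.Homog) : fpair B K F β (word x) v.2 (word y) c.2 = ∑ p ∈ decomps β,
      sumSplit x fun x₁ x₂ => sumSplit y fun y₁ y₂ =>
      sgn k (deg x₁ * (deg x₂ + v.1 + deg y₁ + deg y₂ + c.1)) *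
        B (K p.1 (word x₂) v.2 (word y₁)) (F p.2 (word y₂) c.2 (word x₁)) := by
  simp only [fpair, lift₂, LinearMap.sum_apply, pair_word]

theorem fmul_add_left (f f' : BiFam G V E M) (g : BiFam G V F E) :
    fmul (f + f') g = fmul f g + fmul f' g := lift₂_add_left _ _ _ _

theorem fmul_add_right (f : BiFam G V E M) (g g' : BiFam G V F E) :
    fmul f (g + g') = fmul f g + fmul f g' := lift₂_add_right _ _ _ _

theorem fmul_sub_left (f f' : BiFam G V E M) (g : BiFam G V F E) :
    fmul (f - f') g = fmul f g - fmul f' g := lift₂_sub_left _ _ _ _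

theorem fmul_sub_right (f : BiFam G V E M) (g g' : BiFam G V F E) :
    fmul f (g - g') = fmul f g - fmul f g' := lift₂_sub_right _ _ _ _

theorem fmul_neg_left (f : BiFam G V E M) (g : BiFam G V F E) :
    fmul (-f) g = -fmul f g := lift₂_neg_left _ _ _

theorem fmul_neg_right (f : BiFam G V E M) (g : BiFam G V F E) :
    fmul f (-g) = -fmul f g := lift₂_neg_right _ _ _

theorem zero_fmul (g : BiFam G V F E) : fmul (0 : BiFam G V E M) g = 0 := lift₂_zero_left _ _

theorem fmul_zero (f : BiFam G V E M) : fmul f (0 : BiFam G V F E) = 0 := lift₂_zero_right _ _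

theorem fmul_assoc (f : BiFam G V F M) (g : BiFam G V E F) (h : BiFam G V C.carrier E) :
    fmul (fmul f g) h = fmul f (fmul g h) := lift₂_assoc fun _ _ _ => mul_assoc' _ _ _

theorem one_fmul (f : BiFam G V C.carrier E) : fmul (fconst LinearMap.id) f = f :=
  funext fun β => by rw [fmul, fconst, lift₂_single_left, const_id_mul]

theorem fmul_one (f : BiFam G V C.carrier E) : fmul f (fconst LinearMap.id) = f :=
  funext fun β => by rw [fmul, fconst, lift₂_single_right, mul_const_id]

theorem fmul_fconst (f : BiFam G V E M) (a : C.carrier →ₗ[k] E) (β : G.Elt) (x : V.Bar)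
    (v : C.carrier) (y : V.Bar) : fmul f (fconst a) β x v y = f β x (a v) y := by
  rw [fmul, fconst, lift₂_single_right, mul_const_right]

theorem fconst_fmul (f : BiFam G V C.carrier E) (a : E →ₗ[k] M) (β : G.Elt) (x : V.Bar)
    (v : C.carrier) (y : V.Bar) : fmul (fconst a) f β x v y = a (f β x v y) := by
  rw [fmul, fconst, lift₂_single_left, mul_const_left]

theorem fconst_fmul_fconst (a : E →ₗ[k] M) (b : C.carrier →ₗ[k] E) :
    fmul (fconst (G := G) (V := V) a) (fconst b) = fconst (a ∘ₗ b) := by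
  funext β
  refine LinearMap.ext fun x => LinearMap.ext fun v => LinearMap.ext fun y => ?_
  rw [fconst_fmul, fconst, fconst]
  by_cases hβ : β = 0
  · subst hβ; simp [const_apply]
  · simp [single_of_ne _ hβ]

theorem fpair_add_left (B : W →ₗ[k] W' →ₗ[k] k) (K K' : BiFam G V C.carrier W)
    (F : BiFam G V C'.carrier W') : fpair B (K + K') F = fpair B K F + fpair B K' F :=
  lift₂_add_left _ _ _ _

theorem fpair_add_right (B : W →ₗ[k] W' →ₗ[k] k) (K : BiFam G V C.carrier W)
    (F F' : BiFam G V C'.carrier W') : fpair B K (F + F') = fpair B K F + fpair B K F' :=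
  lift₂_add_right _ _ _ _

theorem fpair_sub_left (B : W →ₗ[k] W' →ₗ[k] k) (K K' : BiFam G V C.carrier W)
    (F : BiFam G V C'.carrier W') : fpair B (K - K') F = fpair B K F - fpair B K' F :=
  lift₂_sub_left _ _ _ _

theorem fpair_sub_right (B : W →ₗ[k] W' →ₗ[k] k) (K : BiFam G V C.carrier W)
    (F F' : BiFam G V C'.carrier W') : fpair B K (F - F') = fpair B K F - fpair B K F' :=
  lift₂_sub_right _ _ _ _

theorem fpair_neg_left (B : W →ₗ[k] W' →ₗ[k] k) (K : BiFam G V C.carrier W)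
    (F : BiFam G V C'.carrier W') : fpair B (-K) F = -fpair B K F := lift₂_neg_left _ _ _

theorem fpair_zero_left (B : W →ₗ[k] W' →ₗ[k] k) (F : BiFam G V C'.carrier W') :
    fpair B (0 : BiFam G V C.carrier W) F = 0 := lift₂_zero_left _ _

theorem fmul_fpair [CharZero k] (B : W →ₗ[k] W' →ₗ[k] k) (K : BiFam G V D.carrier W)
    (F : BiFam G V C'.carrier W') {g : BiFam G V C.carrier D.carrier} (hg : BiDeg 0 g) :
    fmul (fpair B K F) g = fpair B (fmul K g) F :=
  lift₂_right_comm fun _ _ c => mul_pair _ _ _ (hg c) (even_sub c)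

theorem fpair_fpair [CharZero k] (B : W →ₗ[k] W' →ₗ[k] k) (K : BiFam G V C.carrier W)
    (F : BiFam G V D.carrier W') {g : BiFam G V C'.carrier D.carrier} (hg : BiDeg 0 g) :
    fpair LinearMap.id (fpair B K F) g = fpair B K (fmul F g) :=
  lift₂_assoc fun _ _ c => pair_pair _ _ _ (hg c) (even_sub c)

theorem fpair_one [CharZero k] (φ : BiFam G V C.carrier (Module.Dual k C'.carrier)) :
    fpair LinearMap.id φ (fconst LinearMap.id) = φ := by
  funext β
  refine LinearMap.ext fun x => LinearMap.ext fun v => LinearMap.ext fun y => LinearMap.ext fun c => ?_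
  rw [fpair, fconst, lift₂_single_right, pair_const_right]; rfl

theorem fmul_fsL_fpair [CharZero k] (B : W →ₗ[k] W' →ₗ[k] k) (K : BiFam G V D.carrier W)
    (F : BiFam G V C'.carrier W') {g : BiFam G V C.carrier D.carrier} (hg : BiDeg 1 g) :
    fmul (fsL (fpair B K F)) g = fpair B (fmul (fsL K) g) F :=
  lift₂_right_comm_map sL fun _ _ c => mul_sL_pair _ _ _ (hg c) (odd_sub c)

theorem fpair_fsA_fpair [CharZero k] (B : W →ₗ[k] W' →ₗ[k] k) (K : BiFam G V C.carrier W)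
    (F : BiFam G V D.carrier W') {g : BiFam G V C'.carrier D.carrier} (hg : BiDeg 1 g) :
    fpair LinearMap.id (fsA (fpair B K F)) g = fpair B (fsA K) (fmul (fsL F) g) :=
  lift₂_assoc_map sA fun _ _ c => pair_sA_pair _ _ _ (hg c) (odd_sub c)

theorem fsA_fmul (f : BiFam G V D.carrier M) {g : BiFam G V C.carrier D.carrier}
    (hg : BiDeg 0 g) : fsA (fmul f g) = fmul (fsA f) g := by
  exact map_lift₂_eq sA fun a b => sA_mul _ (hg b) (even_sub b)

theorem fsL_fmul (f : BiFam G V E M) (g : BiFam G V C.carrier E) :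
    fsL (fmul f g) = fmul (fsL f) (fsL g) := by
  exact map_lift₂_eq sL fun a b => sL_mul _ _

theorem fsL_fsL (f : BiFam G V E M) : fsL (fsL f) = f := funext fun _ => sL_sL _

theorem fsL_add (f g : BiFam G V E M) : fsL (f + g) = fsL f + fsL g := funext fun _ => map_add _ _ _

theorem fsL_fconst (f : E →ₗ[k] M) : fsL (fconst (G := G) (V := V) f) = fconst f := by
  funext β
  rw [fsL, fconst]
  by_cases hβ : β = 0
  · subst hβ; rw [single_zero, sL_const]
  · rw [single_of_ne _ hβ, map_zero]

variable {m : Coch G V V.carrier}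

theorem finsL_fconst (hm : CoDeg 1 m) (f : C.carrier →ₗ[k] M) :
    finsL m (fconst (V := V) f) = 0 := by
  funext β
  rw [finsL, fconst, lift₂_single_left, LinearMap.compl₂_apply, insL_const _ (hm β)]; rfl

theorem finsR_fconst (hm : CoDeg 1 m) (f : C.carrier →ₗ[k] M) :
    finsR m (fconst (V := V) f) = 0 := by
  funext β
  rw [finsR, fconst, lift₂_single_left, LinearMap.compl₂_apply, insR_const _ (hm β)]; rfl

theorem fhat_fconst (hm : CoDeg 1 m) (f : C.carrier →ₗ[k] M)
    (b : BiFam G V C.carrier C.carrier) : fhat m (fconst f) b = fmul (fconst f) b := by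
  rw [fhat, finsL_fconst hm, finsR_fconst hm, fsL_fconst, zero_add, add_zero]

theorem finsL_fmul (hm : CoDeg 1 m) (f : BiFam G V E M) (g : BiFam G V C.carrier E) :
    finsL m (fmul f g) = fmul (finsL m f) g + fmul (fsL f) (finsL m g) :=
  lift₂_deriv (f' := fsL f) fun _ _ c => insL_mul _ _ (hm c)

theorem finsR_fmul (hm : CoDeg 1 m) (f : BiFam G V D.carrier M)
    {g : BiFam G V C.carrier D.carrier} {e : ℤ} (hg : BiDeg e g) (he : Even e) :
    finsR m (fmul f g) = fmul (finsR m f) g + fmul (fsL f) (finsR m g) :=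
  lift₂_deriv (f' := fsL f) fun a b c => by
    rw [LinearMap.compl₂_apply, insR_mul _ (hg b) (hm c), sgn_even (he.sub (maslov_even b)), one_smul]
    rfl

theorem finsR_fmul_odd (hm : CoDeg 1 m) (f : BiFam G V D.carrier M)
    {g : BiFam G V C.carrier D.carrier} {e : ℤ} (hg : BiDeg e g) (he : Odd e) :
    finsR m (fmul f g) = -fmul (finsR m f) g + fmul (fsL f) (finsR m g) := by
  rw [← fmul_neg_left]
  have h : -finsR m f = lift₂ (-(insR.compl₂ coder)) f m := by
    funext β; simp [finsR, lift₂]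
  rw [h]
  refine lift₂_deriv (f' := fsL f) fun a b c => ?_
  rw [LinearMap.compl₂_apply, insR_mul _ (hg b) (hm c), sgn_odd (he.sub_even (maslov_even b)), neg_smul, one_smul,
    LinearMap.neg_apply, LinearMap.neg_apply, map_neg, LinearMap.neg_apply]
  rfl

/-- The behaviour of `fhat` under composition. -/
theorem fhat_fmul (hm : CoDeg 1 m) (f : BiFam G V D.carrier M) {g : BiFam G V C.carrier D.carrier}
    (hg : BiDeg 0 g) (b : BiFam G V C.carrier C.carrier) (b' : BiFam G V D.carrier D.carrier) :
    fhat m (fmul f g) b = fmul (fhat m f b') g + fmul (fsL f) (fhat m g b - fmul b' g) := by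
  simp only [fhat, finsL_fmul hm, finsR_fmul hm _ hg Even.zero, fsL_fmul, fmul_add_left,
    fmul_add_right, fmul_sub_right, fmul_assoc]
  abel

theorem finsL_finsL (h : (Conv.chat m).comp (Conv.chat m) = 0) (f : BiFam G V E M) :
    finsL m (finsL m f) = 0 := by
  have h1 : (lift₂ (LinearMap.llcomp k V.Bar V.Bar V.Bar) (fun β => coder (m β))
      fun β => coder (m β)) = 0 := by
    have := congr_arg Conv.fam h
    simp only [Conv.comp_fam, fcomp] at this
    rw [show (Conv.chat m).fam = fun β => coder (m β) from funext fun β => Conv.chat_fam m β] at this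
    exact this
  have h2 : finsL m (finsL m f) = lift₂ insL f (lift₂ (LinearMap.llcomp k V.Bar V.Bar V.Bar)
      (fun β => coder (m β)) fun β => coder (m β)) := by
    rw [show finsL m (finsL m f) = lift₂ insL (lift₂ insL f fun β => coder (m β))
      fun β => coder (m β) from rfl]
    exact lift₂_assoc fun a b c => LinearMap.ext fun x => LinearMap.ext fun v =>
      LinearMap.ext fun y => by simp only [insL_apply, LinearMap.llcomp_apply]
  rw [h2, h1, lift₂_zero_right]

theorem finsR_finsR (h : (Conv.chat m).comp (Conv.chat m) = 0) (f : BiFam G V C.carrier M) :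
    finsR m (finsR m f) = 0 := by
  have h1 : (lift₂ (LinearMap.llcomp k V.Bar V.Bar V.Bar) (fun β => coder (m β))
      fun β => coder (m β)) = 0 := by
    have := congr_arg Conv.fam h
    simp only [Conv.comp_fam, fcomp] at this
    rw [show (Conv.chat m).fam = fun β => coder (m β) from funext fun β => Conv.chat_fam m β] at this
    exact this
  let μ : BiOp V C.carrier M →ₗ[k] (V.Bar →ₗ[k] V.Bar) →ₗ[k] BiOp V C.carrier M :=
    LinearMap.mk₂ k (fun K t => comp₃ K LinearMap.id LinearMap.id t) (by intros; ext; simp)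
    (by intros; ext; simp) (by intros; ext; simp) (by intros; ext; simp)
  have h2 : finsR m (finsR m f) = lift₂ μ f (lift₂ (LinearMap.llcomp k V.Bar V.Bar V.Bar)
      (fun β => coder (m β)) fun β => coder (m β)) := by
    rw [show finsR m (finsR m f) = lift₂ insR (lift₂ insR f fun β => coder (m β))
      fun β => coder (m β) from rfl]
    refine lift₂_assoc fun a b c => LinearMap.ext fun x => LinearMap.ext fun v =>
      LinearMap.ext fun y => ?_
    have := LinearMap.congr_fun (par_comp_par (V := C)) v
    simp only [LinearMap.comp_apply, LinearMap.id_apply] at this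
    simp [μ, parT_parT, this]
  rw [h2, h1, lift₂_zero_right]

/-- The sign of a right insertion contains the parity of the left argument, which an odd insertion
there reverses. -/
theorem finsL_finsR (hm : CoDeg 1 m) (f : BiFam G V C.carrier M) :
    finsL m (finsR m f) = -finsR m (finsL m f) := by
  rw [finsL, finsR, finsR, finsL]
  funext β
  rw [Pi.neg_apply, lift₂_lift₂_left, lift₂_lift₂_left, ← Finset.sum_neg_distrib]
  refine Finset.sum_congr rfl fun p _ => ?_
  rw [sum_decomps_swap p.2 fun a b => (insL.compl₂ coder) ((insR.compl₂ coder) (f p.1) (m a)) (m b),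
    ← Finset.sum_neg_distrib]
  refine Finset.sum_congr rfl fun q _ => LinearMap.ext fun x => LinearMap.ext fun v =>
      LinearMap.ext fun y => ?_
  simp [parT_coder (hm _) (hm.odd _)]

theorem fsL_finsL (hm : CoDeg 1 m) (f : BiFam G V E M) : fsL (finsL m f) = -finsL m (fsL f) := by
  funext β
  simp only [fsL, finsL, Pi.neg_apply, lift₂, map_sum, ← Finset.sum_neg_distrib]
  exact Finset.sum_congr rfl fun p _ => sL_insL _ (hm _) (hm.odd _)

theorem fsL_finsR (f : BiFam G V C.carrier M) : fsL (finsR m f) = finsR m (fsL f) :=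
  map_lift₂_eq sL fun _ _ => sL_insR _ _

theorem finsL_add (f g : BiFam G V E M) : finsL m (f + g) = finsL m f + finsL m g :=
  lift₂_add_left _ _ _ _

theorem finsR_add (f g : BiFam G V C.carrier M) : finsR m (f + g) = finsR m f + finsR m g :=
  lift₂_add_left _ _ _ _

/-- Insertions on the same side square to zero by the relations of the algebra, insertions on
opposite sides anticommute, and cross terms with `b` cancel. What survives is `f` applied to the
bimodule relation. -/
theorem fhat_fhat_eq (hm : CoDeg 1 m) (h : (Conv.chat m).comp (Conv.chat m) = 0)
    (f : BiFam G V C.carrier M) {b : BiFam G V C.carrier C.carrier} (hb : BiDeg 1 b) :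
    fhat m (fhat m f b) b = fmul f (fhat m b b) := by
  simp only [fhat, finsL_add, finsR_add, fsL_add, finsL_finsL h, finsR_finsR h,
    finsL_finsR hm, finsL_fmul hm, finsR_fmul_odd hm _ hb odd_one, fsL_finsL hm, fsL_finsR, fsL_fsL,
    fsL_fmul, fmul_add_left, fmul_add_right, fmul_assoc, fmul_neg_left]
  abel

end BiFam

end BimoduleCalculus

/-! ### Homomorphisms into a dual and their pullbacks -/

section BimoduleCalculus

open GradedSpace GappingMonoid BiOp

variable {k : Type v} [Field k] {G : GappingMonoid} {V : GradedSpace.{u} k}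
variable {C : GradedSpace.{u₁} k} {C' : GradedSpace.{u₂} k} {D : GradedSpace.{u₃} k}
  {D' : GradedSpace.{u₄} k}
variable {E F M W W' : Type*} [AddCommGroup E] [Module k E]
  [AddCommGroup F] [Module k F]
  [AddCommGroup M] [Module k M] [AddCommGroup W] [Module k W] [AddCommGroup W'] [Module k W']

namespace BiOp

theorem rotT_mul_sL [CharZero k] (ω : BiOp V C.carrier (Module.Dual k C'.carrier))
    {b : BiOp V D.carrier C.carrier} {e : ℤ} (hb : IsHom e b) (he : Odd e) :
    rotT (mul (sL ω) b) = pair LinearMap.id (sA (rotT ω)) b := by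
  refine ext_dual fun x v y c => ?_
  have he' := odd_cast he
  have hr : ∀ p q r s, rotT ω (word p) v.2 (word q) (b (word r) c.2 (word s)) = 
      sgn k ((deg p + v.1) * (deg q + (deg r + c.1 + deg s + e))) *
      ω (word q) (b (word r) c.2 (word s)) (word p) v.2 :=
    fun p q r s => rotT_word ω p v q (hb.val r c s)
  simp only [rotT_word, pair_word, LinearMap.id_apply, mul_word, sumSplit_lapply, mul_sumSplit,
    sA_word, sL_word, LinearMap.smul_apply, smul_eq_mul, hr]
  rw [sumSplit_comm]
  refine sumSplit_congr fun x₁ x₂ hx => sumSplit_congr fun y₁ y₂ hy => ?_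
  simp only [← mul_assoc, ← sgn_add]
  refine congr_arg (· * _) (sgn_congr ?_)
  simp only [hx, hy, deg_append, Int.cast_add, Int.cast_mul]
  grind

end BiOp

namespace BiFam

variable {m : Coch G V V.carrier}

theorem finsL_fpair [CharZero k] (hm : CoDeg 1 m) (B : W →ₗ[k] W' →ₗ[k] k)
    (K : BiFam G V C.carrier W) (F : BiFam G V C'.carrier W') :
    finsL m (fpair B K F) = fpair B (finsL m K) F + fpair B (fsA K) (finsR m F) :=
  by
  exact lift₂_deriv (f' := fsA K) fun a b c => by
    simp only [LinearMap.compl₂_apply]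
    rw [insL_pair _ _ _ (hm c) (hm.odd c), fsA]

theorem finsR_fpair [CharZero k] (hm : CoDeg 1 m) (B : W →ₗ[k] W' →ₗ[k] k)
    (K : BiFam G V C.carrier W) (F : BiFam G V C'.carrier W') :
    finsR m (fpair B K F) = fpair B (finsR m K) F + fpair B (fsA K) (finsL m F) :=
  by
  exact lift₂_deriv (f' := fsA K) fun a b c => by
    simp only [LinearMap.compl₂_apply]
    rw [insR_pair _ _ _ (hm c) (hm.odd c), fsA]

/-- The defect of `φ` from being a homomorphism from a bimodule to the dual of a bimodule. -/
noncomputable def frel (m : Coch G V V.carrier)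
    (φ : BiFam G V C.carrier (Module.Dual k C'.carrier)) (b : BiFam G V C.carrier C.carrier)
    (b' : BiFam G V C'.carrier C'.carrier) : BiFam G V C.carrier (Module.Dual k C'.carrier) :=
  fhat m φ b + fpair LinearMap.id (fsA φ) b'

/-- The Leibniz rule for the defect: an insertion on either side of the pairing belongs to exactly
one of the two families, and the actions of `b` and `b'` complete the two coderivations. -/
theorem frel_fpair [CharZero k] (hm : CoDeg 1 m) (B : W →ₗ[k] W' →ₗ[k] k)
    (K : BiFam G V C.carrier W) (F : BiFam G V C'.carrier W')
    {b : BiFam G V C.carrier C.carrier} {b' : BiFam G V C'.carrier C'.carrier}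
    (hb : BiDeg 1 b) (hb' : BiDeg 1 b') : frel m (fpair B K F) b b' =
      fpair B (fhat m K b) F + fpair B (fsA K) (fhat m F b') := by
  simp only [frel, fhat, finsL_fpair hm, finsR_fpair hm, fmul_fsL_fpair _ _ _ hb,
    fpair_fsA_fpair _ _ _ hb', fpair_add_left, fpair_add_right]
  abel

/-- The pullback of a family with values in a dual space along a family. -/
noncomputable def pull (φ : BiFam G V D.carrier (Module.Dual k D.carrier))
    (g : BiFam G V C.carrier D.carrier) : BiFam G V C.carrier (Module.Dual k C.carrier) :=
  fpair LinearMap.id (fmul φ g) g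

/-- Along a homomorphism `g` the defect of a pullback is the pullback of the defect. Thus
homomorphisms to the dual pull back to such, and for invertible `g` the converse holds. -/
theorem frel_pull [CharZero k] (hm : CoDeg 1 m) (φ : BiFam G V D.carrier (Module.Dual k D.carrier))
    {g : BiFam G V C.carrier D.carrier} (hg : BiDeg 0 g) {b : BiFam G V C.carrier C.carrier}
    {b' : BiFam G V D.carrier D.carrier} (hb : BiDeg 1 b)
    (h : fhat m g b = fmul b' g) : frel m (pull φ g) b b = pull (frel m φ b' b') g := by
  rw [pull, frel_fpair hm _ _ _ hb hb, fhat_fmul hm φ hg b b', h, sub_self, fmul_zero, add_zero,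
    fsA_fmul _ hg, pull, frel, fmul_add_left, fpair_add_left, fmul_fpair _ _ _ hg,
    fpair_fpair _ _ _ hg]

theorem pull_pull [CharZero k] (φ : BiFam G V D.carrier (Module.Dual k D.carrier))
    {g : BiFam G V C.carrier D.carrier} {g' : BiFam G V C'.carrier C.carrier}
    (hg' : BiDeg 0 g') : pull (pull φ g) g' = pull φ (fmul g g') := by
  rw [pull, pull, pull, fmul_fpair _ _ _ hg', fpair_fpair _ _ _ hg', fmul_assoc]

theorem pull_one [CharZero k] (φ : BiFam G V D.carrier (Module.Dual k D.carrier)) :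
    pull φ (fconst LinearMap.id) = φ := by
  rw [pull, fmul_one, fpair_one]

theorem pull_zero (g : BiFam G V C.carrier D.carrier) :
    pull (0 : BiFam G V D.carrier (Module.Dual k D.carrier)) g = 0 := by
  rw [pull, zero_fmul, fpair_zero_left]

theorem frot_fpair_fmul [CharZero k] (φ : BiFam G V D.carrier (Module.Dual k D'.carrier))
    {g : BiFam G V C.carrier D.carrier} {g' : BiFam G V C'.carrier D'.carrier}
    (hg : BiDeg 0 g) (hg' : BiDeg 0 g') :
    frot (fpair LinearMap.id (fmul φ g) g') = fpair LinearMap.id (fmul (frot φ) g') g := by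
  funext β
  rw [frot, fpair, fmul, fpair, fmul, lift₂_lift₂_left, lift₂_lift₂_left, map_sum]
  refine Finset.sum_congr rfl fun p _ => ?_
  rw [sum_decomps_swap p.2 fun a b => (pair LinearMap.id) ((mul (frot φ p.1)) (g' a)) (g b), map_sum]
  refine Finset.sum_congr rfl fun q _ => ?_
  rw [rotT_pair_mul _ (hg q.1) (hg' q.2) (even_sub _) (even_sub _), frot]

theorem frot_pull [CharZero k] (φ : BiFam G V D.carrier (Module.Dual k D.carrier))
    {g : BiFam G V C.carrier D.carrier} (hg : BiDeg 0 g) : frot (pull φ g) = pull (frot φ) g :=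
  frot_fpair_fmul φ hg hg

theorem frot_sub (φ φ' : BiFam G V C.carrier (Module.Dual k C'.carrier)) :
    frot (φ - φ') = frot φ - frot φ' := funext fun β => map_sub rotT (φ β) (φ' β)

theorem fhat_add (f g : BiFam G V C.carrier M) (b : BiFam G V C.carrier C.carrier) :
    fhat m (f + g) b = fhat m f b + fhat m g b := by
  simp only [fhat, finsL_add, finsR_add, fsL_add, fmul_add_left]
  abel

theorem fhat_neg (f : BiFam G V C.carrier M) (b : BiFam G V C.carrier C.carrier) :
    fhat m (-f) b = -fhat m f b := by
  have h := fhat_add (m := m) f (-f) b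
  have h0 : fhat m (0 : BiFam G V C.carrier M) b = 0 := by
    have := fhat_add (m := m) (0 : BiFam G V C.carrier M) 0 b
    rw [add_zero] at this
    simpa using this
  rw [add_neg_cancel, h0] at h
  exact (neg_eq_of_add_eq_zero_right h.symm).symm

theorem fhat_sub (f g : BiFam G V C.carrier M) (b : BiFam G V C.carrier C.carrier) :
    fhat m (f - g) b = fhat m f b - fhat m g b := by
  rw [sub_eq_add_neg, fhat_add, fhat_neg, sub_eq_add_neg]

/-! ### Degrees -/

theorem BiDeg.add {e : ℤ} {f g : BiFam G V C.carrier D.carrier} (hf : BiDeg e f)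
    (hg : BiDeg e g) : BiDeg e (f + g) := fun β x v y => Submodule.add_mem _ (hf β x v y) (hg β x v y)

theorem BiDeg.neg {e : ℤ} {f : BiFam G V C.carrier D.carrier} (hf : BiDeg e f) : BiDeg e (-f) :=
  fun β x v y => Submodule.neg_mem _ (hf β x v y)

theorem BiDeg.sub {e : ℤ} {f g : BiFam G V C.carrier D.carrier} (hf : BiDeg e f)
    (hg : BiDeg e g) : BiDeg e (f - g) := by rw [sub_eq_add_neg]; exact hf.add hg.neg

theorem BiDeg.mul {e e' : ℤ} {f : BiFam G V D.carrier D'.carrier} {g : BiFam G V C.carrier D.carrier}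
    (hf : BiDeg e f) (hg : BiDeg e' g) : BiDeg (e + e') (fmul f g) := by
  intro β x v y
  rw [fmul_word]
  refine Submodule.sum_mem _ fun p hp => Submodule.sum_mem _ fun i _ =>
    Submodule.sum_mem _ fun j _ => ?_
  have hx := congr_arg deg (List.take_append_drop i x)
  have hy := congr_arg deg (List.take_append_drop j y)
  have hm := maslov_of_mem hp
  simp only [deg_append] at hx hy
  have key : deg x + v.1 + deg y + (e + e' - maslov β) = deg (x.take i) +
    (deg (x.drop i) + v.1 + deg (y.take j) + (e' - maslov p.2)) + deg (y.drop j) +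
      (e - maslov p.1) := by omega
  rw [key]
  exact hf p.1 (x.take i) ((hg p.2).val (x.drop i) v (y.take j)) (y.drop j)

theorem BiDeg.const {e : ℤ} {f : C.carrier →ₗ[k] D.carrier}
    (hf : ∀ c : C.Homog, f c.2 ∈ D.piece (c.1 + e)) : BiDeg e (fconst (G := G) (V := V) f) := by
  intro β x v y
  rw [fconst]
  by_cases hβ : β = 0
  · subst hβ
    rw [single_zero]
    by_cases hx : x = []
    · by_cases hy : y = []
      · subst hx hy
        have := hf v
        simpa [maslov_zero, const_apply, deg_nil] using this
      · rw [const_right_ne _ _ _ hy]; exact zero_mem _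
    · rw [const_left_ne _ hx]; exact zero_mem _
  · rw [single_of_ne _ hβ]; exact zero_mem _

theorem BiDeg.one : BiDeg 0 (fconst (G := G) (V := V) (LinearMap.id : C.carrier →ₗ[k] C.carrier)) :=
  BiDeg.const fun c => by simp

end BiFam

end BimoduleCalculus

/-! ### The structures of the statement as families -/

section Structures

open GradedSpace GappingMonoid BiOp BiFam

variable {k : Type v} [Field k] {G : GappingMonoid}

namespace GappedAlgebra

variable (A : GappedAlgebra.{u} k G)

theorem coDeg : CoDeg 1 A.m := fun β x => by
  rw [← add_sub_assoc]; exact A.m_degree β x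

end GappedAlgebra

theorem BiFam.ext_pairing {V : GradedSpace.{u} k} {C : GradedSpace.{u₁} k} {C' : GradedSpace.{u₂} k}
    {f g : BiFam G V C.carrier (Module.Dual k C'.carrier)}
    (h : ∀ (β : G.Elt) (x : List V.Homog) (v : C.Homog) (y : List V.Homog) (c : C'.Homog),
      f β (word x) v.2 (word y) c.2 = g β (word x) v.2 (word y) c.2) : f = g :=
  funext fun β => ext_dual (h β)

theorem coder_relation_word {V : GradedSpace.{u} k} {M : Type*} [AddCommGroup M] [Module k M]
    {m : Coch G V V.carrier} (f : Coch G V M) (β : G.Elt) (x : List V.Homog) :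
    fcomp f (Conv.chat m).fam β (word x) = ∑ p ∈ decomps β,
      sumSplit x (fun x₁ r => sumSplit r (fun x₂ x₃ => (deg x₁).negOnePow •
        f p.1 (word x₁ * TensorAlgebra.ι k (m p.2 (word x₂)) * word x₃))) := by
  rw [fcomp_apply]
  refine Finset.sum_congr rfl fun p _ => ?_
  rw [Conv.chat_fam, coder_word, map_sumSplit]
  refine sumSplit_congr fun _ _ _ => ?_
  rw [map_sumSplit]
  refine sumSplit_congr fun _ _ _ => ?_
  rw [map_smul, negOnePow_smul (k := k)]

theorem GappedAlgebra.fcomp_chat (A : GappedAlgebra.{u} k G) :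
    fcomp A.m (Conv.chat A.m).fam = 0 :=
  Coch.ext_word fun β x => (coder_relation_word A.m β x).trans (A.relation β x)

theorem GappedAlgebra.chat_chat (A : GappedAlgebra.{u} k G) :
    (Conv.chat A.m).comp (Conv.chat A.m) = 0 := Conv.chat_comp_chat A.coDeg A.fcomp_chat

/-- The algebra with given operations. -/
noncomputable def GappedAlgebra.ofCoch (V : GradedSpace.{u} k) (m : Coch G V V.carrier)
    (hm : CoDeg 1 m) (h0 : m 0 1 = 0) (h : fcomp m (Conv.chat m).fam = 0) : GappedAlgebra k G where
  toGradedSpace := V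
  m := m
  m_degree β x := by rw [add_sub_assoc]; exact hm β x
  m_zero := h0
  relation β x := by rw [← coder_relation_word m β x, h]; rfl

section

variable {A : GappedAlgebra.{u} k G} {C : GradedSpace.{w} k} {M : Type*} [AddCommGroup M] [Module k M]

theorem compHat_eq (φ : BiFam G A.toGradedSpace C.carrier M)
    (b : BiFam G A.toGradedSpace C.carrier C.carrier) (β : G.Elt) (x : List A.Homog) (v : C.Homog)
    (y : List A.Homog) :
    compHat A C φ b β x v y = fhat A.m φ b β (word x) v.2 (word y) := by
  have hL : finsL A.m φ β (word x) v.2 (word y) = ∑ p ∈ decomps β,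
      sumSplit x (fun x₁ r => sumSplit r (fun x₂ x₃ => sgn k (deg x₁) •
        φ p.1 (word x₁ * TensorAlgebra.ι k (A.m p.2 (word x₂)) * word x₃) v.2 (word y))) := by
    simp only [finsL, lift₂, LinearMap.sum_apply, LinearMap.compl₂_apply, insL_apply, coder_word,
      map_sumSplit, sumSplit_lapply, map_smul, LinearMap.smul_apply]
  have hR : finsR A.m φ β (word x) v.2 (word y) = ∑ p ∈ decomps β,
      sumSplit y (fun y₁ r => sumSplit r (fun y₂ y₃ => sgn k (deg x + v.1 + deg y₁) •
        φ p.1 (word x) v.2 (word y₁ * TensorAlgebra.ι k (A.m p.2 (word y₂)) * word y₃))) := by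
    simp only [finsR, lift₂, LinearMap.sum_apply, LinearMap.compl₂_apply, insR_apply, coder_word,
      map_sumSplit, parT_word, par_homog, map_smul, LinearMap.smul_apply, smul_smul, sgn_add]
    refine Finset.sum_congr rfl fun p _ => sumSplit_congr fun _ _ _ => sumSplit_congr fun _ _ _ => ?_
    congr 1
    ring
  simp only [compHat, fhat, Pi.add_apply, LinearMap.add_apply, hL, hR, fmul_word, fsL, sL_word,
    negOnePow_smul (k := k), Finset.sum_add_distrib]

theorem GappedBimodule.biDeg (C : GappedBimodule.{u, v, w} A) : BiDeg 1 C.b := fun β x c y => by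
  rw [← add_sub_assoc]; exact C.b_degree β x c y

theorem GappedBimodule.fhat_b (C : GappedBimodule.{u, v, w} A) : fhat A.m C.b C.b = 0 :=
  BiFam.ext_word fun β x v y => by rw [← compHat_eq, C.relation]; rfl

/-- The bimodule with given operations. -/
noncomputable def GappedBimodule.ofBiFam (C : GradedSpace.{w} k)
    (b : BiFam G A.toGradedSpace C.carrier C.carrier) (hb : BiDeg 1 b) (h : fhat A.m b b = 0) :
    GappedBimodule A where
  toGradedSpace := C
  b := b
  b_degree β x c y := by rw [add_sub_assoc]; exact hb β x c y
  relation β x c y := by rw [compHat_eq, h]; rfl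

variable {C D : GappedBimodule.{u, v, w} A}

theorem BimoduleHom.biDeg (g : BimoduleHom C D) : BiDeg 0 g.g := fun β x c y => by
  rw [zero_sub, ← sub_eq_add_neg]; exact g.g_degree β x c y

theorem BimoduleHom.fhat_eq (g : BimoduleHom C D) : fhat A.m g.g C.b = fmul D.b g.g :=
  BiFam.ext_word fun β x v y => by rw [← compHat_eq, g.relation, fmul_word]

/-- The homomorphism with given components. -/
noncomputable def BimoduleHom.ofBiFam (g : BiFam G A.toGradedSpace C.carrier D.carrier)
    (hg : BiDeg 0 g) (h : fhat A.m g C.b = fmul D.b g) : BimoduleHom C D where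
  g := g
  g_degree β x c y := by
    have := hg β x c y
    rwa [zero_sub, ← sub_eq_add_neg] at this
  relation β x c y := by rw [compHat_eq, h, fmul_word]

/-- The exponent in `dualOp` has three parts: the summand 1 gives the minus sign, the degree of the
functional is the twist `fsA`, and the rest is the Koszul sign of the pairing. -/
theorem frel_word [CharZero k] (φ : BiFam G A.toGradedSpace C.carrier (Module.Dual k C.carrier))
    (β : G.Elt) (x : List A.Homog) (v : C.Homog) (y : List A.Homog) (c : C.Homog) :
    frel A.m φ C.b C.b β (word x) v.2 (word y) c.2 =
      compHat A C.toGradedSpace φ C.b β x v y c.2 - ∑ p ∈ decomps β,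
        sumSplit x (fun x₁ x₂ => sumSplit y (fun y₁ y₂ =>
          dualOp (C.b p.1) x₁ (deg x₂ + v.1 + deg y₁) (φ p.2 (word x₂) v.2 (word y₁)) y₂ c)) := by
  rw [compHat_eq, sub_eq_add_neg, frel]
  simp only [Pi.add_apply, LinearMap.add_apply]
  congr 1
  rw [fpair_word, sum_decomps_swap β fun a b => sumSplit x fun x₁ x₂ => sumSplit y fun y₁ y₂ =>
    sgn k (deg x₁ * (deg x₂ + v.1 + deg y₁ + deg y₂ + c.1)) *
      LinearMap.id (fsA φ a (word x₂) v.2 (word y₁)) (C.b b (word y₂) c.2 (word x₁)),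
    ← Finset.sum_neg_distrib]
  refine Finset.sum_congr rfl fun p _ => ?_
  rw [← sumSplit_neg]
  refine sumSplit_congr fun _ _ _ => ?_
  rw [← sumSplit_neg]
  refine sumSplit_congr fun _ _ _ => ?_
  rw [dualOp, fsA, sA_word, negOnePow_smul (k := k) (M := k), LinearMap.id_apply, LinearMap.smul_apply, smul_eq_mul,
    smul_eq_mul, ← mul_assoc, ← sgn_add, sgn_add (k := k) (1 + _), sgn_add (k := k) 1, sgn_one, sgn_add]
  ring

theorem DualHom.frel_eq [CharZero k] {N : ℤ} (φ : DualHom C N) : frel A.m φ.φ C.b C.b = 0 :=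
  BiFam.ext_pairing fun β x v y c => by
    rw [frel_word, φ.relation, sub_self]; rfl

/-- The homomorphism with given components. -/
noncomputable def DualHom.ofBiFam [CharZero k] {N : ℤ}
    (φ : BiFam G A.toGradedSpace C.carrier (Module.Dual k C.carrier))
    (hφ : ∀ (β : G.Elt) (x : List A.Homog) (c : C.Homog) (y : List A.Homog) (c' : C.Homog),
      φ β (word x) c.2 (word y) c'.2 ≠ 0 →
        c'.1 = - (deg x + c.1 + deg y - GappingMonoid.maslov β) - N)
    (h : frel A.m φ C.b C.b = 0) : DualHom C N where
  φ := φ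
  φ_degree := hφ
  relation β x c y c' := by
    have := frel_word φ β x c y c'
    rw [h] at this
    exact (sub_eq_zero.mp this.symm)

theorem DualHom.isSkew_iff [CharZero k] {N : ℤ} {φ : DualHom C N} :
    φ.IsSkew ↔ frot φ.φ = -φ.φ := by
  constructor
  · intro h
    refine BiFam.ext_pairing fun β x v y c => ?_
    rw [frot, rotT_word, Pi.neg_apply]
    simp only [LinearMap.neg_apply]
    rw [h β x v y c, neg_neg, negOnePow_smul (k := k) (M := k), smul_eq_mul]
  · intro h β x v y c
    have h1 := congr_arg (fun f => f β (word x) v.2 (word y) c.2) h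
    simp only [frot, rotT_word, Pi.neg_apply, LinearMap.neg_apply] at h1
    rw [negOnePow_smul (k := k) (M := k), smul_eq_mul, h1, neg_neg]

end

section

variable {V : GradedSpace.{u} k} {C D : GradedSpace.{w} k}

theorem pullback_eq [CharZero k] (B : D.carrier →ₗ[k] Module.Dual k D.carrier)
    (g : BiFam G V C.carrier D.carrier) (β : G.Elt)
    (x : List V.Homog) (v : C.Homog) (y : List V.Homog) (c : C.Homog) :
    pullback g B β x v y c = pull (fconst B) g β (word x) v.2 (word y) c.2 := by
  rw [pull, fpair_word, pullback, sum_decomps_swap β fun a b => sumSplit x fun x₁ x₂ =>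
    sumSplit y fun y₁ y₂ => dualMap (g a) x₁ (deg x₂ + v.1 + deg y₁)
        (B (g b (word x₂) v.2 (word y₁))) y₂ c]
  refine Finset.sum_congr rfl fun p _ => sumSplit_congr fun _ _ _ => sumSplit_congr fun _ _ _ => ?_
  rw [dualMap, negOnePow_smul (k := k) (M := k), smul_eq_mul, fconst_fmul, LinearMap.id_apply]

end

section

variable {A : GappedAlgebra.{u} k G} {D : GappedBimodule.{u, v, w} A} {N : ℤ}

theorem SkewForm.frot_fconst [CharZero k] {V : GradedSpace.{u} k} {D : GradedSpace.{w} k}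
    (B : SkewForm D N) : frot (fconst (G := G) (V := V) B.form) = -fconst B.form := by
  refine BiFam.ext_pairing fun β x v y c => ?_
  rw [frot, rotT_word, Pi.neg_apply]
  simp only [LinearMap.neg_apply]
  rw [fconst]
  by_cases hβ : β = 0
  · subst hβ
    rw [single_zero]
    by_cases hx : x = []
    · by_cases hy : y = []
      · subst hx hy
        simp only [word_nil, const_one, deg_nil, zero_add]
        rw [B.skew v c, negOnePow_smul (k := k) (M := k), smul_eq_mul, neg_neg]
      · rw [const_left_ne _ hy, const_right_ne _ _ _ hy]; simp
    · rw [const_left_ne _ hx, const_right_ne _ _ _ hx]; simp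
  · rw [single_of_ne _ hβ]; simp

theorem frel_fconst_word [CharZero k] (B : D.carrier →ₗ[k] Module.Dual k D.carrier)
    (β : G.Elt) (x : List A.Homog) (v : D.Homog) (y : List A.Homog) (c : D.Homog) :
    frel A.m (fconst B) D.b D.b β (word x) v.2 (word y) c.2 =
      B (D.b β (word x) v.2 (word y)) c.2 - dualOp (D.b β) x v.1 (B v.2) y c := by
  have e : fsA (fconst (G := G) (V := A.toGradedSpace) B) =
      fconst (B ∘ₗ D.par) := by
    refine BiFam.ext_word fun β x v y => ?_
    rw [fsA, sA_word, fconst, fconst]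
    by_cases hβ : β = 0
    · subst hβ
      rw [single_zero, single_zero]
      by_cases hx : x = []
      · by_cases hy : y = []
        · subst hx hy
          simp [deg_nil, par_homog]
        · rw [const_right_ne _ _ _ hy, const_right_ne _ _ _ hy]; simp
      · rw [const_left_ne _ hx, const_left_ne _ hx]; simp
    · rw [single_of_ne _ hβ, single_of_ne _ hβ]; simp
  rw [frel, fhat_fconst A.coDeg, Pi.add_apply, LinearMap.add_apply, LinearMap.add_apply,
    LinearMap.add_apply, LinearMap.add_apply, fconst_fmul, e, sub_eq_add_neg]
  congr 1
  rw [fpair, fconst, lift₂_single_left, pair_const_left, dualOp, negOnePow_smul (k := k) (M := k), LinearMap.comp_apply,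
    par_homog, map_smul, LinearMap.id_apply, LinearMap.smul_apply, smul_eq_mul, smul_eq_mul,
    sgn_add (k := k) (1 + _), sgn_add (k := k) 1, sgn_one]
  ring_nf

theorem SkewForm.isCyclicBimodule_iff [CharZero k] (B : SkewForm D.toGradedSpace N) :
    B.IsCyclicBimodule ↔ frel A.m (fconst B.form) D.b D.b = 0 := by
  constructor
  · intro h
    refine BiFam.ext_pairing fun β x v y c => ?_
    rw [frel_fconst_word, h β x v y c, sub_self]; rfl
  · intro h β x v y c
    have := frel_fconst_word B.form β x v y c
    rw [h] at this
    exact (sub_eq_zero.mp this.symm)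

end

end Structures

/-! ### Graded linear algebra and contractions onto cohomology -/

section Linear

open GradedSpace

variable {k : Type v} [Field k]

namespace GradedSpace

variable {V : GradedSpace.{u} k} {W : GradedSpace.{w} k} {M : Type*} [AddCommGroup M] [Module k M]

variable (V) in
noncomputable def decomp : V.carrier ≃ₗ[k] DirectSum ℤ fun i => V.piece i :=
  (LinearEquiv.ofBijective (DirectSum.coeLinearMap V.piece) V.isInternal).symm

theorem decomp_of (a : V.Homog) :
    V.decomp a.2 = DirectSum.lof k ℤ (fun i => V.piece i) a.1 a.2 := by
  rw [decomp, LinearEquiv.symm_apply_eq]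
  exact (DirectSum.coeLinearMap_lof V.piece a.1 a.2).symm

/-- The linear map with given restrictions to the graded pieces. -/
noncomputable def ofPieces (f : ∀ i, V.piece i →ₗ[k] M) : V.carrier →ₗ[k] M :=
  DirectSum.toModule k ℤ M f ∘ₗ V.decomp.toLinearMap

theorem ofPieces_homog (f : ∀ i, V.piece i →ₗ[k] M) (a : V.Homog) :
    ofPieces f a.2 = f a.1 a.2 := by
  rw [ofPieces, LinearMap.comp_apply, LinearEquiv.coe_coe, decomp_of, DirectSum.toModule_lof]

variable (V) in
/-- The component of degree `i`. -/
noncomputable def component (i : ℤ) : V.carrier →ₗ[k] V.carrier :=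
  (V.piece i).subtype ∘ₗ DirectSum.component k ℤ (fun i => V.piece i) i ∘ₗ V.decomp.toLinearMap

theorem component_mem (i : ℤ) (x : V.carrier) : V.component i x ∈ V.piece i := by
  rw [component, LinearMap.comp_apply]; exact Subtype.prop _

theorem component_of_mem {i : ℤ} {x : V.carrier} (hx : x ∈ V.piece i) : V.component i x = x := by
  have := decomp_of (V := V) ⟨i, x, hx⟩
  simp only at this
  rw [component, LinearMap.comp_apply, LinearMap.comp_apply, LinearEquiv.coe_coe, this,
    DirectSum.component.lof_self]
  rfl

theorem component_of_ne {i j : ℤ} (h : i ≠ j) {x : V.carrier} (hx : x ∈ V.piece i) :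
    V.component j x = 0 := by
  have := decomp_of (V := V) ⟨i, x, hx⟩
  simp only at this
  rw [component, LinearMap.comp_apply, LinearMap.comp_apply, LinearEquiv.coe_coe, this,
    DirectSum.component.of, dif_neg h, map_zero]

theorem sum_component (x : V.carrier) : ∃ s : Finset ℤ, x = ∑ i ∈ s, V.component i x := by
  classical
  have h : x = DirectSum.coeLinearMap V.piece (V.decomp x) :=
    ((LinearEquiv.ofBijective (DirectSum.coeLinearMap V.piece) V.isInternal).apply_symm_apply x).symm
  refine ⟨(V.decomp x).support, ?_⟩
  nth_rw 1 [h]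
  rw [DirectSum.coeLinearMap_eq_dfinsuppSum]
  rfl

theorem mem_of_component {S : Submodule k V.carrier} {x : V.carrier}
    (h : ∀ i, V.component i x ∈ S) : x ∈ S := by
  obtain ⟨s, hs⟩ := sum_component x
  rw [hs]
  exact Submodule.sum_mem _ fun i _ => h i

/-- A linear map of degree `e`. -/
def IsDeg (e : ℤ) (f : V.carrier →ₗ[k] W.carrier) : Prop :=
  ∀ a : V.Homog, f a.2 ∈ W.piece (a.1 + e)

theorem IsDeg.component_apply {e : ℤ} {f : V.carrier →ₗ[k] W.carrier} (hf : IsDeg e f) (i : ℤ)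
    (x : V.carrier) : W.component (i + e) (f x) = f (V.component i x) := by
  have : W.component (i + e) ∘ₗ f = f ∘ₗ V.component i := by
    refine hom_ext_homog fun a => ?_
    rw [LinearMap.comp_apply, LinearMap.comp_apply]
    by_cases h : a.1 = i
    · subst h
      rw [component_of_mem (hf a), component_of_mem a.2.2]
    · rw [component_of_ne h a.2.2, component_of_ne (by omega) (hf a), map_zero]
  exact LinearMap.congr_fun this x

theorem IsDeg.comp {e e' : ℤ} {U : GradedSpace.{u₁} k} {f : W.carrier →ₗ[k] U.carrier}
    {g : V.carrier →ₗ[k] W.carrier} (hf : IsDeg e f) (hg : IsDeg e' g) {n : ℤ} (hn : n = e' + e) :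
    IsDeg n (f ∘ₗ g) := by
  intro a
  have := hf ⟨_, g a.2, hg a⟩
  rw [hn, ← add_assoc]
  exact this

theorem IsDeg.sub {e : ℤ} {f g : V.carrier →ₗ[k] W.carrier} (hf : IsDeg e f) (hg : IsDeg e g) :
    IsDeg e (f - g) := fun a => Submodule.sub_mem _ (hf a) (hg a)

theorem IsDeg.one : IsDeg 0 (1 : Module.End k V.carrier) := fun a => by
  rw [add_zero]; exact a.2.2

/-- The part of degree `e` of a linear map. -/
theorem exists_part (f : V.carrier →ₗ[k] W.carrier) (e : ℤ) :
    ∃ g : V.carrier →ₗ[k] W.carrier, IsDeg e g ∧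
      ∀ a : V.Homog, g a.2 = W.component (a.1 + e) (f a.2) := by
  refine ⟨ofPieces fun i => W.component (i + e) ∘ₗ f ∘ₗ (V.piece i).subtype, fun a => ?_, fun a => ?_⟩
  · rw [ofPieces_homog]; exact component_mem _ _
  · rw [ofPieces_homog]; rfl

/-- The image of an idempotent of degree zero. -/
noncomputable def image (p : Module.End k V.carrier) (hp : IsDeg 0 p) : GradedSpace.{u} k where
  carrier := LinearMap.range p
  piece i := (V.piece i).submoduleOf (LinearMap.range p)
  isInternal := by
    rw [DirectSum.isInternal_submodule_iff_iSupIndep_and_iSup_eq_top]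
    constructor
    · intro i
      rw [Submodule.disjoint_def]
      intro x hx hx'
      have h : (⨆ j, ⨆ (_ : j ≠ i), (V.piece j).submoduleOf (LinearMap.range p)) ≤
          LinearMap.ker (V.component i ∘ₗ (LinearMap.range p).subtype) := by
        refine iSup₂_le fun j hj y hy => ?_
        exact component_of_ne hj hy
      have h1 : V.component i x = 0 := h hx'
      exact Subtype.ext ((component_of_mem (Submodule.mem_comap.mp hx)).symm.trans h1)
    · rw [eq_top_iff]
      rintro ⟨_, x, rfl⟩ -
      obtain ⟨s, hs⟩ := sum_component x
      have h : (⟨p x, x, rfl⟩ : LinearMap.range p) =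
          ∑ i ∈ s, ⟨p (V.component i x), V.component i x, rfl⟩ := by
        refine Subtype.ext ?_
        rw [AddSubmonoidClass.coe_finsetSum]
        simp only
        rw [← map_sum, ← hs]
      rw [h]
      refine Submodule.sum_mem _ fun i _ => Submodule.mem_iSup_of_mem i ?_
      have := hp ⟨i, _, component_mem i x⟩
      rw [add_zero] at this
      exact this

/-- A homotopy that contracts a complex onto its cohomology. -/
structure Contraction (V : GradedSpace.{u} k) (d : Module.End k V.carrier) where
  d_deg : IsDeg 1 d
  d_d : d * d = 0
  h : Module.End k V.carrier
  h_deg : IsDeg (-1) h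
  h_h : h * h = 0
  h_d_h : h * d * h = h
  d_h_d : d * h * d = d

/-- A linear section of d over its image, extended to the whole space and cut down to degree −1,
gives s with dsd = d. The side conditions on the homotopy are then arranged by algebra. -/
theorem exists_contraction {d : Module.End k V.carrier} (hd : IsDeg 1 d) (hdd : d * d = 0) :
    Nonempty (Contraction V d) := by
  obtain ⟨t, ht⟩ := (d.rangeRestrict).exists_rightInverse_of_surjective d.range_rangeRestrict
  obtain ⟨t', ht'⟩ := LinearMap.exists_extend t
  obtain ⟨s, hs, hs'⟩ := exists_part (V := V) (W := V) t' (-1)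
  have h0 : ∀ x, d (t' (d x)) = d x := by
    intro x
    have h1 : t' (d x) = t ⟨d x, x, rfl⟩ := LinearMap.congr_fun ht' ⟨d x, x, rfl⟩
    rw [h1]
    exact congr_arg Subtype.val (LinearMap.congr_fun ht ⟨d x, x, rfl⟩)
  have hds : d * s * d = d := by
    refine hom_ext_homog fun a => ?_
    have h1 := hs' ⟨_, d a.2, hd a⟩
    simp only at h1
    rw [Module.End.mul_apply, Module.End.mul_apply, h1, ← hd.component_apply, h0]
    exact component_of_mem (by have := hd a; rwa [add_assoc, add_assoc])
  have hds' : ∀ x : Module.End k V.carrier, d * (s * (d * x)) = d * x := fun x => by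
    rw [← mul_assoc, ← mul_assoc, hds]
  have hdd' : ∀ x : Module.End k V.carrier, d * (d * x) = 0 := fun x => by
    rw [← mul_assoc, hdd, zero_mul]
  have hds'' : d * (s * d) = d := by rw [← mul_assoc, hds]
  have h1 : IsDeg (-1) (s * d * s) := (hs.comp hd rfl).comp hs (by ring)
  -- The element t = sds satisfies tdt = t and dtd = d; the factor 1 − td, which annihilates t from
  -- the left, makes the square vanish.
  refine ⟨⟨hd, hdd, s * d * s * (1 - s * d * s * d), ?_, ?_, ?_, ?_⟩⟩
  · exact h1.comp (IsDeg.one.sub (h1.comp hd (by ring))) (by ring)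
  · simp only [mul_sub, sub_mul, mul_assoc, mul_one, hds', hds'', sub_self]
  · simp only [mul_sub, sub_mul, mul_assoc, mul_one, hds', hds'', hdd, mul_zero, sub_zero]
  · simp only [mul_sub, sub_mul, mul_assoc, mul_one, hds', hds'', hdd, mul_zero, sub_zero]

namespace Contraction

variable {d : Module.End k V.carrier} (c : Contraction V d)

/-- The projection onto the harmonic elements. -/
def pi : Module.End k V.carrier := 1 - d * c.h - c.h * d

theorem pi_d : c.pi * d = 0 := by
  rw [pi, sub_mul, sub_mul, c.d_h_d, mul_assoc, c.d_d, mul_zero, one_mul, sub_self, sub_zero]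

theorem d_pi : d * c.pi = 0 := by
  rw [pi, mul_sub, mul_sub, ← mul_assoc, c.d_d, zero_mul, ← mul_assoc, c.d_h_d, mul_one, sub_zero,
    sub_self]

theorem pi_h : c.pi * c.h = 0 := by
  rw [pi, sub_mul, sub_mul, c.h_d_h, mul_assoc, c.h_h, mul_zero, one_mul, sub_zero, sub_self]

theorem h_pi : c.h * c.pi = 0 := by
  rw [pi, mul_sub, mul_sub, ← mul_assoc, ← mul_assoc, c.h_h, zero_mul, c.h_d_h, mul_one, sub_self,
    sub_zero]

theorem pi_pi : c.pi * c.pi = c.pi := by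
  nth_rw 1 [pi]
  rw [sub_mul, sub_mul, mul_assoc, c.h_pi, mul_assoc, c.d_pi, one_mul, mul_zero, mul_zero, sub_zero,
    sub_zero]

theorem pi_deg : IsDeg 0 c.pi :=
  (IsDeg.one.sub (c.d_deg.comp c.h_deg (by ring))).sub (c.h_deg.comp c.d_deg (by ring))

/-- The harmonic elements. -/
noncomputable def H : GradedSpace.{u} k := image c.pi c.pi_deg

noncomputable def incl : c.H.carrier →ₗ[k] V.carrier := (LinearMap.range c.pi).subtype

noncomputable def proj : V.carrier →ₗ[k] c.H.carrier := c.pi.rangeRestrict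

theorem incl_proj : c.incl ∘ₗ c.proj = c.pi := rfl

theorem incl_injective : Function.Injective c.incl := Subtype.val_injective

theorem pi_incl : c.pi ∘ₗ c.incl = c.incl := by
  refine LinearMap.ext ?_
  rintro ⟨_, x, rfl⟩
  exact LinearMap.congr_fun c.pi_pi x

theorem proj_incl : c.proj ∘ₗ c.incl = LinearMap.id := by
  refine LinearMap.ext fun x => c.incl_injective ?_
  exact LinearMap.congr_fun c.pi_incl x

theorem d_incl : d ∘ₗ c.incl = 0 := by
  rw [← c.pi_incl, ← LinearMap.comp_assoc]
  exact (congr_arg (· ∘ₗ c.incl) c.d_pi).trans (LinearMap.zero_comp _)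

theorem proj_d : c.proj ∘ₗ d = 0 :=
  LinearMap.ext fun x => c.incl_injective (LinearMap.congr_fun c.pi_d x)

theorem proj_h : c.proj ∘ₗ c.h = 0 :=
  LinearMap.ext fun x => c.incl_injective (LinearMap.congr_fun c.pi_h x)

theorem incl_deg : IsDeg 0 c.incl := fun a => by
  rw [add_zero]; exact a.2.2

theorem proj_deg : IsDeg 0 c.proj := fun a => c.pi_deg a

theorem eq_of_closed {x : V.carrier} (hx : d x = 0) : x = c.pi x + d (c.h x) := by
  simp [pi, hx]

theorem incl_notMem_range {a : c.H.carrier} (ha : a ≠ 0) : c.incl a ∉ LinearMap.range d := by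
  rintro ⟨x, hx⟩
  refine ha ?_
  have h1 := LinearMap.congr_fun c.proj_d x
  rw [LinearMap.comp_apply, hx] at h1
  have h2 := LinearMap.congr_fun c.proj_incl a
  rw [LinearMap.comp_apply] at h2
  rw [← LinearMap.id_apply (R := k) a, ← h2, h1]
  rfl

theorem inducesIso : InducesIso (V := V) (W := c.H) d 0 c.proj := by
  constructor
  · rintro a ha ⟨x, hx⟩
    have h1 : c.proj a = 0 := hx.symm
    have h2 : c.pi a = 0 := by rw [← c.incl_proj, LinearMap.comp_apply, h1, map_zero]
    rw [c.eq_of_closed ha, h2, zero_add]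
    exact ⟨_, rfl⟩
  · intro b _
    refine ⟨c.incl b, LinearMap.congr_fun c.d_incl b, ?_⟩
    rw [← LinearMap.comp_apply, c.proj_incl, LinearMap.id_apply, sub_self]
    exact Submodule.zero_mem _

/-- A non-zero harmonic element is a cycle that is not a boundary, so each piece embeds into
cohomology. -/
theorem finiteDimensional (hf : FiniteCohomology (V := V) d) (i : ℤ) :
    FiniteDimensional k (c.H.piece i) := by
  let S := LinearMap.ker d ⊓ V.piece i
  have hS : ∀ a : c.H.piece i, c.incl a ∈ S := fun a =>
    ⟨LinearMap.congr_fun c.d_incl a, a.2⟩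
  let f : c.H.piece i →ₗ[k] S ⧸ (LinearMap.range d).submoduleOf S :=
    (Submodule.mkQ _) ∘ₗ LinearMap.codRestrict S (c.incl ∘ₗ (c.H.piece i).subtype) hS
  have := hf i
  refine FiniteDimensional.of_injective f ?_
  rw [← LinearMap.ker_eq_bot, LinearMap.ker_eq_bot']
  intro a ha
  have ha' : ((LinearMap.range d).submoduleOf S).mkQ ⟨c.incl a, hS a⟩ = 0 := ha
  have h1 : c.incl a ∈ LinearMap.range d := by
    rw [← LinearMap.mem_ker, Submodule.ker_mkQ] at ha'
    exact ha'
  by_contra hne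
  exact c.incl_notMem_range (fun h => hne (Subtype.ext h)) h1

end Contraction

end GradedSpace

/-! ### Non-degenerate forms -/

namespace SkewForm

variable {V : GradedSpace.{u} k} {N : ℤ}

theorem form_component (B : SkewForm V N) (a : V.Homog) (b : V.carrier) :
    B.form a.2 b = B.form a.2 (V.component (-a.1 - N) b) := by
  have : B.form a.2 = B.form a.2 ∘ₗ V.component (-a.1 - N) := by
    refine hom_ext_homog fun c => ?_
    rw [LinearMap.comp_apply]
    by_cases h : c.1 = -a.1 - N
    · rw [← h, component_of_mem c.2.2]
    · rw [component_of_ne h c.2.2, map_zero]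
      by_contra h1
      exact h (by have := B.degree a c h1; omega)
  exact LinearMap.congr_fun this b

theorem eq_zero_of_homog (B : SkewForm V N) (a : V.Homog) (h : ∀ b : V.Homog, B.form a.2 b.2 = 0) :
    (a.2 : V.carrier) = 0 := by
  have : a.2 = 0 := (B.nondegenerate a.1).1 (by
    refine LinearMap.ext fun b => ?_
    simp only [LinearMap.domRestrict_apply, ZeroMemClass.coe_zero, map_zero, LinearMap.zero_apply]
    exact h ⟨_, b⟩)
  rw [this]; rfl

/-- Non-degeneracy is given degree by degree. A homogeneous argument singles out one component of
the element, so the components can be tested separately. -/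
theorem form_injective (B : SkewForm V N) : Function.Injective B.form := by
  rw [← LinearMap.ker_eq_bot, LinearMap.ker_eq_bot']
  intro x hx
  suffices x ∈ (⊥ : Submodule k V.carrier) from this
  refine mem_of_component fun i => ?_
  refine B.eq_zero_of_homog ⟨i, _, component_mem i x⟩ fun b => ?_
  by_cases hb : b.1 = -i - N
  · obtain ⟨s, hs⟩ := sum_component x
    have h1 : ∀ j, j ≠ i → B.form (V.component j x) b.2 = 0 := fun j hj => by
      by_contra h
      have := B.degree ⟨j, _, component_mem j x⟩ b h
      simp only at this
      exact hj (by omega)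
    have h2 : B.form x b.2 = ∑ j ∈ s, B.form (V.component j x) b.2 := by
      nth_rw 1 [hs]
      rw [map_sum, LinearMap.sum_apply]
    rw [hx, LinearMap.zero_apply] at h2
    by_cases hi : i ∈ s
    · rw [Finset.sum_eq_single_of_mem i hi fun j _ hj => h1 j hj] at h2
      exact h2.symm
    · have : V.component i x = 0 := by
        have h3 := congr_arg (V.component i) hs
        rw [map_sum, Finset.sum_eq_zero fun j hj => ?_] at h3
        · exact h3
        · exact component_of_ne (by rintro rfl; exact hi hj) (component_mem j x)
      simp [this]
  · by_contra h
    have := B.degree ⟨i, _, component_mem i x⟩ b h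
    simp only at this
    exact hb (by omega)

/-- A functional supported in a single degree is represented by the form. -/
theorem exists_form_eq (B : SkewForm V N) (i : ℤ) (f : Module.Dual k V.carrier)
    (hf : ∀ b : V.Homog, f b.2 ≠ 0 → b.1 = -i - N) :
    ∃ a ∈ V.piece i, B.form a = f := by
  obtain ⟨a, ha⟩ := (B.nondegenerate i).2 (f.domRestrict (V.piece (-i - N)))
  refine ⟨a, a.2, hom_ext_homog fun b => ?_⟩
  by_cases hb : b.1 = -i - N
  · obtain ⟨j, b⟩ := b
    simp only at hb
    subst hb
    exact LinearMap.congr_fun ha b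
  · have h1 : f b.2 = 0 := by by_contra h; exact hb (hf b h)
    have h2 : B.form a b.2 = 0 := by
      by_contra h
      have := B.degree ⟨i, a⟩ b h
      simp only at this
      exact hb (by omega)
    rw [h1, h2]

/-- With respect to a form that is compatible with a differential, only boundaries are
orthogonal to all cycles. -/
theorem mem_range (B : SkewForm V N) {d : V.carrier →ₗ[k] V.carrier} (hd : IsDeg 1 d)
    (hB : ∀ v w : V.Homog, B.form (d v.2) w.2 = -(sgn k v.1 * B.form v.2 (d w.2)))
    {y : V.carrier} (hy : ∀ w, d w = 0 → B.form y w = 0) : y ∈ LinearMap.range d := by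
  refine mem_of_component fun i => ?_
  set z : V.Homog := ⟨i, _, component_mem i y⟩ with hz
  have hBz : ∀ w, B.form z.2 w = B.form y (V.component (-i - N) w) := by
    intro w
    rw [B.form_component z]
    obtain ⟨s, hs⟩ := sum_component y
    have key : ∀ j, j ≠ i →
        B.form (V.component j y) (V.component (-i - N) w) = 0 := fun j hj => by
      by_contra h
      have := B.degree ⟨j, _, component_mem j y⟩ ⟨_, _, component_mem (-i - N) w⟩ h
      simp only at this
      exact hj (by omega)
    have h2 : B.form y (V.component (-i - N) w) =
        ∑ j ∈ s, B.form (V.component j y) (V.component (-i - N) w) := by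
      nth_rw 1 [hs]
      rw [map_sum, LinearMap.sum_apply]
    rw [h2]
    by_cases hi : i ∈ s
    · rw [Finset.sum_eq_single_of_mem i hi fun j _ hj => key j hj]
    · have : V.component i y = 0 := by
        have h3 := congr_arg (V.component i) hs
        rw [map_sum, Finset.sum_eq_zero fun j hj => ?_] at h3
        · exact h3
        · exact component_of_ne (by rintro rfl; exact hi hj) (component_mem j y)
      rw [Finset.sum_eq_zero fun j hj => key j (by rintro rfl; exact hi hj)]
      have hz' : (z.2 : V.carrier) = 0 := this
      rw [hz', map_zero, LinearMap.zero_apply]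
  have hker : ∀ w, d w = 0 → B.form z.2 w = 0 := by
    intro w hw
    rw [hBz]
    refine hy _ ?_
    rw [← hd.component_apply, hw, map_zero]
  obtain ⟨t, ht⟩ := (d.rangeRestrict).exists_rightInverse_of_surjective d.range_rangeRestrict
  -- The rule dw ↦ B(z, w) is well defined on boundaries since z is orthogonal to cycles; `f`
  -- extends it to the whole space.
  obtain ⟨f, hf⟩ := LinearMap.exists_extend (p := LinearMap.range d) (B.form z.2 ∘ₗ t)
  have hfd : ∀ w, f (d w) = B.form z.2 w := by
    intro w
    have h1 : f (d w) = B.form z.2 (t ⟨d w, w, rfl⟩) := LinearMap.congr_fun hf ⟨d w, w, rfl⟩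
    rw [h1, ← sub_eq_zero, ← map_sub]
    refine hker _ ?_
    rw [map_sub, sub_eq_zero]
    exact congr_arg Subtype.val (LinearMap.congr_fun ht ⟨d w, w, rfl⟩)
  -- Restricted to the single degree that matters, `f` is represented by an element a of degree i −
  -- 1. Compatibility of the form with d then makes da equal to z up to sign.
  obtain ⟨a, ha, hBa⟩ := B.exists_form_eq (i - 1) (f ∘ₗ V.component (-(i - 1) - N)) fun b hb => by
    by_contra h
    exact hb (by rw [LinearMap.comp_apply, component_of_ne h b.2.2, map_zero])
  have h3 : B.form (d a) = -(sgn k (i - 1) • B.form z.2) := by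
    refine hom_ext_homog fun w => ?_
    have h4 := hB ⟨i - 1, a, ha⟩ w
    simp only at h4
    rw [h4, hBa, LinearMap.comp_apply, LinearMap.neg_apply, LinearMap.smul_apply, smul_eq_mul]
    by_cases hw : w.1 = -i - N
    · have hw' : w.1 + 1 = -(i - 1) - N := by omega
      rw [← hw', component_of_mem (hd w), hfd]
    · rw [component_of_ne (by omega) (hd w), map_zero]
      have : B.form z.2 w.2 = 0 := by
        by_contra h
        have := B.degree z w h
        simp only [hz] at this
        exact hw (by omega)
      rw [this]
  have h5 : z.2 = d (-(sgn k (i - 1) • a)) := by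
    refine B.form_injective ?_
    rw [map_neg, map_neg, map_smul, map_smul, h3, smul_neg, neg_neg, smul_smul, sgn_mul_self, one_smul]
  exact ⟨_, h5.symm⟩

/-- Otherwise g a would be orthogonal to every cycle, because each cycle is some g b up to a
boundary and the cycle g a is orthogonal to boundaries. Then g a is a boundary by `mem_range`, so a
is one as well. -/
theorem exists_ne_zero_of_inducesIso (B : SkewForm V N) {C : GradedSpace.{w} k}
    {d : V.carrier →ₗ[k] V.carrier} (hd : IsDeg 1 d)
    (hB : ∀ v w : V.Homog, B.form (d v.2) w.2 = -(sgn k v.1 * B.form v.2 (d w.2)))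
    {d' : C.carrier →ₗ[k] C.carrier} {g : C.carrier →ₗ[k] V.carrier} (hg : InducesIso d' d g)
    (hcomm : ∀ x, d (g x) = g (d' x)) {a : C.carrier} (ha : d' a = 0)
    (ha' : a ∉ LinearMap.range d') : ∃ b, d' b = 0 ∧ B.form (g a) (g b) ≠ 0 := by
  by_contra! h
  have hex : ∀ x w, B.form (d x) w = -B.form (V.par x) (d w) := by
    intro x w
    have : B.form ∘ₗ d = -(((B.form ∘ₗ V.par).compl₂ d)) :=
      hom_ext_homog fun v => hom_ext_homog fun w => by
        rw [LinearMap.comp_apply, hB, LinearMap.neg_apply, LinearMap.neg_apply,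
          LinearMap.compl₂_apply, LinearMap.comp_apply, par_homog, map_smul, LinearMap.smul_apply,
          smul_eq_mul]
    exact LinearMap.congr_fun (LinearMap.congr_fun this x) w
  refine ha' (hg.1 a ha (B.mem_range hd hB fun w hw => ?_))
  obtain ⟨b, hb, u, hu⟩ := hg.2 w hw
  rw [← sub_add_cancel w (g b), ← hu, map_add, h b hb, add_zero]
  have h1 := hex (V.par (g a)) u
  have h2 := LinearMap.congr_fun (par_comp_par (V := V)) (g a)
  simp only [LinearMap.comp_apply, LinearMap.id_apply] at h2
  rw [h2] at h1
  have h3 : d (V.par (g a)) = 0 := by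
    have : d ∘ₗ V.par = -(V.par ∘ₗ d) := hom_ext_homog fun v => by
      rw [LinearMap.comp_apply, par_homog, map_smul, LinearMap.neg_apply, LinearMap.comp_apply,
        par_of_mem (hd v), sgn_add, sgn_one, mul_neg, mul_one, neg_smul, neg_neg]
    have h4 := LinearMap.congr_fun this (g a)
    simp only [LinearMap.comp_apply, LinearMap.neg_apply] at h4
    rw [h4, hcomm, ha, map_zero, map_zero, neg_zero]
  rw [h3, map_zero, LinearMap.zero_apply] at h1
  exact neg_eq_zero.mp h1.symm

/-- On a space with finite dimensional pieces, injectivity suffices for non-degeneracy. -/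
noncomputable def ofInjective (form : V.carrier →ₗ[k] Module.Dual k V.carrier)
    (degree : ∀ a b : V.Homog, form a.2 b.2 ≠ 0 → a.1 + b.1 + N = 0)
    (skew : ∀ a b : V.Homog, form a.2 b.2 = -((a.1 * b.1).negOnePow • form b.2 a.2))
    (hf : ∀ i, FiniteDimensional k (V.piece i))
    (inj : ∀ a : V.Homog, (∀ b : V.Homog, form a.2 b.2 = 0) → a.2 = 0) : SkewForm V N where
  form := form
  degree := degree
  skew := skew
  nondegenerate i := by
    let T : ∀ i : ℤ, V.piece i →ₗ[k] Module.Dual k (V.piece (-i - N)) := fun i =>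
      LinearMap.domRestrict' (V.piece (-i - N)) ∘ₗ form ∘ₗ (V.piece i).subtype
    have hT : ∀ i, Function.Injective (T i) := by
      intro i
      rw [← LinearMap.ker_eq_bot, LinearMap.ker_eq_bot']
      intro a ha
      refine inj ⟨i, a⟩ fun b => ?_
      by_contra h
      have h1 := degree _ _ h
      obtain ⟨j, b⟩ := b
      obtain rfl : j = -i - N := by simp only at h1; omega
      exact h (LinearMap.congr_fun ha b)
    -- Injectivity in the complementary degrees i and −i − N bounds the dimension of each piece by
    -- that of the other, so they agree and injectivity gives surjectivity.
    have h1 := LinearMap.finrank_le_finrank_of_injective (hT i)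
    have h2 := LinearMap.finrank_le_finrank_of_injective (hT (-i - N))
    rw [Subspace.dual_finrank_eq] at h1 h2
    rw [show -(-i - N) - N = i by ring] at h2
    exact ⟨hT i, (LinearMap.injective_iff_surjective_of_finrank_eq_finrank
      (by rw [Subspace.dual_finrank_eq]; omega)).mp (hT i)⟩

end SkewForm

/-- A form on a complex that is non-degenerate on cohomology restricts to a non-degenerate form on
the harmonic elements. -/
theorem GradedSpace.Contraction.exists_skewForm {V : GradedSpace.{u} k} {N : ℤ}
    {d : Module.End k V.carrier} (c : Contraction V d)
    (hfin : FiniteCohomology (V := V) d) (φ : V.carrier →ₗ[k] Module.Dual k V.carrier)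
    (degree : ∀ a b : V.Homog, φ a.2 b.2 ≠ 0 → a.1 + b.1 + N = 0)
    (skew : ∀ a b : V.Homog, φ a.2 b.2 = -((a.1 * b.1).negOnePow • φ b.2 a.2))
    (closed : ∀ v w : V.Homog, φ (d v.2) w.2 = -(sgn k v.1 * φ v.2 (d w.2)))
    (nondeg : ∀ a, d a = 0 → a ∉ LinearMap.range d → ∃ b, d b = 0 ∧ φ a b ≠ 0) :
    ∃ B : SkewForm c.H N, ∀ a b, B.form a b = φ (c.incl a) (c.incl b) := by
  have hmem : ∀ a : c.H.Homog, c.incl a.2 ∈ V.piece a.1 := fun a => a.2.2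
  refine ⟨SkewForm.ofInjective ((φ ∘ₗ c.incl).compl₂ c.incl)
    (fun a b => degree ⟨_, _, hmem a⟩ ⟨_, _, hmem b⟩) (fun a b => skew ⟨_, _, hmem a⟩ ⟨_, _, hmem b⟩)
    (c.finiteDimensional hfin) fun a ha => ?_, fun a b => rfl⟩
  by_contra hne
  have hda : d (c.incl a.2) = 0 := LinearMap.congr_fun c.d_incl a.2
  obtain ⟨b, hb, hab⟩ := nondeg (c.incl a.2) hda
    (c.incl_notMem_range fun h => hne (Subtype.ext h))
  refine hab ?_
  have h1 : (φ ∘ₗ c.incl).compl₂ c.incl a.2 = 0 := hom_ext_homog ha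
  -- Harmonic elements are orthogonal to boundaries. A cycle that detects a may therefore be
  -- replaced by its harmonic part.
  have h2 : φ (c.incl a.2) ∘ₗ d = 0 := hom_ext_homog fun w => by
    have := closed ⟨_, _, hmem a⟩ w
    simp only at this
    rw [hda, map_zero, LinearMap.zero_apply, eq_comm, neg_eq_zero] at this
    rw [LinearMap.comp_apply, LinearMap.zero_apply]
    have h := congr_arg (sgn k a.1 * ·) this
    simpa only [← mul_assoc, sgn_mul_self, one_mul, mul_zero] using h
  rw [c.eq_of_closed hb, map_add]
  have h3 := LinearMap.congr_fun h1 (c.proj b)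
  have h4 := LinearMap.congr_fun h2 (c.h b)
  rw [LinearMap.compl₂_apply, LinearMap.comp_apply, ← LinearMap.comp_apply c.incl, c.incl_proj,
    LinearMap.zero_apply] at h3
  rw [LinearMap.comp_apply, LinearMap.zero_apply] at h4
  rw [h3, h4, add_zero]

end Linear

/-! ### Homological perturbation for bimodules -/

section BimoduleTransfer

open GradedSpace GappingMonoid BiOp

variable {k : Type v} [Field k] {G : GappingMonoid} {V : GradedSpace.{u} k}
variable {C : GradedSpace.{u₁} k} {C' : GradedSpace.{u₂} k} {D : GradedSpace.{u₃} k}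
variable {E M W W' : Type*} [AddCommGroup E] [Module k E]
  [AddCommGroup M] [Module k M] [AddCommGroup W] [Module k W] [AddCommGroup W'] [Module k W']

namespace BiFam

/-- The family vanishes on all arguments of weight less than `n`. -/
def BSmall (n : ℕ) (f : BiFam G V E M) : Prop :=
  ∀ (β : G.Elt) (x : List V.Homog) (v : E) (y : List V.Homog),
    wt β (x.length + y.length) < n → f β (word x) v (word y) = 0

theorem BSmall.zero_left (f : BiFam G V E M) : BSmall 0 f := fun _ _ _ _ h => absurd h (by omega)

theorem BSmall.mono {n n' : ℕ} {f : BiFam G V E M} (h : BSmall n f) (hn : n' ≤ n) : BSmall n' f :=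
  fun β x v y hx => h β x v y (by omega)

theorem BSmall.add {n : ℕ} {f g : BiFam G V E M} (hf : BSmall n f) (hg : BSmall n g) :
    BSmall n (f + g) := fun β x v y hx => by
  rw [Pi.add_apply, LinearMap.add_apply, LinearMap.add_apply, LinearMap.add_apply, hf β x v y hx,
    hg β x v y hx, add_zero]

theorem BSmall.neg {n : ℕ} {f : BiFam G V E M} (hf : BSmall n f) : BSmall n (-f) :=
  fun β x v y hx => by
    rw [Pi.neg_apply, LinearMap.neg_apply, LinearMap.neg_apply, LinearMap.neg_apply, hf β x v y hx,
      neg_zero]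

theorem BSmall.sub {n : ℕ} {f g : BiFam G V E M} (hf : BSmall n f) (hg : BSmall n g) :
    BSmall n (f - g) := by rw [sub_eq_add_neg]; exact hf.add hg.neg

theorem eq_zero_of_bSmall {f : BiFam G V C.carrier M} (h : ∀ n, BSmall n f) : f = 0 :=
  ext_word fun β x v y => h _ β x v.2 y (Nat.lt_succ_self _)

theorem wt_split_take {β : G.Elt} {p : G.Elt × G.Elt} (hp : p ∈ decomps β) (x y : List V.Homog)
    (i j : ℕ) : wt p.1 ((x.take i).length + (y.drop j).length) +
      wt p.2 ((x.drop i).length + (y.take j).length) ≤ wt β (x.length + y.length) := by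
  have h1 := congr_arg List.length (List.take_append_drop i x)
  have h2 := congr_arg List.length (List.take_append_drop j y)
  rw [List.length_append] at h1 h2
  have := wt_split hp ((x.take i).length + (y.drop j).length) ((x.drop i).length + (y.take j).length)
  refine this.trans (le_of_eq (congr_arg _ ?_))
  omega

theorem BSmall.mul {n n' : ℕ} {f : BiFam G V E M} {g : BiFam G V W E} (hf : BSmall n f)
    (hg : BSmall n' g) : BSmall (n + n') (fmul f g) := by
  intro β x v y hx
  rw [fmul_word]
  refine Finset.sum_eq_zero fun p hp => Finset.sum_eq_zero fun i _ => Finset.sum_eq_zero fun j _ => ?_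
  have := wt_split_take hp x y i j
  rcases lt_or_ge (wt p.1 ((x.take i).length + (y.drop j).length)) n with h | h
  · exact hf _ _ _ _ h
  · beta_reduce
    rw [hg p.2 _ _ _ (by omega), map_zero, LinearMap.zero_apply]

theorem BSmall.mul_left {n : ℕ} {f : BiFam G V E M} (g : BiFam G V W E) (hf : BSmall n f) :
    BSmall n (fmul f g) := hf.mul (BSmall.zero_left g)

theorem BSmall.mul_right {n : ℕ} (f : BiFam G V E M) {g : BiFam G V W E} (hg : BSmall n g) :
    BSmall n (fmul f g) := by
  have := (BSmall.zero_left f).mul hg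
  rwa [zero_add] at this

theorem BSmall.sL {n : ℕ} {f : BiFam G V E M} (hf : BSmall n f) : BSmall n (fsL f) := by
  intro β x v y hx
  rw [fsL, sL_word, hf β x v y hx, smul_zero]

theorem BSmall.pair [CharZero k] {n n' : ℕ} {B : W →ₗ[k] W' →ₗ[k] k} {K : BiFam G V C.carrier W}
    {F : BiFam G V C'.carrier W'} (hK : BSmall n K) (hF : BSmall n' F) :
    BSmall (n + n') (fpair B K F) := by
  suffices ∀ (β : G.Elt) (x : List V.Homog) (y : List V.Homog),
      wt β (x.length + y.length) < n + n' → ((fpair B K F β (word x)).flip (word y)) = 0 from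
    fun β x v y hx => LinearMap.congr_fun (this β x y hx) v
  intro β x y hx
  refine hom_ext_homog fun v => hom_ext_homog fun c => ?_
  rw [LinearMap.flip_apply, fpair_word]
  refine Finset.sum_eq_zero fun p hp => Finset.sum_eq_zero fun i _ => Finset.sum_eq_zero fun j _ => ?_
  have h1 := congr_arg List.length (List.take_append_drop i x)
  have h2 := congr_arg List.length (List.take_append_drop j y)
  rw [List.length_append] at h1 h2
  have := wt_split hp ((x.drop i).length + (y.take j).length) ((y.drop j).length + (x.take i).length)
  rw [show (x.drop i).length + (y.take j).length + ((y.drop j).length + (x.take i).length) =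
    x.length + y.length by omega] at this
  rcases lt_or_ge (wt p.1 ((x.drop i).length + (y.take j).length)) n with h | h
  · beta_reduce
    rw [hK _ _ _ _ h, map_zero, LinearMap.zero_apply, mul_zero]
  · beta_reduce
    rw [hF p.2 _ _ _ (by omega), map_zero, mul_zero]

theorem bSmall_one {f : BiFam G V E M} (h : (f 0).core = 0) : BSmall 1 f := by
  intro β x v y hx
  have hβ : β = 0 := by
    by_contra hβ
    have := ord_pos hβ
    unfold wt at hx
    omega
  subst hβ
  have hl : x.length + y.length < 1 := by unfold wt at hx; omega
  obtain rfl : x = [] := List.length_eq_zero_iff.mp (by omega)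
  obtain rfl : y = [] := List.length_eq_zero_iff.mp (by omega)
  rw [word_nil]
  exact LinearMap.congr_fun h v

theorem BSmall.core {f : BiFam G V E M} (h : BSmall 1 f) : (f 0).core = 0 := by
  refine LinearMap.ext fun v => ?_
  have := h 0 [] v [] (by simp [wt, ord_zero])
  rwa [word_nil] at this

theorem core_fconst (f : E →ₗ[k] M) : (fconst (G := G) (V := V) f 0).core = f := by
  refine LinearMap.ext fun v => ?_
  rw [fconst, single_zero]
  exact const_one f v

theorem core_fmul (f : BiFam G V E M) (g : BiFam G V W E) :
    (fmul f g 0).core = (f 0).core ∘ₗ (g 0).core := by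
  refine LinearMap.ext fun v => ?_
  have := fmul_word f g 0 [] v []
  rw [decomps_zero, Finset.sum_singleton, sumSplit_nil, sumSplit_nil, word_nil] at this
  exact this

/-- A contraction with respect to the weight has a fixed point. -/
theorem exists_fixed_of_bSmall (e : ℤ) (n : ℕ)
    (Φ : BiFam G V C.carrier D.carrier → BiFam G V C.carrier D.carrier)
    (hP : ∀ f, BiDeg e f → BSmall n f → BiDeg e (Φ f) ∧ BSmall n (Φ f))
    (h : ∀ j f g, BSmall n f → BSmall n g → BSmall j (f - g) → BSmall (j + 1) (Φ f - Φ g)) :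
    ∃ f, (BiDeg e f ∧ BSmall n f) ∧ Φ f = f := by
  have hom : ∀ {j : ℕ} {f g : BiFam G V C.carrier D.carrier}, (∀ (β : G.Elt) (x : List V.Homog)
      (c : C.Homog) (y : List V.Homog), wt β (x.length + y.length) < j →
        f β (word x) c.2 (word y) = g β (word x) c.2 (word y)) → BSmall j (f - g) := by
    intro j f g h β x v y hx
    have : (((f - g) β (word x)).flip (word y)) = 0 :=
      hom_ext_homog fun v => sub_eq_zero.mpr (h β x v y hx)
    exact LinearMap.congr_fun this v
  refine BiFam.exists_fixed_point (fun f => BiDeg e f ∧ BSmall n f) (fun f hf => ⟨?_, ?_⟩)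
    ⟨fun _ _ _ _ => Submodule.zero_mem _, fun _ _ _ _ _ => rfl⟩ Φ (fun f hf => hP f hf.1 hf.2)
    fun j f g hf hg hfg β x c y hx => ?_
  · intro β x v y
    obtain ⟨g, hg, hfg⟩ := hf (wt β (x.length + y.length) + 1)
    rw [hfg β x v y (Nat.lt_succ_self _)]
    exact hg.1 β x v y
  · intro β x v y hx
    obtain ⟨g, hg, hfg⟩ := hf (wt β (x.length + y.length) + 1)
    have := hom hfg β x v y (Nat.lt_succ_self _)
    rw [Pi.sub_apply, LinearMap.sub_apply, LinearMap.sub_apply, LinearMap.sub_apply,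
      hg.2 β x v y hx, sub_zero] at this
    exact this
  · exact sub_eq_zero.mp (h j f g hf.2 hg.2 (hom hfg) β x c.2 y hx)

theorem fhat_fconst_fmul {m : Coch G V V.carrier} (hm : CoDeg 1 m) (f : D.carrier →ₗ[k] M)
    {X : BiFam G V C.carrier D.carrier} (hX : BiDeg 1 X) (b : BiFam G V C.carrier C.carrier) :
    fhat m (fmul (fconst f) X) b = fmul (fconst f) (fhat m X b) := by
  simp only [fhat, finsL_fmul hm, finsR_fmul_odd hm _ hX odd_one, finsL_fconst hm, finsR_fconst hm,
    fsL_fmul, fsL_fconst, zero_fmul, neg_zero, zero_add, fmul_add_right, fmul_assoc]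

theorem BiDeg.sL {e : ℤ} {f : BiFam G V C.carrier D.carrier} (hf : BiDeg e f) : BiDeg e (fsL f) := by
  intro β x v y
  rw [fsL, sL_word]
  exact Submodule.smul_mem _ _ (hf β x v y)

theorem fconst_sub (f g : E →ₗ[k] M) :
    fconst (G := G) (V := V) (f - g) = fconst f - fconst g := by
  funext β
  rw [fconst, fconst, fconst, Pi.sub_apply]
  by_cases hβ : β = 0
  · subst hβ; rw [single_zero, single_zero, single_zero, map_sub]
  · rw [single_of_ne _ hβ, single_of_ne _ hβ, single_of_ne _ hβ, sub_zero]

theorem fconst_zero : fconst (G := G) (V := V) (0 : E →ₗ[k] M) = 0 := by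
  have := fconst_sub (G := G) (V := V) (0 : E →ₗ[k] M) 0
  simpa using this

theorem BiDeg.mul_eq {e e' n : ℤ} {f : BiFam G V D.carrier C'.carrier}
    {g : BiFam G V C.carrier D.carrier} (hf : BiDeg e f) (hg : BiDeg e' g) (hn : e + e' = n) :
    BiDeg n (fmul f g) := hn ▸ hf.mul hg

section Perturbation

variable {m : Coch G V V.carrier} {d : Module.End k C.carrier} (c : Contraction C d)
  {b b' : BiFam G V C.carrier C.carrier}

theorem fconst_pi : fconst (G := G) (V := V) c.pi = fconst LinearMap.id -
    fmul (fconst d) (fconst c.h) - fmul (fconst c.h) (fconst d) := by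
  rw [fconst_fmul_fconst, fconst_fmul_fconst, ← fconst_sub, ← fconst_sub]; rfl

theorem fconst_d_d (c : Contraction C d) : fmul (fconst (G := G) (V := V) d) (fconst d) = 0 := by
  rw [fconst_fmul_fconst]; exact (congr_arg fconst c.d_d).trans fconst_zero

/-- The bimodule relation rewritten for the perturbation b' = b − d, using d² = 0. -/
theorem fhat_perturbation (c : Contraction C d) (hm : CoDeg 1 m) (hbb : fhat m b b = 0) (hbb' : b = fconst d + b') :
    fhat m b' b = -fmul (fconst d) b' := by
  have h1 : fmul (fconst d) b = fmul (fconst d) b' := by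
    rw [hbb', fmul_add_right, fconst_d_d c, zero_add]
  have h2 : b' = b - fconst d := by rw [hbb']; abel
  nth_rw 1 [h2]
  rw [fhat_sub, hbb, fhat_fconst hm, h1, zero_sub]

/-- The inclusion of the harmonic elements extends to a homomorphism. -/
theorem exists_incl (hm : CoDeg 1 m) (hs' : BSmall 1 b') (hdeg' : BiDeg 1 b')
    (hbb : fhat m b b = 0) (hbb' : b = fconst d + b') :
    ∃ i : BiFam G V c.H.carrier C.carrier, BiDeg 0 i ∧
      fconst c.incl - fmul (fconst c.h) (fmul b' i) = i ∧
      fmul (fconst c.proj) i = fconst LinearMap.id ∧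
      fhat m i (fmul (fconst c.proj) (fmul b' i)) = fmul b i := by
  have hfb' := fhat_perturbation c hm hbb hbb'
  have hpi := fconst_pi (G := G) (V := V) c
  have hI : BiDeg 0 (fconst (G := G) (V := V) c.incl) := BiDeg.const c.incl_deg
  have hh : BiDeg (-1) (fconst (G := G) (V := V) c.h) := BiDeg.const c.h_deg
  -- The perturbation series with terms (−h b')^n applied to the inclusion, in closed form.
  obtain ⟨i, ⟨hi, -⟩, hi'⟩ := exists_fixed_of_bSmall (G := G) (V := V) (C := c.H) (D := C) 0 0
    (fun i => fconst c.incl - fmul (fconst c.h) (fmul b' i))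
    (fun f hf _ => ⟨hI.sub (hh.mul_eq (hdeg'.mul_eq hf rfl) rfl), BSmall.zero_left _⟩) (by
      intro j f g _ _ hfg
      have e : fconst c.incl - fmul (fconst c.h) (fmul b' f) -
          (fconst c.incl - fmul (fconst c.h) (fmul b' g)) =
          -fmul (fconst c.h) (fmul b' (f - g)) := by
        simp only [fmul_sub_right]; abel
      rw [e, add_comm]
      exact ((hs'.mul hfg).mul_right _).neg)
  obtain ⟨bH, hbH⟩ : ∃ bH, bH = fmul (fconst c.proj) (fmul b' i) := ⟨_, rfl⟩
  have hdI : fmul (fconst (G := G) (V := V) d) (fconst c.incl) = 0 := by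
    rw [fconst_fmul_fconst, c.d_incl, fconst_zero]
  have hPi : fmul (fconst c.proj) i = fconst LinearMap.id := by
    rw [← hi', fmul_sub_right, ← fmul_assoc, fconst_fmul_fconst, fconst_fmul_fconst, c.proj_incl,
      c.proj_h, fconst_zero, zero_fmul, sub_zero]
  have hi_hom : fhat m i bH = fmul b i := by
    -- The defect e of the homomorphism relation. The equation for i, together with dh + hd = 1 − π,
    -- expresses e through h b' e with signs; this raises its order, so e = 0.
    obtain ⟨e, he⟩ : ∃ e, e = fhat m i bH - fmul b i := ⟨_, rfl⟩
    have h1 : fhat m (fmul b' i) bH = -fmul (fconst d) (fmul b' i) + fmul (fsL b') e := by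
      rw [fhat_fmul hm _ hi bH b, hfb', fmul_neg_left, fmul_assoc, ← he]
    have h2 : fhat m i bH = fmul (fconst c.incl) bH +
        fmul (fconst c.h) (fmul (fconst d) (fmul b' i)) -
          fmul (fconst c.h) (fmul (fsL b') e) := by
      nth_rw 1 [← hi']
      rw [fhat_sub, fhat_fconst hm, fhat_fconst_fmul hm _ (hdeg'.mul_eq hi rfl), h1, fmul_add_right,
        fmul_neg_right]
      abel
    have h3 : fmul b i = -fmul (fconst d) (fmul (fconst c.h) (fmul b' i)) + fmul b' i := by
      rw [hbb', fmul_add_left]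
      refine congr_arg (· + fmul b' i) ?_
      nth_rw 1 [← hi']
      rw [fmul_sub_right, hdI, zero_sub]
    have h4 : fmul (fconst c.incl) bH = fmul b' i - fmul (fconst d) (fmul (fconst c.h) (fmul b' i)) -
        fmul (fconst c.h) (fmul (fconst d) (fmul b' i)) := by
      rw [hbH, ← fmul_assoc, fconst_fmul_fconst, c.incl_proj, hpi, fmul_sub_left, fmul_sub_left,
        one_fmul, fmul_assoc, fmul_assoc]
    have h5 : e = -fmul (fconst c.h) (fmul (fsL b') e) := by
      nth_rw 1 [he]
      rw [h2, h3, h4]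
      abel
    have h6 : e = 0 := eq_zero_of_bSmall fun n => by
      induction n with
      | zero => exact BSmall.zero_left _
      | succ n ih =>
        rw [h5, add_comm]
        exact ((hs'.sL.mul ih).mul_right _).neg
    rw [h6] at he
    exact (sub_eq_zero.mp he.symm)
  exact ⟨i, hi, hi', hPi, by rw [← hbH]; exact hi_hom⟩

/-- The projection to the harmonic elements extends to a homomorphism. -/
theorem exists_proj (hm : CoDeg 1 m) (hs' : BSmall 1 b') (hdeg' : BiDeg 1 b')
    (hbb : fhat m b b = 0) (hbb' : b = fconst d + b') {i : BiFam G V c.H.carrier C.carrier}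
    (hi' : fconst c.incl - fmul (fconst c.h) (fmul b' i) = i)
    {bH : BiFam G V c.H.carrier c.H.carrier} (hbH : bH = fmul (fconst c.proj) (fmul b' i)) :
    ∃ p : BiFam G V C.carrier c.H.carrier, BiDeg 0 p ∧
      fconst c.proj - fmul p (fmul (fsL b') (fconst c.h)) = p ∧ fhat m p b = fmul bH p := by
  have hfb' := fhat_perturbation c hm hbb hbb'
  have hpi := fconst_pi (G := G) (V := V) c
  have hdd := fconst_d_d (G := G) (V := V) c
  have hP : BiDeg 0 (fconst (G := G) (V := V) c.proj) := BiDeg.const c.proj_deg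
  have hh : BiDeg (-1) (fconst (G := G) (V := V) c.h) := BiDeg.const c.h_deg
  -- The mirror perturbation series. The twist `fsL b'` appears because b' is now composed with the
  -- odd map h on its right.
  obtain ⟨p, ⟨hp, -⟩, hp'⟩ := exists_fixed_of_bSmall (G := G) (V := V) (C := C) (D := c.H) 0 0
    (fun p => fconst c.proj - fmul p (fmul (fsL b') (fconst c.h)))
    (fun f hf _ => ⟨hP.sub (hf.mul_eq (hdeg'.sL.mul_eq hh rfl) rfl), BSmall.zero_left _⟩) (by
      intro j f g _ _ hfg
      have e : fconst c.proj - fmul f (fmul (fsL b') (fconst c.h)) -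
          (fconst c.proj - fmul g (fmul (fsL b') (fconst c.h))) =
          -fmul (f - g) (fmul (fsL b') (fconst c.h)) := by
        simp only [fmul_sub_left]; abel
      rw [e]
      exact (hfg.mul (hs'.sL.mul_left _)).neg)
  have hsp : fsL p = fconst c.proj - fmul (fsL p) (fmul b' (fconst c.h)) := by
    nth_rw 1 [← hp']
    have : fsL (fconst c.proj - fmul p (fmul (fsL b') (fconst c.h))) =
        fsL (fconst c.proj) - fsL (fmul p (fmul (fsL b') (fconst c.h))) :=
      funext fun _ => map_sub BiOp.sL _ _
    rw [this, fsL_fconst, fsL_fmul, fsL_fmul, fsL_fsL, fsL_fconst]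
  have hPb : ∀ X : BiFam G V C.carrier C.carrier, fmul (fconst c.proj) X =
      fmul (fsL p) X + fmul (fsL p) (fmul b' (fmul (fconst c.h) X)) := by
    intro X
    have : fconst c.proj = fsL p + fmul (fsL p) (fmul b' (fconst c.h)) := by
      nth_rw 1 [hsp]; abel
    rw [this, fmul_add_left, fmul_assoc, fmul_assoc]
  -- The transferred structure can equally be computed from p: both expressions are the double
  -- series with b' h b' … b' between projection and inclusion.
  have hbH' : bH = fmul (fsL p) (fmul b' (fconst c.incl)) := by
    have h1 : fconst c.proj = fsL p + fmul (fsL p) (fmul b' (fconst c.h)) := by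
      nth_rw 1 [hsp]; abel
    have h2 : fconst c.incl = i + fmul (fconst c.h) (fmul b' i) := by
      nth_rw 1 [← hi']; abel
    rw [hbH, h1, h2, fmul_add_left, fmul_add_right, fmul_add_right, fmul_assoc, fmul_assoc]
  have hp_hom : fhat m p b = fmul bH p := by
    obtain ⟨e, he⟩ : ∃ e, e = fhat m p b - fmul bH p := ⟨_, rfl⟩
    obtain ⟨g, hg⟩ : ∃ g, g = fmul (fsL b') (fconst c.h) := ⟨_, rfl⟩
    have hgdeg : BiDeg 0 g := by rw [hg]; exact hdeg'.sL.mul_eq hh rfl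
    have hbX : ∀ X : BiFam G V C.carrier C.carrier, fmul b X = fmul (fconst d) X + fmul b' X :=
      fun X => by rw [← fmul_add_left, ← hbb']
    have hdb : fmul (fconst d) b = fmul (fconst d) b' := by
      rw [hbb', fmul_add_right, hdd, zero_add]
    -- The failure of g = (twisted b')h to be a bimodule endomorphism of C, expressed by the
    -- bimodule relation.
    have hfg : fhat m g b - fmul b g =
        fmul b' (fconst LinearMap.id - fconst c.pi) + fmul b' (fmul (fconst c.h) b') := by
      have h1 : finsL m g + finsR m g = -fmul (fsL (finsL m b' + finsR m b')) (fconst c.h) := by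
        rw [hg, finsL_fmul hm, finsR_fmul_odd hm _ hh (by decide), finsL_fconst hm, finsR_fconst hm,
          fmul_zero, fsL_add, fsL_finsL hm, fsL_finsR, fmul_add_left, fmul_neg_left]
        abel
      have h2 : finsL m b' + finsR m b' = -fmul (fconst d) b - fmul (fsL b') b := by
        have h3 : finsL m b' + finsR m b' = fhat m b' b - fmul (fsL b') b := by
          rw [fhat]; abel
        rw [h3, hfb', hdb]
      have h4 : fsL (finsL m b' + finsR m b') = -fmul b (fsL b) := by
        rw [h2]
        have : fsL (-fmul (fconst d) b - fmul (fsL b') b) =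
            -fsL (fmul (fconst d) b) - fsL (fmul (fsL b') b) := by
          funext β
          exact (map_sub BiOp.sL _ _).trans (congr_arg (· - _) (map_neg BiOp.sL _))
        rw [this, fsL_fmul, fsL_fmul, fsL_fsL, fsL_fconst]
        rw [hbX (fsL b)]
        abel
      have h5 : fsL b = fconst d + fsL b' := by rw [hbb', fsL_add, fsL_fconst]
      have h6 : fhat m g b = fmul b (fmul (fsL b) (fconst c.h)) + fmul b' (fmul (fconst c.h) b) := by
        rw [fhat, show finsL m g + fmul (fsL g) b + finsR m g =
          finsL m g + finsR m g + fmul (fsL g) b by abel, h1, h4, hg, fsL_fmul, fsL_fsL, fsL_fconst,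
          fmul_neg_left, neg_neg, fmul_assoc, fmul_assoc]
      have h7 : fmul b (fmul (fsL b) (fconst c.h)) =
          fmul b' (fmul (fconst d) (fconst c.h)) + fmul b g := by
        rw [h5, fmul_add_left, fmul_add_right, ← hg]
        refine congr_arg (· + fmul b g) ?_
        nth_rw 1 [hbb']
        rw [fmul_add_left, ← fmul_assoc, hdd, zero_fmul, zero_add]
      have h8 : fmul (fconst c.h) b = fmul (fconst c.h) (fconst d) + fmul (fconst c.h) b' := by
        rw [← fmul_add_right, ← hbb']
      rw [h6, h7, hpi, h8]
      simp only [fmul_add_right, fmul_sub_right]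
      abel
    have h1 : fhat m p b = fmul (fconst c.proj) b' - fmul (fhat m p b) g -
        fmul (fsL p) (fmul b' (fconst LinearMap.id - fconst c.pi) +
          fmul b' (fmul (fconst c.h) b')) := by
      nth_rw 1 [← hp']
      rw [← hg, fhat_sub, fhat_fmul hm p hgdeg b b, hfg, fhat_fconst hm]
      have : fmul (fconst c.proj) b = fmul (fconst c.proj) b' := by
        rw [hbb', fmul_add_right, fconst_fmul_fconst]
        rw [show c.proj ∘ₗ d = 0 from c.proj_d, fconst_zero, zero_add]
      rw [this]
      abel
    have h2 : fmul (fsL p) (fmul b' (fconst c.pi)) = fmul bH (fconst c.proj) := by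
      rw [hbH', ← c.incl_proj, ← fconst_fmul_fconst, fmul_assoc, fmul_assoc]
    have h3 : fmul bH p = fmul bH (fconst c.proj) - fmul (fmul bH p) g := by
      nth_rw 1 [← hp']
      rw [← hg, fmul_sub_right, fmul_assoc]
    -- Differentiating p = proj − pg reproduces the defect with the factor g, which has order one;
    -- hence e = 0.
    have h4 : e = -fmul e g := by
      have h5 : fmul e g = fmul (fhat m p b) g - fmul (fmul bH p) g := by rw [he, fmul_sub_left]
      rw [hPb b', fmul_add_right, fmul_sub_right, fmul_sub_right, fmul_one, h2] at h1
      rw [h5]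
      nth_rw 1 [he, h1]
      nth_rw 1 [h3]
      abel
    have h6 : e = 0 := eq_zero_of_bSmall fun n => by
      induction n with
      | zero => exact BSmall.zero_left _
      | succ n ih =>
        rw [h4]
        exact (ih.mul (hg ▸ hs'.sL.mul_left _)).neg
    rw [h6] at he
    exact (sub_eq_zero.mp he.symm)
  exact ⟨p, hp, hp', hp_hom⟩

end Perturbation

/-- The homological perturbation lemma for bimodules. -/
theorem exists_transfer {m : Coch G V V.carrier} (hm : CoDeg 1 m)
    (hmm : (Conv.chat m).comp (Conv.chat m) = 0) {d : Module.End k C.carrier}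
    (c : Contraction C d) {b : BiFam G V C.carrier C.carrier} (hb : BiDeg 1 b)
    (hbb : fhat m b b = 0) (hbd : (b 0).core = d) :
    ∃ (bH : BiFam G V c.H.carrier c.H.carrier) (i : BiFam G V c.H.carrier C.carrier)
      (p : BiFam G V C.carrier c.H.carrier), BiDeg 1 bH ∧ BSmall 1 bH ∧ fhat m bH bH = 0 ∧
      BiDeg 0 i ∧ BSmall 1 (i - fconst c.incl) ∧ fhat m i bH = fmul b i ∧
      BiDeg 0 p ∧ BSmall 1 (p - fconst c.proj) ∧ fhat m p b = fmul bH p := by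
  obtain ⟨b', hb'⟩ : ∃ b', b' = b - fconst d := ⟨_, rfl⟩
  have hbb' : b = fconst d + b' := by rw [hb']; abel
  have hs' : BSmall 1 b' := bSmall_one (by
    rw [hb']
    exact (congr_arg₂ (· - ·) hbd (core_fconst (G := G) (V := V) d)).trans (sub_self d))
  have hdeg' : BiDeg 1 b' := by rw [hb']; exact hb.sub (BiDeg.const c.d_deg)
  obtain ⟨i, hi, hi', hPi, hi_hom⟩ := exists_incl c hm hs' hdeg' hbb hbb'
  obtain ⟨bH, hbH⟩ : ∃ bH, bH = fmul (fconst c.proj) (fmul b' i) := ⟨_, rfl⟩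
  obtain ⟨p, hp, hp', hp_hom⟩ := exists_proj c hm hs' hdeg' hbb hbb' hi' hbH
  rw [← hbH] at hi_hom
  have hP : BiDeg 0 (fconst (G := G) (V := V) c.proj) := BiDeg.const c.proj_deg
  have hbHdeg : BiDeg 1 bH := by rw [hbH]; exact hP.mul_eq (hdeg'.mul_eq hi rfl) rfl
  have hbHs : BSmall 1 bH := by rw [hbH]; exact (hs'.mul_left i).mul_right _
  have hbHH : fhat m bH bH = 0 := by
    -- Applying the coderivation twice to i turns the relation for bH into the known relation for b.
    -- The map i can be cancelled, since the constant projection is a left inverse of it.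
    have h1 : fmul i (fhat m bH bH) = 0 := by
      rw [← fhat_fhat_eq hm hmm i hbHdeg, hi_hom, fhat_fmul hm b hi bH b, hbb, zero_fmul, hi_hom,
        sub_self, fmul_zero, add_zero]
    rw [← one_fmul (fhat m bH bH), ← hPi, fmul_assoc, h1, fmul_zero]
  refine ⟨bH, i, p, hbHdeg, hbHs, hbHH, hi, ?_, hi_hom, hp, ?_, hp_hom⟩
  · rw [show i - fconst c.incl = -fmul (fconst c.h) (fmul b' i) by nth_rw 1 [← hi']; abel]
    exact ((hs'.mul_left i).mul_right _).neg
  · rw [show p - fconst c.proj = -fmul p (fmul (fsL b') (fconst c.h)) by nth_rw 1 [← hp']; abel]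
    exact ((hs'.sL.mul_left _).mul_right _).neg

end BiFam

end BimoduleTransfer

/-! ### A Darboux theorem for skew families -/

section Darboux

open GradedSpace GappingMonoid BiOp

variable {k : Type v} [Field k] {G : GappingMonoid} {V : GradedSpace.{u} k}
variable {C : GradedSpace.{u₁} k} {C' : GradedSpace.{u₂} k} {D : GradedSpace.{u₃} k}

namespace BiFam

/-- The values of the family are functionals with the support prescribed by a pairing of degree
`N`. -/
def DualDeg (N : ℤ) (φ : BiFam G V C.carrier (Module.Dual k C'.carrier)) : Prop :=
  ∀ (β : G.Elt) (x : List V.Homog) (c : C.Homog) (y : List V.Homog) (c' : C'.Homog),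
    φ β (word x) c.2 (word y) c'.2 ≠ 0 → c'.1 = - (deg x + c.1 + deg y - maslov β) - N

theorem DualDeg.smul {N : ℤ} {φ : BiFam G V C.carrier (Module.Dual k C'.carrier)}
    (h : DualDeg N φ) (r : k) : DualDeg N (r • φ) := by
  intro β x c y c' hne
  refine h β x c y c' fun h1 => hne ?_
  change r • φ β (word x) c.2 (word y) c'.2 = 0
  rw [h1, smul_zero]

theorem DualDeg.sub {N : ℤ} {φ φ' : BiFam G V C.carrier (Module.Dual k C'.carrier)}
    (h : DualDeg N φ) (h' : DualDeg N φ') : DualDeg N (φ - φ') := by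
  intro β x c y c' hne
  by_contra hd
  refine hne ?_
  have h1 : φ β (word x) c.2 (word y) c'.2 = 0 := by
    by_contra h1; exact hd (h β x c y c' h1)
  have h2 : φ' β (word x) c.2 (word y) c'.2 = 0 := by
    by_contra h1; exact hd (h' β x c y c' h1)
  change φ β (word x) c.2 (word y) c'.2 - φ' β (word x) c.2 (word y) c'.2 = 0
  rw [h1, h2, sub_zero]

theorem DualDeg.pull [CharZero k] {N : ℤ} {φ : BiFam G V D.carrier (Module.Dual k D.carrier)}
    (h : DualDeg N φ) {g : BiFam G V C.carrier D.carrier} (hg : BiDeg 0 g) :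
    DualDeg N (pull φ g) := by
  intro β x c y c' hne
  by_contra hd
  refine hne ?_
  rw [BiFam.pull, fpair_word]
  refine Finset.sum_eq_zero fun p hp => Finset.sum_eq_zero fun i _ => Finset.sum_eq_zero fun j _ => ?_
  have hx := congr_arg deg (List.take_append_drop i x)
  have hy := congr_arg deg (List.take_append_drop j y)
  have hm := maslov_of_mem hp
  simp only [deg_append] at hx hy
  beta_reduce
  rw [LinearMap.id_apply, fmul_word, LinearMap.sum_apply, Finset.sum_eq_zero, mul_zero]
  intro q hq
  rw [sumSplit_lapply]
  refine Finset.sum_eq_zero fun i' _ => ?_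
  beta_reduce
  rw [sumSplit_lapply]
  refine Finset.sum_eq_zero fun j' _ => ?_
  by_contra h1
  have h2 := h q.1 _ ((hg q.2).val _ c _) _ ((hg p.2).val _ c' _) h1
  have hx' := congr_arg deg (List.take_append_drop i' (x.drop i))
  have hy' := congr_arg deg (List.take_append_drop j' (y.take j))
  have hm' := maslov_of_mem hq
  simp only [deg_append] at hx' hy'
  simp only [IsHom.val] at h2
  omega

theorem DualDeg.const {N : ℤ} (B : SkewForm D N) :
    DualDeg N (fconst (G := G) (V := V) B.form) := by
  intro β x c y c' hne
  rw [fconst] at hne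
  by_cases hβ : β = 0
  · subst hβ
    rw [single_zero] at hne
    by_cases hx : x = []
    · by_cases hy : y = []
      · subst hx hy
        rw [word_nil, const_one] at hne
        have := B.degree c c' hne
        rw [deg_nil, maslov_zero]
        omega
      · rw [const_right_ne _ _ _ hy] at hne; exact absurd rfl hne
    · rw [const_left_ne _ hx] at hne; exact absurd rfl hne
  · rw [single_of_ne _ hβ] at hne; exact absurd rfl hne

/-- A family with values in a dual space, with the correct support, factors through a
non-degenerate form. -/
theorem DualDeg.exists_lift {N : ℤ} (B : SkewForm D N) {Bi : Module.Dual k D.carrier →ₗ[k] D.carrier}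
    (hBi : Bi ∘ₗ B.form = LinearMap.id) {φ : BiFam G V C.carrier (Module.Dual k D.carrier)}
    (h : DualDeg N φ) : BiDeg 0 (fmul (fconst Bi) φ) ∧ fmul (fconst B.form) (fmul (fconst Bi) φ) = φ := by
  have key : ∀ (β : G.Elt) (x : List V.Homog) (c : C.Homog) (y : List V.Homog),
      ∃ a ∈ D.piece (deg x + c.1 + deg y - maslov β), B.form a = φ β (word x) c.2 (word y) :=
    fun β x c y => B.exists_form_eq _ _ fun b hb => h β x c y b hb
  constructor
  · intro β x c y
    obtain ⟨a, ha, hBa⟩ := key β x c y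
    rw [fconst_fmul, ← hBa, ← LinearMap.comp_apply, hBi, LinearMap.id_apply, zero_sub,
      ← sub_eq_add_neg]
    exact ha
  · refine ext_word fun β x c y => ?_
    obtain ⟨a, ha, hBa⟩ := key β x c y
    rw [fconst_fmul, fconst_fmul, ← hBa, ← LinearMap.comp_apply Bi, hBi, LinearMap.id_apply]

theorem BSmall.smul {E M : Type*} [AddCommGroup E] [Module k E] [AddCommGroup M] [Module k M]
    {n : ℕ} {f : BiFam G V E M} (hf : BSmall n f) (r : k) : BSmall n (r • f) :=
  fun β x v y hx => by
    change r • f β (word x) v (word y) = 0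
    rw [hf β x v y hx, smul_zero]

theorem frot_smul (r : k) (φ : BiFam G V C.carrier (Module.Dual k C'.carrier)) :
    frot (r • φ) = r • frot φ := funext fun β => map_smul rotT r (φ β)

section

variable {E M : Type*} [AddCommGroup E] [Module k E] [AddCommGroup M] [Module k M]

theorem smul_sub_fam (r : k) (f g : BiFam G V E M) : r • f - r • g = r • (f - g) :=
  funext fun β => (smul_sub r (f β) (g β)).symm

theorem neg_smul_fam (r : k) (f : BiFam G V E M) : -(r • f) = r • (-f) :=
  funext fun β => (smul_neg r (f β)).symm

theorem half_add_half [CharZero k] (f : BiFam G V E M) : (2⁻¹ : k) • f + (2⁻¹ : k) • f = f :=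
  funext fun β => by
    change (2⁻¹ : k) • f β + (2⁻¹ : k) • f β = f β
    rw [← add_smul, ← two_mul, mul_inv_cancel₀ two_ne_zero, one_smul]

end

/-- A skew symmetric family is the pullback of its constant part. -/
theorem exists_pull_eq [CharZero k] {N : ℤ} (B : SkewForm D N)
    {φ : BiFam G V D.carrier (Module.Dual k D.carrier)} (hφ : DualDeg N φ)
    (hskew : frot φ = -φ) (hB : (φ 0).core = B.form) :
    ∃ η : BiFam G V D.carrier D.carrier, BiDeg 0 η ∧ BSmall 1 η ∧
      pull (fconst B.form) (fconst LinearMap.id + η) = φ := by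
  -- The full dual is larger than the image of the form when infinitely many degrees occur, so only
  -- a left inverse exists. It suffices because the values that occur are supported in a single
  -- degree.
  obtain ⟨Bi, hBi⟩ := B.form.exists_leftInverse_of_injective
    (LinearMap.ker_eq_bot.mpr B.form_injective)
  -- The pullback of B along 1 + η has two linear terms in η, exchanged by rotation, and one
  -- quadratic term. Setting Bη equal to half of φ − B − η^*Bη makes the linear terms add up to the
  -- remainder.
  let R : BiFam G V D.carrier D.carrier → BiFam G V D.carrier (Module.Dual k D.carrier) :=
    fun η => (2⁻¹ : k) • (φ - fconst B.form - pull (fconst B.form) η)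
  have hR : ∀ η, BiDeg 0 η → DualDeg N (R η) := fun η hη =>
    ((hφ.sub (DualDeg.const B)).sub ((DualDeg.const B).pull hη)).smul _
  obtain ⟨η, ⟨hη, hs⟩, hfix⟩ := exists_fixed_of_bSmall (G := G) (V := V) (C := D) (D := D) 0 1
    (fun η => fmul (fconst Bi) (R η)) (fun η hη hs => ⟨((hR η hη).exists_lift B hBi).1, by
      refine BSmall.mul_right _ (BSmall.smul (BSmall.sub ?_ ?_) _)
      · refine bSmall_one ?_
        exact (congr_arg₂ (· - ·) hB (core_fconst B.form)).trans (sub_self _)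
      · exact ((hs.mul_right _).pair hs).mono (by omega)⟩) (by
      intro j f g hf hg hfg
      rw [← fmul_sub_right]
      refine BSmall.mul_right _ ?_
      have e : R f - R g = (2⁻¹ : k) • (fpair LinearMap.id (fmul (fconst B.form) (g - f)) g +
          fpair LinearMap.id (fmul (fconst B.form) f) (g - f)) := by
        simp only [R]
        rw [smul_sub_fam]
        congr 1
        simp only [pull, fmul_sub_right, fpair_sub_left, fpair_sub_right]
        abel
      have hgf : BSmall j (g - f) := by rw [← neg_sub]; exact hfg.neg
      rw [e]
      refine BSmall.smul (BSmall.add ((hgf.mul_right _).pair hg) ?_) _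
      rw [add_comm]
      exact (hf.mul_right _).pair hgf)
  refine ⟨η, hη, hs, ?_⟩
  have h1 : fmul (fconst B.form) η = R η := by
    nth_rw 1 [← hfix]
    exact ((hR η hη).exists_lift B hBi).2
  have h2 : frot (R η) = -R η := by
    simp only [R]
    rw [frot_smul, frot_sub, frot_sub, hskew, B.frot_fconst, frot_pull _ hη, B.frot_fconst, pull,
      fmul_neg_left, fpair_neg_left, ← pull, neg_smul_fam]
    congr 1
    abel
  -- The second linear term is minus the rotation of the first; as the remainder is skew, it equals
  -- `R η` too.
  have h3 : fpair LinearMap.id (fconst B.form) η = R η := by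
    have h4 := frot_fpair_fmul (fconst B.form) hη (BiDeg.one (G := G) (V := V) (C := D))
    rw [fpair_one, h1, h2, B.frot_fconst, fmul_neg_left, fmul_one, fpair_neg_left] at h4
    exact neg_injective h4.symm
  rw [pull, fmul_add_right, fmul_one, fpair_add_left, fpair_add_right, fpair_add_right, fpair_one,
    h3, fpair_one, ← pull, h1]
  have h5 : R η + R η = φ - fconst B.form - pull (fconst B.form) η :=
    half_add_half _
  rw [show fconst B.form + R η + (R η + pull (fconst B.form) η) =
    fconst B.form + (R η + R η) + pull (fconst B.form) η by abel, h5]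
  abel

/-- Left and right Neumann series, obtained separately as fixed points, coincide. -/
theorem exists_inverse {η : BiFam G V D.carrier D.carrier} (hη : BiDeg 0 η) (hs : BSmall 1 η) :
    ∃ g : BiFam G V D.carrier D.carrier, BiDeg 0 g ∧ BSmall 1 (g - fconst LinearMap.id) ∧
      fmul g (fconst LinearMap.id + η) = fconst LinearMap.id ∧
      fmul (fconst LinearMap.id + η) g = fconst LinearMap.id := by
  obtain ⟨g, ⟨hg, -⟩, hg'⟩ := exists_fixed_of_bSmall (G := G) (V := V) (C := D) (D := D) 0 0
    (fun g => fconst LinearMap.id - fmul g η)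
    (fun f hf _ => ⟨BiDeg.one.sub (hf.mul hη), BSmall.zero_left _⟩) (by
      intro j f g _ _ hfg
      rw [show fconst LinearMap.id - fmul f η - (fconst LinearMap.id - fmul g η) =
        -fmul (f - g) η by rw [fmul_sub_left]; abel]
      exact (hfg.mul hs).neg)
  obtain ⟨g', -, hg''⟩ := exists_fixed_of_bSmall (G := G) (V := V) (C := D) (D := D) 0 0
    (fun g => fconst LinearMap.id - fmul η g)
    (fun f hf _ => ⟨BiDeg.one.sub (hη.mul hf), BSmall.zero_left _⟩) (by
      intro j f g _ _ hfg
      rw [show fconst LinearMap.id - fmul η f - (fconst LinearMap.id - fmul η g) =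
        -fmul η (f - g) by rw [fmul_sub_right]; abel, add_comm]
      exact (hs.mul hfg).neg)
  have h1 : fmul g (fconst LinearMap.id + η) = fconst LinearMap.id := by
    rw [fmul_add_right, fmul_one]
    nth_rw 1 [← hg']
    abel
  have h2 : fmul (fconst LinearMap.id + η) g' = fconst LinearMap.id := by
    rw [fmul_add_left, one_fmul]
    nth_rw 1 [← hg'']
    abel
  have h3 : g = g' := by
    rw [← fmul_one g, ← h2, ← fmul_assoc, h1, one_fmul]
  refine ⟨g, hg, ?_, h1, h3 ▸ h2⟩
  rw [show g - fconst LinearMap.id = -fmul g η by nth_rw 1 [← hg']; abel]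
  exact (hs.mul_right g).neg

theorem BiDeg.fhat {m : Coch G V V.carrier} (hm : CoDeg 1 m) {e : ℤ}
    {f : BiFam G V C.carrier D.carrier} (hf : BiDeg e f) {b : BiFam G V C.carrier C.carrier}
    (hb : BiDeg 1 b) : BiDeg (e + 1) (fhat m f b) := by
  refine BiDeg.add (BiDeg.add (fun β x v y => ?_) (hf.sL.mul hb)) fun β x v y => ?_
  · rw [finsL, lift₂, LinearMap.sum_apply, LinearMap.sum_apply, LinearMap.sum_apply]
    refine Submodule.sum_mem _ fun p hp => ?_
    rw [LinearMap.compl₂_apply, insL_word _ (hm p.2)]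
    refine Submodule.sum_mem _ fun i _ => Submodule.sum_mem _ fun j _ => Submodule.smul_mem _ _ ?_
    have hx := congr_arg deg (List.take_append_drop i x)
    have hx' := congr_arg deg (List.take_append_drop j (x.drop i))
    have hm' := maslov_of_mem hp
    simp only [deg_append] at hx hx'
    have := hf p.1 (x.take i ++ (hm p.2).val ((x.drop i).take j) :: (x.drop i).drop j) v y
    rwa [show deg (x.take i ++ (hm p.2).val ((x.drop i).take j) :: (x.drop i).drop j) + v.1 + deg y +
      (e - maslov p.1) = deg x + v.1 + deg y + (e + 1 - maslov β) by
        simp only [deg_append, deg_cons, IsHomog.val]; omega] at this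
  · rw [finsR, lift₂, LinearMap.sum_apply, LinearMap.sum_apply, LinearMap.sum_apply]
    refine Submodule.sum_mem _ fun p hp => ?_
    rw [LinearMap.compl₂_apply, insR_word _ (hm p.2)]
    refine Submodule.sum_mem _ fun i _ => Submodule.sum_mem _ fun j _ => Submodule.smul_mem _ _ ?_
    have hy := congr_arg deg (List.take_append_drop i y)
    have hy' := congr_arg deg (List.take_append_drop j (y.drop i))
    have hm' := maslov_of_mem hp
    simp only [deg_append] at hy hy'
    have := hf p.1 x v (y.take i ++ (hm p.2).val ((y.drop i).take j) :: (y.drop i).drop j)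
    rwa [show deg x + v.1 + deg (y.take i ++ (hm p.2).val ((y.drop i).take j) :: (y.drop i).drop j) +
      (e - maslov p.1) = deg x + v.1 + deg y + (e + 1 - maslov β) by
        simp only [deg_append, deg_cons, IsHomog.val]; omega] at this

/-- At energy zero and without inputs the algebra can only insert its curvature of energy zero,
which vanishes. -/
theorem core_fhat {M : Type*} [AddCommGroup M] [Module k M] {m : Coch G V V.carrier}
    (h0 : m 0 1 = 0) (f : BiFam G V C.carrier M)
    (b : BiFam G V C.carrier C.carrier) :
    (fhat m f b 0).core = (f 0).core ∘ₗ (b 0).core := by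
  have h : coder (m 0) 1 = 0 := by
    have := coder_word (m 0) []
    rw [sumSplit_nil, sumSplit_nil, word_nil, h0, map_zero] at this
    simpa using this
  have hsl : (fsL f 0).core = (f 0).core := by
    refine LinearMap.ext fun v => ?_
    have := sL_word (f 0) [] v 1
    rw [word_nil, deg_nil, sgn_zero, one_smul] at this
    exact this
  have hl : (finsL m f 0).core = 0 := by
    refine LinearMap.ext fun v => ?_
    change finsL m f 0 1 v 1 = 0
    rw [finsL, lift₂, decomps_zero, Finset.sum_singleton, LinearMap.compl₂_apply, insL_apply, h,
      map_zero]; rfl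
  have hr : (finsR m f 0).core = 0 := by
    refine LinearMap.ext fun v => ?_
    change finsR m f 0 1 v 1 = 0
    rw [finsR, lift₂, decomps_zero, Finset.sum_singleton, LinearMap.compl₂_apply, insR_apply, h,
      map_zero]
  have : (fhat m f b 0).core =
      (finsL m f 0).core + (fmul (fsL f) b 0).core + (finsR m f 0).core := rfl
  rw [this, hl, hr, core_fmul, hsl, zero_add, add_zero]

theorem core_fpair [CharZero k] {W W' : Type*} [AddCommGroup W] [Module k W] [AddCommGroup W']
    [Module k W'] (B : W →ₗ[k] W' →ₗ[k] k) (K : BiFam G V C.carrier W)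
    (F : BiFam G V C'.carrier W') (v : C.carrier) (c : C'.carrier) :
    (fpair B K F 0).core v c = B ((K 0).core v) ((F 0).core c) := by
  have : (fpair B K F 0).core = (B ∘ₗ (K 0).core).compl₂ (F 0).core :=
    hom_ext_homog fun v => hom_ext_homog fun c => by
      have := fpair_word B K F 0 [] v [] c
      rw [decomps_zero, Finset.sum_singleton, sumSplit_nil, sumSplit_nil, word_nil, deg_nil,
        zero_mul, sgn_zero, one_mul] at this
      exact this
  rw [this]; rfl

theorem core_pull [CharZero k] (φ : BiFam G V D.carrier (Module.Dual k D.carrier))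
    (g : BiFam G V C.carrier D.carrier) (v c : C.carrier) :
    (pull φ g 0).core v c = (φ 0).core ((g 0).core v) ((g 0).core c) := by
  rw [pull, core_fpair, core_fmul]; rfl

theorem BiDeg.core {e : ℤ} {f : BiFam G V C.carrier D.carrier} (hf : BiDeg e f) :
    IsDeg e (f 0).core := fun a => by
  have := hf 0 [] a []
  rwa [deg_nil, zero_add, add_zero, maslov_zero, sub_zero, word_nil] at this

/-- A homomorphism to the dual is compatible with the differentials. -/
theorem core_frel [CharZero k] {m : Coch G V V.carrier} (h0 : m 0 1 = 0)
    {φ : BiFam G V C.carrier (Module.Dual k C.carrier)} {b : BiFam G V C.carrier C.carrier}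
    (h : frel m φ b b = 0) (v w : C.Homog) :
    (φ 0).core ((b 0).core v.2) w.2 = -(sgn k v.1 * (φ 0).core v.2 ((b 0).core w.2)) := by
  have h1 : (fsA φ 0).core v.2 = sgn k v.1 • (φ 0).core v.2 := by
    have := sA_word (φ 0) [] v []
    rw [word_nil, deg_nil, zero_add, add_zero] at this
    exact this
  have h2 : (frel m φ b b 0).core v.2 w.2 = 0 := by rw [h]; rfl
  have h3 : (fhat m φ b 0).core v.2 w.2 = (φ 0).core ((b 0).core v.2) w.2 := by
    rw [core_fhat h0]; rfl
  have h4 : (frel m φ b b 0).core v.2 w.2 = (fhat m φ b 0).core v.2 w.2 +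
      (fpair LinearMap.id (fsA φ) b 0).core v.2 w.2 := rfl
  rw [h4, h3, core_fpair, h1] at h2
  exact eq_neg_of_add_eq_zero_left h2

end BiFam

end Darboux

/-! ### Homotopy inner products on bimodules -/

section BimoduleCase

open GradedSpace GappingMonoid BiOp BiFam

variable {k : Type v} [Field k] {G : GappingMonoid} {A : GappedAlgebra.{u} k G} {N : ℤ}

theorem core_hom_comm {C D : GappedBimodule.{u, v, w} A} {g : BiFam G A.toGradedSpace C.carrier D.carrier}
    (h : fhat A.m g C.b = fmul D.b g) (x : C.carrier) :
    D.d ((g 0).core x) = (g 0).core (C.d x) := by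
  have := congr_arg (fun f : BiFam G A.toGradedSpace C.carrier D.carrier => (f 0).core x) h
  simp only [core_fhat A.m_zero, core_fmul] at this
  exact this.symm

theorem GappedBimodule.d_d (C : GappedBimodule.{u, v, w} A) : C.d ∘ₗ C.d = 0 := by
  have := congr_arg (fun f : BiFam G A.toGradedSpace C.carrier C.carrier => (f 0).core) C.fhat_b
  simp only [core_fhat A.m_zero] at this
  exact this

theorem DualHom.form_degree {C : GappedBimodule.{u, v, w} A} (φ : DualHom C N) (a b : C.Homog)
    (h : (φ.φ 0).core a.2 b.2 ≠ 0) : a.1 + b.1 + N = 0 := by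
  have := φ.φ_degree 0 [] a [] b (by rw [word_nil]; exact h)
  rw [deg_nil, maslov_zero] at this
  omega

theorem DualHom.form_skew {C : GappedBimodule.{u, v, w} A} {φ : DualHom C N} (h : φ.IsSkew)
    (a b : C.Homog) :
    (φ.φ 0).core a.2 b.2 = -((a.1 * b.1).negOnePow • (φ.φ 0).core b.2 a.2) := by
  have := h 0 [] a [] b
  rwa [deg_nil, zero_add, zero_add, word_nil] at this

variable [CharZero k]

/-- Skewness passes from the constant form to its pullback because rotation commutes with pullback;
non-degeneracy follows since on cores the pullback is the form evaluated on the images of a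
quasi-isomorphism. -/
theorem DualHom.isHomotopyInnerProduct_imp {C : GappedBimodule.{u, v, w} A} {φ : DualHom C N}
    (h : φ.IsHomotopyInnerProduct) : φ.IsSkew ∧ φ.IsHomologicallyNondegenerate := by
  obtain ⟨D, B, g, hB, hg, hφ⟩ := h
  have e : φ.φ = pull (fconst B.form) g.g :=
    ext_pairing fun β x v y c => (hφ β x v y c).trans (pullback_eq B.form g.g β x v y c)
  refine ⟨DualHom.isSkew_iff.mpr ?_, fun a ha ha' => ?_⟩
  · rw [e, frot_pull _ g.biDeg, B.frot_fconst, pull, fmul_neg_left, fpair_neg_left]; rfl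
  · obtain ⟨b, hb, hne⟩ := B.exists_ne_zero_of_inducesIso D.biDeg.core
      (fun v w => by
        have := core_frel A.m_zero (B.isCyclicBimodule_iff.mp hB) v w
        rwa [core_fconst] at this) hg (core_hom_comm g.fhat_eq) ha ha'
    refine ⟨b, hb, ?_⟩
    rwa [e, core_pull, core_fconst]

theorem DualHom.form_closed {C : GappedBimodule.{u, v, w} A} (φ : DualHom C N) (a b : C.Homog) :
    (φ.φ 0).core (C.d a.2) b.2 = -(sgn k a.1 * (φ.φ 0).core a.2 (C.d b.2)) :=
  core_frel A.m_zero φ.frel_eq a b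

/-- Transfer to cohomology, then Darboux. The homomorphism obtained is the pullback of φ along
inclusion and projection, p^*i^*φ. -/
theorem exists_isHomotopyInnerProduct {C : GappedBimodule.{u, v, w} A}
    (hfin : FiniteCohomology (V := C.toGradedSpace) C.d) {φ : DualHom C N} (hskew : φ.IsSkew)
    (hnd : φ.IsHomologicallyNondegenerate) : ∃ φ' : DualHom C N, φ'.IsHomotopyInnerProduct := by
  obtain ⟨c⟩ := exists_contraction (V := C.toGradedSpace) (d := C.d) C.biDeg.core C.d_d
  obtain ⟨B, hB⟩ := c.exists_skewForm hfin (φ.φ 0).core φ.form_degree (DualHom.form_skew hskew)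
    φ.form_closed hnd
  obtain ⟨bH, i, p, hbH, sbH, hbb, hi, si, hib, hp, sp, hpb⟩ :=
    exists_transfer A.coDeg A.chat_chat c C.biDeg C.fhat_b rfl
  have ci : (i 0).core = c.incl := by
    have := si.core
    rw [← core_fconst (G := G) (V := A.toGradedSpace) c.incl]
    exact sub_eq_zero.mp this
  have cp : (p 0).core = c.proj := by
    have := sp.core
    rw [← core_fconst (G := G) (V := A.toGradedSpace) c.proj]
    exact sub_eq_zero.mp this
  have hH : frel A.m (pull φ.φ i) bH bH = 0 := by
    rw [frel_pull A.coDeg _ hi hbH hib, φ.frel_eq, pull_zero]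
  obtain ⟨η, hη, sη, hpull⟩ := exists_pull_eq (G := G) (V := A.toGradedSpace) B
    (φ := pull φ.φ i) (DualDeg.pull φ.φ_degree hi)
    (by rw [frot_pull _ hi, DualHom.isSkew_iff.mp hskew, pull, fmul_neg_left, fpair_neg_left]; rfl)
    (LinearMap.ext fun a => LinearMap.ext fun b => by rw [core_pull, ci, hB])
  obtain ⟨g', hg', sg', hl, hr⟩ := BiFam.exists_inverse hη sη
  set g := fconst LinearMap.id + η with hgdef
  have hg : BiDeg 0 g := BiDeg.one.add hη
  -- The transferred structure conjugated by the Darboux coordinate change, so that g becomes a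
  -- homomorphism by construction.
  let b := fmul (fhat A.m g bH) g'
  have hb : BiDeg 1 b := (hg.fhat A.coDeg hbH).mul_eq hg' (by norm_num)
  have hgb : fhat A.m g bH = fmul b g := by
    rw [show b = _ from rfl, fmul_assoc, hl, fmul_one]
  have hb0 : fhat A.m b b = 0 := by
    have h1 := fhat_fhat_eq A.coDeg A.chat_chat g hbH
    rw [hbb, fmul_zero, hgb, fhat_fmul A.coDeg b hg bH b, hgb, sub_self, fmul_zero, add_zero] at h1
    rw [← fmul_one (fhat A.m b b), ← hr, ← fmul_assoc, h1, zero_fmul]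
  let D := GappedBimodule.ofBiFam (A := A) c.H b hb hb0
  -- Pulled back along g, the cyclicity defect of B becomes the defect of i^*φi, which is zero; g is
  -- invertible.
  have hfrel : frel A.m (fconst B.form) b b = 0 := by
    have h1 := frel_pull A.coDeg (fconst B.form) hg hbH hgb
    rw [hpull, hH] at h1
    rw [← pull_one (frel A.m (fconst B.form) b b), ← hr, ← pull_pull _ hg', ← h1, pull_zero]
  let q := fmul g p
  have hq : BiDeg 0 q := hg.mul_eq hp (by norm_num)
  have hqb : fhat A.m q C.b = fmul b q := by
    rw [show q = _ from rfl, fhat_fmul A.coDeg g hp C.b bH, hpb, sub_self, fmul_zero, add_zero, hgb,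
      fmul_assoc]
  have cq : (q 0).core = c.proj := by
    rw [show q = _ from rfl, core_fmul, cp, show (g 0).core =
      (fconst (G := G) (V := A.toGradedSpace) (LinearMap.id : c.H.carrier →ₗ[k] _) 0).core +
      (η 0).core from rfl, sη.core, core_fconst, add_zero, LinearMap.id_comp]
  -- The new structure is minimal, so the quasi-isomorphism condition concerns only the linear
  -- projection onto harmonic elements.
  have hD : D.d = 0 := by
    change (b 0).core = 0
    rw [core_fmul, core_fhat A.m_zero, sbH.core, LinearMap.comp_zero, LinearMap.zero_comp]
  refine ⟨DualHom.ofBiFam (pull (fconst B.form) q) ((DualDeg.const B).pull hq)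
    (by rw [frel_pull A.coDeg _ hq C.biDeg hqb, hfrel, pull_zero]), D, B,
    BimoduleHom.ofBiFam (D := D) q hq hqb, (SkewForm.isCyclicBimodule_iff (D := D) B).mpr hfrel, ?_,
    fun β x v y w => (pullback_eq B.form q β x v y w).symm⟩
  change InducesIso (V := C.toGradedSpace) (W := c.H) C.d D.d (q 0).core
  rw [hD, cq]
  exact c.inducesIso

end BimoduleCase

/-! ### Inserting the values of a coalgebra homomorphism -/

section ChangeOfAlgebra

open GradedSpace GappingMonoid BiOp

variable {k : Type v} [Field k] {G : GappingMonoid}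
variable {V : GradedSpace.{u} k} {W : GradedSpace.{u₁} k} {U : GradedSpace.{u₂} k}

section Grouplike

variable {N₁ N₂ N : Type*} [AddCommGroup N₁] [Module k N₁] [AddCommGroup N₂] [Module k N₂]
  [AddCommGroup N] [Module k N]

/-- The convolution product with respect to a bilinear map. -/
noncomputable def bconv (T : N₁ →ₗ[k] N₂ →ₗ[k] N) :
    (V.Bar →ₗ[k] N₁) →ₗ[k] (V.Bar →ₗ[k] N₂) →ₗ[k] (V.Bar →ₗ[k] N) :=
  LinearMap.mk₂ k (fun f g => cut (T.compl₁₂ f g))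
    (by intro f f' g; rw [← map_add]; congr 1; ext; simp)
    (by intro c f g; rw [← map_smul]; congr 1; ext; simp)
    (by intro f g g'; rw [← map_add]; congr 1; ext; simp)
    (by intro c f g; rw [← map_smul]; congr 1; ext; simp)

theorem bconv_word (T : N₁ →ₗ[k] N₂ →ₗ[k] N) (f : V.Bar →ₗ[k] N₁) (g : V.Bar →ₗ[k] N₂)
    (x : List V.Homog) :
    bconv T f g (word x) = sumSplit x fun a b => T (f (word a)) (g (word b)) := by
  simp [bconv, cut_word]

/-- Grouplikeness of `hat f` again, now for an arbitrary bilinear product of the values, so that it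
applies to compositions of operations. -/
theorem bconv_fcomp_hat (T : N₁ →ₗ[k] N₂ →ₗ[k] N) (X : Coch G W N₁) (Y : Coch G W N₂)
    {f : Coch G V W.carrier} (h : IsSmall 1 f) :
    fcomp (lift₂ (bconv T) X Y) (Conv.hat f).fam =
      lift₂ (bconv T) (fcomp X (Conv.hat f).fam) (fcomp Y (Conv.hat f).fam) := by
  have h1 := congr_arg Conv.fam (Conv.cop_comp_hat h)
  let μ : (W.Bar →ₗ[k] N₁) →ₗ[k] (W.Bar →ₗ[k] N₂) →ₗ[k] (TensorProduct k W.Bar W.Bar →ₗ[k] N) :=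
    LinearMap.mk₂ k (fun f g => TensorProduct.lift (T.compl₁₂ f g))
      (by intros; ext; simp) (by intros; ext; simp) (by intros; ext; simp) (by intros; ext; simp)
  have h2 : lift₂ (bconv T) X Y = fcomp (lift₂ μ X Y) (single W.cop) := by
    funext β
    rw [fcomp_single]
    refine bar_ext fun x => ?_
    simp only [lift₂, LinearMap.sum_apply, LinearMap.comp_apply, bconv_word, cop_word, map_sumSplit]
    rw [← sumSplit_sum]
    simp [μ]
  let l : (V.Bar →ₗ[k] W.Bar) →ₗ[k] (V.Bar →ₗ[k] W.Bar) →ₗ[k]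
      (V.Bar →ₗ[k] TensorProduct k W.Bar W.Bar) := conv.compl₁₂
    (LinearMap.llcomp k V.Bar W.Bar (TensorProduct k W.Bar W.Bar)
      (Algebra.TensorProduct.includeLeft : W.Bar →ₐ[k] TensorProduct k W.Bar W.Bar).toLinearMap)
    (LinearMap.llcomp k V.Bar W.Bar (TensorProduct k W.Bar W.Bar)
      (Algebra.TensorProduct.includeRight : W.Bar →ₐ[k] TensorProduct k W.Bar W.Bar).toLinearMap)
  have h3 : (Conv.map (Algebra.TensorProduct.includeLeft : W.Bar →ₐ[k] TensorProduct k W.Bar W.Bar)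
      (Conv.hat f) * Conv.map Algebra.TensorProduct.includeRight (Conv.hat f)).fam =
      lift₂ l (Conv.hat f).fam (Conv.hat f).fam := rfl
  rw [h2, fcomp_assoc]
  rw [Conv.comp_fam] at h1
  rw [h1, h3]
  refine lift₂_interchange (ν := μ) (l := l) (μ' := bconv (V := V) T) fun a b c d =>
    bar_ext fun x => ?_
  simp only [LinearMap.llcomp_apply, conv_word, bconv_word, map_sumSplit, l,
    LinearMap.compl₁₂_apply]
  refine sumSplit_congr fun p q _ => ?_
  simp [μ]

end Grouplike

section Reverse

variable {X Y D E M : Type*} [AddCommGroup X] [Module k X] [AddCommGroup Y] [Module k Y]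
  [AddCommGroup D] [Module k D] [AddCommGroup E] [Module k E] [AddCommGroup M] [Module k M]

/-- Interchange of the two outer arguments. -/
noncomputable def rev : (X →ₗ[k] D →ₗ[k] Y →ₗ[k] M) →ₗ[k] (Y →ₗ[k] D →ₗ[k] X →ₗ[k] M) where
  toFun K := LinearMap.mk₂ k (fun y v => (K.flip v).flip y)
    (by intros; ext; simp) (by intros; ext; simp) (by intros; ext; simp) (by intros; ext; simp)
  map_add' _ _ := rfl
  map_smul' _ _ := rfl

theorem rev_apply (K : X →ₗ[k] D →ₗ[k] Y →ₗ[k] M) (y : Y) (v : D) (x : X) :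
    rev K y v x = K x v y := rfl

variable (V D E M) in
/-- The analogue of `mulInner` for the left arguments. -/
noncomputable def mulOuter : (D →ₗ[k] V.Bar →ₗ[k] E) →ₗ[k] (E →ₗ[k] V.Bar →ₗ[k] M) →ₗ[k]
    (D →ₗ[k] V.Bar →ₗ[k] M) :=
  (LinearMap.llcomp k D (V.Bar →ₗ[k] E) (V.Bar →ₗ[k] M) ∘ₗ
    LinearMap.llcomp k (V.Bar →ₗ[k] E) (V.Bar →ₗ[k] V.Bar →ₗ[k] M) (V.Bar →ₗ[k] M)
      (cut ∘ₗ (LinearMap.lflip (R₀ := k)).toLinearMap) ∘ₗ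
    LinearMap.llcomp k V.Bar E (V.Bar →ₗ[k] M)).flip

theorem mulOuter_word (g : D →ₗ[k] V.Bar →ₗ[k] E) (f : E →ₗ[k] V.Bar →ₗ[k] M) (v : D)
    (x : List V.Homog) : mulOuter V D E M g f v (word x) =
      sumSplit x fun x₁ x₂ => f (g v (word x₂)) (word x₁) :=
  cut_word _ x

theorem mulInner_word (f : E →ₗ[k] V.Bar →ₗ[k] M) (g : D →ₗ[k] V.Bar →ₗ[k] E) (v : D)
    (x : List V.Homog) : mulInner V D E M f g v (word x) =
      sumSplit x fun x₁ x₂ => f (g v (word x₁)) (word x₂) :=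
  cut_word _ x

/-- Composition cuts both outer arguments. Reversing them lets the cut of the right argument also be
treated as a convolution, with a different inner product. -/
theorem rev_bconv_mulInner (f : V.Bar →ₗ[k] E →ₗ[k] W.Bar →ₗ[k] M)
    (g : V.Bar →ₗ[k] D →ₗ[k] W.Bar →ₗ[k] E) :
    rev (bconv (mulInner W D E M) f g) = bconv (mulOuter V D E M) (rev g) (rev f) := by
  refine bar_ext fun y => LinearMap.ext fun v => bar_ext fun x => ?_
  rw [rev_apply, bconv_word, bconv_word, sumSplit_lapply, sumSplit_lapply, sumSplit_lapply,
    sumSplit_lapply]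
  simp only [mulInner_word, mulOuter_word, rev_apply]
  exact sumSplit_comm _ _ _

end Reverse

namespace BiFam

variable {D E M : Type*} [AddCommGroup D] [Module k D] [AddCommGroup E] [Module k E]
  [AddCommGroup M] [Module k M]

section

variable {X Y X' Y' : Type*} [AddCommGroup X] [Module k X] [AddCommGroup Y] [Module k Y]
  [AddCommGroup X'] [Module k X'] [AddCommGroup Y'] [Module k Y']

/-- Interchange of the two outer arguments, for families. -/
noncomputable def frev (K : G.Elt → (X →ₗ[k] D →ₗ[k] Y →ₗ[k] M)) :
    G.Elt → (Y →ₗ[k] D →ₗ[k] X →ₗ[k] M) := fun β => rev (K β)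

theorem frev_sub (K K' : G.Elt → (X →ₗ[k] D →ₗ[k] Y →ₗ[k] M)) :
    frev (K - K') = frev K - frev K' := rfl

theorem frev_add (K K' : G.Elt → (X →ₗ[k] D →ₗ[k] Y →ₗ[k] M)) :
    frev (K + K') = frev K + frev K' := rfl

/-- Substitutions in the two outer arguments commute. -/
theorem frev_comm (K : G.Elt → (X →ₗ[k] D →ₗ[k] Y →ₗ[k] M)) (F : G.Elt → (X' →ₗ[k] X))
    (F' : G.Elt → (Y' →ₗ[k] Y)) :
    frev (fcomp (frev (fcomp (frev K) F')) F) = fcomp (frev (fcomp K F)) F' := by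
  funext β
  refine LinearMap.ext fun y => LinearMap.ext fun v => LinearMap.ext fun x => ?_
  simp only [frev, rev_apply, fcomp_apply, LinearMap.sum_apply]
  have := sum_decomps_assoc β fun a b c => K a (F c x) v (F' b y)
  have h' := sum_decomps_assoc β fun a b c => K a (F b x) v (F' c y)
  rw [this, h']
  exact Finset.sum_congr rfl fun p _ =>
    sum_decomps_swap p.2 fun a b => K p.1 (F b x) v (F' a y)

end

/-- The family obtained by inserting values of `L` into all arguments in the algebra. -/
noncomputable def chg (K : BiFam G W D M) (L : Conv G V W.Bar) : BiFam G V D M :=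
  frev (fcomp (frev (fcomp K L.fam)) L.fam)

theorem chg_apply (K : BiFam G W D M) (L : Conv G V W.Bar) (β : G.Elt) (x : V.Bar) (v : D)
    (y : V.Bar) : chg K L β x v y =
      ∑ p ∈ decomps β, ∑ q ∈ decomps p.2, K p.1 (L.fam q.1 x) v (L.fam q.2 y) := by
  simp only [chg, frev, rev_apply, fcomp_apply, LinearMap.sum_apply]
  exact sum_decomps_assoc β fun a b c => K a (L.fam b x) v (L.fam c y)

theorem chg_eq (K : BiFam G W D M) (L : Conv G V W.Bar) :
    chg K L = fcomp (frev (fcomp (frev K) L.fam)) L.fam :=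
  frev_comm (frev K) L.fam L.fam

theorem chg_sub (K K' : BiFam G W D M) (L : Conv G V W.Bar) :
    chg (K - K') L = chg K L - chg K' L := by
  rw [chg, chg, chg, sub_fcomp, frev_sub, sub_fcomp, frev_sub]

theorem chg_add (K K' : BiFam G W D M) (L : Conv G V W.Bar) :
    chg (K + K') L = chg K L + chg K' L := by
  rw [chg, chg, chg, add_fcomp, frev_add, add_fcomp, frev_add]

theorem chg_zero (L : Conv G V W.Bar) : chg (0 : BiFam G W D M) L = 0 := by
  rw [← sub_self (0 : BiFam G W D M), chg_sub, sub_self]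

theorem chg_chg (K : BiFam G W D M) (L : Conv G V W.Bar) (L' : Conv G U V.Bar) :
    chg (chg K L) L' = chg K (L.comp L') := by
  rw [chg_eq (chg K L), chg]
  change fcomp (frev (fcomp (fcomp (frev (fcomp K L.fam)) L.fam) L'.fam)) L'.fam = _
  rw [fcomp_assoc, ← Conv.comp_fam, ← frev_comm, chg]
  change frev (fcomp (frev (fcomp (fcomp K L.fam) L'.fam)) (L.comp L').fam) = _
  rw [fcomp_assoc, Conv.comp_fam]

theorem chg_idc (K : BiFam G V D M) : chg K (Conv.idc G V) = K := by
  rw [chg, Conv.idc, fcomp_id, fcomp_id]; rfl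

theorem frev_mulInner (f : G.Elt → (V.Bar →ₗ[k] E →ₗ[k] W.Bar →ₗ[k] M))
    (g : G.Elt → (V.Bar →ₗ[k] D →ₗ[k] W.Bar →ₗ[k] E)) :
    frev (lift₂ (bconv (mulInner W D E M)) f g) =
      lift₂ (bconv (mulOuter V D E M)) (frev g) (frev f) := by
  rw [← lift₂_flip]
  funext β
  rw [frev, lift₂, lift₂, map_sum]
  exact Finset.sum_congr rfl fun p _ => rev_bconv_mulInner _ _

theorem frev_mulOuter (f : G.Elt → (V.Bar →ₗ[k] E →ₗ[k] W.Bar →ₗ[k] M))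
    (g : G.Elt → (V.Bar →ₗ[k] D →ₗ[k] W.Bar →ₗ[k] E)) :
    frev (lift₂ (bconv (mulOuter V D E M)) (frev g) (frev f)) =
      lift₂ (bconv (mulInner W D E M)) f g := by
  rw [← frev_mulInner]; rfl

/-- Grouplikeness is used once for the left argument and, after reversal, once for the right
argument. -/
theorem chg_fmul (K : BiFam G W E M) (F : BiFam G W D E) {f : Coch G V W.carrier}
    (h : IsSmall 1 f) :
    chg (fmul K F) (Conv.hat f) = fmul (chg K (Conv.hat f)) (chg F (Conv.hat f)) := by
  have e1 : fmul K F = lift₂ (bconv (mulInner W D E M)) K F := rfl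
  rw [chg, e1, bconv_fcomp_hat _ _ _ h]
  rw [frev_mulInner, bconv_fcomp_hat _ _ _ h]
  exact frev_mulOuter (chg K (Conv.hat f)) (chg F (Conv.hat f))

end BiFam

end ChangeOfAlgebra

/-! ### Restriction of bimodule structures along algebra homomorphisms -/

section ChangeOfAlgebra

open GradedSpace GappingMonoid BiOp

variable {k : Type v} [Field k] {G : GappingMonoid}
variable {V : GradedSpace.{u} k} {W : GradedSpace.{u₁} k} {C : GradedSpace.{u₂} k}
  {C' : GradedSpace.{u₃} k}
variable {D E M : Type*} [AddCommGroup D] [Module k D] [AddCommGroup E] [Module k E]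
  [AddCommGroup M] [Module k M]

theorem GradedSpace.apply_mem_of_degPart {S : Submodule k M} {n : ℤ} (T : V.Bar →ₗ[k] M)
    (h : ∀ y : List V.Homog, deg y = n → T (word y) ∈ S) {z : V.Bar} (hz : z ∈ Conv.degPart V n) :
    T z ∈ S := by
  have : Conv.degPart V n ≤ S.comap T :=
    Submodule.span_le.mpr (by rintro _ ⟨y, hy, rfl⟩; exact h y hy)
  exact this hz

namespace BiFam

/-- A family of maps without inputs in the algebra. -/
noncomputable def fop (Q : G.Elt → (D →ₗ[k] M)) : BiFam G V D M := fun β => const (Q β)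

theorem fop_single (Q : D →ₗ[k] M) : fop (V := V) (G := G) (single Q) = fconst Q := by
  funext β
  by_cases h : β = 0
  · subst h; rw [fop, fconst, single_zero, single_zero]
  · rw [fop, fconst, single_of_ne _ h, single_of_ne _ h, map_zero]

theorem fop_fmul_word (Q : G.Elt → (E →ₗ[k] M)) (K : BiFam G V D E) (β : G.Elt)
    (x : List V.Homog) (v : D) (y : List V.Homog) :
    fmul (fop Q) K β (word x) v (word y) = ∑ p ∈ decomps β, Q p.1 (K p.2 (word x) v (word y)) := by
  rw [fmul_word]
  refine Finset.sum_congr rfl fun p _ => ?_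
  rw [sumSplit_eq_right, sumSplit_eq_left]
  · exact const_one _ _
  · intro a b hb; exact const_right_ne _ _ _ hb
  · intro a b ha; exact sumSplit_eq_zero fun _ _ _ => by rw [fop, const_left_ne _ ha]

theorem algebraMapInv_hat {f : Coch G V W.carrier} (h : IsSmall 1 f) :
    fcomp (single (TensorAlgebra.algebraMapInv : W.Bar →ₐ[k] k).toLinearMap) (Conv.hat f).fam =
      single (TensorAlgebra.algebraMapInv : V.Bar →ₐ[k] k).toLinearMap := by
  have := congr_arg Conv.fam (Conv.one_comp_hat (R := k) h)
  rw [Conv.comp_fam, Conv.one_fam, Conv.one_fam] at this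
  exact this

variable (W) in
/-- A map without inputs in an algebra on the right. -/
noncomputable def constRight (Q : D →ₗ[k] M) : D →ₗ[k] W.Bar →ₗ[k] M :=
  LinearMap.mk₂ k (fun v y => TensorAlgebra.algebraMapInv (R := k) y • Q v)
    (by intros; simp) (by intro c v y; rw [map_smul, smul_comm]) (by intros; simp [add_smul])
    (by intros; simp [mul_smul])

variable (V W) in
/-- A map without inputs in two algebras. -/
noncomputable def constMixed (Q : D →ₗ[k] M) : V.Bar →ₗ[k] D →ₗ[k] W.Bar →ₗ[k] M :=
  LinearMap.toSpanSingleton k (D →ₗ[k] W.Bar →ₗ[k] M) (constRight W Q) ∘ₗ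
    (TensorAlgebra.algebraMapInv : V.Bar →ₐ[k] k).toLinearMap

theorem constMixed_fcomp {U : GradedSpace.{u₂} k} (Q : G.Elt → (D →ₗ[k] M)) {f : Coch G V W.carrier}
    (h : IsSmall 1 f) : fcomp (fun β => constMixed W U (Q β)) (Conv.hat f).fam =
      fun β => constMixed V U (Q β) := by
  have e : (fun β => constMixed W U (Q β)) = fcomp (fun β =>
      LinearMap.toSpanSingleton k (D →ₗ[k] U.Bar →ₗ[k] M) (constRight U (Q β)))
      (single (TensorAlgebra.algebraMapInv : W.Bar →ₐ[k] k).toLinearMap) :=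
    funext fun β => by rw [fcomp_single]; rfl
  rw [e, fcomp_assoc, algebraMapInv_hat h]
  funext β
  rw [fcomp_single]; rfl

theorem frev_constMixed (Q : G.Elt → (D →ₗ[k] M)) :
    frev (fun β => constMixed V W (Q β)) = fun β => constMixed W V (Q β) :=
  funext fun _ => LinearMap.ext fun _ => LinearMap.ext fun _ => LinearMap.ext fun _ =>
    smul_comm _ _ _

theorem fop_eq (Q : G.Elt → (D →ₗ[k] M)) : fop (V := V) Q = fun β => constMixed V V (Q β) := rfl

/-- `hat f` preserves the counit, so operations without algebra inputs, in particular constant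
forms, do not change. -/
theorem chg_fop (Q : G.Elt → (D →ₗ[k] M)) {f : Coch G V W.carrier} (h : IsSmall 1 f) :
    chg (fop Q) (Conv.hat f) = fop Q := by
  rw [chg, fop_eq, constMixed_fcomp Q h, frev_constMixed, constMixed_fcomp Q h, frev_constMixed]
  rfl

section Parity

variable {L : Conv G V W.Bar} (hL : Conv.map W.parT L = Conv.s L)

include hL

theorem parT_fam (β : G.Elt) (z : V.Bar) : L.fam β (V.parT z) = W.parT (L.fam β z) := by
  rw [← Conv.s_fam, ← hL, Conv.map_fam]

theorem fsL_chg (K : BiFam G W D M) : fsL (chg K L) = chg (fsL K) L := by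
  funext β
  refine LinearMap.ext fun x => LinearMap.ext fun v => LinearMap.ext fun y => ?_
  rw [chg_apply]
  change chg K L β (V.parT x) v y = _
  simp only [chg_apply, parT_fam hL]
  rfl

theorem frot_chg [CharZero k] (K : BiFam G W C.carrier (Module.Dual k C'.carrier)) :
    frot (chg K L) = chg (frot K) L := by
  funext β
  refine LinearMap.ext fun x => LinearMap.ext fun v => LinearMap.ext fun y =>
    LinearMap.ext fun c => ?_
  rw [chg_apply]
  have h : ∀ (x : V.Bar) (v : C'.carrier) (y : V.Bar) (c : C.carrier), chg K L β y c x v =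
      ∑ p ∈ decomps β, ∑ q ∈ decomps p.2, K p.1 (L.fam q.2 y) c (L.fam q.1 x) v := by
    intro x v y c
    rw [chg_apply]
    simp only [LinearMap.sum_apply]
    exact Finset.sum_congr rfl fun p _ =>
      sum_decomps_swap p.2 fun a b => K p.1 (L.fam a y) c (L.fam b x) v
  change (2⁻¹ : k) • (chg K L β y c x v + chg K L β y c (V.parT x) (C'.par v) +
    chg K L β (V.parT y) (C.par c) x v - chg K L β (V.parT y) (C.par c) (V.parT x) (C'.par v)) = _
  simp only [h, ← Finset.sum_add_distrib, ← Finset.sum_sub_distrib, Finset.smul_sum, parT_fam hL,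
    LinearMap.sum_apply]
  rfl

end Parity

section Coderivation

variable {m' : Coch G V V.carrier} {m : Coch G W W.carrier} {L : Conv G V W.Bar}

theorem finsL_eq (m : Coch G W W.carrier) (K : BiFam G W D M) :
    finsL m K = fcomp K (Conv.chat m).fam := by
  funext β
  rw [finsL, fcomp, lift₂, lift₂]
  exact Finset.sum_congr rfl fun p _ => by rw [Conv.chat_fam]; rfl

/-- The twist by the parity of the first two arguments. -/
noncomputable def ftwist (K : BiFam G W C.carrier M) : BiFam G W C.carrier M :=
  fun β => comp₃ (K β) W.parT.toLinearMap C.par LinearMap.id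

theorem finsR_eq (m : Coch G W W.carrier) (K : BiFam G W C.carrier M) :
    finsR m K = frev (fcomp (frev (ftwist K)) (Conv.chat m).fam) := by
  funext β
  rw [finsR, frev, fcomp, lift₂, lift₂, map_sum]
  exact Finset.sum_congr rfl fun p _ => by rw [Conv.chat_fam]; rfl

theorem ftwist_chg (hL : Conv.map W.parT L = Conv.s L) (K : BiFam G W C.carrier M) :
    ftwist (chg K L) = chg (ftwist K) L := by
  funext β
  refine LinearMap.ext fun x => LinearMap.ext fun v => LinearMap.ext fun y => ?_
  rw [chg_apply]
  change chg K L β (V.parT x) (C.par v) y = _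
  simp only [chg_apply, parT_fam hL]
  rfl

/-- Substitution by `L` intertwines the insertions because `L` intertwines the coderivations; on the
right side it must also respect parity, as required in the next lemma. -/
theorem finsL_chg (hm : L.comp (Conv.chat m') = (Conv.chat m).comp L) (K : BiFam G W D M) :
    finsL m' (chg K L) = chg (finsL m K) L := by
  have h := congr_arg Conv.fam hm
  rw [Conv.comp_fam, Conv.comp_fam] at h
  rw [finsL_eq, finsL_eq, chg_eq, fcomp_assoc, h, ← fcomp_assoc, chg_eq]
  exact congr_arg (fcomp · L.fam) (frev_comm (frev K) L.fam (Conv.chat m).fam).symm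

theorem finsR_chg (hL : Conv.map W.parT L = Conv.s L)
    (hm : L.comp (Conv.chat m') = (Conv.chat m).comp L) (K : BiFam G W C.carrier M) :
    finsR m' (chg K L) = chg (finsR m K) L := by
  have h := congr_arg Conv.fam hm
  rw [Conv.comp_fam, Conv.comp_fam] at h
  rw [finsR_eq, finsR_eq, ftwist_chg hL, chg, chg]
  change frev (fcomp (fcomp (frev (fcomp (ftwist K) L.fam)) L.fam) (Conv.chat m').fam) = _
  rw [fcomp_assoc, h, ← fcomp_assoc]
  exact congr_arg (fun P => frev (fcomp P L.fam))
    (frev_comm (ftwist K) L.fam (Conv.chat m).fam).symm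

end Coderivation

section Degree

variable {L : Conv G V W.Bar}

theorem BiDeg.chg {e : ℤ} {K : BiFam G W C.carrier C'.carrier} (hK : BiDeg e K)
    (hL : Conv.ConvDeg 0 L) : BiDeg e (chg K L) := by
  intro β x v y
  rw [chg_apply]
  refine Submodule.sum_mem _ fun p hp => Submodule.sum_mem _ fun q hq => ?_
  have h1 := maslov_of_mem hp
  have h2 := maslov_of_mem hq
  refine apply_mem_of_degPart ((K p.1).flip v.2 |>.flip (L.fam q.2 (word y))) (fun x' hx' => ?_)
    (hL q.1 x)
  refine apply_mem_of_degPart (K p.1 (word x') v.2) (fun y' hy' => ?_) (hL q.2 y)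
  have := hK p.1 x' v y'
  rwa [show deg x' + v.1 + deg y' + (e - maslov p.1) = deg x + v.1 + deg y + (e - maslov β) by
    omega] at this

theorem DualDeg.chg {N : ℤ} {K : BiFam G W C.carrier (Module.Dual k C'.carrier)}
    (hK : DualDeg N K) (hL : Conv.ConvDeg 0 L) : DualDeg N (chg K L) := by
  intro β x v y c
  contrapose!
  intro hne
  rw [chg_apply]
  simp only [LinearMap.sum_apply]
  refine Finset.sum_eq_zero fun p hp => Finset.sum_eq_zero fun q hq => ?_
  have h1 := maslov_of_mem hp
  have h2 := maslov_of_mem hq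
  refine (Submodule.mem_bot k).mp (apply_mem_of_degPart
    (((K p.1).flip v.2 |>.flip (L.fam q.2 (word y))).flip c.2) (fun x' hx' => ?_) (hL q.1 x))
  refine apply_mem_of_degPart ((K p.1 (word x') v.2).flip c.2) (fun y' hy' => ?_) (hL q.2 y)
  refine (Submodule.mem_bot k).mpr ?_
  by_contra h
  have := hK p.1 x' v y' c h
  omega

theorem core_chg (K : BiFam G W D M) (h : L.fam 0 1 = 1) : (chg K L 0).core = (K 0).core := by
  refine LinearMap.ext fun v => ?_
  change chg K L 0 1 v 1 = K 0 1 v 1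
  rw [chg_apply, decomps_zero, Finset.sum_singleton, decomps_zero, Finset.sum_singleton, h]

end Degree

/-- The action on the dual side is the rotation of an ordinary composition. In this form its
compatibility with change of algebra follows from that of composition and of rotation. -/
theorem frot_fsA_fpair [CharZero k] (φ : BiFam G V C.carrier (Module.Dual k C'.carrier))
    {b : BiFam G V C'.carrier C'.carrier} (hb : BiDeg 1 b) :
    fpair LinearMap.id (fsA φ) b = frot (fmul (fsL (frot φ)) b) := by
  funext β
  rw [frot, fmul, fpair, lift₂, lift₂, map_sum]
  refine Finset.sum_congr rfl fun p _ => ?_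
  rw [fsL, rotT_mul_sL _ (hb p.2) (odd_sub p.2), fsA, frot, rotT_rotT]

/-- Restriction of scalars along a homomorphism of algebras. -/
theorem frel_chg [CharZero k] {m' : Coch G V V.carrier} {m : Coch G W W.carrier}
    {f : Coch G V W.carrier} (hf : IsSmall 1 f) (hd : CoDeg 0 f)
    (hm : (Conv.hat f).comp (Conv.chat m') = (Conv.chat m).comp (Conv.hat f))
    (φ : BiFam G W C.carrier (Module.Dual k C.carrier)) {b : BiFam G W C.carrier C.carrier}
    (hb : BiDeg 1 b) :
    frel m' (chg φ (Conv.hat f)) (chg b (Conv.hat f)) (chg b (Conv.hat f)) =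
      chg (frel m φ b b) (Conv.hat f) := by
  have hL := Conv.map_parT_hat hf hd
  rw [frel, frel, fhat, fhat, chg_add, chg_add, chg_add, frot_fsA_fpair _ hb,
    frot_fsA_fpair _ (hb.chg (Conv.ConvDeg.hat hf hd)), finsL_chg hm, finsR_chg hL hm, frot_chg hL,
    fsL_chg hL, fsL_chg hL, ← chg_fmul _ _ hf, ← chg_fmul _ _ hf, frot_chg hL]

end BiFam

end ChangeOfAlgebra

/-! ### The families f_{p+1+q} over an algebra -/

section DiagonalFamilies

open GradedSpace GappingMonoid BiOp

variable {k : Type v} [Field k] {G : GappingMonoid}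
variable {V : GradedSpace.{u} k} {W : GradedSpace.{u₁} k} {U : GradedSpace.{u₂} k}
variable {D E M : Type*} [AddCommGroup D] [Module k D] [AddCommGroup E] [Module k E]
  [AddCommGroup M] [Module k M]

namespace BiFam

/-- The families `f_{p+1+q}`. -/
noncomputable def fofOp (f : Coch G V M) : BiFam G V V.carrier M := fun β => BiOp.ofOp (f β)

theorem fofOp_word (f : Coch G V M) (β : G.Elt) (x : List V.Homog) (v : V.Homog)
    (y : List V.Homog) : fofOp f β (word x) v.2 (word y) = f β (word (x ++ v :: y)) := by
  rw [fofOp, ofOp_apply, word_append, word_cons, mul_assoc]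

theorem fofOp_add (f g : Coch G V M) : fofOp (f + g) = fofOp f + fofOp g :=
  ext_word fun β x v y => by
    rw [fofOp_word]
    exact congr_arg₂ (· + ·) (fofOp_word f β x v y).symm (fofOp_word g β x v y).symm

theorem fofOp_sub (f g : Coch G V M) : fofOp (f - g) = fofOp f - fofOp g :=
  ext_word fun β x v y => by
    rw [fofOp_word]
    exact congr_arg₂ (· - ·) (fofOp_word f β x v y).symm (fofOp_word g β x v y).symm

theorem fofOp_pr : fofOp (Conv.pr G V) = fconst LinearMap.id := by
  refine ext_word fun β x v y => ?_
  rw [fofOp_word, Conv.pr, fconst]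
  by_cases hβ : β = 0
  · subst hβ
    rw [single_zero, single_zero]
    by_cases hx : x = []
    · by_cases hy : y = []
      · subst hx hy
        rw [List.nil_append, word_cons, word_nil, mul_one, letter_ι, const_one]; rfl
      · rw [const_right_ne _ _ _ hy, letter_word_of_length_ne]
        have := List.length_pos_iff.mpr hy
        simp only [List.length_append, List.length_cons]; omega
    · rw [const_left_ne _ hx, letter_word_of_length_ne]
      have := List.length_pos_iff.mpr hx
      simp only [List.length_append, List.length_cons]; omega
  · rw [single_of_ne _ hβ, single_of_ne _ hβ]; rfl

theorem BiDeg.ofOp {e : ℤ} {f : Coch G V W.carrier} (hf : CoDeg e f) : BiDeg e (fofOp f) := by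
  intro β x v y
  rw [fofOp_word]
  have := hf β (x ++ v :: y)
  rwa [deg_append, deg_cons, ← add_assoc] at this

theorem BSmall.ofOp {n : ℕ} {f : Coch G V M} (hf : IsSmall (n + 1) f) : BSmall n (fofOp f) := by
  intro β x v y hx
  have h : (fofOp f β (word x)).flip (word y) = 0 := hom_ext_homog fun v => by
    rw [LinearMap.flip_apply, fofOp_word]
    refine hf β _ ?_
    unfold wt at hx ⊢
    rw [List.length_append, List.length_cons]
    omega
  exact LinearMap.congr_fun h v

theorem fofOp_fcomp (Q : G.Elt → (E →ₗ[k] M)) (f : Coch G V E) :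
    fofOp (fcomp Q f) = fmul (fop Q) (fofOp f) := by
  refine ext_word fun β x v y => ?_
  rw [fop_fmul_word, fofOp_word, fcomp_apply]
  exact Finset.sum_congr rfl fun p _ => by rw [fofOp_word]

variable (V W) in
/-- Left multiplication by the values of a map. -/
noncomputable def lmulOp : (V.Bar →ₗ[k] W.Bar) →ₗ[k] BiOp V W.Bar W.Bar :=
  LinearMap.llcomp k V.Bar W.Bar _
    (LinearMap.llcomp k W.Bar W.Bar _ (constRight V LinearMap.id) ∘ₗ LinearMap.mul k W.Bar)

/-- Left multiplication by the values of a family. -/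
noncomputable def lmulFam (c : Conv G V W.Bar) : BiFam G V W.Bar W.Bar := fun β =>
  lmulOp V W (c.fam β)

/-- Right multiplication by the values of a family. -/
noncomputable def rmulFam (c : Conv G V W.Bar) : BiFam G V W.Bar W.Bar := frev fun β =>
  (LinearMap.llcomp k W.Bar W.Bar _ (constRight V LinearMap.id)) ∘ₗ (LinearMap.mul k W.Bar).flip ∘ₗ
    c.fam β

theorem constRight_word (z : E) (y : List V.Homog) :
    constRight V (LinearMap.id : E →ₗ[k] E) z (word y) = if y = [] then z else 0 := by
  by_cases h : y = []
  · subst h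
    simp [constRight, word_nil]
  · simp [constRight, h, algebraMapInv_word_of_ne h]

theorem lmulOp_word (c : V.Bar →ₗ[k] W.Bar) (x : List V.Homog) (z : W.Bar) (y : List V.Homog) :
    lmulOp V W c (word x) z (word y) = if y = [] then c (word x) * z else 0 :=
  constRight_word _ y

theorem lmulFam_fmul_word (c : Conv G V W.Bar) (K : BiFam G V U.carrier W.Bar) (β : G.Elt)
    (x : List V.Homog) (v : U.Homog) (y : List V.Homog) :
    fmul (lmulFam c) K β (word x) v.2 (word y) = ∑ p ∈ decomps β,
      sumSplit x fun x₁ x₂ => c.fam p.1 (word x₁) * K p.2 (word x₂) v.2 (word y) := by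
  rw [fmul_word]
  refine Finset.sum_congr rfl fun p _ => sumSplit_congr fun a b _ => ?_
  rw [sumSplit_eq_left]
  · exact (constRight_word (_ : W.Bar) []).trans (if_pos rfl)
  · intro s t ht
    exact (constRight_word _ t).trans (if_neg ht)

theorem rmulFam_fmul_word (c : Conv G V W.Bar) (K : BiFam G V U.carrier W.Bar) (β : G.Elt)
    (x : List V.Homog) (v : U.Homog) (y : List V.Homog) :
    fmul (rmulFam c) K β (word x) v.2 (word y) = ∑ p ∈ decomps β,
      sumSplit y fun y₁ y₂ => K p.2 (word x) v.2 (word y₁) * c.fam p.1 (word y₂) := by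
  rw [fmul_word]
  refine Finset.sum_congr rfl fun p _ => ?_
  rw [sumSplit_eq_right]
  · refine sumSplit_congr fun a b _ => ?_
    exact (constRight_word _ []).trans (if_pos rfl)
  · intro s t hs
    exact sumSplit_eq_zero fun a b _ => (constRight_word _ s).trans (if_neg hs)

theorem lmulFam_mul (c c' : Conv G V W.Bar) : lmulFam (c * c') = fmul (lmulFam c) (lmulFam c') := by
  funext β
  rw [lmulFam, Conv.mul_fam, lift₂, map_sum, fmul, lift₂]
  refine Finset.sum_congr rfl fun p _ => ?_
  rw [lmulFam, lmulFam]
  generalize c.fam p.1 = a, c'.fam p.2 = b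
  refine bar_ext fun x => LinearMap.ext fun z => bar_ext fun y => ?_
  rw [BiOp.mul_word, lmulOp_word]
  split_ifs with h
  · subst h
    rw [conv_word, sumSplit_mul]
    refine sumSplit_congr fun x₁ x₂ _ => ?_
    rw [sumSplit_nil, lmulOp_word, lmulOp_word, if_pos rfl, if_pos rfl, mul_assoc]
  · refine (sumSplit_eq_zero fun x₁ x₂ _ => ?_).symm
    rw [sumSplit_eq_left _ _ fun s t ht => (lmulOp_word _ _ _ t).trans (if_neg ht), lmulOp_word,
      lmulOp_word, if_neg h, mul_zero, if_pos rfl]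

theorem lmulFam_one_fmul (K : BiFam G V U.carrier W.Bar) :
    fmul (lmulFam (1 : Conv G V W.Bar)) K = K := by
  have h : lmulFam (1 : Conv G V W.Bar) = fconst LinearMap.id := by
    funext β
    refine bar_ext fun x => LinearMap.ext fun z => bar_ext fun y => ?_
    rw [lmulFam, lmulOp_word, Conv.one_fam, fconst]
    by_cases hβ : β = 0
    · subst hβ
      rw [single_zero, single_zero]
      by_cases hx : x = []
      · by_cases hy : y = []
        · subst hx hy
          simp [word_nil, const_one]
        · rw [const_right_ne _ _ _ hy, if_neg hy]
      · rw [const_left_ne _ hx]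
        simp [algebraMapInv_word_of_ne hx]
    · rw [single_of_ne _ hβ, single_of_ne _ hβ]
      simp
  rw [h, one_fmul]

/-- In f̂(x v y) exactly one factor contains v, so the value is a sum of terms f̂(x₁) f(x₂ v y₁)
f̂(y₂). Both sides solve the same recursion, obtained by splitting off the first factor, and the
recursion raises the order. -/
theorem fofOp_hat {f : Coch G V W.carrier} (hf : IsSmall 1 f) :
    fofOp (Conv.hat f).fam = fmul (lmulFam (Conv.hat f))
      (fmul (rmulFam (Conv.hat f)) (fofOp (Conv.letters f).fam)) := by
  set T := fmul (rmulFam (Conv.hat f)) (fofOp (Conv.letters f).fam) with hT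
  have h1 : fofOp (Conv.hat f).fam =
      T + fmul (lmulFam (Conv.letters f)) (fofOp (Conv.hat f).fam) := by
    refine ext_word fun β x v y => ?_
    change _ = T β (word x) v.2 (word y) + _
    rw [lmulFam_fmul_word, hT, rmulFam_fmul_word, fofOp_word,
      show (Conv.hat f).fam β (word (x ++ v :: y)) = (1 + Conv.letters f * Conv.hat f).fam β _ from
        congr_arg (fun c : Conv G V W.Bar => c.fam β _) (Conv.hat_eq hf), Conv.add_fam,
      Pi.add_apply, LinearMap.add_apply, Conv.one_fam, Conv.mul_word]
    have h0 : single (G := G) (Algebra.linearMap k W.Bar ∘ₗ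
        (TensorAlgebra.algebraMapInv : V.Bar →ₐ[k] k).toLinearMap) β (word (x ++ v :: y)) = 0 := by
      by_cases hβ : β = 0
      · subst hβ
        rw [single_zero, LinearMap.comp_apply, AlgHom.toLinearMap_apply,
          algebraMapInv_word_of_ne (by simp), map_zero]
      · rw [single_of_ne _ hβ]; rfl
    rw [h0, zero_add]
    simp only [sumSplit_append_cons, Finset.sum_add_distrib, fofOp_word]
    rw [add_comm]
    refine congr_arg (· + _) ?_
    exact sum_decomps_swap β fun a b => sumSplit y fun y₁ y₂ =>
      (Conv.letters f).fam a (word (x ++ v :: y₁)) * (Conv.hat f).fam b (word y₂)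
  have h2 : fmul (lmulFam (Conv.hat f)) T =
      T + fmul (lmulFam (Conv.letters f)) (fmul (lmulFam (Conv.hat f)) T) := by
    nth_rw 1 [Conv.hat_eq hf]
    have e : lmulFam (1 + Conv.letters f * Conv.hat f) =
        lmulFam 1 + lmulFam (Conv.letters f * Conv.hat f) :=
      funext fun β => map_add (lmulOp V W) _ _
    rw [e, fmul_add_left, lmulFam_one_fmul, lmulFam_mul, fmul_assoc]
  refine sub_eq_zero.mp (eq_zero_of_bSmall fun n => ?_)
  induction n with
  | zero => exact BSmall.zero_left _
  | succ n ih =>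
    rw [h1, h2, add_sub_add_left_eq_sub, ← fmul_sub_right, add_comm]
    refine BSmall.mul (fun β x z y hx => ?_) ih
    rw [lmulFam, lmulOp_word]
    split_ifs with hy
    · subst hy
      rw [Conv.small_letters hf β x (by simpa using hx), zero_mul]
    · rfl

/-- Composition with the coalgebra homomorphism induced by `f`. -/
theorem fofOp_fcomp_hat {f : Coch G V W.carrier} (hf : IsSmall 1 f) (Q : Coch G W M) :
    fofOp (fcomp Q (Conv.hat f).fam) = fmul (chg (fofOp Q) (Conv.hat f)) (fofOp f) := by
  have e1 : fofOp (Conv.letters f).fam = fmul (fconst (TensorAlgebra.ι k)) (fofOp f) := by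
    rw [← fop_single, ← fofOp_fcomp]
    congr 1
    funext β
    rw [single_fcomp]; rfl
  -- The universal case, in which the operation on words is the identity: inserting f̂ on both sides
  -- of a letter is multiplication by f̂ from both sides.
  have e2 : chg (fofOp (Conv.idc G W).fam) (Conv.hat f) =
      fmul (lmulFam (Conv.hat f)) (fmul (rmulFam (Conv.hat f)) (fconst (TensorAlgebra.ι k))) := by
    refine ext_word fun β x v y => ?_
    rw [chg_apply, lmulFam_fmul_word, Finset.sum_eq_single (0, β)]
    · refine Finset.sum_congr rfl fun p _ => ?_
      rw [sumSplit_eq_left]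
      · rw [fmul_fconst]
        refine Eq.trans ?_ (congr_arg ((Conv.hat f).fam p.1 (word x) * ·)
          ((constRight_word _ []).trans (if_pos rfl)).symm)
        rw [fofOp, ofOp_apply]
        change single (G := G) (LinearMap.id : W.Bar →ₗ[k] W.Bar) 0 _ = _
        rw [single_zero, LinearMap.id_apply, mul_assoc]
        rfl
      · intro s t ht
        rw [fmul_fconst]
        exact (congr_arg ((Conv.hat f).fam p.1 (word s) * ·)
          ((constRight_word _ t).trans (if_neg ht))).trans (mul_zero _)
    · intro p hp hne
      refine Finset.sum_eq_zero fun q _ => ?_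
      have : p.1 ≠ 0 := fun h => hne (Prod.ext h (by
        have := mem_decomps.mp hp
        rwa [h, zero_add] at this))
      rw [fofOp, ofOp_apply]
      change single (G := G) (LinearMap.id : W.Bar →ₗ[k] W.Bar) p.1 _ = _
      rw [single_of_ne _ this]
      rfl
    · intro h; exact absurd (by simp) h
  -- Every operation is obtained from the universal one by composing with a family without inputs,
  -- which change of algebra does not affect.
  have e3 : fofOp Q = fmul (fop Q) (fofOp (Conv.idc G W).fam) := by
    rw [← fofOp_fcomp, Conv.idc, fcomp_id]
  rw [fofOp_fcomp, fofOp_hat hf, e1, e3, chg_fmul _ _ hf, chg_fop _ hf, e2]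
  simp only [fmul_assoc]

end BiFam

end DiagonalFamilies

/-! ### Transport of algebra structures and of homomorphisms to the dual -/

section AlgebraTransport

open GradedSpace GappingMonoid BiOp BiFam

variable {k : Type v} [Field k] {G : GappingMonoid}

/-- A subword of x v y that is replaced lies in x, contains v, or lies in y: these are the three
terms of the bimodule coderivation. -/
theorem GappedAlgebra.fhat_fofOp (A : GappedAlgebra.{u} k G) {M : Type*} [AddCommGroup M] [Module k M]
    (Q : Coch G A.toGradedSpace M) :
    fhat A.m (fofOp Q) (fofOp A.m) = fofOp (fcomp Q (Conv.chat A.m).fam) := by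
  refine BiFam.ext_word fun β x v y => ?_
  rw [← compHat_eq, fofOp_word, coder_relation_word]
  unfold compHat
  refine Finset.sum_congr rfl fun p _ => ?_
  simp only [sumSplit_append_cons, sumSplit_add, word_append, word_cons, deg_append, deg_cons,
    fofOp, BiOp.ofOp_apply, mul_assoc, add_assoc]

section

variable {V : GradedSpace.{u} k} {W : GradedSpace.{u₁} k}

theorem Conv.hat_one {f : Coch G V W.carrier} (hf : IsSmall 1 f) : (Conv.hat f).fam 0 1 = 1 := by
  have h0 : f 0 1 = 0 := by
    have := hf 0 [] (by simp [wt, ord_zero])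
    rwa [word_nil] at this
  have := congr_arg (fun c : Conv G V W.Bar => c.fam 0 (word [])) (Conv.hat_eq hf)
  rw [word_nil] at this
  rw [this, Conv.add_fam, Pi.add_apply, LinearMap.add_apply, Conv.one_fam, single_zero,
    ← word_nil, Conv.mul_word]
  simp [decomps_zero, Conv.letters_fam, word_nil, h0, sumSplit_nil]

theorem fcomp_pr_chat {m : Coch G V V.carrier} {e : ℤ} (hm : CoDeg e m) :
    fcomp (Conv.pr G V) (Conv.chat m).fam = m := by
  refine Coch.ext_word fun β x => ?_
  rw [Conv.pr, single_fcomp, LinearMap.comp_apply, Conv.chat_fam, coder_word' (hm β), map_sumSplit,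
    sumSplit_eq_right, map_sumSplit, sumSplit_eq_left]
  · simp [deg_nil, IsHomog.val, word_nil]
  · intro a b hb
    rw [map_smul, letter_word_of_length_ne (by simpa using hb), smul_zero]
  · intro a b ha
    rw [map_sumSplit]
    refine sumSplit_eq_zero fun c d _ => ?_
    rw [map_smul, letter_word_of_length_ne, smul_zero]
    rw [List.length_append, List.length_cons]
    have := List.length_pos_iff.mpr ha
    omega

/-- A structure transported along an invertible map again satisfies the `A∞`-relations. -/
theorem fcomp_chat_of_comm {m : Coch G V V.carrier} {m' : Coch G W W.carrier} (hm : CoDeg 1 m)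
    (hmm : fcomp m (Conv.chat m).fam = 0)
    {f : Coch G V W.carrier} (hf : IsSmall 1 f) (hd : CoDeg 0 f)
    (hc : fcomp f (Conv.chat m).fam = fcomp m' (Conv.hat f).fam)
    {L : Conv G W V.Bar} (hL : (Conv.hat f).comp L = Conv.idc G W) :
    fcomp m' (Conv.chat m').fam = 0 := by
  have h1 := Conv.hat_comp_chat_of_comm hm hf hd hc
  -- It suffices to check the relation after precomposing with f̂, which has the right inverse `L`.
  have h2 : fcomp (fcomp m' (Conv.chat m').fam) (Conv.hat f).fam = 0 := by
    rw [fcomp_assoc, ← Conv.comp_fam, ← h1, Conv.comp_fam, ← fcomp_assoc, ← hc, fcomp_assoc,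
      ← Conv.comp_fam, Conv.chat_comp_chat hm hmm]
    exact fcomp_zero _
  have h3 := congr_arg (fun z => fcomp z L.fam) h2
  simp only [zero_fcomp] at h3
  rw [fcomp_assoc, ← Conv.comp_fam, hL] at h3
  exact (fcomp_id _).symm.trans h3

end

variable {A : GappedAlgebra.{u} k G} {B : GappedAlgebra.{u₁} k G}

/-- Over A, the family f_{p+1+q} is a bimodule homomorphism to the restriction of the diagonal
bimodule of B along f̂. So the restriction lemma `frel_chg` combines with `frel_pull`. -/
theorem frel_pull_fofOp [CharZero k] {f : Coch G A.toGradedSpace B.carrier} (hf : IsSmall 1 f)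
    (hd : CoDeg 0 f) (hc : fcomp f (Conv.chat A.m).fam = fcomp B.m (Conv.hat f).fam)
    (φ : BiFam G B.toGradedSpace B.carrier (Module.Dual k B.carrier)) :
    frel A.m (pull (chg φ (Conv.hat f)) (fofOp f)) (fofOp A.m) (fofOp A.m) =
      pull (chg (frel B.m φ (fofOp B.m) (fofOp B.m)) (Conv.hat f)) (fofOp f) := by
  have hm := Conv.hat_comp_chat_of_comm A.coDeg hf hd hc
  rw [← frel_chg hf hd hm φ (BiDeg.ofOp B.coDeg)]
  refine frel_pull A.coDeg _ (BiDeg.ofOp hd) (BiDeg.ofOp A.coDeg) ?_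
  rw [GappedAlgebra.fhat_fofOp, hc, fofOp_fcomp_hat hf]

theorem GappedAlgebra.diagonal_d (A : GappedAlgebra.{u} k G) : A.diagonal.d = A.d := by
  ext a
  simp [GappedBimodule.d, GappedAlgebra.d, BiOp.core]

theorem core_fofOp {V : GradedSpace.{u} k} {M : Type*} [AddCommGroup M] [Module k M]
    (f : Coch G V M) : (fofOp f 0).core = f 0 ∘ₗ TensorAlgebra.ι k := by
  ext a
  simp [fofOp, BiOp.core]

end AlgebraTransport

/-! ### Linear morphisms and the homotopy on words -/

section LinearMorphisms

open GradedSpace GappingMonoid BiOp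

variable {k : Type v} [Field k] {G : GappingMonoid}
variable {V : GradedSpace.{u} k} {W : GradedSpace.{u₁} k} {U : GradedSpace.{u₂} k}

/-- A coderivation induced by a linear map acts on one letter at a time, so it is also a twisted
derivation for concatenation. Coderivations with higher components do not have this property. -/
theorem coder_linear_mul (t : V.carrier →ₗ[k] V.carrier) (x y : V.Bar) :
    coder (t ∘ₗ letter) (x * y) =
      coder (t ∘ₗ letter) x * y + V.parT x * coder (t ∘ₗ letter) y := by
  set D := coder (V := V) (t ∘ₗ letter) with hD
  have h0 : D 1 = 0 := by
    rw [hD, ← word_nil, coder_word]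
    simp [sumSplit_nil, word_nil]
  have h1 : ∀ (a : V.Homog) (x : List V.Homog), D (word (a :: x)) =
      TensorAlgebra.ι k (t a.2) * word x + V.parT (TensorAlgebra.ι k a.2) * D (word x) := by
    intro a x
    rw [hD, coder_word, sumSplit_cons]
    refine congr_arg₂ (· + ·) ?_ ?_
    · rw [sumSplit_cons, sumSplit_eq_right]
      · simp [deg_nil, word_nil]
      · intro b c hb
        rw [LinearMap.comp_apply, letter_word_of_length_ne
          (by simpa using hb), map_zero, map_zero, mul_zero, zero_mul, smul_zero]
    · rw [coder_word, mul_sumSplit]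
      refine sumSplit_congr fun _ _ _ => ?_
      rw [mul_sumSplit]
      refine sumSplit_congr fun _ _ _ => ?_
      rw [parT_ι, par_homog, deg_cons, sgn_add, word_cons, map_smul, smul_mul_assoc,
        mul_smul_comm, smul_smul, mul_assoc, mul_assoc, mul_assoc]
  have h2 : ∀ x y : List V.Homog, D (word x * word y) = D (word x) * word y +
      V.parT (word x) * D (word y) := by
    intro x y
    induction x with
    | nil => simp [word_nil, h0]
    | cons a x ih =>
      rw [← word_append, List.cons_append, h1, word_append, ih, h1, word_cons, map_mul]
      simp only [add_mul, mul_add, mul_assoc, add_assoc]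
  have h3 : ∀ x : List V.Homog, D ∘ₗ LinearMap.mulLeft k (word x) =
      LinearMap.mulLeft k (D (word x)) + LinearMap.mulLeft k (V.parT (word x)) ∘ₗ D := fun x =>
    bar_ext fun y => h2 x y
  have h4 : D ∘ₗ LinearMap.mulRight k y =
      LinearMap.mulRight k y ∘ₗ D + LinearMap.mulRight k (D y) ∘ₗ V.parT.toLinearMap :=
    bar_ext fun x => LinearMap.congr_fun (h3 x) y
  exact LinearMap.congr_fun h4 x

/-- The family with a single component, of length one and energy zero. -/
noncomputable def lin (t : V.carrier →ₗ[k] W.carrier) : Coch G V W.carrier := single (t ∘ₗ letter)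

theorem lin_eq (t : V.carrier →ₗ[k] W.carrier) :
    lin (G := G) t = fcomp (single t) (Conv.pr G V) := by
  funext β
  rw [single_fcomp, lin, Conv.pr]
  by_cases hβ : β = 0
  · subst hβ; simp
  · simp [single_of_ne _ hβ]

theorem lin_id : lin (G := G) (LinearMap.id : V.carrier →ₗ[k] V.carrier) = Conv.pr G V := by
  rw [lin, LinearMap.id_comp]; rfl

theorem lin_zero : lin (G := G) (0 : V.carrier →ₗ[k] W.carrier) = 0 := by
  rw [lin, LinearMap.zero_comp]
  funext β
  by_cases hβ : β = 0
  · subst hβ; simp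
  · simp [single_of_ne _ hβ]

theorem single_fcomp_single (t : W.carrier →ₗ[k] U.carrier) (t' : V.carrier →ₗ[k] W.carrier) :
    fcomp (single (G := G) t) (single t') = single (t ∘ₗ t') := by
  funext β
  rw [single_fcomp]
  by_cases hβ : β = 0
  · subst hβ; simp
  · simp [single_of_ne _ hβ]

theorem single_fcomp_lin (t : W.carrier →ₗ[k] U.carrier) (t' : V.carrier →ₗ[k] W.carrier) :
    fcomp (single t) (lin (G := G) t') = lin (t ∘ₗ t') := by
  rw [lin_eq, lin_eq, ← fcomp_assoc, single_fcomp_single]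

theorem lin_fcomp_hat (t : W.carrier →ₗ[k] U.carrier) {f : Coch G V W.carrier} (hf : IsSmall 1 f) :
    fcomp (lin t) (Conv.hat f).fam = fcomp (single t) f := by
  rw [lin_eq, fcomp_assoc, Conv.pr_fcomp_hat hf]

theorem lin_fcomp_chat (t : V.carrier →ₗ[k] U.carrier) {m : Coch G V V.carrier} {e : ℤ}
    (hm : CoDeg e m) : fcomp (lin t) (Conv.chat m).fam = fcomp (single t) m := by
  rw [lin_eq, fcomp_assoc, fcomp_pr_chat hm]

theorem lin_sub (t t' : V.carrier →ₗ[k] W.carrier) : lin (G := G) (t - t') = lin t - lin t' := by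
  funext β
  rw [Pi.sub_apply]
  by_cases hβ : β = 0
  · subst hβ; simp [lin, LinearMap.sub_comp]
  · simp [lin, single_of_ne _ hβ]

theorem lin_add (t t' : V.carrier →ₗ[k] W.carrier) : lin (G := G) (t + t') = lin t + lin t' := by
  funext β
  rw [Pi.add_apply]
  by_cases hβ : β = 0
  · subst hβ; simp [lin, LinearMap.add_comp]
  · simp [lin, single_of_ne _ hβ]

theorem coDeg_single_fcomp {e e' : ℤ} {t : W.carrier →ₗ[k] U.carrier} (ht : IsDeg e t)
    {f : Coch G V W.carrier} (hf : CoDeg e' f) : CoDeg (e' + e) (fcomp (single t) f) := by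
  intro β x
  rw [single_fcomp, LinearMap.comp_apply]
  have := ht ⟨_, ⟨_, hf β x⟩⟩
  rwa [show deg x + (e' - maslov β) + e = deg x + (e' + e - maslov β) by ring] at this

theorem small_single_fcomp {E M : Type*} [AddCommGroup E] [Module k E] [AddCommGroup M] [Module k M]
    {n : ℕ} (t : E →ₗ[k] M) {f : Coch G V E} (hf : IsSmall n f) :
    IsSmall n (fcomp (single t) f) := fun β x hx => by
  rw [single_fcomp, LinearMap.comp_apply, hf β x hx, map_zero]

theorem small_lin (t : V.carrier →ₗ[k] W.carrier) : IsSmall 1 (lin (G := G) t) := by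
  rw [lin_eq]; exact small_single_fcomp t Conv.small_pr

theorem coDeg_lin {e : ℤ} {t : V.carrier →ₗ[k] W.carrier} (ht : IsDeg e t) :
    CoDeg e (lin (G := G) t) := by
  rw [lin_eq]
  have := coDeg_single_fcomp ht (CoDeg.pr (G := G))
  rwa [zero_add] at this

namespace Conv

theorem chat_lin_comp_mul (t : V.carrier →ₗ[k] V.carrier) (X Y : Conv G U V.Bar) :
    (chat (lin t)).comp (X * Y) =
      (chat (lin t)).comp X * Y + map V.parT X * (chat (lin t)).comp Y := by
  have h : (chat (lin (G := G) t)).fam = single (coder (t ∘ₗ letter)) := by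
    funext β
    rw [chat_fam, lin]
    by_cases hβ : β = 0
    · subst hβ; simp
    · simp [single_of_ne _ hβ]
  have h1 : ∀ Z : Conv G U V.Bar, ∀ β z, ((chat (lin t)).comp Z).fam β z =
      coder (t ∘ₗ letter) (Z.fam β z) := fun Z β z => by
    rw [comp_fam, h, single_fcomp]; rfl
  refine ext_word fun β x => ?_
  rw [h1, add_fam, Pi.add_apply, LinearMap.add_apply, mul_word, mul_word, mul_word, map_sum,
    ← Finset.sum_add_distrib]
  refine Finset.sum_congr rfl fun p _ => ?_
  rw [map_sumSplit, ← sumSplit_add]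
  refine sumSplit_congr fun _ _ _ => ?_
  rw [coder_linear_mul, h1, h1, map_fam]

theorem chat_lin_comp_letters (t : V.carrier →ₗ[k] V.carrier) (f : Coch G U V.carrier) :
    (chat (lin t)).comp (letters f) = letters (fcomp (single t) f) := by
  refine ext_word fun β x => ?_
  rw [comp_fam, fcomp_apply, Finset.sum_eq_single (0, β)]
  · rw [chat_fam, lin, single_zero, letters_fam, letters_fam, single_fcomp, LinearMap.comp_apply]
    have h : coder (t ∘ₗ letter) ∘ₗ TensorAlgebra.ι k = TensorAlgebra.ι k ∘ₗ t := by
      refine hom_ext_homog fun a => ?_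
      have := coder_word (t ∘ₗ letter) [a]
      rw [word_singleton] at this
      rw [LinearMap.comp_apply, this, sumSplit_cons, sumSplit_cons, sumSplit_nil, sumSplit_nil,
        sumSplit_nil]
      simp [word_nil, deg_nil]
    exact LinearMap.congr_fun h _
  · intro p hp hne
    have : p.1 ≠ 0 := fun h => hne (Prod.ext h (by
      have := mem_decomps.mp hp
      rwa [h, zero_add] at this))
    rw [chat_fam, lin, single_of_ne _ this]; simp
  · intro h; exact absurd (by simp) h

theorem map_parT_letters_odd {e : ℤ} (he : Odd e) {f : Coch G V W.carrier} (h : CoDeg e f) :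
    map W.parT (letters f) = -s (letters f) := by
  refine ext_word fun β x => ?_
  rw [map_fam, letters_fam, parT_ι, neg_fam, Pi.neg_apply, LinearMap.neg_apply, s_fam, parT_word,
    map_smul, letters_fam, par_of_mem (h β x), map_smul, ← neg_smul, ← neg_one_mul (sgn k _),
    ← sgn_one, ← sgn_add, sgn_congr]
  have := odd_cast (he.sub_even (maslov_even β))
  push_cast at this ⊢
  rw [this, add_comm]

theorem s_comp {R : Type*} [Ring R] [Algebra k R] (X : Conv G W R) (L : Conv G V W.Bar) :
    s (X.comp L) = X.comp (s L) :=
  ext_word fun β x => by rw [s_fam, comp_fam, comp_fam, fcomp_apply, fcomp_apply]; rfl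

theorem hat_eq_right {f : Coch G V W.carrier} (hf : IsSmall 1 f) :
    hat f = 1 + hat f * letters f := by
  refine (eq_hat hf ?_).symm
  nth_rw 1 [hat_eq hf]
  rw [add_mul, one_mul, mul_add, mul_one, mul_assoc]


section Homotopy

variable {d : Module.End k V.carrier} (c : Contraction V d)

/-- The homotopy on words induced by a contraction. -/
noncomputable def homotopy (G : GappingMonoid) (c : Contraction V d) : Conv G V V.Bar :=
  s (hat (lin c.pi)) * letters (lin c.h) * idc G V

theorem hat_pi_comp_chat : (hat (lin (G := G) c.pi)).comp (chat (lin d)) = 0 := by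
  rw [hat_comp_chat (coDeg_lin c.d_deg) (small_lin _), lin_fcomp_chat _ (coDeg_lin c.d_deg),
    single_fcomp_lin, show c.pi ∘ₗ d = 0 from c.pi_d, lin_zero, letters_zero, mul_zero, zero_mul]

theorem chat_comp_hat_pi : (chat (lin (G := G) d)).comp (hat (lin c.pi)) = 0 := by
  rw [chat_comp_hat _ (small_lin _) (coDeg_lin c.pi_deg), lin_fcomp_hat _ (small_lin _),
    single_fcomp_lin, show d ∘ₗ c.pi = 0 from c.d_pi, lin_zero, letters_zero, mul_zero, zero_mul]

/-- The tensor trick. The homotopy applies π to the letters before the place of h and the identity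
to those after it. Its commutator with d puts dh + hd = 1 − π at that place, and the sum over the
places telescopes to 1 − π^{⊗n}. -/
theorem homotopy_eq : (homotopy G c).comp (chat (lin d)) + (chat (lin d)).comp (homotopy G c) =
    idc G V - hat (lin c.pi) := by
  set P := hat (lin (G := G) c.pi) with hP
  set l := letters (lin (G := G) c.h) with hl
  have hd := coDeg_lin (G := G) c.d_deg
  have e1 : (homotopy G c).comp (chat (lin d)) =
      P * letters (lin (c.h * d)) * idc G V + P * s l * chat (lin d) := by
    rw [homotopy, mul_assoc, mul_comp_chat _ _ hd, mul_comp_chat _ _ hd, s_comp_chat _ hd,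
      hat_pi_comp_chat, map_zero, neg_zero, zero_mul, zero_add, s_s, idc_comp, hl, ← letters_fcomp,
      lin_fcomp_chat _ hd, single_fcomp_lin, mul_add, mul_assoc, mul_assoc]
    rfl
  have e2 : (chat (lin d)).comp (homotopy G c) =
      P * letters (lin (d * c.h)) * idc G V - P * s l * chat (lin d) := by
    have e3 : (chat (lin d)).comp (s P) = 0 := by
      have : s ((chat (lin (G := G) d)).comp P) = (chat (lin d)).comp (s P) := s_comp _ _
      rw [← this, hP, chat_comp_hat_pi, map_zero]
    have e4 : map V.parT (s P) = P := by
      have : map V.parT (s P) = s (map V.parT P) := rfl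
      rw [this, map_parT_hat (small_lin _) (coDeg_lin c.pi_deg), s_s]
    rw [homotopy, mul_assoc, chat_lin_comp_mul, e3, zero_mul, zero_add, e4, chat_lin_comp_mul,
      comp_idc, chat_lin_comp_letters, single_fcomp_lin,
      map_parT_letters_odd (by decide) (coDeg_lin c.h_deg), neg_mul, mul_add, mul_neg,
      ← sub_eq_add_neg, mul_assoc, mul_assoc]
    rfl
  have e5 : letters (lin (G := G) (c.h * d)) + letters (lin (d * c.h)) =
      letters (pr G V) - letters (lin c.pi) := by
    rw [← letters_add, ← letters_sub, ← lin_id, ← lin_add, ← lin_sub]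
    congr 2
    rw [Contraction.pi]
    change _ = 1 - _
    abel
  rw [e1, e2, add_add_sub_cancel, ← add_mul, ← mul_add, e5, mul_sub, sub_mul]
  have e6 : letters (pr G V) * idc G V = idc G V - 1 := by
    nth_rw 2 [idc_eq]; rw [add_sub_cancel_left]
  have e7 : P * letters (lin c.pi) = P - 1 := by
    nth_rw 2 [hP]; rw [hat_eq_right (small_lin _), add_sub_cancel_left]
  rw [mul_assoc, e6, e7, mul_sub, sub_mul]
  simp only [mul_one, one_mul]
  abel

theorem homotopy_comp_pi : (homotopy G c).comp (hat (lin c.pi)) = 0 := by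
  rw [homotopy, mul_comp_hat _ _ (small_lin _), mul_comp_hat _ _ (small_lin _), ← letters_fcomp,
    lin_fcomp_hat _ (small_lin _), single_fcomp_lin, show c.h ∘ₗ c.pi = 0 from c.h_pi, lin_zero,
    letters_zero, mul_zero, zero_mul]

theorem homotopy_deg : ConvDeg (-1) (homotopy G c) := by
  have := ((ConvDeg.hat (small_lin _) (coDeg_lin (G := G) c.pi_deg)).s.mul
    (ConvDeg.letters (coDeg_lin (G := G) c.h_deg))).mul ConvDeg.idc
  rwa [zero_add, add_zero] at this

theorem lowers_homotopy : Lowers 0 (homotopy G c) :=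
  Lowers.mul (i := 0) (j := 0) (Lowers.mul (i := 0) (j := 0) (lowers_hat (small_lin _)).s
    (lowers_letters (j := 0) (small_lin _))) lowers_idc

end Homotopy

end Conv

end LinearMorphisms

/-! ### The minimal model of an algebra -/

section MinimalModel

open GradedSpace GappingMonoid BiOp Conv

variable {k : Type v} [Field k] {G : GappingMonoid}
variable {V : GradedSpace.{u} k} {W : GradedSpace.{u₁} k} {U : GradedSpace.{u₂} k}

/-- The family `f` is a homomorphism of `A∞`-structures. -/
structure IsMor (m : Coch G V V.carrier) (m' : Coch G W W.carrier) (f : Coch G V W.carrier) :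
    Prop where
  small : IsSmall 1 f
  deg : CoDeg 0 f
  comm : fcomp f (chat m).fam = fcomp m' (hat f).fam

theorem IsMor.hat_comm {m : Coch G V V.carrier} {m' : Coch G W W.carrier} {f : Coch G V W.carrier}
    (hf : IsMor m m' f) (hm : CoDeg 1 m) : (hat f).comp (chat m) = (chat m').comp (hat f) :=
  hat_comp_chat_of_comm hm hf.small hf.deg hf.comm

section

variable {M : Type*} [AddCommGroup M] [Module k M]

theorem fcomp_comp (X : Coch G U M) (L : Conv G W U.Bar) (L' : Conv G V W.Bar) :
    fcomp (fcomp X L.fam) L'.fam = fcomp X (L.comp L').fam := fcomp_assoc _ _ _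

theorem fcomp_conv_add (X : Coch G W M) (L L' : Conv G V W.Bar) :
    fcomp X (L + L').fam = fcomp X L.fam + fcomp X L'.fam := fcomp_add _ _ _

theorem fcomp_conv_sub (X : Coch G W M) (L L' : Conv G V W.Bar) :
    fcomp X (L - L').fam = fcomp X L.fam - fcomp X L'.fam := by
  rw [sub_eq_add_neg, fcomp_conv_add, sub_eq_add_neg]
  exact congr_arg _ (fcomp_neg _ _)

theorem fcomp_conv_zero (X : Coch G W M) : fcomp X (0 : Conv G V W.Bar).fam = 0 := fcomp_zero _

theorem fcomp_conv_idc (X : Coch G V M) : fcomp X (idc G V).fam = X := fcomp_id _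

end

theorem IsMor.comp {m : Coch G V V.carrier} {m' : Coch G W W.carrier} {m'' : Coch G U U.carrier}
    {f : Coch G V W.carrier} {g : Coch G W U.carrier} (hg : IsMor m' m'' g) (hf : IsMor m m' f)
    (hm : CoDeg 1 m) : IsMor m m'' (fcomp g (hat f).fam) where
  small := small_fcomp_hat hf.small hg.small
  deg := by
    have := hg.deg.fcomp (ConvDeg.hat hf.small hf.deg)
    rwa [add_zero] at this
  comm := by
    rw [fcomp_comp, hf.hat_comm hm, ← fcomp_comp, hg.comm, fcomp_comp, hat_comp_hat hf.small hg.small]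

theorem IsMor.inverse {m : Coch G V V.carrier} {m' : Coch G W W.carrier} {f : Coch G V W.carrier}
    (hf : IsMor m m' f) (hm : CoDeg 1 m) {g : Coch G W V.carrier} (hgs : IsSmall 1 g)
    (hgd : CoDeg 0 g) (hgf : (hat g).comp (hat f) = idc G V) (hfg : (hat f).comp (hat g) = idc G W) :
    IsMor m' m g where
  small := hgs
  deg := hgd
  comm := by
    have h1 : (hat g).comp (chat m') = (chat m).comp (hat g) := by
      rw [← comp_idc ((hat g).comp (chat m')), ← hfg, ← comp_assoc, comp_assoc (hat g),
        ← hf.hat_comm hm, ← comp_assoc, hgf, idc_comp]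
    have h2 := congr_arg (fun z : Conv G W V.Bar => fcomp (pr G V) z.fam) h1
    simp only [← fcomp_comp] at h2
    rwa [pr_fcomp_hat hgs, fcomp_pr_chat hm] at h2

variable {d : Module.End k V.carrier} (c : Contraction V d)

/-- A structure is isomorphic to one whose non-linear part takes values in the cohomology. -/
theorem exists_partial_minimal (c : Contraction V d) {m : Coch G V V.carrier} (hm : CoDeg 1 m)
    (hmm : fcomp m (chat m).fam = 0) (hd : IsSmall 2 (m - lin d)) :
    ∃ n F g : Coch G V V.carrier, CoDeg 1 n ∧ IsSmall 2 n ∧ fcomp (single c.pi) n = n ∧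
      IsSmall 2 (F - pr G V) ∧ IsSmall 2 (g - pr G V) ∧ IsMor m (lin d + n) F ∧
      IsMor (lin d + n) m g ∧ (hat F).comp (hat g) = idc G V := by
  have hld := coDeg_lin (G := G) c.d_deg
  -- With F = 1 + h(m − d) and m∘m̂ = 0, the difference F∘m̂ − d∘F is (1 − hd − dh)m = πm. So one
  -- coordinate change already gives a nonlinear part with harmonic values.
  set F := pr G V + fcomp (single c.h) (m - lin d) with hF
  have hFs : IsSmall 2 (F - pr G V) := by
    rw [hF, add_sub_cancel_left]; exact small_single_fcomp _ hd
  have hFd : CoDeg 0 F := by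
    refine CoDeg.pr.add ?_
    have := coDeg_single_fcomp c.h_deg (hm.sub hld)
    rwa [show (1 : ℤ) + -1 = 0 by norm_num] at this
  obtain ⟨g, hgd, hgs, -, -, hgF, hFg⟩ := exists_inverse hFd hFs
  have hF1 := small_one_of_sub_pr hFs
  have hg1 := small_one_of_sub_pr hgs
  set n := fcomp (single c.pi) (fcomp m (hat g).fam) with hn
  have hnd : CoDeg 1 n := by
    have := coDeg_single_fcomp c.pi_deg (hm.fcomp (ConvDeg.hat hg1 hgd))
    rwa [add_zero, add_zero] at this
  have hns : IsSmall 2 n := by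
    have e : n = fcomp (single c.pi) (fcomp (m - lin d) (hat g).fam) := by
      rw [sub_fcomp, fcomp_sub, ← fcomp_assoc _ (lin d), single_fcomp_lin,
        show c.pi ∘ₗ d = 0 from c.pi_d, lin_zero, zero_fcomp, sub_zero]
    rw [e]
    exact small_single_fcomp _ (small_fcomp hd (lowers_hat hg1))
  have hpn : fcomp (single c.pi) n = n := by
    rw [hn, ← fcomp_assoc, single_fcomp_single, show c.pi ∘ₗ c.pi = c.pi from c.pi_pi]
  have hFm : IsMor m (lin d + n) F := by
    refine ⟨hF1, hFd, ?_⟩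
    have e1 : fcomp F (chat m).fam = m - fcomp (single (c.h * d)) m := by
      rw [hF, add_fcomp, fcomp_pr_chat hm, fcomp_assoc, sub_fcomp, hmm, lin_fcomp_chat _ hm, zero_sub,
        fcomp_neg, ← fcomp_assoc, single_fcomp_single, ← sub_eq_add_neg]
      rfl
    have e2 : fcomp (lin d) (hat F).fam = fcomp (single (d * c.h)) m := by
      rw [lin_fcomp_hat _ hF1, hF, fcomp_add, ← fcomp_assoc, single_fcomp_single, fcomp_sub,
        single_fcomp_lin, ← lin_eq, show (d ∘ₗ c.h) ∘ₗ d = d from c.d_h_d, add_sub_cancel]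
      rfl
    have e3 : fcomp n (hat F).fam = fcomp (single c.pi) m := by
      rw [hn, fcomp_assoc, fcomp_comp, hgF, fcomp_conv_idc]
    rw [e1, add_fcomp, e2, e3]
    funext β
    simp only [Pi.add_apply, Pi.sub_apply, single_fcomp, Contraction.pi]
    refine LinearMap.ext fun z => ?_
    simp only [LinearMap.sub_apply, LinearMap.add_apply, LinearMap.comp_apply, Module.End.one_apply]
    abel
  exact ⟨n, F, g, hnd, hns, hpn, hFs, hgs, hFm, hFm.inverse hm hg1 hgd hgF hFg, hFg⟩

/-- Harmonic values are killed by d, so the relation for d + n loses every term in which d is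
applied last. -/
theorem fcomp_nonlinear_chat (c : Contraction V d) {n : Coch G V V.carrier} (hn : CoDeg 1 n)
    (hpn : fcomp (single c.pi) n = n)
    (hmm : fcomp (lin d + n) (chat (lin d + n)).fam = 0) :
    fcomp n (chat (lin d + n)).fam = 0 := by
  have hdn : fcomp (single d) n = 0 := by
    rw [← hpn, ← fcomp_assoc, single_fcomp_single, show d ∘ₗ c.pi = 0 from c.d_pi]
    exact funext fun β => by rw [single_fcomp, LinearMap.zero_comp]; rfl
  rwa [add_fcomp, lin_fcomp_chat _ ((coDeg_lin c.d_deg).add hn), fcomp_add, hdn, single_fcomp_lin,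
    show d ∘ₗ d = 0 from c.d_d, lin_zero, add_zero, zero_add] at hmm

/-- The projection of a structure whose non-linear part takes values in the cohomology. -/
theorem exists_minimal_projection (c : Contraction V d) {n : Coch G V V.carrier} (hn : CoDeg 1 n)
    (hns : IsSmall 2 n) (hpn : fcomp (single c.pi) n = n)
    (hmm : fcomp (lin d + n) (chat (lin d + n)).fam = 0) :
    ∃ q : Coch G V V.carrier, CoDeg 0 q ∧ IsSmall 1 q ∧ IsSmall 2 (q - lin c.pi) ∧
      fcomp (single c.pi) q = q ∧ fcomp q (chat (lin d + n)).fam = fcomp n (hat q).fam := by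
  have hld := coDeg_lin (G := G) c.d_deg
  set D := chat (lin (G := G) d) with hD
  set T := homotopy G c with hT
  set P := hat (lin (G := G) c.pi) with hP
  -- The homomorphism relation for q is q∘d̂ = X(q). It is integrated along the homotopy T on words,
  -- which suggests the equation q = π + X(q)∘T.
  let X : Coch G V V.carrier → Coch G V V.carrier :=
    fun q => fcomp n (hat q).fam - fcomp q (chat n).fam
  have hnL : Lowers 1 (chat n) := lowers_chat hns
  obtain ⟨q, ⟨hqd, hq1⟩, hq⟩ := exists_fixed_of_small (fun q => CoDeg 0 q ∧ IsSmall 1 q)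
    (fun f hf => ⟨CoDeg.of_approx f fun j => (hf j).imp fun g hg => ⟨hg.1.1, hg.2⟩,
      IsSmall.of_approx f fun j => (hf j).imp fun g hg => ⟨hg.1.2, hg.2⟩⟩)
    ⟨CoDeg.zero, fun _ _ _ => rfl⟩
    (fun q => lin c.pi + fcomp (single c.pi) (fcomp (X q) T.fam))
    (fun q hq => by
      refine ⟨(coDeg_lin c.pi_deg).add ?_, IsSmall_add (small_lin _) (small_single_fcomp _ ?_)⟩
      · have h1 := hn.fcomp (ConvDeg.hat hq.2 hq.1)
        have h2 := hq.1.fcomp (ConvDeg.chat hn)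
        have := coDeg_single_fcomp c.pi_deg ((CoDeg.sub (e := 1) h1 h2).fcomp (homotopy_deg c))
        exact this
      · exact small_fcomp (j := 0) (IsSmall_sub (IsSmall_mono (by norm_num)
          (small_fcomp hns (lowers_hat hq.2))) (IsSmall_mono (by norm_num)
          (small_fcomp hq.2 hnL))) (lowers_homotopy c))
    (fun j q q' hq hq' h => by
      rw [add_sub_add_left_eq_sub, ← fcomp_sub, ← sub_fcomp]
      refine small_single_fcomp _ (small_fcomp (j := 0) ?_ (lowers_homotopy c))
      have e : X q - X q' = fcomp n (hat q - hat q').fam - fcomp (q - q') (chat n).fam := by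
        change (_ - _) - (_ - _) = _
        rw [fcomp_conv_sub, sub_fcomp]; abel
      rw [e]
      refine IsSmall_sub ?_ (small_fcomp h hnL)
      cases j with
      | zero => exact IsSmall_mono (by norm_num) (small_fcomp (j := 0) hns
          (lowers_hat_sub_hat hq.2 hq'.2 (IsSmall_sub hq.2 hq'.2)))
      | succ j =>
        have := small_fcomp hns (lowers_hat_sub_hat hq.2 hq'.2 h)
        rwa [show 2 + j = j + 1 + 1 by ring] at this)
  have hpq : fcomp (single c.pi) q = q := by
    rw [← hq, fcomp_add, single_fcomp_lin, ← fcomp_assoc, single_fcomp_single,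
      show c.pi ∘ₗ c.pi = c.pi from c.pi_pi]
  have hpX : fcomp (single c.pi) (X q) = X q := by
    rw [fcomp_sub, ← fcomp_assoc, ← fcomp_assoc, hpn, hpq]
  rw [← fcomp_assoc, hpX] at hq
  have hXs : IsSmall 2 (X q) := IsSmall_sub (small_fcomp hns (lowers_hat hq1)) (small_fcomp hq1 hnL)
  have hdq : fcomp (single d) q = 0 := by
    rw [← hpq, ← fcomp_assoc, single_fcomp_single, show d ∘ₗ c.pi = 0 from c.d_pi]
    exact funext fun β => by rw [single_fcomp, LinearMap.zero_comp]; rfl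
  have hDD : D.comp D = 0 := chat_comp_chat hld (by
    rw [lin_fcomp_chat _ hld, single_fcomp_lin, show d ∘ₗ d = 0 from c.d_d, lin_zero])
  have hNN : (chat n).comp D + D.comp (chat n) + (chat n).comp (chat n) = 0 := by
    have := chat_comp_chat (hld.add hn) hmm
    rw [chat_add, add_comp, comp_add, comp_add, hDD, zero_add] at this
    rw [← this]; abel
  have hnn : fcomp n D.fam + fcomp n (chat n).fam = 0 := by
    have := fcomp_nonlinear_chat c hn hpn hmm
    rw [chat_add, fcomp_conv_add] at this
    exact this
  -- The defect of the relation to be proved; the rest of the proof derives an equation for e that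
  -- raises its order.
  set e := fcomp q D.fam - X q with he
  have hqP : fcomp q P.fam = lin c.pi := by
    nth_rw 1 [← hq]
    rw [add_fcomp, fcomp_comp, homotopy_comp_pi, fcomp_conv_zero, add_zero,
      lin_fcomp_hat _ (small_lin _), single_fcomp_lin, show c.pi ∘ₗ c.pi = c.pi from c.pi_pi]
  -- On words of harmonic letters q is just π, and π intertwines n∘P with n; so the two terms of
  -- X(q) cancel there.
  have hXP : fcomp (X q) P.fam = 0 := by
    have hr : CoDeg 1 (fcomp n P.fam) := by
      have := hn.fcomp (ConvDeg.hat (small_lin _) (coDeg_lin (G := G) c.pi_deg))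
      rwa [add_zero] at this
    have h1 : IsMor (fcomp n P.fam) n (lin c.pi) := ⟨small_lin _, coDeg_lin c.pi_deg, by
      rw [lin_fcomp_chat _ hr, ← fcomp_assoc, hpn]⟩
    rw [sub_fcomp, fcomp_comp, fcomp_comp, hP, hat_comp_hat (small_lin _) hq1, hqP,
      ← h1.hat_comm hr, ← fcomp_comp, hqP, h1.comm, sub_self]
  set E := s (hat q) * letters e * hat q with hE
  have hqD : (hat q).comp D = E + (chat n).comp (hat q) - (hat q).comp (chat n) := by
    rw [hat_comp_chat hld hq1, hat_comp_chat hn hq1, chat_comp_hat n hq1 hqd, hE, ← hD, he,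
      letters_sub, letters_sub]
    noncomm_ring
  have hDq : D.comp (hat q) = 0 := by
    rw [chat_comp_hat _ hq1 hqd, lin_fcomp_hat _ hq1, hdq, letters_zero, mul_zero, zero_mul]
  have hXD : fcomp (X q) D.fam = fcomp n E.fam + fcomp e (chat n).fam := by
    have h1 : fcomp (fcomp n (chat n).fam) (hat q).fam = 0 := by
      rw [← eq_neg_iff_add_eq_zero, eq_comm, neg_eq_iff_eq_neg] at hnn
      rw [hnn, neg_fcomp, fcomp_comp, hDq, fcomp_conv_zero, neg_zero]
    have h2 : (chat n).comp D = -(D.comp (chat n)) - (chat n).comp (chat n) := by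
      rw [← sub_eq_zero, ← hNN]; abel
    have h3 : fcomp (fcomp q (chat n).fam) D.fam =
        -(fcomp (fcomp q D.fam) (chat n).fam) - fcomp (fcomp q (chat n).fam) (chat n).fam := by
      rw [fcomp_comp, h2, fcomp_conv_sub, fcomp_comp, fcomp_comp]
      exact congr_arg (· - _) (fcomp_neg _ _)
    rw [show fcomp q D.fam = e + X q by rw [he, sub_add_cancel], add_fcomp,
      show fcomp (X q) (chat n).fam = _ from sub_fcomp _ _ _] at h3
    rw [show fcomp (X q) D.fam = _ from sub_fcomp _ _ _, h3, fcomp_comp n, hqD, fcomp_conv_sub, fcomp_conv_add, ← fcomp_comp n (chat n),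
      h1, fcomp_comp n]
    abel
  -- Substituting T d̂ = 1 − P − d̂ T into q = π + X(q)T removes everything except X(q)d̂T, and
  -- `hXD` expresses X(q)d̂ through e.
  have heq : e = -fcomp (fcomp n E.fam + fcomp e (chat n).fam) T.fam := by
    have h1 : T.comp D = idc G V - P - D.comp T := by
      rw [← homotopy_eq c]; abel
    rw [← hXD, fcomp_comp]
    nth_rw 1 [he]
    nth_rw 1 [← hq]
    rw [add_fcomp, fcomp_comp, h1, fcomp_conv_sub, fcomp_conv_sub, fcomp_conv_idc, hXP,
      lin_fcomp_chat _ hld, single_fcomp_lin, show c.pi ∘ₗ d = 0 from c.pi_d, lin_zero]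
    abel
  -- If e has order j + 1, then its induced map E loses j units of weight; since n has order two,
  -- one order is gained. The induction therefore starts from order one.
  have he0 : e = 0 := by
    refine eq_zero_of_small fun j => ?_
    have h1 : IsSmall 1 e :=
      IsSmall_sub (small_fcomp (j := 0) hq1 (lowers_chat (j := 0) (small_lin _)))
        (IsSmall_mono (by norm_num) hXs)
    induction j with
    | zero => exact IsSmall_mono (by norm_num) h1
    | succ j ih =>
      cases j with
      | zero => exact h1
      | succ j =>
        rw [heq]
        have h2 : Lowers j E := by
          have := ((lowers_hat hq1).s.mul (lowers_letters ih)).mul (lowers_hat hq1)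
          rwa [zero_add, add_zero] at this
        refine IsSmall_neg (small_fcomp (j := 0) (IsSmall_add ?_ (small_fcomp ih hnL))
          (lowers_homotopy c))
        have := small_fcomp hns h2
        rwa [show 2 + j = j + 1 + 1 by ring] at this
  refine ⟨q, hqd, hq1, ?_, hpq, ?_⟩
  · nth_rw 1 [← hq]
    rw [add_sub_cancel_left]
    exact small_fcomp (j := 0) hXs (lowers_homotopy c)
  · rw [he, sub_eq_zero] at he0
    rw [chat_add, fcomp_conv_add, ← hD, he0]
    exact sub_add_cancel _ _

/-- The minimal model of an `A∞`-structure. -/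
theorem exists_minimal_model (c : Contraction V d) {m : Coch G V V.carrier} (hm : CoDeg 1 m)
    (hmm : fcomp m (chat m).fam = 0) (hd : IsSmall 2 (m - lin d)) :
    ∃ (mH : Coch G c.H c.H.carrier) (i : Coch G c.H V.carrier) (p : Coch G V c.H.carrier),
      CoDeg 1 mH ∧ IsSmall 2 mH ∧ fcomp mH (chat mH).fam = 0 ∧
      IsMor mH m i ∧ IsSmall 2 (i - lin c.incl) ∧ IsMor m mH p ∧ IsSmall 2 (p - lin c.proj) := by
  obtain ⟨n, F, g, hnd, hns, hpn, hFs, hgs, hF, hg, hFg⟩ := exists_partial_minimal c hm hmm hd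
  have hld := coDeg_lin (G := G) c.d_deg
  have hm' := hld.add hnd
  have hmm' := fcomp_chat_of_comm hm hmm hF.small hF.deg hF.comm hFg
  obtain ⟨q, hqd, hq1, hqs, hpq, hqn⟩ := exists_minimal_projection c hnd hns hpn hmm'
  have hI1 := small_lin (G := G) c.incl
  have hId := coDeg_lin (G := G) c.incl_deg
  -- After the coordinate change the linear inclusion is already a homomorphism, so the minimal
  -- structure is the restriction of n to harmonic elements.
  set mH := fcomp (single c.proj) (fcomp n (hat (lin c.incl)).fam) with hmH
  have hHd : CoDeg 1 mH := by
    have := coDeg_single_fcomp c.proj_deg (hnd.fcomp (ConvDeg.hat hI1 hId))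
    rwa [add_zero, add_zero] at this
  have hHs : IsSmall 2 mH := small_single_fcomp _ (small_fcomp hns (lowers_hat hI1))
  have hi : IsMor mH (lin d + n) (lin c.incl) := by
    refine ⟨hI1, hId, ?_⟩
    rw [lin_fcomp_chat _ hHd, hmH, ← fcomp_assoc, single_fcomp_single, c.incl_proj, ← fcomp_assoc,
      hpn, add_fcomp, lin_fcomp_hat _ hI1, single_fcomp_lin, c.d_incl, lin_zero, zero_add]
  have hp : IsMor (lin d + n) mH (fcomp (single c.proj) q) := by
    have h1 := small_single_fcomp c.proj hq1
    refine ⟨h1, by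
      have := coDeg_single_fcomp c.proj_deg hqd
      rwa [add_zero] at this, ?_⟩
    rw [fcomp_assoc, hqn, hmH, fcomp_assoc, fcomp_comp, hat_comp_hat h1 hI1, lin_fcomp_hat _ h1,
      ← fcomp_assoc (single c.incl), single_fcomp_single, c.incl_proj, hpq]
  have hHH : fcomp mH (chat mH).fam = 0 := by
    have h1 := fcomp_nonlinear_chat c hnd hpn hmm'
    nth_rw 1 [hmH]
    rw [fcomp_assoc, fcomp_comp, hi.hat_comm hHd, ← fcomp_comp, h1, zero_fcomp, fcomp_zero]
  refine ⟨mH, fcomp g (hat (lin c.incl)).fam, fcomp (fcomp (single c.proj) q) (hat F).fam, hHd, hHs,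
    hHH, hg.comp hi hHd, ?_, hp.comp hF hm, ?_⟩
  · have e : fcomp g (hat (lin c.incl)).fam - lin c.incl =
        fcomp (g - pr G V) (hat (lin c.incl)).fam := by
      rw [sub_fcomp, pr_fcomp_hat hI1]
    rw [e]
    exact small_fcomp hgs (lowers_hat hI1)
  · have hp1 := small_single_fcomp c.proj hqs
    have e0 : fcomp (single c.proj) (lin (G := G) c.pi) = lin c.proj := by
      rw [single_fcomp_lin, ← c.incl_proj, ← LinearMap.comp_assoc, c.proj_incl, LinearMap.id_comp]
    have e : fcomp (fcomp (single c.proj) q) (hat F).fam - lin c.proj =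
        fcomp (fcomp (single c.proj) (q - lin c.pi)) (hat F).fam +
          fcomp (single c.proj) (F - pr G V) := by
      rw [fcomp_sub, fcomp_sub, e0, sub_fcomp, lin_fcomp_hat _ hF.small, ← lin_eq]
      abel
    rw [e]
    exact IsSmall_add (small_fcomp (j := 0) hp1 (lowers_hat hF.small)) (small_single_fcomp _ hFs)

end MinimalModel

/-! ### A Darboux theorem for closed skew families -/

section ClosedDarboux

open GradedSpace GappingMonoid BiOp BiFam

variable {k : Type v} [Field k] {G : GappingMonoid}
variable {V : GradedSpace.{u} k} {W : GradedSpace.{u₁} k}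

namespace BiOp

theorem Closed.add {ω ω' : BiOp V V.carrier (Module.Dual k V.carrier)} (h : Closed ω)
    (h' : Closed ω') : Closed (ω + ω') := fun p q r s a b c => by
  have h1 := h p q r s a b c
  have h2 := h' p q r s a b c
  simp only [LinearMap.add_apply]
  linear_combination h1 + h2

theorem Closed.smul {ω : BiOp V V.carrier (Module.Dual k V.carrier)} (h : Closed ω) (t : k) :
    Closed (t • ω) := fun p q r s a b c => by
  have h1 := h p q r s a b c
  simp only [LinearMap.smul_apply, smul_eq_mul]
  linear_combination t * h1

theorem Closed.sub {ω ω' : BiOp V V.carrier (Module.Dual k V.carrier)} (h : Closed ω)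
    (h' : Closed ω') : Closed (ω - ω') := by
  have e : ∀ x v y c, (ω - ω') x v y c = ω x v y c - ω' x v y c := fun _ _ _ _ => rfl
  intro p q r s a b c
  have h1 := h p q r s a b c
  have h2 := h' p q r s a b c
  simp only [e]
  linear_combination h1 - h2

theorem closed_zero : Closed (0 : BiOp V V.carrier (Module.Dual k V.carrier)) :=
  fun p q r s a b c => by simp

theorem closed_sum {ι : Type*} (s : Finset ι) (f : ι → BiOp V V.carrier (Module.Dual k V.carrier))
    (h : ∀ i, Closed (f i)) : Closed (∑ i ∈ s, f i) :=
  Finset.sum_induction _ _ (fun _ _ => Closed.add) closed_zero fun i _ => h i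

theorem euler_add {M : Type*} [AddCommGroup M] [Module k M] (ω ω' : BiOp V V.carrier M) :
    euler (ω + ω') = euler ω + euler ω' := bar_ext fun x => by
  rw [LinearMap.add_apply, euler_word, euler_word, euler_word, ← smul_add, ← sumMark_add]
  rfl

theorem euler_sub {M : Type*} [AddCommGroup M] [Module k M] (ω ω' : BiOp V V.carrier M) :
    euler (ω - ω') = euler ω - euler ω' := by
  rw [eq_sub_iff_add_eq, ← euler_add, sub_add_cancel]

end BiOp

namespace BiFam

theorem closed_fpair_sub_frot [CharZero k] {M M' : Type*} [AddCommGroup M] [Module k M]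
    [AddCommGroup M'] [Module k M'] (B : M →ₗ[k] M' →ₗ[k] k) (K : Coch G V M) (F : Coch G V M')
    (β : G.Elt) :
    Closed ((fpair (C := V) (C' := V) B (fofOp K) (fofOp F) -
      frot (fpair (C := V) (C' := V) B (fofOp K) (fofOp F))) β) := by
  have e : (fpair (C := V) (C' := V) B (fofOp K) (fofOp F) -
      frot (fpair (C := V) (C' := V) B (fofOp K) (fofOp F))) β =
      ∑ p ∈ decomps β, (pair (C := V) (C' := V) B (ofOp (K p.1)) (ofOp (F p.2)) -
        rotT (pair (C := V) (C' := V) B (ofOp (K p.1)) (ofOp (F p.2)))) := by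
    refine BiOp.ext_word fun x v y => LinearMap.ext fun c => ?_
    have e1 : frot (fpair (C := V) (C' := V) B (fofOp K) (fofOp F)) β =
      ∑ p ∈ decomps β, rotT (pair (C := V) (C' := V) B (ofOp (K p.1)) (ofOp (F p.2))) :=
      map_sum rotT _ _
    rw [Pi.sub_apply, e1]
    simp only [fpair, lift₂, fofOp, LinearMap.sub_apply, LinearMap.sum_apply,
      Finset.sum_sub_distrib]
  rw [e]
  exact closed_sum _ _ fun p => closed_pair_sub_rotT B _ _

theorem closed_of_eq_sub_frot [CharZero k] {φ : BiFam G V V.carrier (Module.Dual k V.carrier)}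
    (hs : frot φ = -φ) (h : ∀ β, Closed ((φ - frot φ) β)) (β : G.Elt) : Closed (φ β) := by
  have e : (φ - frot φ) β = φ β + φ β := by
    rw [hs]; exact sub_neg_eq_add (φ β) (φ β)
  have := (h β).smul (2⁻¹ : k)
  rwa [e, ← two_smul k, smul_smul, inv_mul_cancel₀ two_ne_zero, one_smul] at this

theorem frot_pull_fconst [CharZero k] {N : ℤ} (B : SkewForm W N) {C : GradedSpace.{u₂} k}
    {g : BiFam G V C.carrier W.carrier} (hg : BiDeg 0 g) :
    frot (pull (fconst B.form) g) = -pull (fconst B.form) g := by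
  rw [frot_pull _ hg, B.frot_fconst, pull, fmul_neg_left, fpair_neg_left]; rfl

/-- Being skew, the pullback is half of its own antisymmetrisation, and the antisymmetrisation of a
pairing of two maps on words is closed. -/
theorem closed_pull_fconst [CharZero k] {N : ℤ} (B : SkewForm W N) {f : Coch G V W.carrier}
    (hf : CoDeg 0 f) (β : G.Elt) : Closed (pull (fconst B.form) (fofOp f) β) := by
  refine closed_of_eq_sub_frot (frot_pull_fconst B (BiDeg.ofOp hf)) (fun β => ?_) β
  rw [pull, ← fop_single, ← fofOp_fcomp]
  exact closed_fpair_sub_frot _ _ _ β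

/-- The primitive of a closed family given by the Euler homotopy. -/
noncomputable def feuler {M : Type*} [AddCommGroup M] [Module k M]
    (φ : BiFam G V V.carrier M) : Coch G V M := fun β => euler (φ β)

theorem eq_feuler_sub_frot [CharZero k] {φ : BiFam G V V.carrier (Module.Dual k V.carrier)}
    (hc : ∀ β, Closed (φ β)) (hs : frot φ = -φ) :
    φ = fofOp (feuler φ) - frot (fofOp (feuler φ)) := by
  have h : ∀ β, pair (C := V) (C' := V) LinearMap.id (ofOp (euler (φ β))) (const LinearMap.id) =
      fofOp (feuler φ) β := fun β => by
    rw [← fpair_one (fofOp (feuler φ)), fpair, fconst, lift₂_single_right]; rfl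
  funext β
  have := eq_euler_sub_rotT (hc β) (congr_fun hs β)
  rw [h] at this
  exact this

/-- The order rises by one only because the bimodule entry now counts as a letter of the word. -/
theorem small_feuler {M : Type*} [AddCommGroup M] [Module k M] {n : ℕ} {φ : BiFam G V V.carrier M}
    (h : BSmall n φ) : IsSmall (n + 1) (feuler φ) := fun β x hx => by
  rw [feuler, euler_word, sumMark_congr (F' := fun _ _ _ => 0), sumMark_const, smul_zero, smul_zero]
  rintro x' a x'' rfl
  refine h β x' a.2 x'' ?_
  simp only [wt, List.length_append, List.length_cons] at hx ⊢
  omega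

theorem DualDeg.feuler {N : ℤ} {φ : BiFam G V V.carrier (Module.Dual k V.carrier)}
    (h : DualDeg N φ) : DualDeg N (fofOp (feuler φ)) := fun β x v y c hne => by
  by_contra hc
  refine hne ?_
  rw [fofOp_word, BiFam.feuler, euler_word, LinearMap.smul_apply,
    ← LinearMap.applyₗ_apply_apply (R := k), map_sumMark,
    sumMark_congr (F' := fun _ _ _ => 0), sumMark_const, smul_zero, smul_zero]
  intro x' a x'' e
  by_contra hne'
  have h1 := h β x' a x'' c hne'
  have h2 := congr_arg deg e
  simp only [deg_append, deg_cons] at h2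
  exact hc (by omega)

theorem coDeg_of_biDeg {e : ℤ} {f : Coch G V W.carrier} (h : BiDeg e (fofOp f))
    (h0 : ∀ β, f β 1 = 0) : CoDeg e f := fun β x => by
  cases x with
  | nil => rw [word_nil, h0]; exact Submodule.zero_mem _
  | cons a x =>
    have := h β [] a x
    rw [fofOp_word] at this
    simpa [deg_nil] using this

/-- The equation of the bimodule case, but now the linear terms are Bη minus its rotation, with Bη a
one-form on words. So Bη is taken to be the Euler primitive of φ − B − η^*Bη. Its antisymmetrisation
is the remainder itself, because the remainder is closed and skew. -/
theorem exists_pull_fofOp_eq [CharZero k] {N : ℤ} (B : SkewForm V N)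
    {φ : BiFam G V V.carrier (Module.Dual k V.carrier)} (hφ : DualDeg N φ)
    (hskew : frot φ = -φ) (hclosed : ∀ β, Closed (φ β)) (hB : (φ 0).core = B.form) :
    ∃ h : Coch G V V.carrier, CoDeg 0 h ∧ IsSmall 2 (h - Conv.pr G V) ∧
      pull (fconst B.form) (fofOp h) = φ := by
  obtain ⟨Bi, hBi⟩ := B.form.exists_leftInverse_of_injective
    (LinearMap.ker_eq_bot.mpr B.form_injective)
  let R : Coch G V V.carrier → BiFam G V V.carrier (Module.Dual k V.carrier) :=
    fun η => φ - fconst B.form - pull (fconst B.form) (fofOp η)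
  have hR : ∀ η, CoDeg 0 η → DualDeg N (R η) := fun η hη =>
    (hφ.sub (DualDeg.const B)).sub ((DualDeg.const B).pull (BiDeg.ofOp hη))
  have hR1 : ∀ η, IsSmall 2 η → BSmall 1 (R η) := fun η hη => by
    refine BSmall.sub (bSmall_one ?_) ?_
    · exact (congr_arg₂ (· - ·) hB (core_fconst B.form)).trans (sub_self _)
    · exact (((BSmall.ofOp hη).mul_right _).pair (BSmall.ofOp (n := 1) hη)).mono (by omega)
  have hΦ : ∀ ω, fofOp (fcomp (single Bi) (feuler ω)) =
      fmul (fconst Bi) (fofOp (feuler (G := G) (V := V) (M := Module.Dual k V.carrier) ω)) :=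
    fun ω => by rw [fofOp_fcomp, fop_single]
  obtain ⟨η, ⟨hη, hs⟩, hfix⟩ := Conv.exists_fixed_of_small
    (fun η : Coch G V V.carrier => CoDeg 0 η ∧ IsSmall 2 η)
    (fun f hf => ⟨CoDeg.of_approx f fun j => (hf j).imp fun g hg => ⟨hg.1.1, hg.2⟩,
      IsSmall.of_approx f fun j => (hf j).imp fun g hg => ⟨hg.1.2, hg.2⟩⟩)
    ⟨CoDeg.zero, fun _ _ _ => rfl⟩ (fun η => fcomp (single Bi) (feuler (R η)))
    (fun η hη => ⟨coDeg_of_biDeg (by rw [hΦ]; exact ((hR η hη.1).feuler.exists_lift B hBi).1)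
        fun β => by
          rw [single_fcomp, LinearMap.comp_apply, feuler, ← word_nil, euler_word]
          simp [sumMark],
      small_single_fcomp _ (small_feuler (hR1 η hη.2))⟩)
    (fun j f g hf hg hfg => by
      rw [← fcomp_sub]
      refine small_single_fcomp _ ?_
      have e : feuler (R f) - feuler (R g) = feuler (R f - R g) :=
        funext fun β => (euler_sub _ _).symm
      rw [e]
      have key : ∀ j, IsSmall (j + 1) (f - g) → IsSmall (j + 2) (feuler (R f - R g)) := by
        intro j hfg
        have hgf : BSmall j (fofOp (g - f)) := by
          refine BSmall.ofOp ?_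
          rw [← neg_sub]
          exact Conv.IsSmall_neg hfg
        have e : R f - R g = fpair LinearMap.id (fmul (fconst B.form) (fofOp (g - f))) (fofOp g) +
            fpair LinearMap.id (fmul (fconst B.form) (fofOp f)) (fofOp (g - f)) := by
          simp only [R]
          simp only [fofOp_sub, pull, fmul_sub_right, fpair_sub_left, fpair_sub_right]
          abel
        rw [e]
        refine small_feuler (BSmall.add ((hgf.mul_right _).pair (BSmall.ofOp (n := 1) hg.2)) ?_)
        rw [add_comm]
        exact ((BSmall.ofOp (n := 1) hf.2).mul_right _).pair hgf
      -- The estimate needs a difference of order at least one. At level zero this comes from f and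
      -- g, which both have order two.
      obtain _ | j := j
      · have h0 := Conv.IsSmall_mono (n' := 1) (by omega) (Conv.IsSmall_sub hf.2 hg.2)
        exact Conv.IsSmall_mono (by omega) (key 0 h0)
      · exact key j hfg)
  refine ⟨Conv.pr G V + η, CoDeg.pr.add hη, by rwa [add_sub_cancel_left], ?_⟩
  have hRs : frot (R η) = -R η := by
    simp only [R]
    rw [frot_sub, frot_sub, hskew, B.frot_fconst, frot_pull_fconst B (BiDeg.ofOp hη)]
    abel
  have hRc : ∀ β, Closed (R η β) := fun β => by
    have h1 := closed_pull_fconst (G := G) B CoDeg.pr β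
    rw [fofOp_pr, pull_one] at h1
    exact ((hclosed β).sub h1).sub (closed_pull_fconst B hη β)
  have h1 : fmul (fconst B.form) (fofOp η) = fofOp (feuler (R η)) := by
    nth_rw 1 [← hfix]
    rw [hΦ]
    exact ((hR η hη).feuler.exists_lift B hBi).2
  -- The second linear term is minus the rotation of the first, so together they form the
  -- antisymmetrised primitive.
  have h3 : fpair LinearMap.id (fconst B.form) (fofOp η) = -frot (fofOp (feuler (R η))) := by
    have h4 := frot_fpair_fmul (fconst B.form) (BiDeg.ofOp hη) (BiDeg.one (G := G) (V := V) (C := V))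
    rw [fpair_one, h1, B.frot_fconst, fmul_neg_left, fmul_one, fpair_neg_left] at h4
    rw [h4]
    abel
  rw [fofOp_add, fofOp_pr, pull, fmul_add_right, fmul_one, fpair_add_left, fpair_add_right,
    fpair_add_right, fpair_one, h3, fpair_one, ← pull, h1]
  have h5 := eq_feuler_sub_frot hRc hRs
  rw [show fconst B.form + -frot (fofOp (feuler (R η))) + (fofOp (feuler (R η)) +
    pull (fconst B.form) (fofOp η)) = fconst B.form + (fofOp (feuler (R η)) -
    frot (fofOp (feuler (R η)))) + pull (fconst B.form) (fofOp η) by abel, ← h5]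
  simp only [R]
  abel

end BiFam

end ClosedDarboux

/-! ### Algebra homomorphisms and cyclic algebras as families -/

section AlgebraHomomorphisms

open GradedSpace GappingMonoid BiOp BiFam

variable {k : Type v} [Field k] {G : GappingMonoid}

section

variable {V : GradedSpace.{u} k} {W : GradedSpace.{u₁} k} {M : Type*} [AddCommGroup M] [Module k M]

theorem sumHat_eq (f : Coch G V W.carrier) (n : ℕ) (β : G.Elt) (x : List V.Homog)
    (F : W.Bar →ₗ[k] M) :
    sumHat f n β x F = F ((Conv.letters f ^ n).fam β (word x)) := by
  induction n generalizing β x F with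
  | zero =>
    rw [sumHat, pow_zero, Conv.one_fam]
    by_cases hβ : β = 0
    · subst hβ
      by_cases hx : x = []
      · subst hx; simp [word_nil]
      · simp [hx, algebraMapInv_word_of_ne hx]
    · simp [hβ, single_of_ne _ hβ]
  | succ n ih =>
    rw [sumHat, pow_succ', Conv.mul_word, map_sum]
    refine Finset.sum_congr rfl fun p _ => ?_
    rw [map_sumSplit]
    refine sumSplit_congr fun _ _ _ => ?_
    rw [ih]; rfl

theorem Conv.small_pow {R : Type*} [Ring R] [Algebra k R] {X : Conv G V R} (h : IsSmall 1 X.fam)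
    (n : ℕ) : IsSmall n (X ^ n).fam := by
  induction n with
  | zero => exact fun _ _ hx => absurd hx (by omega)
  | succ n ih => rw [pow_succ]; exact Conv.small_mul ih h

theorem Conv.hat_fam_word {f : Coch G V W.carrier} (hf : IsSmall 1 f) {n : ℕ} {β : G.Elt}
    {x : List V.Homog} (hx : wt β x.length < n) :
    (Conv.hat f).fam β (word x) =
      ∑ i ∈ Finset.range n, (Conv.letters f ^ i).fam β (word x) := by
  have h : ∀ n : ℕ, (Conv.hat f).fam β (word x) =
      (∑ i ∈ Finset.range n, (Conv.letters f ^ i).fam β (word x)) +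
        (Conv.letters f ^ n * Conv.hat f).fam β (word x) := by
    intro n
    induction n with
    | zero => simp
    | succ n ih =>
      rw [ih, Finset.sum_range_succ, add_assoc]
      nth_rw 1 [Conv.hat_eq hf]
      rw [mul_add, mul_one, ← mul_assoc, ← pow_succ]
      rfl
  rw [h n, Conv.small_mul (Conv.small_pow (Conv.small_letters hf) n)
    (b := 0) (fun _ _ hx => absurd hx (by omega)) β x (by simpa using hx), add_zero]

/-- The n-th convolution power of f has order n, so at a given energy and word only n up to the
weight contributes; these terms make up f̂. -/
theorem finsum_sumHat {f : Coch G V W.carrier} (hf : IsSmall 1 f) (m : Coch G W M) (β : G.Elt)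
    (x : List V.Homog) :
    ∑ᶠ n : ℕ, ∑ p ∈ decomps β, sumHat f n p.2 x (m p.1) =
      fcomp m (Conv.hat f).fam β (word x) := by
  have hle : ∀ p ∈ decomps β, wt p.2 x.length ≤ wt β x.length := fun p hp => by
    have := ord_add_le_of_mem hp
    unfold wt
    omega
  rw [finsum_eq_sum_of_support_subset (s := Finset.range (wt β x.length + 1)), Finset.sum_comm,
    fcomp_apply]
  · refine Finset.sum_congr rfl fun p hp => ?_
    rw [Conv.hat_fam_word hf (Nat.lt_succ_of_le (hle p hp)), map_sum]
    exact Finset.sum_congr rfl fun n _ => sumHat_eq f n p.2 x (m p.1)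
  · intro n hn
    by_contra hn'
    refine hn (Finset.sum_eq_zero fun p hp => ?_)
    rw [sumHat_eq, Conv.small_pow (Conv.small_letters hf) n p.2 x, map_zero]
    have := hle p hp
    simp only [Finset.coe_range, Set.mem_Iio, not_lt] at hn'
    omega

end

variable {A B : GappedAlgebra.{u} k G}

theorem AlgebraHom.isMor (f : AlgebraHom A B) : IsMor A.m B.m f.f where
  small := small_one f.f_zero
  deg β x := by
    have := f.f_degree β x
    rwa [zero_sub, ← sub_eq_add_neg]
  comm := Coch.ext_word fun β x => by
    rw [coder_relation_word, f.relation, finsum_sumHat (small_one f.f_zero)]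

/-- The homomorphism with given components. -/
noncomputable def AlgebraHom.ofCoch (f : Coch G A.toGradedSpace B.carrier) (hf : IsMor A.m B.m f) :
    AlgebraHom A B where
  f := f
  f_degree β x := by
    have := hf.deg β x
    rwa [zero_sub, ← sub_eq_add_neg] at this
  f_zero := by
    have := hf.small 0 [] (by simp [wt, ord_zero])
    rwa [word_nil] at this
  relation β x := by rw [finsum_sumHat hf.small, ← hf.comm, coder_relation_word]

theorem DualHom.isClosed_iff {N : ℤ} {φ : DualHom A.diagonal N} :
    φ.IsClosed ↔ ∀ β, Closed (φ.φ β) := by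
  simp only [DualHom.IsClosed, Closed, negOnePow_smul (k := k) (M := k), smul_eq_mul]

section

variable [CharZero k] {N : ℤ} (ψ : SkewForm B.toGradedSpace N)

/-- For the diagonal bimodule, cyclicity rotates the block x v past the rest of the word. The cyclic
condition on the algebra rotates one letter; iterating it along x gives the block rotation, and x
empty gives the converse. -/
theorem SkewForm.isCyclicAlgebra_iff :
    ψ.IsCyclicAlgebra ↔ frel B.m (fconst ψ.form) (fofOp B.m) (fofOp B.m) = 0 := by
  have key : ∀ (β : G.Elt) (x : List B.Homog) (v : B.Homog) (y : List B.Homog) (c : B.Homog),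
      dualOp (BiOp.ofOp (B.m β)) x v.1 (ψ.form v.2) y c =
        sgn k ((deg x + v.1) * (deg y + c.1)) * ψ.form (B.m β (word (y ++ c :: x))) v.2 := by
    intro β x v y c
    have h := ψ.skew v ⟨_, ⟨_, B.coDeg β (y ++ c :: x)⟩⟩
    have e : BiOp.ofOp (B.m β) (word y) c.2 (word x) = B.m β (word (y ++ c :: x)) :=
      fofOp_word B.m β y c x
    rw [dualOp, e, negOnePow_smul (k := k) (M := k), smul_eq_mul, h,
      negOnePow_smul (k := k) (M := k), smul_eq_mul, mul_neg, ← mul_assoc, ← sgn_add,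
      ← neg_mul, ← neg_one_mul (sgn k _), ← sgn_one, ← sgn_add]
    refine congr_arg (· * _) (sgn_congr ?_)
    have h1 := odd_cast (odd_one.sub_even (maslov_even β))
    simp only [deg_append, deg_cons]
    push_cast at h1 ⊢
    generalize (maslov β : ZMod 2) = μ at h1 ⊢
    have : μ = 0 := by grind
    subst this
    grind
  have key' : (SkewForm.IsCyclicBimodule (D := B.diagonal) ψ) ↔
      ∀ (β : G.Elt) (x : List B.Homog) (v : B.Homog) (y : List B.Homog) (c : B.Homog),
        ψ.form (B.m β (word (x ++ v :: y))) c.2 =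
          sgn k ((deg x + v.1) * (deg y + c.1)) * ψ.form (B.m β (word (y ++ c :: x))) v.2 := by
    refine forall_congr' fun β => forall_congr' fun x => forall_congr' fun v =>
      forall_congr' fun y => forall_congr' fun c => ?_
    rw [← key, ← fofOp_word B.m β x v y]
    rfl
  refine Iff.trans ?_ (SkewForm.isCyclicBimodule_iff (D := B.diagonal) ψ)
  rw [key']
  constructor
  · intro h β x
    induction x with
    | nil =>
      intro v y c
      rw [List.nil_append, h, negOnePow_smul (k := k) (M := k), smul_eq_mul, deg_nil, zero_add]
    | cons a x ih =>
      intro v y c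
      rw [List.cons_append, h, negOnePow_smul (k := k) (M := k), smul_eq_mul, List.append_assoc,
        List.cons_append, ih, ← mul_assoc, ← sgn_add, List.append_assoc, List.singleton_append]
      refine congr_arg (· * _) (sgn_congr ?_)
      simp only [deg_append, deg_cons, deg_nil]
      push_cast
      grind
  · intro h β a x c
    have := h β [] a x c
    rw [negOnePow_smul (k := k) (M := k), smul_eq_mul]
    rwa [List.nil_append, deg_nil, zero_add] at this

end

end AlgebraHomomorphisms

/-! ### Strong homotopy inner products on algebras -/

section StrongInnerProducts

open GradedSpace GappingMonoid BiOp BiFam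

variable {k : Type v} [Field k] {G : GappingMonoid} {A : GappedAlgebra.{u} k G} {N : ℤ}

/-- Non-zero energy already weighs at least two, so weight below two leaves only the empty word and
single letters, both at energy zero. -/
theorem small_two {V : GradedSpace.{u} k} {M : Type*} [AddCommGroup M] [Module k M]
    {f : Coch G V M} (h0 : f 0 1 = 0) (h : f 0 ∘ₗ TensorAlgebra.ι k = 0) : IsSmall 2 f := by
  intro β x hx
  by_cases hx1 : wt β x.length < 1
  · exact small_one h0 β x hx1
  · match x with
    | [] => unfold wt at hx hx1; simp only [List.length_nil] at hx hx1; omega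
    | [a] =>
      have hβ : β = 0 := by
        by_contra hβ
        have := ord_pos hβ
        unfold wt at hx
        omega
      subst hβ
      rw [word_singleton]
      exact LinearMap.congr_fun h _
    | _ :: _ :: _ => unfold wt at hx; simp only [List.length_cons] at hx; omega

theorem linear_of_small_two {V : GradedSpace.{u} k} {W : GradedSpace.{u₁} k} {f : Coch G V W.carrier}
    {t : V.carrier →ₗ[k] W.carrier} (h : IsSmall 2 (f - lin t)) : f 0 ∘ₗ TensorAlgebra.ι k = t := by
  refine hom_ext_homog fun a => ?_
  have := h 0 [a] (by simp [wt, ord_zero])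
  rw [Pi.sub_apply, LinearMap.sub_apply, lin, single_zero, word_singleton, LinearMap.comp_apply,
    letter_ι, sub_eq_zero] at this
  exact this

theorem small_m_sub_lin (A : GappedAlgebra.{u} k G) : IsSmall 2 (A.m - lin A.d) := by
  refine small_two ?_ (LinearMap.ext fun a => ?_)
  · rw [Pi.sub_apply, LinearMap.sub_apply, A.m_zero, lin, single_zero, LinearMap.comp_apply,
      letter_one, map_zero, sub_zero]
  · rw [LinearMap.comp_apply, Pi.sub_apply, LinearMap.sub_apply, lin, single_zero,
      LinearMap.comp_apply, letter_ι]
    exact sub_self _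

theorem BiFam.chg_neg {V : GradedSpace.{u} k} {W : GradedSpace.{u₁} k} {D M : Type*}
    [AddCommGroup D] [Module k D] [AddCommGroup M] [Module k M] (K : BiFam G W D M)
    (L : Conv G V W.Bar) : chg (-K) L = -chg K L := by
  rw [← zero_sub, chg_sub, chg_zero, zero_sub]

theorem IsMor.linear_comm {B : GappedAlgebra.{u₁} k G} {f : Coch G A.toGradedSpace B.carrier}
    (hf : IsMor A.m B.m f) (x : A.carrier) :
    B.d (f 0 (TensorAlgebra.ι k x)) = f 0 (TensorAlgebra.ι k (A.d x)) := by
  have h := A.fhat_fofOp f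
  rw [hf.comm, fofOp_fcomp_hat hf.small] at h
  have h1 := congr_arg (fun z : BiFam G A.toGradedSpace A.carrier B.carrier => (z 0).core x) h
  simp only [core_fhat A.m_zero, core_fmul, core_chg _ (Conv.hat_one hf.small), core_fofOp] at h1
  exact h1.symm

variable [CharZero k]

/-- All three properties are those of a pullback of a constant form; closedness is the additional
one that uses that the bimodule map comes from a map on words. -/
theorem DualHom.isStrongHomotopyInnerProduct_imp {φ : DualHom A.diagonal N}
    (h : φ.IsStrongHomotopyInnerProduct) :
    φ.IsSkew ∧ φ.IsClosed ∧ φ.IsHomologicallyNondegenerate := by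
  obtain ⟨B, ψ, f, hψ, hf, hφ⟩ := h
  have hm := f.isMor
  have e : φ.φ = pull (fconst ψ.form) (fofOp f.f) :=
    ext_pairing fun β x v y c => (hφ β x v y c).trans (pullback_eq ψ.form _ β x v y c)
  refine ⟨DualHom.isSkew_iff.mpr ?_, DualHom.isClosed_iff.mpr fun β => ?_, fun a ha ha' => ?_⟩
  · rw [e, frot_pull_fconst ψ (BiDeg.ofOp hm.deg)]
  · rw [e]; exact closed_pull_fconst ψ hm.deg β
  · rw [A.diagonal_d] at ha ha'
    obtain ⟨b, hb, hne⟩ := ψ.exists_ne_zero_of_inducesIso (d := B.d)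
      (B.diagonal_d ▸ B.diagonal.biDeg.core)
      (fun v w => by
        have := core_frel B.m_zero (ψ.isCyclicAlgebra_iff.mp hψ) v w
        rwa [core_fconst, core_fofOp] at this) hf hm.linear_comm ha ha'
    refine ⟨b, by rwa [A.diagonal_d], ?_⟩
    rw [e]
    refine (core_pull _ _ _ _).trans_ne ?_
    rwa [core_fconst, core_fofOp]

/-- A closed skew symmetric homomorphism on an algebra restricts to such a family on another. -/
theorem closed_pull_chg {V : GradedSpace.{u} k} {W : GradedSpace.{u₁} k}
    {φ : BiFam G W W.carrier (Module.Dual k W.carrier)} (hs : frot φ = -φ)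
    (hc : ∀ β, Closed (φ β)) {f : Coch G V W.carrier} (hf : IsSmall 1 f) (hd : CoDeg 0 f) :
    frot (pull (chg φ (Conv.hat f)) (fofOp f)) = -pull (chg φ (Conv.hat f)) (fofOp f) ∧
      ∀ β, Closed (pull (chg φ (Conv.hat f)) (fofOp f) β) := by
  have hfd := BiDeg.ofOp hd
  have hT := Conv.map_parT_hat hf hd
  constructor
  · rw [frot_pull _ hfd, frot_chg hT, hs, chg_neg, pull, fmul_neg_left, fpair_neg_left]; rfl
  · intro β
    -- Closedness is transported through exactness: φ is the antisymmetrisation of its Euler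
    -- primitive, and the pullback of a one-form is again of the form required by
    -- `closed_fpair_sub_frot`.
    rw [eq_feuler_sub_frot hc hs, chg_sub, pull, fmul_sub_left, fpair_sub_left, ← pull, ← pull,
      ← frot_chg hT, ← frot_pull _ hfd, pull, ← fofOp_fcomp_hat hf]
    exact closed_fpair_sub_frot _ _ _ β

/-- Minimal model, then the closed Darboux theorem. Since the coordinate change comes from maps on
words, it transports the algebra structure itself and not only the diagonal bimodule. -/
theorem exists_isStrongHomotopyInnerProduct
    (hfin : FiniteCohomology (V := A.toGradedSpace) A.d) {φ : DualHom A.diagonal N}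
    (hskew : φ.IsSkew) (hclosed : φ.IsClosed) (hnd : φ.IsHomologicallyNondegenerate) :
    ∃ φ' : DualHom A.diagonal N, φ'.IsStrongHomotopyInnerProduct := by
  have hdeg : IsDeg 1 A.d := A.diagonal_d ▸ A.diagonal.biDeg.core
  have hdd : A.d ∘ₗ A.d = 0 := A.diagonal_d ▸ A.diagonal.d_d
  obtain ⟨c⟩ := exists_contraction (V := A.toGradedSpace) hdeg hdd
  have hcl : ∀ a b : A.Homog, (φ.φ 0).core (A.d a.2) (b.2 : A.carrier) =
      -(sgn k a.1 * (φ.φ 0).core (a.2 : A.carrier) (A.d b.2)) := fun a b => by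
    rw [← A.diagonal_d]; exact φ.form_closed a b
  have hnd' : ∀ a : A.carrier, A.d a = 0 → a ∉ LinearMap.range A.d →
      ∃ b, A.d b = 0 ∧ (φ.φ 0).core a b ≠ 0 := by
    rw [← A.diagonal_d]; exact hnd
  obtain ⟨B, hB⟩ := c.exists_skewForm (N := N) hfin (φ.φ 0).core φ.form_degree
    (DualHom.form_skew hskew) hcl hnd'
  obtain ⟨mH, i, p, hHd, hHs, hHH, hi, his, hp, hps⟩ :=
    exists_minimal_model c A.coDeg A.fcomp_chat (small_m_sub_lin A)
  have hzero : ∀ {m : Coch G c.H c.H.carrier}, IsSmall 2 m → m 0 1 = 0 := fun hm => by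
    have := hm 0 [] (by simp [wt, ord_zero])
    rwa [word_nil] at this
  let AH := GappedAlgebra.ofCoch c.H mH hHd (hzero hHs) hHH
  have hfH : frel mH (pull (chg φ.φ (Conv.hat i)) (fofOp i)) (fofOp mH) (fofOp mH) =
      pull (chg (frel A.m φ.φ (fofOp A.m) (fofOp A.m)) (Conv.hat i)) (fofOp i) :=
    frel_pull_fofOp (A := AH) (B := A) hi.small hi.deg hi.comm φ.φ
  rw [show frel A.m φ.φ (fofOp A.m) (fofOp A.m) = 0 from φ.frel_eq, chg_zero, pull_zero] at hfH
  have hs : frot (C := A.toGradedSpace) (C' := A.toGradedSpace) φ.φ = -φ.φ :=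
    DualHom.isSkew_iff.mp hskew
  have hc : ∀ β, Closed (V := A.toGradedSpace) (φ.φ β) := DualHom.isClosed_iff.mp hclosed
  obtain ⟨hHskew, hHclosed⟩ := closed_pull_chg (W := A.toGradedSpace) (φ := φ.φ) hs hc hi.small hi.deg
  set φH := pull (chg φ.φ (Conv.hat i)) (fofOp i) with hφH
  have hHdeg : DualDeg N φH :=
    (DualDeg.chg φ.φ_degree (Conv.ConvDeg.hat hi.small hi.deg)).pull (BiDeg.ofOp hi.deg)
  have hHcore : (φH 0).core = B.form := LinearMap.ext fun a => LinearMap.ext fun b => by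
    rw [hφH, core_pull, core_chg _ (Conv.hat_one hi.small), core_fofOp, linear_of_small_two his, hB]
  obtain ⟨h, hhd, hhs, hpull⟩ := exists_pull_fofOp_eq B hHdeg hHskew hHclosed hHcore
  obtain ⟨g, hgd, hgs, -, -, hgh, hhg⟩ := Conv.exists_inverse hhd hhs
  have hh1 := Conv.small_one_of_sub_pr hhs
  have hg1 := Conv.small_one_of_sub_pr hgs
  -- The minimal structure conjugated by the coordinate change h, with g its inverse.
  set mB := fcomp (fcomp h (Conv.chat mH).fam) (Conv.hat g).fam with hmB
  have hBd : CoDeg 1 mB := by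
    have := (hhd.fcomp (Conv.ConvDeg.chat hHd)).fcomp (Conv.ConvDeg.hat hg1 hgd)
    rwa [zero_add, add_zero] at this
  have hBs : IsSmall 2 mB := Conv.small_fcomp (j := 0)
    (Conv.small_fcomp (n := 1) (j := 1) hh1 (Conv.lowers_chat hHs)) (Conv.lowers_hat hg1)
  have hh : IsMor mH mB h := ⟨hh1, hhd, by
    rw [hmB, fcomp_comp _ (Conv.hat g), hgh, fcomp_conv_idc]⟩
  let BB := GappedAlgebra.ofCoch c.H mB hBd (hzero hBs) (fcomp_chat_of_comm hHd hHH hh1 hhd hh.comm hhg)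
  have hconst : chg (fconst B.form) (Conv.hat h) = fconst B.form := by
    rw [← fop_single, chg_fop _ hh1]
  have hκ : frel mB (fconst B.form) (fofOp mB) (fofOp mB) = 0 := by
    have h1 : frel mH (pull (chg (fconst B.form) (Conv.hat h)) (fofOp h)) (fofOp mH) (fofOp mH) =
        pull (chg (frel mB (fconst B.form) (fofOp mB) (fofOp mB)) (Conv.hat h)) (fofOp h) :=
      frel_pull_fofOp (A := AH) (B := BB) hh1 hhd hh.comm (fconst B.form)
    rw [hconst, hpull, hφH, hfH] at h1
    -- The cyclicity defect of B is known to vanish after two operations. First the pullback along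
    -- the bimodule family of h is undone: this family is the identity plus a term of order one.
    obtain ⟨g', hg', -, -, hr⟩ := BiFam.exists_inverse (BiDeg.ofOp (hhd.sub CoDeg.pr))
      (BSmall.ofOp (n := 1) hhs)
    rw [fofOp_sub, fofOp_pr, add_sub_cancel] at hr
    have h2 : chg (frel mB (fconst B.form) (fofOp mB) (fofOp mB)) (Conv.hat h) = 0 := by
      rw [← pull_one (chg _ _), ← hr, ← pull_pull _ hg']
      exact (congr_arg (fun z => pull z g') h1.symm).trans (pull_zero _)
    -- Then the change of algebra along ĥ is undone with ĝ.
    rw [← chg_idc (frel mB _ _ _), ← hhg, ← chg_chg, h2, chg_zero]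
  have hf := hh.comp hp A.coDeg
  set f := fcomp h (Conv.hat p).fam with hfdef
  have hfs : IsSmall 2 (f - lin c.proj) := by
    have e : f - lin c.proj = fcomp (h - Conv.pr G c.H) (Conv.hat p).fam + (p - lin c.proj) := by
      rw [sub_fcomp, Conv.pr_fcomp_hat hp.small]; abel
    rw [e]
    exact Conv.IsSmall_add (Conv.small_fcomp (j := 0) hhs (Conv.lowers_hat hp.small)) hps
  have hfrel : frel A.m (pull (chg (fconst B.form) (Conv.hat f)) (fofOp f)) (fofOp A.m) (fofOp A.m) =
      pull (chg (frel mB (fconst B.form) (fofOp mB) (fofOp mB)) (Conv.hat f)) (fofOp f) :=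
    frel_pull_fofOp (A := A) (B := BB) hf.small hf.deg hf.comm (fconst B.form)
  rw [hκ, chg_zero, pull_zero, ← fop_single, chg_fop _ hf.small, fop_single] at hfrel
  refine ⟨DualHom.ofBiFam (C := A.diagonal) (pull (fconst B.form) (fofOp f))
    ((DualDeg.const B).pull (BiDeg.ofOp hf.deg)) hfrel, BB, B, AlgebraHom.ofCoch (B := BB) f hf,
    (SkewForm.isCyclicAlgebra_iff (B := BB) B).mpr hκ, ?_,
    fun β x v y w => (pullback_eq B.form (fofOp f) β x v y w).symm⟩
  have hd0 : mB 0 ∘ₗ TensorAlgebra.ι k = 0 :=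
    linear_of_small_two (t := (0 : c.H.carrier →ₗ[k] c.H.carrier)) (by rwa [lin_zero, sub_zero])
  change InducesIso (V := A.toGradedSpace) (W := c.H) A.d
    (mB 0 ∘ₗ TensorAlgebra.ι k) (f 0 ∘ₗ TensorAlgebra.ι k)
  rw [hd0, linear_of_small_two hfs]
  exact c.inducesIso

end StrongInnerProducts

/-! ### The theorem -/

set_option maxSynthPendingDepth 1

theorem corollary8p1 {k : Type v} [Field k] [CharZero k] (G : GappingMonoid) (N : ℤ)
    (A : GappedAlgebra.{u} k G) :
    (∀ C : GappedBimodule.{u, v, w} A, GradedSpace.FiniteCohomology (V := C.toGradedSpace) C.d →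
      ((∃ φ : DualHom C N, φ.IsHomotopyInnerProduct) ↔
        ∃ φ : DualHom C N, φ.IsSkew ∧ φ.IsHomologicallyNondegenerate)) ∧
    (GradedSpace.FiniteCohomology (V := A.toGradedSpace) A.d →
      ((∃ φ : DualHom A.diagonal N, φ.IsStrongHomotopyInnerProduct) ↔
        ∃ φ : DualHom A.diagonal N,
          φ.IsSkew ∧ φ.IsClosed ∧ φ.IsHomologicallyNondegenerate)) := by
  exact ⟨fun C hfin => ⟨fun ⟨φ, hφ⟩ => ⟨φ, DualHom.isHomotopyInnerProduct_imp hφ⟩,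
      fun ⟨_, hs, hn⟩ => exists_isHomotopyInnerProduct hfin hs hn⟩,
    fun hfin => ⟨fun ⟨φ, hφ⟩ => ⟨φ, DualHom.isStrongHomotopyInnerProduct_imp hφ⟩,
      fun ⟨_, hs, hc, hn⟩ => exists_isStrongHomotopyInnerProduct hfin hs hc hn⟩⟩
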